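/- Let $\pi$ be the free group on $X,Y$ and put $Z=(XY)^{-1}$. The character of a representation $\rho:\pi\to\mathrm{SL}(2,\mathbb C)$ is $\chi(\rho)=(\operatorname{tr}\rho(X),\operatorname{tr}\rho(Y),\operatorname{tr}\rho(XY))\in\mathbb C^3$. Let $\Gamma$ be the group of polynomial automorphisms of $\mathbb C^3$ which preserve $\kappa(x,y,z)=x^2+y^2+z^2-xyz-2$, let $\Sigma\subset\Gamma$ be the group of order four of sign-changes (changing the signs of an even number of coordinates), and let $\Omega_0=(-\infty,-2)^3\subset\mathbb R^3\subset\mathbb C^3$. Call $\rho$ a discrete $P$-embedding if it is conjugate in $\mathrm{SL}(2,\mathbb C)$ to an injective representation $\rho_0:\pi\to\mathrm{SL}(2,\mathbb R)$ with discrete image for which the quotient of the hyperbolic plane $\mathbf H^2$ by $\rho_0(\pi)$ is a three-holed sphere. Here the quotient surface is taken with its boundary: it is the quotient by $\rho_0(\pi)$ of the union of the upper half-plane $\mathbf H^2$ and the set of those points of $\mathbb R\cup\{\infty\}$ at which $\rho_0(\pi)$ acts discontinuously, and it is required to be homeomorphic, as a surface with boundary, to the compact three-holed sphere $P$, the complement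 in the sphere of three open discs with disjoint closures (so the quotient has no cusps). An element of $\pi$ corresponds to a boundary component if it generates the group of deck transformations preserving some connected component of the preimage of that boundary component in the universal covering; that is, its free homotopy class is that of the boundary component with one of its two orientations. Three elements correspond to the boundary components if they do so to the three different ones, in some order. Then, for every representation $\rho:\pi\to\mathrm{SL}(2,\mathbb C)$: 1. The following are equivalent: (a) $\chi(\rho)\in\Gamma\cdot\Omega_0$; (b) $\rho$ is a discrete $P$-embedding; (c) $\rho$ is a discrete $P$-embedding such that, for some automorphism $\phi$ of $\pi$, the elements $\phi(X),\phi(Y),\phi(Z)$ correspond to the boundary components of the quotient. 2. For every automorphism $\phi$ of $\pi$, $\chi(\rho\circ\phi)\in\Sigma\cdot\Omega_0$ if and only if $\rho$ is a discrete $P$-embedding such that $\phi(X),\phi(Y),\phi(Z)$ correspond to the boundary components of the quotient. In particular, $\chi(\rho)\in\Sigma\cdot\Omega_0$ if and only if $\rho$ is a discrete $P$-embedding such that $X,Y,Z$ correspond to the boundary components of the quotient. -/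

import Mathlib

noncomputable section

namespace PantsChar

open MvPolynomial Matrix

/-! ### Characters of the free group of rank two -/

/-- The free group `π` of rank two. -/
abbrev Pi2 : Type := FreeGroup (Fin 2)

/-- The first free generator `X` of `π`. -/
def genX : Pi2 := FreeGroup.of 0

/-- The second free generator `Y` of `π`. -/
def genY : Pi2 := FreeGroup.of 1

/-- The element `Z = (XY)⁻¹`, so that `XYZ = 1`. -/
def genZ : Pi2 := (genX * genY)⁻¹

/-- The triple `(X, Y, Z)`. -/
def peripheral : Fin 3 → Pi2 := ![genX, genY, genZ]

/-- The character `(x, y, z) = (tr ρ(X), tr ρ(Y), tr ρ(XY))` of a representation. -/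
def character (ρ : Pi2 →* SpecialLinearGroup (Fin 2) ℂ) : Fin 3 → ℂ :=
  ![trace (ρ genX : Matrix (Fin 2) (Fin 2) ℂ),
    trace (ρ genY : Matrix (Fin 2) (Fin 2) ℂ),
    trace (ρ (genX * genY) : Matrix (Fin 2) (Fin 2) ℂ)]

/-! ### The modular group and the octant -/

/-- The polynomial `κ = x² + y² + z² - xyz - 2`. -/
def kappa : MvPolynomial (Fin 3) ℂ :=
  X 0 ^ 2 + X 1 ^ 2 + X 2 ^ 2 - X 0 * X 1 * X 2 - 2

/-- The group `Γ` of polynomial automorphisms of `ℂ³` which preserve `κ`, given through their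
action on the coordinate ring. -/
def Gam : Subgroup (MvPolynomial (Fin 3) ℂ ≃ₐ[ℂ] MvPolynomial (Fin 3) ℂ) :=
  MulAction.stabilizer _ kappa

/-- The polynomial map `ℂ³ → ℂ³` whose coordinate functions are the images of the coordinates
under an automorphism of the coordinate ring. -/
def polyMap (φ : MvPolynomial (Fin 3) ℂ ≃ₐ[ℂ] MvPolynomial (Fin 3) ℂ) (p : Fin 3 → ℂ) :
    Fin 3 → ℂ :=
  fun i => eval p (φ (X i))

/-- The octant `Ω₀ = (-∞, -2)³` in `ℝ³ ⊆ ℂ³`. -/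
def octant : Set (Fin 3 → ℂ) :=
  {p | ∃ t : Fin 3 → ℝ, (∀ i, t i < -2) ∧ p = fun i => (t i : ℂ)}

/-- The orbit `Γ · Ω₀`. -/
def gamOctant : Set (Fin 3 → ℂ) :=
  {p | ∃ φ ∈ Gam, ∃ q ∈ octant, p = polyMap φ q}

/-- The orbit `Σ · Ω₀` under the group `Σ ≅ ℤ/2 × ℤ/2` of sign-changes, which change the signs of
an even number of coordinates. -/
def signOctant : Set (Fin 3 → ℂ) :=
  {p | ∃ s : Fin 3 → ℤˣ, s 0 * s 1 * s 2 = 1 ∧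
    ∃ q ∈ octant, p = fun i => ((s i : ℤ) : ℂ) * q i}

/-! ### The quotient surface -/

/-- The complexification of a real matrix, as an element of `GL(2, ℂ)`. -/
def complexify : SpecialLinearGroup (Fin 2) ℝ →* GL (Fin 2) ℂ :=
  SpecialLinearGroup.toGL.comp (SpecialLinearGroup.map Complex.ofRealHom)

/-- The action of `γ ∈ π` on the Riemann sphere by the Möbius transformation `ρ(γ)`. -/
def moeb (ρ : Pi2 →* SpecialLinearGroup (Fin 2) ℝ) (γ : Pi2) (z : OnePoint ℂ) : OnePoint ℂ :=
  complexify (ρ γ) • z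

/-- The circle at infinity `ℝ ∪ {∞}` of the upper half-plane. -/
def idealCircle : Set (OnePoint ℂ) :=
  insert OnePoint.infty (Set.range fun t : ℝ => ((t : ℂ) : OnePoint ℂ))

/-- The hyperbolic plane: the upper half-plane in the Riemann sphere. -/
def upperHalf : Set (OnePoint ℂ) :=
  (fun w : ℂ => (w : OnePoint ℂ)) '' {w : ℂ | 0 < w.im}

/-- The set of discontinuity of `ρ(π)` in the Riemann sphere. -/
def discontinuitySet (ρ : Pi2 →* SpecialLinearGroup (Fin 2) ℝ) : Set (OnePoint ℂ) :=
  {z | ∃ U ∈ nhds z, {γ : Pi2 | (moeb ρ γ '' U ∩ U).Nonempty}.Finite}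

/-- The hyperbolic plane together with the points of its circle at infinity at which `ρ(π)` acts
discontinuously. -/
def bordered (ρ : Pi2 →* SpecialLinearGroup (Fin 2) ℝ) : Set (OnePoint ℂ) :=
  (upperHalf ∪ idealCircle) ∩ discontinuitySet ρ

/-- Two points are equivalent when they lie in the same orbit of `ρ(π)`. -/
def orbitSetoid (ρ : Pi2 →* SpecialLinearGroup (Fin 2) ℝ) : Setoid (bordered ρ) where
  r a b := ∃ γ : Pi2, moeb ρ γ a = b
  iseqv :=
    { refl := fun a => ⟨1, by simp [moeb]⟩
      symm := by
        rintro a b ⟨γ, h⟩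
        exact ⟨γ⁻¹, by rw [← h]; simp [moeb]⟩
      trans := by
        rintro a b c ⟨γ, h⟩ ⟨δ, h'⟩
        exact ⟨δ * γ, by rw [← h', ← h]; simp [moeb, mul_smul]⟩ }

/-- The quotient of the hyperbolic plane by `ρ(π)`, with its boundary (the quotient of the ordinary
points of the circle at infinity), in the quotient topology. -/
abbrev QuotientSurface (ρ : Pi2 →* SpecialLinearGroup (Fin 2) ℝ) : Type :=
  Quotient (orbitSetoid ρ)

/-- The three-holed sphere: a closed disc (that is, the complement of an open disc in the sphere)
without two open discs, where the three removed open discs have disjoint closures. -/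
abbrev ThreeHoledSphere : Type :=
  {w : ℂ // ‖w‖ ≤ 4 ∧ 1 ≤ ‖w - 2‖ ∧ 1 ≤ ‖w + 2‖}

/-- The three boundary circles of the three-holed sphere. -/
def boundaryCircle : Fin 3 → Set ThreeHoledSphere :=
  ![{w | ‖(w : ℂ)‖ = 4}, {w | ‖(w : ℂ) - 2‖ = 1}, {w | ‖(w : ℂ) + 2‖ = 1}]

/-- `h` is a homeomorphism of surfaces with boundary: it matches the boundary of the quotient with
the boundary of the three-holed sphere. -/
def MatchesBoundary (ρ : Pi2 →* SpecialLinearGroup (Fin 2) ℝ)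
    (h : QuotientSurface ρ ≃ₜ ThreeHoledSphere) : Prop :=
  ∀ z : bordered ρ, (z : OnePoint ℂ) ∈ idealCircle ↔
    ∃ i, h (Quotient.mk (orbitSetoid ρ) z) ∈ boundaryCircle i

/-- The preimage in the universal covering of the `i`-th boundary component of the quotient. -/
def boundaryPreimage (ρ : Pi2 →* SpecialLinearGroup (Fin 2) ℝ)
    (h : QuotientSurface ρ ≃ₜ ThreeHoledSphere) (i : Fin 3) : Set (OnePoint ℂ) :=
  {z | ∃ hz : z ∈ bordered ρ, h (Quotient.mk (orbitSetoid ρ) ⟨z, hz⟩) ∈ boundaryCircle i}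

/-- `γ ∈ π` corresponds to the `i`-th boundary component of the quotient: it generates the
group of deck transformations which preserve some connected component of the preimage of that
boundary component in the universal covering. Equivalently, the free homotopy class of loops in the
quotient determined by `γ` is that of the boundary component, with one of its two orientations. -/
def CorrespondsTo (ρ : Pi2 →* SpecialLinearGroup (Fin 2) ℝ)
    (h : QuotientSurface ρ ≃ₜ ThreeHoledSphere) (γ : Pi2) (i : Fin 3) : Prop :=
  ∃ z ∈ boundaryPreimage ρ h i,
    {δ : Pi2 | moeb ρ δ '' connectedComponentIn (boundaryPreimage ρ h i) z =
        connectedComponentIn (boundaryPreimage ρ h i) z} =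
      (Subgroup.zpowers γ : Set Pi2)

/-! ### Discrete embeddings with quotient a three-holed sphere -/

/-- `ρ` is injective with discrete image. -/
def IsDiscreteEmbedding (ρ : Pi2 →* SpecialLinearGroup (Fin 2) ℝ) : Prop :=
  Function.Injective ρ ∧ DiscreteTopology ρ.range

/-- A real representation is a discrete `P`-embedding. -/
def IsRealPEmbedding (ρ : Pi2 →* SpecialLinearGroup (Fin 2) ℝ) : Prop :=
  IsDiscreteEmbedding ρ ∧ ∃ h : QuotientSurface ρ ≃ₜ ThreeHoledSphere, MatchesBoundary ρ h

/-- A real representation is a discrete `P`-embedding such that `c 0`, `c 1`, `c 2` correspond to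
the three components of the boundary of the quotient, in some order. -/
def IsRealPEmbeddingWith (ρ : Pi2 →* SpecialLinearGroup (Fin 2) ℝ) (c : Fin 3 → Pi2) : Prop :=
  IsDiscreteEmbedding ρ ∧ ∃ h : QuotientSurface ρ ≃ₜ ThreeHoledSphere, MatchesBoundary ρ h ∧
    ∃ e : Equiv.Perm (Fin 3), ∀ i, CorrespondsTo ρ h (c i) (e i)

/-- `ρ` is conjugate by `g ∈ SL(2, ℂ)` to the real representation `ρ₀`. -/
def IsConjToReal (ρ : Pi2 →* SpecialLinearGroup (Fin 2) ℂ) (g : SpecialLinearGroup (Fin 2) ℂ)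
    (ρ₀ : Pi2 →* SpecialLinearGroup (Fin 2) ℝ) : Prop :=
  ∀ γ, ρ γ = g * SpecialLinearGroup.map Complex.ofRealHom (ρ₀ γ) * g⁻¹

/-- A representation in `SL(2, ℂ)` is a discrete `P`-embedding: it is so as a representation in
`SL(2, ℝ)`, after a conjugation. -/
def IsPEmbedding (ρ : Pi2 →* SpecialLinearGroup (Fin 2) ℂ) : Prop :=
  ∃ g ρ₀, IsConjToReal ρ g ρ₀ ∧ IsRealPEmbedding ρ₀

/-- A representation in `SL(2, ℂ)` is a discrete `P`-embedding such that `c 0`, `c 1`, `c 2`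
correspond to the three components of the boundary of the quotient, in some order. -/
def IsPEmbeddingWith (ρ : Pi2 →* SpecialLinearGroup (Fin 2) ℂ) (c : Fin 3 → Pi2) : Prop :=
  ∃ g ρ₀, IsConjToReal ρ g ρ₀ ∧ IsRealPEmbeddingWith ρ₀ c

end PantsChar

end

/-! The theorem rests on four implications.

From Γ to automorphisms of π. If an automorphism of the coordinate ring preserves κ and sends some
coordinate to a polynomial of degree at least two, a Vieta involution in an image of greatest degree
lowers that degree (`totalDegree_vieta_lt`); if all images are affine, it is a signed permutation
(`affine_preserving`). So a property stable under Vieta involutions, permutations and even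
sign-changes is stable under Γ (`stable_under_Gam`). The first two kinds of moves are induced by
automorphisms of π, the third by multiplying ρ with signs, whence `exists_aut_of_mem_gamOctant`.

From the octant to an embedding. Numbers x, y, z < -2 are the traces of the pairwise products of
three reflections in disjoint geodesics (`exists_param`). Ping-pong shows that the even words form a
free discrete group whose ordinary points are exactly the translates of the cell outside three discs
(`ReflData.Generates.mem_discontinuitySet`). The upper half of the cell is a right-angled hexagon,
and the surface consists of two copies of it. An explicit map from the hexagon to half of the planar
model, continued by reflections, descends to a homeomorphism (`Param.homeo`), and the two seams that
meet a boundary circle generate the stabilizers of its lifts (`Param.correspondsTo_of_side`). As κ ≠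
2, the character determines the representation up to conjugation (`exists_conj_of_trace_eq`), so the
result carries over to ρ.

From a marked embedding to the octant. Compactness of the quotient excludes parabolic elements
(`two_lt_abs_trace`). If c preserves an interval of ordinary points, then no δ ≠ 1 has a fixed point
in it, so the fixed-point form of δ has a constant sign there and the same weak sign at the two
fixed points of c; this means tr [c, δ] ≥ 2 (`InvariantInterval.two_le_trace_commutator`). For the
pairs (A, B) and (AB, BA), with A, B running cyclically through X, Y, Z, one obtains xyz ≤ x² + y²
and its cyclic analogues. Together with |x|, |y|, |z| > 2 they force xyz < 0.

From an embedding to the orbit. The value of κ at the character is tr [X, Y], which lies outside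
[-2, 2]. A value below -2 would give the ping-pong pattern of a one-holed torus: the gaps between
the arcs have marked points in a single orbit, while every boundary circle lifts to an interval
containing such a point, so that distinct boundary circles would meet (`commutator_trace_ge`). Hence
κ > 2. As long as xyz ≥ 0, the Vieta involution in a coordinate of largest absolute value then
decreases this absolute value by a uniform amount, so the product becomes negative after finitely
many steps (`descent`). -/

noncomputable section

namespace PantsChar

open Matrix Topology

/-! ### Homogeneous coordinates on the Riemann sphere -/

/-- Homogeneous coordinates of a point of the Riemann sphere. -/
def vec (z : OnePoint ℂ) : ℂ × ℂ := z.elim (1, 0) fun w => (w, 1)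

@[simp] lemma vec_infty : vec OnePoint.infty = (1, 0) := rfl

@[simp] lemma vec_coe (w : ℂ) : vec (w : OnePoint ℂ) = (w, 1) := rfl

/-- The point of the Riemann sphere with given homogeneous coordinates. -/
def pt (v : ℂ × ℂ) : OnePoint ℂ := if v.2 = 0 then OnePoint.infty else ((v.1 / v.2 : ℂ) : OnePoint ℂ)

lemma vec_ne_zero (z : OnePoint ℂ) : vec z ≠ 0 := by
  induction z using OnePoint.rec <;> simp [Prod.ext_iff]

@[simp] lemma pt_vec (z : OnePoint ℂ) : pt (vec z) = z := by
  induction z using OnePoint.rec <;> simp [pt]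

lemma pt_smul {t : ℂ} (ht : t ≠ 0) (v : ℂ × ℂ) : pt (t • v) = pt v := by
  by_cases h : v.2 = 0
  · simp [pt, h]
  · simp [pt, h, ht, mul_div_mul_left]

lemma vec_pt {v : ℂ × ℂ} (hv : v ≠ 0) : ∃ t : ℂ, t ≠ 0 ∧ v = t • vec (pt v) := by
  by_cases h : v.2 = 0
  · refine ⟨v.1, fun h1 => hv (Prod.ext h1 h), ?_⟩
    ext <;> simp [pt, h]
  · refine ⟨v.2, h, ?_⟩
    ext <;> simp [pt, h, mul_div_cancel₀]

lemma pt_eq_pt_iff {v w : ℂ × ℂ} (hv : v ≠ 0) (hw : w ≠ 0) :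
    pt v = pt w ↔ v.1 * w.2 = v.2 * w.1 := by
  by_cases h : v.2 = 0 <;> by_cases h' : w.2 = 0
  · simp [pt, h, h']
  · have : v.1 ≠ 0 := fun h1 => hv (Prod.ext h1 h)
    simp [pt, h, h', this, OnePoint.infty_ne_coe]
  · have : w.1 ≠ 0 := fun h1 => hw (Prod.ext h1 h')
    simp [pt, h, h', this, OnePoint.coe_ne_infty]
  · simp only [pt, h, h', if_false, OnePoint.coe_eq_coe]
    rw [div_eq_div_iff h h']
    constructor <;> intro e <;> linear_combination e

lemma eq_iff_vec {z w : OnePoint ℂ} : z = w ↔ (vec z).1 * (vec w).2 = (vec z).2 * (vec w).1 := by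
  rw [← pt_eq_pt_iff (vec_ne_zero z) (vec_ne_zero w), pt_vec, pt_vec]

/-- The linear action of real matrices on homogeneous coordinates. -/
def lin (g : Matrix (Fin 2) (Fin 2) ℝ) (v : ℂ × ℂ) : ℂ × ℂ :=
  (g 0 0 * v.1 + g 0 1 * v.2, g 1 0 * v.1 + g 1 1 * v.2)

lemma lin_one (v : ℂ × ℂ) : lin 1 v = v := by simp [lin]

lemma lin_mul (g h : Matrix (Fin 2) (Fin 2) ℝ) (v : ℂ × ℂ) : lin (g * h) v = lin g (lin h v) := by
  simp only [lin, Matrix.mul_apply, Fin.sum_univ_two]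
  ext <;> push_cast <;> ring

lemma lin_smul (g : Matrix (Fin 2) (Fin 2) ℝ) (t : ℂ) (v : ℂ × ℂ) : lin g (t • v) = t • lin g v := by
  ext <;> simp [lin] <;> ring

lemma lin_ne_zero {g : Matrix (Fin 2) (Fin 2) ℝ} (hg : g.det ≠ 0) {v : ℂ × ℂ} (hv : v ≠ 0) :
    lin g v ≠ 0 := by
  intro h
  apply hv
  have h1 : (g 0 0 : ℂ) * v.1 + g 0 1 * v.2 = 0 := congrArg Prod.fst h
  have h2 : (g 1 0 : ℂ) * v.1 + g 1 1 * v.2 = 0 := congrArg Prod.snd h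
  have hd : ((g.det : ℝ) : ℂ) ≠ 0 := by exact_mod_cast hg
  rw [det_fin_two] at hd
  push_cast at hd
  ext
  · refine (mul_eq_zero.1 ?_).resolve_left hd
    linear_combination (g 1 1 : ℂ) * h1 - g 0 1 * h2
  · refine (mul_eq_zero.1 ?_).resolve_left hd
    linear_combination (g 0 0 : ℂ) * h2 - g 1 0 * h1

/-- The action of real Möbius transformations on the Riemann sphere. -/
def mob (g : GL (Fin 2) ℝ) (z : OnePoint ℂ) : OnePoint ℂ :=
  GeneralLinearGroup.map Complex.ofRealHom g • z

lemma mob_eq_pt (g : GL (Fin 2) ℝ) (z : OnePoint ℂ) : mob g z = pt (lin g (vec z)) := by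
  induction z using OnePoint.rec with
  | infty => simp [mob, OnePoint.smul_infty_eq_ite, pt, lin]
  | coe w => simp [mob, OnePoint.smul_some_eq_ite, pt, lin]

lemma det_GL_ne_zero (g : GL (Fin 2) ℝ) : (g : Matrix (Fin 2) (Fin 2) ℝ).det ≠ 0 := g.det_ne_zero

lemma vec_mob (g : GL (Fin 2) ℝ) (z : OnePoint ℂ) :
    ∃ t : ℂ, t ≠ 0 ∧ lin g (vec z) = t • vec (mob g z) := by
  rw [mob_eq_pt]
  exact vec_pt (lin_ne_zero (det_GL_ne_zero g) (vec_ne_zero z))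

lemma mob_pt (g : GL (Fin 2) ℝ) {v : ℂ × ℂ} (hv : v ≠ 0) : mob g (pt v) = pt (lin g v) := by
  obtain ⟨t, ht, h⟩ := vec_pt hv
  rw [mob_eq_pt]
  conv_rhs => rw [h, lin_smul, pt_smul ht]

lemma moeb_eq_mob (ρ : Pi2 →* SpecialLinearGroup (Fin 2) ℝ) (γ : Pi2) (z : OnePoint ℂ) :
    moeb ρ γ z = mob (SpecialLinearGroup.toGL (ρ γ)) z := by
  unfold moeb mob complexify
  congr 1
  ext i j
  simp [SpecialLinearGroup.toGL]

/-! ### Hermitian forms -/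

/-- The hermitian form `A|p|² + 2B Re(p q̄) + 2D Im(p q̄) + C|q|²`. -/
def hform (A B D C : ℝ) (v : ℂ × ℂ) : ℝ :=
  A * Complex.normSq v.1 + 2 * B * (v.1 * star v.2).re + 2 * D * (v.1 * star v.2).im +
    C * Complex.normSq v.2

/-- The square of the euclidean norm. -/
def nsq (v : ℂ × ℂ) : ℝ := Complex.normSq v.1 + Complex.normSq v.2

lemma hform_smul (A B D C : ℝ) (t : ℂ) (v : ℂ × ℂ) :
    hform A B D C (t • v) = Complex.normSq t * hform A B D C v := by
  simp [hform, Complex.normSq_apply]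
  ring

lemma nsq_eq (v : ℂ × ℂ) : nsq v = hform 1 0 0 1 v := by simp [nsq, hform]

lemma nsq_smul (t : ℂ) (v : ℂ × ℂ) : nsq (t • v) = Complex.normSq t * nsq v := by
  rw [nsq_eq, nsq_eq, hform_smul]

lemma nsq_nonneg (v : ℂ × ℂ) : 0 ≤ nsq v := add_nonneg (Complex.normSq_nonneg _) (Complex.normSq_nonneg _)

lemma nsq_pos {v : ℂ × ℂ} (hv : v ≠ 0) : 0 < nsq v := by
  rcases (nsq_nonneg v).lt_or_eq with h | h
  · exact h
  · exfalso
    apply hv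
    unfold nsq at h
    have h1 := Complex.normSq_nonneg v.1
    have h2 := Complex.normSq_nonneg v.2
    ext
    · exact Complex.normSq_eq_zero.1 (by linarith)
    · exact Complex.normSq_eq_zero.1 (by linarith)

lemma hform_pos_iff {A B D C : ℝ} {t : ℂ} (ht : t ≠ 0) {v : ℂ × ℂ} :
    0 < hform A B D C (t • v) ↔ 0 < hform A B D C v := by
  rw [hform_smul]; exact mul_pos_iff_of_pos_left (Complex.normSq_pos.2 ht)

lemma hform_neg_iff {A B D C : ℝ} {t : ℂ} (ht : t ≠ 0) {v : ℂ × ℂ} :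
    hform A B D C (t • v) < 0 ↔ hform A B D C v < 0 := by
  rw [hform_smul]; exact ⟨fun h => (pos_iff_neg_of_mul_neg h).1 (Complex.normSq_pos.2 ht), fun h => mul_neg_of_pos_of_neg (Complex.normSq_pos.2 ht) h⟩

lemma nsq_vec_pos (z : OnePoint ℂ) : 0 < nsq (vec z) := nsq_pos (vec_ne_zero z)

/-- A hermitian form, normalised to a function on the Riemann sphere. -/
def hfun (A B D C : ℝ) (z : OnePoint ℂ) : ℝ := hform A B D C (vec z) / nsq (vec z)

lemma tendsto_cocompact_aux :
    Filter.Tendsto (fun w : ℂ => (1 + Complex.normSq w)⁻¹) (Filter.cocompact ℂ) (𝓝 0) := by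
  apply Filter.Tendsto.inv_tendsto_atTop
  simp_rw [Complex.normSq_eq_norm_sq]
  apply Filter.tendsto_atTop_add_const_left
  exact (Filter.tendsto_pow_atTop two_ne_zero).comp (tendsto_norm_cocompact_atTop)

/-- On ℂ the function is A plus a combination of 1, Re w and Im w divided by 1 + |w|². These
quotients tend to zero at infinity, and A is the value at ∞. -/
lemma continuous_hfun (A B D C : ℝ) : Continuous (hfun A B D C) := by
  rw [OnePoint.continuous_iff]
  have hpos : ∀ w : ℂ, 0 < 1 + Complex.normSq w := fun w => by
    have := Complex.normSq_nonneg w; linarith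
  have key : ∀ w : ℂ, hfun A B D C (w : OnePoint ℂ) =
      A + (C - A) * (1 + Complex.normSq w)⁻¹ + 2 * B * (w.re * (1 + Complex.normSq w)⁻¹) +
        2 * D * (w.im * (1 + Complex.normSq w)⁻¹) := by
    intro w
    have := (hpos w).ne'
    have h2 : Complex.normSq w + 1 ≠ 0 := by rw [add_comm]; exact this
    simp only [hfun, hform, nsq, vec_coe, map_one, star_one, mul_one]
    field_simp
    ring
  constructor
  · rw [Filter.coclosedCompact_eq_cocompact]
    have hlim : ∀ f : ℂ → ℝ, (∀ w, |f w| ≤ ‖w‖) →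
        Filter.Tendsto (fun w => f w * (1 + Complex.normSq w)⁻¹) (Filter.cocompact ℂ) (𝓝 0) := by
      intro f hf
      have h1 : Filter.Tendsto (fun w : ℂ => ‖w‖⁻¹) (Filter.cocompact ℂ) (𝓝 0) :=
        (tendsto_norm_cocompact_atTop).inv_tendsto_atTop
      apply squeeze_zero_norm _ h1
      intro w
      rw [Real.norm_eq_abs, abs_mul, abs_of_pos (inv_pos.2 (hpos w)), Complex.normSq_eq_norm_sq]
      rcases eq_or_ne w 0 with rfl | hw
      · have := hf 0
        simp at this
        simp [this]
      · have hw' : 0 < ‖w‖ := norm_pos_iff.2 hw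
        calc |f w| * (1 + ‖w‖ ^ 2)⁻¹ ≤ ‖w‖ * (‖w‖ ^ 2)⁻¹ := by
              gcongr
              · exact hf w
              · linarith
          _ = ‖w‖⁻¹ := by field_simp
    have := ((tendsto_const_nhds (x := A)).add ((tendsto_cocompact_aux).const_mul (C - A))).add
      ((hlim _ Complex.abs_re_le_norm).const_mul (2 * B)) |>.add
      ((hlim _ Complex.abs_im_le_norm).const_mul (2 * D))
    simp only [mul_zero, add_zero] at this
    refine (this.congr fun w => (key w).symm).trans ?_
    simp [hfun, hform, nsq]
  · have : Continuous fun w : ℂ => A + (C - A) * (1 + Complex.normSq w)⁻¹ +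
        2 * B * (w.re * (1 + Complex.normSq w)⁻¹) + 2 * D * (w.im * (1 + Complex.normSq w)⁻¹) := by
      have hc : Continuous fun w : ℂ => (1 + Complex.normSq w)⁻¹ :=
        (continuous_const.add Complex.continuous_normSq).inv₀ fun w => (hpos w).ne'
      fun_prop
    exact this.congr fun w => (key w).symm

lemma hfun_pos_iff {A B D C : ℝ} {z : OnePoint ℂ} : 0 < hfun A B D C z ↔ 0 < hform A B D C (vec z) := by
  unfold hfun; exact div_pos_iff_of_pos_right (nsq_vec_pos z)

lemma hfun_neg_iff {A B D C : ℝ} {z : OnePoint ℂ} : hfun A B D C z < 0 ↔ hform A B D C (vec z) < 0 := by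
  unfold hfun; rw [div_lt_iff₀ (nsq_vec_pos z), zero_mul]

lemma isOpen_hform_neg (A B D C : ℝ) : IsOpen {z | hform A B D C (vec z) < 0} := by
  simp_rw [← hfun_neg_iff]
  exact isOpen_lt (continuous_hfun A B D C) continuous_const

lemma isOpen_hform_pos (A B D C : ℝ) : IsOpen {z | 0 < hform A B D C (vec z)} := by
  simp_rw [← hfun_pos_iff]
  exact isOpen_lt continuous_const (continuous_hfun A B D C)

lemma isClosed_hform_nonneg (A B D C : ℝ) : IsClosed {z | 0 ≤ hform A B D C (vec z)} := by
  have := (isOpen_hform_neg A B D C).isClosed_compl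
  convert this using 1
  ext z; simp

lemma isClosed_hform_nonpos (A B D C : ℝ) : IsClosed {z | hform A B D C (vec z) ≤ 0} := by
  have := (isOpen_hform_pos A B D C).isClosed_compl
  convert this using 1
  ext z; simp

/-! ### The three parts of the sphere -/

/-- The imaginary part in homogeneous coordinates. -/
def imf (v : ℂ × ℂ) : ℝ := (v.1 * star v.2).im

lemma imf_eq (v : ℂ × ℂ) : imf v = hform 0 0 (1 / 2) 0 v := by simp [imf, hform]

lemma imf_smul (t : ℂ) (v : ℂ × ℂ) : imf (t • v) = Complex.normSq t * imf v := by
  rw [imf_eq, imf_eq, hform_smul]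

lemma imf_lin (g : Matrix (Fin 2) (Fin 2) ℝ) (v : ℂ × ℂ) : imf (lin g v) = g.det * imf v := by
  simp [imf, lin, det_fin_two]
  ring

lemma mem_upperHalf {z : OnePoint ℂ} : z ∈ upperHalf ↔ 0 < imf (vec z) := by
  induction z using OnePoint.rec with
  | infty => simp [upperHalf, imf]
  | coe w => simp [upperHalf, imf]

lemma mem_idealCircle {z : OnePoint ℂ} : z ∈ idealCircle ↔ imf (vec z) = 0 := by
  induction z using OnePoint.rec with
  | infty => simp [idealCircle, imf]
  | coe w =>
    simp only [idealCircle, Set.mem_insert_iff, OnePoint.coe_ne_infty, Set.mem_range,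
      OnePoint.coe_eq_coe, false_or, imf, vec_coe, star_one, mul_one]
    exact ⟨by rintro ⟨t, rfl⟩; simp, fun h => ⟨w.re, Complex.ext rfl h.symm⟩⟩

lemma mem_closedUpper {z : OnePoint ℂ} : z ∈ upperHalf ∪ idealCircle ↔ 0 ≤ imf (vec z) := by
  rw [Set.mem_union, mem_upperHalf, mem_idealCircle, le_iff_lt_or_eq, eq_comm (a := (0 : ℝ))]

lemma imf_vec_mob (g : GL (Fin 2) ℝ) (z : OnePoint ℂ) :
    ∃ t : ℝ, 0 < t ∧ imf (vec (mob g z)) = t * ((g : Matrix (Fin 2) (Fin 2) ℝ).det * imf (vec z)) := by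
  obtain ⟨t, ht, h⟩ := vec_mob g z
  have hp := Complex.normSq_pos.2 ht
  refine ⟨(Complex.normSq t)⁻¹, inv_pos.2 hp, ?_⟩
  rw [← imf_lin, h, imf_smul, ← mul_assoc, inv_mul_cancel₀ hp.ne', one_mul]

lemma mob_mem_idealCircle (g : GL (Fin 2) ℝ) {z : OnePoint ℂ} :
    mob g z ∈ idealCircle ↔ z ∈ idealCircle := by
  obtain ⟨t, ht, h⟩ := imf_vec_mob g z
  rw [mem_idealCircle, mem_idealCircle, h]
  simp [ht.ne', det_GL_ne_zero g]

lemma mob_mem_upperHalf {g : GL (Fin 2) ℝ} (hg : 0 < (g : Matrix (Fin 2) (Fin 2) ℝ).det)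
    {z : OnePoint ℂ} : mob g z ∈ upperHalf ↔ z ∈ upperHalf := by
  obtain ⟨t, ht, h⟩ := imf_vec_mob g z
  rw [mem_upperHalf, mem_upperHalf, h]
  rw [mul_pos_iff_of_pos_left ht, mul_pos_iff_of_pos_left hg]

/-! ### The topology of the sphere -/

/-- The determinant of two vectors. -/
def vdet (v w : ℂ × ℂ) : ℂ := v.1 * w.2 - v.2 * w.1

lemma vdet_lin (g : Matrix (Fin 2) (Fin 2) ℝ) (v w : ℂ × ℂ) :
    vdet (lin g v) (lin g w) = g.det * vdet v w := by
  simp [vdet, lin, det_fin_two]; ring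

/-- For fixed w the left-hand side is a hermitian form in v, so chordal distances are covered by
`continuous_hfun`. -/
lemma normSq_vdet (v w : ℂ × ℂ) : Complex.normSq (vdet v w) =
    hform (Complex.normSq w.2) (-(w.2 * star w.1).re) ((w.2 * star w.1).im)
      (Complex.normSq w.1) v := by
  simp [vdet, hform, Complex.normSq_apply]; ring

lemma normSq_vdet_le (v w : ℂ × ℂ) : Complex.normSq (vdet v w) ≤ nsq v * nsq w := by
  have : nsq v * nsq w - Complex.normSq (vdet v w) =
      Complex.normSq (v.1 * star w.1 + v.2 * star w.2) := by
    simp [vdet, nsq, Complex.normSq_apply]; ring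
  have := Complex.normSq_nonneg (v.1 * star w.1 + v.2 * star w.2)
  linarith

lemma vdet_vec_eq_zero {z w : OnePoint ℂ} : vdet (vec z) (vec w) = 0 ↔ z = w := by
  rw [eq_iff_vec, vdet, sub_eq_zero]

/-- Up to the factor `nsq (vec k)`, the quotient |v ∧ k|² / |v|² is the squared chordal distance
from k. It is positive off k, hence bounded below on the compact complement of an open
neighbourhood. Together with `chordal_mem_nhds` this turns the topology of the sphere into
inequalities between homogeneous coordinates. -/
lemma exists_chordal_nhd {k : OnePoint ℂ} {U : Set (OnePoint ℂ)} (hU : U ∈ 𝓝 k) :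
    ∃ ε > 0, ∀ v : ℂ × ℂ, v ≠ 0 → Complex.normSq (vdet v (vec k)) < ε * nsq v → pt v ∈ U := by
  obtain ⟨V, hVU, hV, hkV⟩ := mem_nhds_iff.1 hU
  set f : OnePoint ℂ → ℝ := hfun (Complex.normSq (vec k).2) (-((vec k).2 * star (vec k).1).re)
    (((vec k).2 * star (vec k).1).im) (Complex.normSq (vec k).1) with hf
  have hfv : ∀ z, f z = Complex.normSq (vdet (vec z) (vec k)) / nsq (vec z) := fun z => by
    rw [normSq_vdet]; rfl
  have hc : IsCompact Vᶜ := hV.isClosed_compl.isCompact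
  obtain ⟨ε, hε, hmin⟩ : ∃ ε > 0, ∀ z ∈ Vᶜ, ε ≤ f z := by
    rcases Vᶜ.eq_empty_or_nonempty with he | hne
    · exact ⟨1, one_pos, by simp [he]⟩
    · obtain ⟨z, hz, hzm⟩ := hc.exists_isMinOn hne (continuous_hfun _ _ _ _).continuousOn
      refine ⟨f z, ?_, fun w hw => hzm hw⟩
      rw [hfv]
      refine div_pos (Complex.normSq_pos.2 fun h => hz ?_) (nsq_vec_pos z)
      rwa [vdet_vec_eq_zero.1 h]
  refine ⟨ε, hε, fun v hv h => hVU ?_⟩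
  by_contra hcon
  have h1 := hmin _ hcon
  obtain ⟨t, ht, hvt⟩ := vec_pt hv
  rw [hfv, le_div_iff₀ (nsq_vec_pos _)] at h1
  rw [hvt, normSq_vdet, hform_smul, ← normSq_vdet, nsq_smul] at h
  have := Complex.normSq_pos.2 ht
  nlinarith

lemma chordal_mem_nhds (k : OnePoint ℂ) {ε : ℝ} (hε : 0 < ε) :
    {z | Complex.normSq (vdet (vec z) (vec k)) < ε * nsq (vec z)} ∈ 𝓝 k := by
  apply IsOpen.mem_nhds
  · have : {z | Complex.normSq (vdet (vec z) (vec k)) < ε * nsq (vec z)} =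
        {z | hfun (Complex.normSq (vec k).2) (-((vec k).2 * star (vec k).1).re)
          (((vec k).2 * star (vec k).1).im) (Complex.normSq (vec k).1) z < ε} := by
      ext z
      rw [Set.mem_ofPred_eq, Set.mem_ofPred_eq, normSq_vdet, hfun, div_lt_iff₀ (nsq_vec_pos z)]
    rw [this]
    exact isOpen_lt (continuous_hfun _ _ _ _) continuous_const
  · simp only [Set.mem_ofPred_eq]
    rw [(vdet_vec_eq_zero (z := k) (w := k)).2 rfl]
    simpa using mul_pos hε (nsq_vec_pos k)

lemma nsq_lin_le (g : Matrix (Fin 2) (Fin 2) ℝ) (v : ℂ × ℂ) :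
    nsq (lin g v) ≤ (g 0 0 ^ 2 + g 0 1 ^ 2 + g 1 0 ^ 2 + g 1 1 ^ 2) * nsq v := by
  simp only [nsq, lin, Complex.normSq_apply, Complex.add_re, Complex.add_im, Complex.re_ofReal_mul,
    Complex.im_ofReal_mul]
  nlinarith [sq_nonneg (g 0 0 * v.2.re - g 0 1 * v.1.re), sq_nonneg (g 0 0 * v.2.im - g 0 1 * v.1.im),
    sq_nonneg (g 1 0 * v.2.re - g 1 1 * v.1.re), sq_nonneg (g 1 0 * v.2.im - g 1 1 * v.1.im)]

/-- A matrix multiplies v ∧ w by its determinant, and shrinks |v|² by at most the factor c read off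
from its inverse. So it stretches chordal distances by a bounded factor. -/
lemma continuous_mob (g : GL (Fin 2) ℝ) : Continuous (mob g) := by
  rw [continuous_iff_continuousAt]
  intro k U hU
  obtain ⟨ε, hε, h⟩ := exists_chordal_nhd hU
  obtain ⟨t, ht, htk⟩ := vec_mob g k
  set M : Matrix (Fin 2) (Fin 2) ℝ := (g : Matrix (Fin 2) (Fin 2) ℝ)
  have hd : M.det ≠ 0 := det_GL_ne_zero g
  set N : Matrix (Fin 2) (Fin 2) ℝ := ((g⁻¹ : GL (Fin 2) ℝ) : Matrix (Fin 2) (Fin 2) ℝ)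
  have hNM : ∀ v, lin N (lin M v) = v := fun v => by
    rw [← lin_mul, ← GeneralLinearGroup.coe_mul, inv_mul_cancel, GeneralLinearGroup.coe_one, lin_one]
  set c : ℝ := N 0 0 ^ 2 + N 0 1 ^ 2 + N 1 0 ^ 2 + N 1 1 ^ 2 with hcdef
  have hc : 0 < c := by
    by_contra hcon
    have h1 := nsq_lin_le N (lin M (vec k))
    rw [hNM] at h1
    have h2 := nsq_vec_pos k
    have h3 := nsq_nonneg (lin M (vec k))
    have h4 : c * nsq (lin M (vec k)) ≤ 0 := mul_nonpos_of_nonpos_of_nonneg (not_lt.1 hcon) h3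
    linarith
  have hT := Complex.normSq_pos.2 ht
  have hd2 : 0 < M.det ^ 2 := by positivity
  have hε' : 0 < ε * Complex.normSq t / (M.det ^ 2 * c) := by positivity
  rw [Filter.mem_map]
  filter_upwards [chordal_mem_nhds k hε'] with z hz
  rw [Set.mem_preimage]
  rw [mob_eq_pt]
  apply h _ (lin_ne_zero hd (vec_ne_zero z))
  have h1 : Complex.normSq t * Complex.normSq (vdet (lin M (vec z)) (vec (mob g k))) =
      M.det ^ 2 * Complex.normSq (vdet (vec z) (vec k)) := by
    have : t * vdet (lin M (vec z)) (vec (mob g k)) = M.det * vdet (vec z) (vec k) := by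
      rw [← vdet_lin, htk]; simp [vdet]; ring
    rw [← Complex.normSq_mul, this, Complex.normSq_mul, Complex.normSq_ofReal]; ring
  have h2 := nsq_lin_le N (lin M (vec z))
  rw [hNM, ← hcdef] at h2
  rw [div_mul_eq_mul_div, lt_div_iff₀ (by positivity)] at hz
  have h3 : Complex.normSq t * c * Complex.normSq (vdet (lin M (vec z)) (vec (mob g k))) <
      Complex.normSq t * c * (ε * nsq (lin M (vec z))) := by
    calc _ = c * (Complex.normSq t * Complex.normSq (vdet (lin M (vec z)) (vec (mob g k)))) := by ring
      _ = Complex.normSq (vdet (vec z) (vec k)) * (M.det ^ 2 * c) := by rw [h1]; ring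
      _ < ε * Complex.normSq t * nsq (vec z) := hz
      _ ≤ ε * Complex.normSq t * (c * nsq (lin M (vec z))) := by gcongr
      _ = _ := by ring
  exact lt_of_mul_lt_mul_left h3 (by positivity)

end PantsChar

end

/-! ### From Γ-orbits to automorphisms of the free group -/

noncomputable section

namespace PantsChar

open MvPolynomial Matrix

/-! ### Polynomial automorphisms preserving `κ` -/

/-- Automorphisms of the coordinate ring act on points by substitution, which reverses the order of
composition. -/
lemma polyMap_mul (φ ψ : MvPolynomial (Fin 3) ℂ ≃ₐ[ℂ] MvPolynomial (Fin 3) ℂ) (p : Fin 3 → ℂ) :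
    polyMap (φ * ψ) p = polyMap ψ (polyMap φ p) := by
  have key : ∀ r, eval p (φ r) = eval (polyMap φ p) r := by
    intro r
    induction r using MvPolynomial.induction_on with
    | C a => rw [← MvPolynomial.algebraMap_eq, φ.commutes]; simp [MvPolynomial.algebraMap_eq]
    | add r s hr hs => simp [hr, hs]
    | mul_X r i hr => simp [hr, polyMap]
  ext i
  exact key _

/-- The Vieta involution in the `i`-th coordinate, on the coordinate ring. -/
def vietaHom (i : Fin 3) : MvPolynomial (Fin 3) ℂ →ₐ[ℂ] MvPolynomial (Fin 3) ℂ :=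
  aeval fun j => if j = i then X (i + 1) * X (i + 2) - X i else X j

lemma vietaHom_vietaHom (i : Fin 3) : (vietaHom i).comp (vietaHom i) = AlgHom.id ℂ _ := by
  ext j : 1
  fin_cases i <;> fin_cases j <;> simp [vietaHom]

/-- The Vieta involution in the `i`-th coordinate, as an automorphism. -/
def vietaEquiv (i : Fin 3) : MvPolynomial (Fin 3) ℂ ≃ₐ[ℂ] MvPolynomial (Fin 3) ℂ :=
  AlgEquiv.ofAlgHom (vietaHom i) (vietaHom i) (vietaHom_vietaHom i) (vietaHom_vietaHom i)

lemma mem_Gam {φ : MvPolynomial (Fin 3) ℂ ≃ₐ[ℂ] MvPolynomial (Fin 3) ℂ} :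
    φ ∈ Gam ↔ φ (X 0) ^ 2 + φ (X 1) ^ 2 + φ (X 2) ^ 2 - φ (X 0) * φ (X 1) * φ (X 2) - 2 = kappa := by
  rw [Gam, MulAction.mem_stabilizer_iff]
  change φ kappa = kappa ↔ _
  conv_lhs => lhs; rw [kappa]
  rw [map_sub, map_sub, map_add, map_add, map_mul, map_mul, map_pow, map_pow, map_pow, map_ofNat]

lemma vietaEquiv_mem (i : Fin 3) : vietaEquiv i ∈ Gam := by
  rw [mem_Gam]
  fin_cases i <;> simp [vietaEquiv, vietaHom, kappa] <;> ring

/-- The Vieta involution in the `i`-th coordinate of `ℂ³`. -/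
def vieta (i : Fin 3) (p : Fin 3 → ℂ) : Fin 3 → ℂ :=
  fun j => if j = i then p (i + 1) * p (i + 2) - p i else p j

lemma polyMap_vietaEquiv (i : Fin 3) (p : Fin 3 → ℂ) : polyMap (vietaEquiv i) p = vieta i p := by
  ext j
  by_cases h : j = i <;> simp [polyMap, vietaEquiv, vietaHom, vieta, h]

/-- A sign-change of the coordinates. -/
def signChange (s : Fin 3 → ℤˣ) (p : Fin 3 → ℂ) : Fin 3 → ℂ := fun i => ((s i : ℤ) : ℂ) * p i

lemma units_int_sq (u : ℤˣ) : ((u : ℤ) : ℂ) * ((u : ℤ) : ℂ) = 1 := by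
  rcases Int.units_eq_one_or u with rfl | rfl <;> simp

/-- A sign-change on the coordinate ring. -/
def signHom (s : Fin 3 → ℤˣ) : MvPolynomial (Fin 3) ℂ →ₐ[ℂ] MvPolynomial (Fin 3) ℂ :=
  aeval fun j => C ((s j : ℤ) : ℂ) * X j

lemma signHom_signHom (s : Fin 3 → ℤˣ) : (signHom s).comp (signHom s) = AlgHom.id ℂ _ := by
  ext j : 1
  simp only [signHom, AlgHom.comp_apply, aeval_X, map_mul, AlgHom.coe_id, id]
  rw [MvPolynomial.aeval_C, MvPolynomial.algebraMap_eq, ← mul_assoc, ← C_mul, units_int_sq, C_1, one_mul]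

/-- A sign-change as an automorphism of the coordinate ring. -/
def signEquiv (s : Fin 3 → ℤˣ) : MvPolynomial (Fin 3) ℂ ≃ₐ[ℂ] MvPolynomial (Fin 3) ℂ :=
  AlgEquiv.ofAlgHom (signHom s) (signHom s) (signHom_signHom s) (signHom_signHom s)

lemma signEquiv_X (s : Fin 3 → ℤˣ) (j : Fin 3) : signEquiv s (X j) = C ((s j : ℤ) : ℂ) * X j :=
  aeval_X (R := ℂ) (fun j => (C ((s j : ℤ) : ℂ) * X j : MvPolynomial (Fin 3) ℂ)) j

lemma signEquiv_mem {s : Fin 3 → ℤˣ} (hs : s 0 * s 1 * s 2 = 1) : signEquiv s ∈ Gam := by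
  rw [mem_Gam]
  have h : ((s 0 : ℤ) : ℂ) * ((s 1 : ℤ) : ℂ) * ((s 2 : ℤ) : ℂ) = 1 := by
    have := congrArg Units.val hs
    push_cast at this
    exact_mod_cast this
  have h2 : ∀ j, (C (((s j : ℤ) : ℂ)) : MvPolynomial (Fin 3) ℂ) ^ 2 = 1 := fun j => by
    rw [← C_pow, sq, units_int_sq, C_1]
  have h3 : (C (((s 0 : ℤ) : ℂ)) * C (((s 1 : ℤ) : ℂ)) * C (((s 2 : ℤ) : ℂ)) :
      MvPolynomial (Fin 3) ℂ) = 1 := by rw [← C_mul, ← C_mul, h, C_1]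
  rw [signEquiv_X, signEquiv_X, signEquiv_X, kappa, mul_pow, mul_pow, mul_pow, h2, h2, h2]
  linear_combination -(X 0 * X 1 * X 2) * h3

lemma polyMap_signEquiv (s : Fin 3 → ℤˣ) (p : Fin 3 → ℂ) :
    polyMap (signEquiv s) p = signChange s p := by
  ext j
  rw [polyMap, signEquiv_X, eval_mul, eval_C, eval_X, signChange]

lemma gamOctant_of_mem {φ : MvPolynomial (Fin 3) ℂ ≃ₐ[ℂ] MvPolynomial (Fin 3) ℂ} (hφ : φ ∈ Gam)
    {p : Fin 3 → ℂ} (hp : p ∈ gamOctant) : polyMap φ p ∈ gamOctant := by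
  obtain ⟨ψ, hψ, q, hq, rfl⟩ := hp
  exact ⟨ψ * φ, mul_mem hψ hφ, q, hq, (polyMap_mul _ _ _).symm⟩

lemma vieta_mem_gamOctant (i : Fin 3) {p : Fin 3 → ℂ} (hp : p ∈ gamOctant) : vieta i p ∈ gamOctant := by
  rw [← polyMap_vietaEquiv]
  exact gamOctant_of_mem (vietaEquiv_mem i) hp

lemma vieta_vieta (i : Fin 3) (p : Fin 3 → ℂ) : vieta i (vieta i p) = p := by
  ext j
  fin_cases i <;> fin_cases j <;> simp [vieta]

lemma signOctant_subset_gamOctant : signOctant ⊆ gamOctant := by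
  rintro p ⟨s, hs, q, hq, rfl⟩
  exact ⟨signEquiv s, signEquiv_mem hs, q, hq, (polyMap_signEquiv s q).symm⟩

lemma eval_of_totalDegree_le_one {f : MvPolynomial (Fin 3) ℂ} (hf : f.totalDegree ≤ 1) :
    ∃ (b : ℂ) (a : Fin 3 → ℂ), ∀ v, eval v f = b + a 0 * v 0 + a 1 * v 1 + a 2 * v 2 := by
  refine ⟨coeff 0 f, fun j => coeff (Finsupp.single j 1) f, fun v => ?_⟩
  have hs : f.support ⊆ {0, Finsupp.single 0 1, Finsupp.single 1 1, Finsupp.single 2 1} := by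
    intro m hm
    have h1 : (m.sum fun _ e => e) ≤ 1 := (le_totalDegree hm).trans hf
    rw [Finsupp.sum_fintype _ _ (fun _ => rfl), Fin.sum_univ_three] at h1
    have : (m 0 = 0 ∧ m 1 = 0 ∧ m 2 = 0) ∨ (m 0 = 1 ∧ m 1 = 0 ∧ m 2 = 0) ∨
        (m 0 = 0 ∧ m 1 = 1 ∧ m 2 = 0) ∨ (m 0 = 0 ∧ m 1 = 0 ∧ m 2 = 1) := by omega
    simp only [Finset.mem_insert, Finset.mem_singleton]
    rcases this with h | h | h | h
    · left; ext i; fin_cases i <;> simp [h]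
    · right; left; ext i; fin_cases i <;> simp [h]
    · right; right; left; ext i; fin_cases i <;> simp [h]
    · right; right; right; ext i; fin_cases i <;> simp [h]
  rw [eval_eq, Finset.sum_subset hs (fun m _ hm => by simp [notMem_support_iff.1 hm])]
  rw [Finset.sum_insert, Finset.sum_insert, Finset.sum_insert, Finset.sum_singleton]
  · simp; ring
  · simp [Finsupp.single_left_inj]
  · simp [Finsupp.single_left_inj]
  · simp [Finsupp.ext_iff, Finsupp.single_apply]

/-- For y = 1 the factors are polynomials in one variable, and ℂ[X] is a domain. -/
lemma linear_forms_product {a b : Fin 3 → ℂ} (h : ∀ x y : ℂ, ∏ i, (a i * x + b i * y) = 0) :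
    ∃ i, a i = 0 ∧ b i = 0 := by
  have h1 : ∏ i, (Polynomial.C (a i) * Polynomial.X + Polynomial.C (b i)) = 0 := by
    apply Polynomial.funext
    intro r
    have := h r 1
    simpa [Polynomial.eval_prod] using this
  obtain ⟨i, -, hi⟩ := Finset.prod_eq_zero_iff.1 h1
  refine ⟨i, ?_, ?_⟩
  · simpa using congrArg (fun p => Polynomial.coeff p 1) hi
  · simpa using congrArg (fun p => Polynomial.coeff p 0) hi

/-- An affine map of `ℂ³` preserving `κ` is a signed permutation of the coordinates. -/
lemma affine_preserving {b : Fin 3 → ℂ} {a : Fin 3 → Fin 3 → ℂ}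
    (h : ∀ v : Fin 3 → ℂ, ∑ i, (b i + a i 0 * v 0 + a i 1 * v 1 + a i 2 * v 2) ^ 2 -
      ∏ i, (b i + a i 0 * v 0 + a i 1 * v 1 + a i 2 * v 2) =
      v 0 ^ 2 + v 1 ^ 2 + v 2 ^ 2 - v 0 * v 1 * v 2) :
    ∃ (σ : Equiv.Perm (Fin 3)) (s : Fin 3 → ℤˣ), s 0 * s 1 * s 2 = 1 ∧
      ∀ (v : Fin 3 → ℂ) (i : Fin 3), b i + a i 0 * v 0 + a i 1 * v 1 + a i 2 * v 2 = ((s (σ i) : ℤ) : ℂ) * v (σ i) := by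
  -- The identities at ±v and ±2v are combined so that all terms of degree other than three cancel;
  -- the product of the linear parts remains.
  have hcub : ∀ v : Fin 3 → ℂ, ∏ i, (a i 0 * v 0 + a i 1 * v 1 + a i 2 * v 2) = v 0 * v 1 * v 2 := by
    intro v
    have h1 := h v
    have h2 := h (fun j => 2 * v j)
    have h3 := h (fun j => -v j)
    have h4 := h (fun j => -(2 * v j))
    simp only [Fin.sum_univ_three, Fin.prod_univ_three] at h1 h2 h3 h4 ⊢
    linear_combination (-1 / 12 : ℂ) * h2 + (1 / 6 : ℂ) * h1 - (1 / 6 : ℂ) * h3 + (1 / 12 : ℂ) * h4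
  -- On the plane v j = 0 the product of the linear parts vanishes, so one of them vanishes on this
  -- plane and is a multiple of v j.
  have hex : ∀ j : Fin 3, ∃ i, ∀ k, k ≠ j → a i k = 0 := by
    intro j
    obtain ⟨i, h1, h2⟩ := linear_forms_product (a := fun i => a i (j + 1)) (b := fun i => a i (j + 2))
      (fun x y => by
        have := hcub (fun k => if k = j + 1 then x else if k = j + 2 then y else 0)
        fin_cases j <;> simpa [Fin.prod_univ_three, add_comm] using this)
    refine ⟨i, fun k hk => ?_⟩
    have : k = j + 1 ∨ k = j + 2 := by revert hk; fin_cases j <;> fin_cases k <;> simp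
    rcases this with rfl | rfl
    · exact h1
    · exact h2
  choose τ hτ using hex
  have hnz : ∀ j, a (τ j) j ≠ 0 := by
    intro j hj
    have := hcub (fun _ => 1)
    rw [Finset.prod_eq_zero (Finset.mem_univ (τ j))] at this
    · simp at this
    · have hz : ∀ k, a (τ j) k = 0 := fun k => by
        by_cases hk : k = j
        · rw [hk, hj]
        · exact hτ j k hk
      simp [hz]
  have hinj : Function.Injective τ := by
    intro j k hjk
    by_contra hne
    exact hnz j (by rw [hjk]; exact hτ k j hne)
  set e : Equiv.Perm (Fin 3) := Equiv.ofBijective τ (Finite.injective_iff_bijective.1 hinj)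
  have hform : ∀ (v : Fin 3 → ℂ) (j : Fin 3), b (τ j) + a (τ j) 0 * v 0 + a (τ j) 1 * v 1 + a (τ j) 2 * v 2 =
      b (τ j) + a (τ j) j * v j := by
    intro v j
    have h01 := hτ 0 1 (by decide)
    have h02 := hτ 0 2 (by decide)
    have h10 := hτ 1 0 (by decide)
    have h12 := hτ 1 2 (by decide)
    have h20 := hτ 2 0 (by decide)
    have h21 := hτ 2 1 (by decide)
    fin_cases j
    · simp [h01, h02]
    · simp [h10, h12]
    · simp [h20, h21]
  have h' : ∀ v : Fin 3 → ℂ, ∑ j, (b (τ j) + a (τ j) j * v j) ^ 2 - ∏ j, (b (τ j) + a (τ j) j * v j) =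
      v 0 ^ 2 + v 1 ^ 2 + v 2 ^ 2 - v 0 * v 1 * v 2 := by
    intro v
    rw [← h v]
    congr 1
    · exact Fintype.sum_equiv e _ _ fun j => by rw [← hform]; rfl
    · exact Fintype.prod_equiv e _ _ fun j => by rw [← hform]; rfl
  simp only [Fin.sum_univ_three, Fin.prod_univ_three] at h'
  have hs := fun x y z => h' ![x, y, z]
  simp only [Matrix.cons_val_zero, Matrix.cons_val_one, Matrix.cons_val] at hs
  set α := a (τ 0) 0
  set β := a (τ 1) 1
  set γ := a (τ 2) 2
  set p := b (τ 0)
  set q := b (τ 1)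
  set r := b (τ 2)
  -- Finite differences over the signs extract the coefficient of v 0 * v 1 * v 2 here and those of
  -- the mixed quadratic terms below; the latter make the constants p, q, r vanish.
  have c1 : α * β * γ = 1 := by
    linear_combination (-1 / 8 : ℂ) * (hs 1 1 1 - hs (-1) 1 1 - hs 1 (-1) 1 - hs 1 1 (-1) + hs (-1) (-1) 1
      + hs (-1) 1 (-1) + hs 1 (-1) (-1) - hs (-1) (-1) (-1))
  have e1 : r * (α * β) = 0 := by
    linear_combination (-1 / 4 : ℂ) * (hs 1 1 0 - hs (-1) 1 0 - hs 1 (-1) 0 + hs (-1) (-1) 0)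
  have e2 : q * (α * γ) = 0 := by
    linear_combination (-1 / 4 : ℂ) * (hs 1 0 1 - hs (-1) 0 1 - hs 1 0 (-1) + hs (-1) 0 (-1))
  have e3 : p * (β * γ) = 0 := by
    linear_combination (-1 / 4 : ℂ) * (hs 0 1 1 - hs 0 (-1) 1 - hs 0 1 (-1) + hs 0 (-1) (-1))
  have n0 : α ≠ 0 := hnz 0
  have n1 : β ≠ 0 := hnz 1
  have n2 : γ ≠ 0 := hnz 2
  have r0 : r = 0 := (mul_eq_zero.1 e1).resolve_right (mul_ne_zero n0 n1)
  have q0 : q = 0 := (mul_eq_zero.1 e2).resolve_right (mul_ne_zero n0 n2)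
  have p0 : p = 0 := (mul_eq_zero.1 e3).resolve_right (mul_ne_zero n1 n2)
  have s0 : α ^ 2 = 1 := by
    have := hs 1 0 0; rw [p0, q0, r0] at this; linear_combination this
  have s1 : β ^ 2 = 1 := by
    have := hs 0 1 0; rw [p0, q0, r0] at this; linear_combination this
  have s2 : γ ^ 2 = 1 := by
    have := hs 0 0 1; rw [p0, q0, r0] at this; linear_combination this
  have hu : ∀ w : ℂ, w ^ 2 = 1 → ∃ u : ℤˣ, ((u : ℤ) : ℂ) = w := by
    intro w hw
    rcases sq_eq_one_iff.1 hw with rfl | rfl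
    · exact ⟨1, by simp⟩
    · exact ⟨-1, by simp⟩
  obtain ⟨u0, hu0⟩ := hu α s0
  obtain ⟨u1, hu1⟩ := hu β s1
  obtain ⟨u2, hu2⟩ := hu γ s2
  refine ⟨e.symm, ![u0, u1, u2], ?_, ?_⟩
  · rw [← hu0, ← hu1, ← hu2] at c1
    have : ((u0 * u1 * u2 : ℤˣ) : ℤ) = 1 := by
      push_cast; exact_mod_cast c1
    simpa [Units.ext_iff] using this
  · intro v i
    obtain ⟨j, rfl⟩ := e.surjective i
    rw [Equiv.symm_apply_apply]
    change b (τ j) + a (τ j) 0 * v 0 + a (τ j) 1 * v 1 + a (τ j) 2 * v 2 = _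
    rw [hform]
    fin_cases j
    · change p + α * v 0 = (u0 : ℤ) * v 0
      rw [p0, hu0, zero_add]
    · change q + β * v 1 = (u1 : ℤ) * v 1
      rw [q0, hu1, zero_add]
    · change r + γ * v 2 = (u2 : ℤ) * v 2
      rw [r0, hu2, zero_add]

/-- The two roots of T² - fgT + f² + g² - (κ + 2) are h and fg - h. Since κ + 2 has degree at most
3, comparing degrees gives deg f + deg g ≤ deg h; then the product f² + g² - (κ + 2) of the roots
has degree less than 2 deg h. -/
lemma totalDegree_vieta_lt {f g h : MvPolynomial (Fin 3) ℂ}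
    (e : f ^ 2 + g ^ 2 + h ^ 2 - f * g * h - 2 = kappa) (hf : 1 ≤ f.totalDegree)
    (hg : 1 ≤ g.totalDegree) (hfh : f.totalDegree ≤ h.totalDegree)
    (hgh : g.totalDegree ≤ h.totalDegree) (hh : 2 ≤ h.totalDegree) :
    (f * g - h).totalDegree < h.totalDegree := by
  have nz : ∀ {p : MvPolynomial (Fin 3) ℂ}, 1 ≤ p.totalDegree → p ≠ 0 := by
    rintro p hp rfl; simp at hp
  have hf0 := nz hf
  have hg0 := nz hg
  have hh0 := nz (le_trans one_le_two hh)
  have hk : (kappa + 2 : MvPolynomial (Fin 3) ℂ).totalDegree ≤ 3 := by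
    have h1 : (kappa + 2 : MvPolynomial (Fin 3) ℂ) = X 0 ^ 2 + X 1 ^ 2 + X 2 ^ 2 - X 0 * X 1 * X 2 := by
      rw [kappa]; ring
    rw [h1]
    have hx : ∀ i : Fin 3, (X i ^ 2 : MvPolynomial (Fin 3) ℂ).totalDegree ≤ 3 := fun i => by
      rw [totalDegree_X_pow]; norm_num
    refine (totalDegree_sub _ _).trans (max_le ((totalDegree_add _ _).trans (max_le
      ((totalDegree_add _ _).trans (max_le (hx 0) (hx 1))) (hx 2))) ?_)
    refine (totalDegree_mul _ _).trans ?_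
    have := totalDegree_mul (X 0 : MvPolynomial (Fin 3) ℂ) (X 1)
    simp only [totalDegree_X] at this ⊢
    omega
  have hsq : ∀ p : MvPolynomial (Fin 3) ℂ, (p ^ 2).totalDegree ≤ 2 * p.totalDegree := fun p => by
    simpa using totalDegree_pow p 2
  have h1 : f * g * h = f ^ 2 + g ^ 2 + h ^ 2 - (kappa + 2) := by linear_combination -e
  have h2 : (f * g * h).totalDegree ≤ 2 * h.totalDegree := by
    rw [h1]
    refine (totalDegree_sub _ _).trans (max_le ((totalDegree_add _ _).trans (max_le
      ((totalDegree_add _ _).trans (max_le ?_ ?_)) (hsq h))) (by omega))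
    · exact (hsq f).trans (by omega)
    · exact (hsq g).trans (by omega)
  rw [totalDegree_mul_of_isDomain (mul_ne_zero hf0 hg0) hh0, totalDegree_mul_of_isDomain hf0 hg0] at h2
  by_cases h0 : f * g - h = 0
  · rw [h0, totalDegree_zero]; omega
  have h3 : (f * g - h) * h = f ^ 2 + g ^ 2 - (kappa + 2) := by linear_combination -e
  have h4 : ((f * g - h) * h).totalDegree ≤ 2 * h.totalDegree - 1 := by
    rw [h3]
    refine (totalDegree_sub _ _).trans (max_le ((totalDegree_add _ _).trans (max_le ?_ ?_)) (by omega))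
    · exact (hsq f).trans (by omega)
    · exact (hsq g).trans (by omega)
  rw [totalDegree_mul_of_isDomain h0 hh0] at h4
  omega

/-- An automorphism fixes the constants, so by injectivity it cannot send a coordinate to one. -/
lemma one_le_totalDegree (φ : MvPolynomial (Fin 3) ℂ ≃ₐ[ℂ] MvPolynomial (Fin 3) ℂ) (i : Fin 3) :
    1 ≤ (φ (X i)).totalDegree := by
  by_contra h
  have h0 : (φ (X i)).totalDegree = 0 := by omega
  rw [totalDegree_eq_zero_iff_eq_C] at h0
  have h1 : φ (X i) = φ (C (coeff 0 (φ (X i)))) := by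
    rw [h0, ← MvPolynomial.algebraMap_eq, φ.commutes]; simp [MvPolynomial.algebraMap_eq]
  have h2 := φ.injective h1
  have := congrArg totalDegree h2
  simp at this

/-- A property of points which is stable under Vieta involutions, permutations and even
sign-changes is stable under `Γ`. -/
theorem stable_under_Gam {R : (Fin 3 → ℂ) → Prop} (hV : ∀ i p, R p → R (vieta i p))
    (hP : ∀ (σ : Equiv.Perm (Fin 3)) p, R p → R (p ∘ σ))
    (hS : ∀ (s : Fin 3 → ℤˣ) p, s 0 * s 1 * s 2 = 1 → R p → R (signChange s p))
    {q : Fin 3 → ℂ} (hq : R q) (φ : MvPolynomial (Fin 3) ℂ ≃ₐ[ℂ] MvPolynomial (Fin 3) ℂ)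
    (hφ : φ ∈ Gam) : R (polyMap φ q) := by
  induction hn : (φ (X 0)).totalDegree + (φ (X 1)).totalDegree + (φ (X 2)).totalDegree
    using Nat.strong_induction_on generalizing φ with
  | _ n ih =>
  have e := mem_Gam.1 hφ
  -- Composition with a Vieta involution changes only the image of X i and lowers the total degree.
  -- The induction hypothesis applies to the composite, and the involution is then undone on points
  -- with `hV`.
  have step : ∀ i, (φ (X (i + 1)) * φ (X (i + 2)) - φ (X i)).totalDegree < (φ (X i)).totalDegree →
      R (polyMap φ q) := by
    intro i hi
    have h1 : R (polyMap (φ * vietaEquiv i) q) := by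
      refine ih _ ?_ _ (mul_mem hφ (vietaEquiv_mem i)) rfl
      rw [← hn]
      have h0 : ∀ j, (φ * vietaEquiv i) (X j) =
          if j = i then φ (X (i + 1)) * φ (X (i + 2)) - φ (X i) else φ (X j) := by
        intro j
        change φ (vietaEquiv i (X j)) = _
        split_ifs with h <;> simp [vietaEquiv, vietaHom, h]
      rw [h0, h0, h0]
      fin_cases i <;> simp at hi ⊢ <;> omega
    rw [polyMap_mul, polyMap_vietaEquiv] at h1
    have := hV i _ h1
    rwa [vieta_vieta] at this
  have d0 := one_le_totalDegree φ 0
  have d1 := one_le_totalDegree φ 1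
  have d2 := one_le_totalDegree φ 2
  by_cases hbig : ∃ i, 2 ≤ (φ (X i)).totalDegree
  · obtain ⟨i, -, hi⟩ := Finset.exists_max_image Finset.univ (fun i => (φ (X i)).totalDegree) ⟨0, by simp⟩
    obtain ⟨k, hk⟩ := hbig
    have hi2 := hk.trans (hi k (Finset.mem_univ _))
    refine step i (totalDegree_vieta_lt ?_ (one_le_totalDegree φ _) (one_le_totalDegree φ _)
      (hi _ (Finset.mem_univ _)) (hi _ (Finset.mem_univ _)) hi2)
    rw [← e]
    fin_cases i <;> simp <;> ring
  · push Not at hbig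
    have ha := fun i => eval_of_totalDegree_le_one (f := φ (X i)) (by have := hbig i; omega)
    choose b a hab using ha
    obtain ⟨σ, s, hs, h⟩ := affine_preserving (b := b) (a := a) (fun v => by
      have := congrArg (eval v) e
      simp only [kappa, map_sub, map_add, map_mul, map_pow, eval_X] at this
      simp only [Fin.sum_univ_three, Fin.prod_univ_three, ← hab]
      linear_combination this)
    have : polyMap φ q = signChange s q ∘ σ := by
      ext i
      simp only [polyMap, hab, h, signChange, Function.comp]
    rw [this]
    exact hP σ _ (hS s q hs hq)

end PantsChar

end

noncomputable section

namespace PantsChar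

open Matrix

/-! ### Automorphisms of the free group acting on characters -/

lemma trace_SL2_inv {R : Type*} [CommRing R] (A : SpecialLinearGroup (Fin 2) R) :
    trace ((A⁻¹ : SpecialLinearGroup (Fin 2) R) : Matrix (Fin 2) (Fin 2) R) =
      trace (A : Matrix (Fin 2) (Fin 2) R) := by
  simp [adjugate_fin_two, trace_fin_two, add_comm]

lemma trace_SL2_mul_inv {R : Type*} [CommRing R] (A B : SpecialLinearGroup (Fin 2) R) :
    trace ((A * B⁻¹ : SpecialLinearGroup (Fin 2) R) : Matrix (Fin 2) (Fin 2) R) =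
      trace (A : Matrix (Fin 2) (Fin 2) R) * trace (B : Matrix (Fin 2) (Fin 2) R) -
        trace ((A * B : SpecialLinearGroup (Fin 2) R) : Matrix (Fin 2) (Fin 2) R) := by
  simp [adjugate_fin_two, trace_fin_two, mul_apply, Fin.sum_univ_two]
  ring

lemma trace_SL2_mul_comm {R : Type*} [CommRing R] (A B : SpecialLinearGroup (Fin 2) R) :
    trace ((A * B : SpecialLinearGroup (Fin 2) R) : Matrix (Fin 2) (Fin 2) R) =
      trace ((B * A : SpecialLinearGroup (Fin 2) R) : Matrix (Fin 2) (Fin 2) R) := by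
  exact trace_mul_comm (A : Matrix (Fin 2) (Fin 2) R) (B : Matrix (Fin 2) (Fin 2) R)

/-- An involutive endomorphism as an automorphism. -/
def involAut (f : Pi2 →* Pi2) (h : f.comp f = MonoidHom.id Pi2) : Pi2 ≃* Pi2 :=
  MonoidHom.toMulEquiv f f h h

/-- The automorphism which exchanges `X` and `Y`. -/
def autSwap : Pi2 ≃* Pi2 := involAut (FreeGroup.lift ![genY, genX]) (by
  ext i; fin_cases i <;> simp [genX, genY])

/-- The automorphism `X ↦ X⁻¹`, `Y ↦ XY`. -/
def autShear : Pi2 ≃* Pi2 := involAut (FreeGroup.lift ![genX⁻¹, genX * genY]) (by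
  ext i; fin_cases i <;> simp [genX, genY])

/-- The automorphism `X ↦ X`, `Y ↦ Y⁻¹`. -/
def autInv : Pi2 ≃* Pi2 := involAut (FreeGroup.lift ![genX, genY⁻¹]) (by
  ext i; fin_cases i <;> simp [genX, genY])

lemma autSwap_genX : autSwap genX = genY := by
  change FreeGroup.lift ![genY, genX] (FreeGroup.of 0) = _
  simp

lemma autSwap_genY : autSwap genY = genX := by
  change FreeGroup.lift ![genY, genX] (FreeGroup.of 1) = _
  simp

lemma autShear_genX : autShear genX = genX⁻¹ := by
  change FreeGroup.lift ![genX⁻¹, genX * genY] (FreeGroup.of 0) = _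
  simp

lemma autShear_genY : autShear genY = genX * genY := by
  change FreeGroup.lift ![genX⁻¹, genX * genY] (FreeGroup.of 1) = _
  simp

lemma autInv_genX : autInv genX = genX := by
  change FreeGroup.lift ![genX, genY⁻¹] (FreeGroup.of 0) = _
  simp

lemma autInv_genY : autInv genY = genY⁻¹ := by
  change FreeGroup.lift ![genX, genY⁻¹] (FreeGroup.of 1) = _
  simp

lemma character_comp (ρ : Pi2 →* SpecialLinearGroup (Fin 2) ℂ) (φ : Pi2 ≃* Pi2) :
    character (ρ.comp φ.toMonoidHom) = ![trace (ρ (φ genX) : Matrix (Fin 2) (Fin 2) ℂ),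
      trace (ρ (φ genY) : Matrix (Fin 2) (Fin 2) ℂ),
      trace (ρ (φ genX * φ genY) : Matrix (Fin 2) (Fin 2) ℂ)] := by
  simp [character]

lemma character_comp_autSwap (ρ : Pi2 →* SpecialLinearGroup (Fin 2) ℂ) :
    character (ρ.comp autSwap.toMonoidHom) = character ρ ∘ Equiv.swap 0 1 := by
  rw [character_comp, autSwap_genX, autSwap_genY, map_mul, trace_SL2_mul_comm, ← map_mul]
  ext i; fin_cases i <;> simp [character, Equiv.swap_apply_of_ne_of_ne]

lemma character_comp_autShear (ρ : Pi2 →* SpecialLinearGroup (Fin 2) ℂ) :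
    character (ρ.comp autShear.toMonoidHom) = character ρ ∘ Equiv.swap 1 2 := by
  rw [character_comp, autShear_genX, autShear_genY, map_inv, trace_SL2_inv, inv_mul_cancel_left]
  ext i; fin_cases i <;> simp [character, Equiv.swap_apply_of_ne_of_ne]

/-- This is the identity tr(AB⁻¹) = tr A · tr B - tr(AB). -/
lemma character_comp_autInv (ρ : Pi2 →* SpecialLinearGroup (Fin 2) ℂ) :
    character (ρ.comp autInv.toMonoidHom) = vieta 2 (character ρ) := by
  rw [character_comp, autInv_genX, autInv_genY, map_mul, map_inv, trace_SL2_inv, trace_SL2_mul_inv,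
    ← map_mul]
  ext i; fin_cases i <;> simp [character, vieta]

/-- The representation `ρ` with its values on the generators multiplied by signs. -/
def twist (ρ : Pi2 →* SpecialLinearGroup (Fin 2) ℂ) (s : Fin 2 → ℤˣ) :
    Pi2 →* SpecialLinearGroup (Fin 2) ℂ :=
  FreeGroup.lift fun i => if s i = 1 then ρ (FreeGroup.of i) else -ρ (FreeGroup.of i)

lemma twist_eq_or (ρ : Pi2 →* SpecialLinearGroup (Fin 2) ℂ) (s : Fin 2 → ℤˣ) (γ : Pi2) :
    twist ρ s γ = ρ γ ∨ twist ρ s γ = -ρ γ := by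
  induction γ using FreeGroup.induction_on with
  | C1 => simp
  | of i => by_cases h : s i = 1 <;> simp [twist, h]
  | inv_of i h =>
    rcases h with h | h <;> rw [map_inv, map_inv, h]
    · exact Or.inl rfl
    · right; ext a b; fin_cases a <;> fin_cases b <;> simp [adjugate_fin_two]
  | mul x y hx hy =>
    rcases hx with hx | hx <;> rcases hy with hy | hy <;> simp [hx, hy]

lemma units_int_cases (u : ℤˣ) : u = 1 ∨ u = -1 := Int.units_eq_one_or u

/-- The signs u, w, uw which the twist puts on φ(X), φ(Y) and their product multiply to one, so they
form an even sign-change. -/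
lemma character_mem_signOctant_of_twist {ρ : Pi2 →* SpecialLinearGroup (Fin 2) ℂ} {s : Fin 2 → ℤˣ}
    {φ : Pi2 ≃* Pi2} (h : character ((twist ρ s).comp φ.toMonoidHom) ∈ signOctant) :
    character (ρ.comp φ.toMonoidHom) ∈ signOctant := by
  obtain ⟨ε, hε, q, hq, h⟩ := h
  have key : ∀ γ, ∃ u : ℤˣ, twist ρ s γ = if u = 1 then ρ γ else -ρ γ := fun γ => by
    rcases twist_eq_or ρ s γ with h | h
    · exact ⟨1, by simp [h]⟩
    · exact ⟨-1, by simp [h]⟩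
  obtain ⟨u, hu⟩ := key (φ genX)
  obtain ⟨w, hw⟩ := key (φ genY)
  have huw : twist ρ s (φ genX * φ genY) = if u * w = 1 then ρ (φ genX * φ genY) else
      -ρ (φ genX * φ genY) := by
    rw [map_mul, map_mul, hu, hw]
    rcases units_int_cases u with rfl | rfl <;> rcases units_int_cases w with rfl | rfl <;> simp
  have ht : ∀ (u : ℤˣ) (A : SpecialLinearGroup (Fin 2) ℂ),
      trace ((if u = 1 then A else -A : SpecialLinearGroup (Fin 2) ℂ) : Matrix (Fin 2) (Fin 2) ℂ) =
        ((u : ℤ) : ℂ) * trace (A : Matrix (Fin 2) (Fin 2) ℂ) := fun u A => by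
    rcases units_int_cases u with rfl | rfl <;> simp
  refine ⟨fun i => ![u, w, u * w] i * ε i, ?_, q, hq, ?_⟩
  · simp only [Matrix.cons_val_zero, Matrix.cons_val_one, Matrix.cons_val]
    calc _ = (u * u) * (w * w) * (ε 0 * ε 1 * ε 2) := by
          rw [mul_assoc, mul_assoc]; simp only [mul_assoc, mul_comm, mul_left_comm]
      _ = 1 := by rw [Int.units_mul_self, Int.units_mul_self, hε]; rfl
  · rw [character_comp, hu, hw, huw, ht, ht, ht] at h
    rw [character_comp]
    have h0 := congrFun h 0
    have h1 := congrFun h 1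
    have h2 := congrFun h 2
    simp only [Matrix.cons_val_zero, Matrix.cons_val_one, Matrix.cons_val] at h0 h1 h2
    have e : ∀ (a : ℤˣ) (b c : ℂ), ((a : ℤ) : ℂ) * b = c → b = ((a : ℤ) : ℂ) * c := fun a b c hh => by
      rw [← hh, ← mul_assoc, units_int_sq, one_mul]
    ext i
    fin_cases i
    · simpa [mul_assoc] using e _ _ _ h0
    · simpa [mul_assoc] using e _ _ _ h1
    · simpa [mul_assoc] using e _ _ _ h2

/-- Even sign-changes correspond to homomorphisms π → {±1}: two signs are free and the third is
their product. -/
lemma character_twist (ρ : Pi2 →* SpecialLinearGroup (Fin 2) ℂ) {s : Fin 3 → ℤˣ}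
    (hs : s 0 * s 1 * s 2 = 1) :
    character (twist ρ ![s 0, s 1]) = signChange s (character ρ) := by
  have h2 : s 2 = s 0 * s 1 := by
    have := congrArg (fun u => s 0 * s 1 * u) hs
    simp only [mul_one] at this
    rw [← this, ← mul_assoc, Int.units_mul_self, one_mul]
  have hX : twist ρ ![s 0, s 1] genX = if s 0 = 1 then ρ genX else -ρ genX := by
    rcases units_int_cases (s 0) with h | h <;> simp [twist, genX, h]
  have hY : twist ρ ![s 0, s 1] genY = if s 1 = 1 then ρ genY else -ρ genY := by
    rcases units_int_cases (s 1) with h | h <;> simp [twist, genY, h]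
  ext i
  fin_cases i
  · simp only [character, hX, signChange]
    rcases units_int_cases (s 0) with h | h <;> simp [h]
  · simp only [character, hY, signChange]
    rcases units_int_cases (s 1) with h | h <;> simp [h]
  · simp only [character, map_mul, hX, hY, signChange]
    rcases units_int_cases (s 0) with h | h <;> rcases units_int_cases (s 1) with h' | h' <;>
      simp [h, h', h2]

/-- A character in the orbit `Γ · Ω₀` comes to lie in `Σ · Ω₀` after an automorphism of `π`. -/
theorem exists_aut_of_mem_gamOctant {ρ : Pi2 →* SpecialLinearGroup (Fin 2) ℂ}
    (h : character ρ ∈ gamOctant) :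
    ∃ φ : Pi2 ≃* Pi2, character (ρ.comp φ.toMonoidHom) ∈ signOctant := by
  obtain ⟨ψ, hψ, q, hq, h⟩ := h
  -- The property concerns all representations with character p. A move can then be made on the
  -- representation and undone on the character, without choosing a representation for each point.
  set R : (Fin 3 → ℂ) → Prop := fun p => ∀ ρ : Pi2 →* SpecialLinearGroup (Fin 2) ℂ,
    character ρ = p → ∃ φ : Pi2 ≃* Pi2, character (ρ.comp φ.toMonoidHom) ∈ signOctant with hR
  have hmove : ∀ (m : (Fin 3 → ℂ) → (Fin 3 → ℂ)) (ν : Pi2 ≃* Pi2),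
      (∀ ρ, character (ρ.comp ν.toMonoidHom) = m (character ρ)) → (∀ p, m (m p) = p) →
      ∀ p, R p → R (m p) := by
    intro m ν hm hmm p hp ρ hρ
    obtain ⟨φ, hφ⟩ := hp (ρ.comp ν.toMonoidHom) (by rw [hm, hρ, hmm])
    exact ⟨φ.trans ν, hφ⟩
  have h01 := hmove (fun p => p ∘ Equiv.swap 0 1) autSwap character_comp_autSwap
    (fun p => by ext i; simp)
  have h12 := hmove (fun p => p ∘ Equiv.swap 1 2) autShear character_comp_autShear
    (fun p => by ext i; simp)
  have hv2 := hmove (vieta 2) autInv character_comp_autInv (vieta_vieta 2)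
  -- The two adjacent transpositions, already realised by automorphisms, generate all permutations.
  have hP : ∀ (σ : Equiv.Perm (Fin 3)) p, R p → R (p ∘ σ) := by
    intro σ
    have hσ : σ ∈ Submonoid.closure (Set.range fun i : Fin 2 => Equiv.swap i.castSucc i.succ) := by
      rw [Equiv.Perm.mclosure_swap_castSucc_succ]; trivial
    induction hσ using Submonoid.closure_induction with
    | mem x hx =>
      obtain ⟨i, rfl⟩ := hx
      fin_cases i
      · exact h01
      · exact h12
    | one => intro p hp; simpa using hp
    | mul x y _ _ hx hy => intro p hp; exact hy _ (hx p hp)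
  refine stable_under_Gam (R := R) ?_ hP ?_ ?_ ψ hψ ρ h
  -- The other Vieta involutions are conjugate to the last one by transpositions.
  · intro i p hp
    have := hP (Equiv.swap i 2) _ (hv2 _ (hP (Equiv.swap i 2) _ hp))
    convert this using 1
    ext j
    fin_cases i <;> fin_cases j <;>
      simp [vieta, Equiv.swap_apply_of_ne_of_ne, mul_comm]
  · intro s p hs hp ρ' hρ'
    obtain ⟨φ, hφ⟩ := hp (twist ρ' ![s 0, s 1]) (by
      rw [character_twist ρ' hs, hρ']
      ext i
      simp only [signChange]
      rw [← mul_assoc, units_int_sq, one_mul])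
    exact ⟨φ, character_mem_signOctant_of_twist hφ⟩
  · intro ρ' hρ'
    refine ⟨MulEquiv.refl _, 1, by simp, q, hq, ?_⟩
    change character ρ' = _
    simp [hρ']

end PantsChar

end

/-! ### From embeddings to characters -/

noncomputable section

namespace PantsChar

open Matrix Topology

/-! ### The action on the set of discontinuity -/

section Discontinuity

variable (ρ : Pi2 →* SpecialLinearGroup (Fin 2) ℝ)

lemma moeb_one (z : OnePoint ℂ) : moeb ρ 1 z = z := by simp [moeb]

lemma moeb_mul (γ δ : Pi2) (z : OnePoint ℂ) : moeb ρ (γ * δ) z = moeb ρ γ (moeb ρ δ z) := by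
  simp [moeb, mul_smul]

lemma moeb_inv_moeb (γ : Pi2) (z : OnePoint ℂ) : moeb ρ γ⁻¹ (moeb ρ γ z) = z := by
  rw [← moeb_mul, inv_mul_cancel, moeb_one]

lemma moeb_moeb_inv (γ : Pi2) (z : OnePoint ℂ) : moeb ρ γ (moeb ρ γ⁻¹ z) = z := by
  rw [← moeb_mul, mul_inv_cancel, moeb_one]

lemma continuous_moeb (γ : Pi2) : Continuous (moeb ρ γ) :=
  (continuous_mob _).congr fun z => (moeb_eq_mob ρ γ z).symm

/-- Elements of `π` act by homeomorphisms of the sphere. -/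
def moebHomeo (γ : Pi2) : OnePoint ℂ ≃ₜ OnePoint ℂ where
  toFun := moeb ρ γ
  invFun := moeb ρ γ⁻¹
  left_inv := moeb_inv_moeb ρ γ
  right_inv := moeb_moeb_inv ρ γ
  continuous_toFun := continuous_moeb ρ γ
  continuous_invFun := continuous_moeb ρ γ⁻¹

lemma isOpen_discontinuitySet : IsOpen (discontinuitySet ρ) := by
  rw [isOpen_iff_mem_nhds]
  rintro z ⟨U, hU, hf⟩
  obtain ⟨V, hVU, hV, hz⟩ := mem_nhds_iff.1 hU
  filter_upwards [hV.mem_nhds hz] with w hw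
  exact ⟨U, Filter.mem_of_superset (hV.mem_nhds hw) hVU, hf⟩

variable {ρ}

lemma moeb_mem_discontinuitySet (γ : Pi2) {z : OnePoint ℂ} (hz : z ∈ discontinuitySet ρ) :
    moeb ρ γ z ∈ discontinuitySet ρ := by
  obtain ⟨U, hU, hf⟩ := hz
  refine ⟨moeb ρ γ '' U, (moebHomeo ρ γ).isOpenMap.image_mem_nhds hU,
    (hf.image fun δ => γ * δ * γ⁻¹).subset ?_⟩
  rintro δ ⟨w, ⟨x, ⟨u, hu, rfl⟩, rfl⟩, ⟨u', hu', h⟩⟩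
  refine ⟨γ⁻¹ * δ * γ, ⟨u', ⟨u, hu, ?_⟩, hu'⟩, by group⟩
  rw [moeb_mul, moeb_mul, ← h, moeb_inv_moeb]

lemma moeb_mem_idealCircle (γ : Pi2) {z : OnePoint ℂ} : moeb ρ γ z ∈ idealCircle ↔ z ∈ idealCircle := by
  rw [moeb_eq_mob, mob_mem_idealCircle]

lemma moeb_mem_upperHalf (γ : Pi2) {z : OnePoint ℂ} : moeb ρ γ z ∈ upperHalf ↔ z ∈ upperHalf := by
  rw [moeb_eq_mob, mob_mem_upperHalf]
  change 0 < (ρ γ : Matrix (Fin 2) (Fin 2) ℝ).det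
  rw [(ρ γ).det_coe]; exact one_pos

lemma moeb_mem_bordered (γ : Pi2) {z : OnePoint ℂ} (hz : z ∈ bordered ρ) : moeb ρ γ z ∈ bordered ρ := by
  refine ⟨?_, moeb_mem_discontinuitySet γ hz.2⟩
  rcases hz.1 with h | h
  · exact Or.inl ((moeb_mem_upperHalf γ).2 h)
  · exact Or.inr ((moeb_mem_idealCircle γ).2 h)

/-- If γ fixed z, then all its powers, infinitely many as π is torsion-free, would bring every
neighbourhood of z back to itself. -/
lemma moeb_ne_self {z : OnePoint ℂ} (hz : z ∈ discontinuitySet ρ) {γ : Pi2} (hγ : γ ≠ 1) :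
    moeb ρ γ z ≠ z := by
  intro h
  obtain ⟨U, hU, hf⟩ := hz
  have hzU := mem_of_mem_nhds hU
  have hpow : ∀ n : ℕ, moeb ρ (γ ^ n) z = z := fun n => by
    induction n with
    | zero => rw [pow_zero, moeb_one]
    | succ n ih => rw [pow_succ, moeb_mul, h, ih]
  have : (Set.range fun n : ℕ => γ ^ n).Infinite :=
    Set.infinite_range_of_injective (injective_pow_iff_not_isOfFinOrder.2
      (not_isOfFinOrder_of_isMulTorsionFree hγ))
  refine this (hf.subset ?_)
  rintro _ ⟨n, rfl⟩
  exact ⟨z, ⟨z, hzU, hpow n⟩, hzU⟩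

/-- Only finitely many elements bring U back to itself, and each nontrivial one moves z; finitely
many separations of z from its images shrink U to a neighbourhood on which the action is free. -/
lemma exists_free_nhd {z : OnePoint ℂ} (hz : z ∈ discontinuitySet ρ) :
    ∃ U ∈ 𝓝 z, ∀ γ : Pi2, ∀ w ∈ U, moeb ρ γ w ∈ U → γ = 1 := by
  obtain ⟨U, hU, hf⟩ := id hz
  have h1 : ∀ γ : Pi2, ∃ V ∈ 𝓝 z, γ ≠ 1 → ∀ w ∈ V, moeb ρ γ w ∉ V := by
    intro γ
    by_cases hγ : γ = 1
    · exact ⟨Set.univ, Filter.univ_mem, fun h => (h hγ).elim⟩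
    · obtain ⟨A, B, hA, hB, hzA, hzB, hAB⟩ := t2_separation (moeb_ne_self hz hγ)
      refine ⟨B ∩ moeb ρ γ ⁻¹' A, Filter.inter_mem (hB.mem_nhds hzB)
        ((continuous_moeb ρ γ).continuousAt.preimage_mem_nhds (hA.mem_nhds hzA)), fun _ w hw hw' => ?_⟩
      exact Set.disjoint_left.1 hAB hw.2 hw'.1
  choose V hV hVf using h1
  refine ⟨U ∩ ⋂ γ ∈ {γ : Pi2 | (moeb ρ γ '' U ∩ U).Nonempty}, V γ,
    Filter.inter_mem hU ((Filter.biInter_mem hf).2 fun γ _ => hV γ), fun γ w hw hw' => ?_⟩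
  by_contra hγ
  have hmem : γ ∈ {γ : Pi2 | (moeb ρ γ '' U ∩ U).Nonempty} := ⟨_, ⟨w, hw.1, rfl⟩, hw'.1⟩
  exact hVf γ hγ w (Set.mem_iInter₂.1 hw.2 γ hmem) (Set.mem_iInter₂.1 hw'.2 γ hmem)

lemma isOpenMap_quotient_mk : IsOpenMap (Quotient.mk (orbitSetoid ρ)) := by
  intro U hU
  refine (isQuotientMap_quotient_mk' (s := orbitSetoid ρ)).isOpen_preimage.1 ?_
  have : ((Quotient.mk (orbitSetoid ρ)) ⁻¹' (Quotient.mk (orbitSetoid ρ) '' U) : Set (bordered ρ)) =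
      ⋃ γ : Pi2, {z : bordered ρ | (⟨moeb ρ γ z, moeb_mem_bordered γ z.2⟩ : bordered ρ) ∈ U} := by
    ext z
    simp only [Set.mem_preimage, Set.mem_image, Set.mem_iUnion]
    constructor
    · rintro ⟨u, hu, h⟩
      obtain ⟨γ, hγ⟩ := Quotient.exact h
      refine ⟨γ⁻¹, ?_⟩
      have : moeb ρ γ⁻¹ z = u := by rw [← hγ, moeb_inv_moeb]
      have h2 : (⟨moeb ρ γ⁻¹ z, moeb_mem_bordered γ⁻¹ z.2⟩ : bordered ρ) = u := Subtype.ext this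
      rw [Set.mem_ofPred_eq, h2]; exact hu
    · rintro ⟨γ, hγ⟩
      exact ⟨_, hγ, Quotient.sound ⟨γ⁻¹, moeb_inv_moeb ρ γ z⟩⟩
  change IsOpen ((Quotient.mk (orbitSetoid ρ)) ⁻¹' _)
  rw [this]
  exact isOpen_iUnion fun γ => hU.preimage
    (((continuous_moeb ρ γ).comp continuous_subtype_val).subtype_mk _)

/-- A discrete subgroup of SL(2, ℝ) acts properly discontinuously on the hyperbolic plane;
injectivity turns finiteness in the image into finiteness in π. -/
lemma upperHalf_subset (hρ : IsDiscreteEmbedding ρ) : upperHalf ⊆ discontinuitySet ρ := by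
  rintro _ ⟨w, hw, rfl⟩
  have := hρ.2
  set τ : UpperHalfPlane := ⟨w, hw⟩
  obtain ⟨K, hK, hτK⟩ := exists_compact_mem_nhds τ
  have hfin := ProperlyDiscontinuousSMul.finite_disjoint_inter_image (Γ := ρ.range) hK hK
  set f : UpperHalfPlane → OnePoint ℂ := fun z => ((z : ℂ) : OnePoint ℂ)
  have hf : IsOpenEmbedding f :=
    OnePoint.isOpenEmbedding_coe.comp UpperHalfPlane.isOpenEmbedding_coe
  have hfρ : ∀ γ z, moeb ρ γ (f z) = f ((ρ.rangeRestrict γ) • z) := by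
    intro γ z
    have hden := UpperHalfPlane.denom_ne_zero (SpecialLinearGroup.toGL (ρ γ)) z
    have hden' : ((ρ γ 1 0 : ℝ) : ℂ) * z + ((ρ γ 1 1 : ℝ) : ℂ) ≠ 0 := hden
    have h1 := UpperHalfPlane.coe_specialLinearGroup_apply (ρ γ) z
    change moeb ρ γ ((z : ℂ) : OnePoint ℂ) = (((ρ γ • z : UpperHalfPlane) : ℂ) : OnePoint ℂ)
    rw [h1, moeb_eq_mob, mob_eq_pt]
    simp only [pt, lin, vec_coe, mul_one]
    exact if_neg hden'
  refine ⟨f '' K, hf.isOpenMap.image_mem_nhds hτK, ?_⟩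
  have hinj : Function.Injective ρ.rangeRestrict := fun a b h => hρ.1 (congrArg Subtype.val h)
  refine (hfin.preimage hinj.injOn).subset ?_
  rintro γ ⟨_, ⟨_, ⟨z, hz, rfl⟩, rfl⟩, ⟨z', hz', h⟩⟩
  rw [hfρ] at h
  exact ⟨z', ⟨z, hz, (hf.injective h).symm⟩, hz'⟩

lemma upperHalf_subset_bordered (hρ : IsDiscreteEmbedding ρ) : upperHalf ⊆ bordered ρ :=
  fun _ hz => ⟨Or.inl hz, upperHalf_subset hρ hz⟩

lemma moeb_pt (γ : Pi2) {v : ℂ × ℂ} (hv : v ≠ 0) :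
    moeb ρ γ (pt v) = pt (lin (ρ γ : Matrix (Fin 2) (Fin 2) ℝ) v) := by
  rw [moeb_eq_mob, mob_pt _ hv]
  rfl

lemma imf_pt_pos {v : ℂ × ℂ} (hv : v ≠ 0) : pt v ∈ upperHalf ↔ 0 < imf v := by
  obtain ⟨t, ht, h⟩ := vec_pt hv
  rw [mem_upperHalf]
  conv_rhs => rw [h, imf_smul]
  exact (mul_pos_iff_of_pos_left (Complex.normSq_pos.2 ht)).symm

lemma SL2_det_eq (A : SpecialLinearGroup (Fin 2) ℝ) : A 0 0 * A 1 1 - A 0 1 * A 1 0 = 1 := by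
  have := A.det_coe
  rwa [det_fin_two] at this

/-- A matrix with |trace| < 2 has complex conjugate eigenvectors, hence a fixed point in the upper
half-plane, where the action is free. -/
lemma two_le_abs_trace (hρ : IsDiscreteEmbedding ρ) {γ : Pi2} (hγ : γ ≠ 1) :
    2 ≤ |trace (ρ γ : Matrix (Fin 2) (Fin 2) ℝ)| := by
  by_contra hlt
  push Not at hlt
  set A := ρ γ
  have hdet := SL2_det_eq A
  rw [trace_fin_two] at hlt
  obtain ⟨hlt1, hlt2⟩ := abs_lt.1 hlt
  change -2 < A 0 0 + A 1 1 at hlt1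
  change A 0 0 + A 1 1 < 2 at hlt2
  have hd : 0 < 4 - (A 0 0 + A 1 1) ^ 2 := by nlinarith
  have hc : A 1 0 ≠ 0 := by
    intro h
    rw [h] at hdet
    nlinarith [sq_nonneg (A 0 0 - A 1 1)]
  set s := Real.sqrt (4 - (A 0 0 + A 1 1) ^ 2)
  have hs : s * s = 4 - (A 0 0 + A 1 1) ^ 2 := Real.mul_self_sqrt hd.le
  have hs0 : 0 < s := Real.sqrt_pos.2 hd
  -- The sign σ selects the eigenvector that lies in the upper half-plane.
  obtain ⟨σ, hσ, hσc⟩ : ∃ σ : ℝ, σ * σ = 1 ∧ 0 < σ * A 1 0 := by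
    rcases hc.lt_or_gt with h | h
    · exact ⟨-1, by norm_num, by linarith⟩
    · exact ⟨1, by norm_num, by linarith⟩
  set v : ℂ × ℂ := (((A 0 0 - A 1 1 : ℝ) : ℂ) + ((σ * s : ℝ) : ℂ) * Complex.I, ((2 * A 1 0 : ℝ) : ℂ)) with hv
  have hv0 : v ≠ 0 := fun h => by
    have h2 := congrArg Prod.snd h
    simp [hv, hc] at h2
  have hmem : pt v ∈ upperHalf := by
    rw [imf_pt_pos hv0]
    simp only [imf, hv]
    simp
    nlinarith [mul_pos hs0 hσc]
  refine moeb_ne_self (upperHalf_subset hρ hmem) hγ ?_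
  set l : ℂ := (((A 0 0 + A 1 1 : ℝ) : ℂ) + ((σ * s : ℝ) : ℂ) * Complex.I) / 2
  have hl : l ≠ 0 := by
    intro h
    have := congrArg Complex.im h
    simp [l] at this
    rcases this with h | h
    · rw [h] at hσ; simp at hσ
    · exact hs0.ne' h
  rw [moeb_pt _ hv0]
  have : lin (A : Matrix (Fin 2) (Fin 2) ℝ) v = l • v := by
    have hs' : (s : ℂ) * s = 4 - ((A 0 0 : ℂ) + A 1 1) ^ 2 := by exact_mod_cast hs
    have hσ' : (σ : ℂ) * σ = 1 := by exact_mod_cast hσ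
    have hdet' : (A 0 0 : ℂ) * A 1 1 - A 0 1 * A 1 0 = 1 := by exact_mod_cast hdet
    have hI := Complex.I_mul_I
    ext
    · simp only [lin, hv, l, Prod.smul_fst, smul_eq_mul]
      push_cast
      linear_combination (1 / 2 : ℂ) * hs' - 2 * hdet' - (1 / 2 : ℂ) * s ^ 2 * σ ^ 2 * hI +
        (1 / 2 : ℂ) * s ^ 2 * hσ'
    · simp only [lin, hv, l, Prod.smul_snd, smul_eq_mul]
      push_cast
      ring
  rw [show (ρ γ : Matrix (Fin 2) (Fin 2) ℝ) = (A : Matrix (Fin 2) (Fin 2) ℝ) from rfl, this, pt_smul hl]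

lemma chordal_pt {v : ℂ × ℂ} (hv : v ≠ 0) {k : ℂ × ℂ} {ε : ℝ} :
    Complex.normSq (vdet (vec (pt v)) k) < ε * nsq (vec (pt v)) ↔
      Complex.normSq (vdet v k) < ε * nsq v := by
  obtain ⟨t, ht, h⟩ := vec_pt hv
  have hp := Complex.normSq_pos.2 ht
  conv_rhs => rw [h, normSq_vdet, hform_smul, ← normSq_vdet, nsq_smul]
  constructor <;> intro hh
  · nlinarith
  · refine lt_of_mul_lt_mul_left ?_ hp.le
    linarith

lemma two_imf_le_nsq (v : ℂ × ℂ) : 2 * imf v ≤ nsq v := by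
  simp [imf, nsq, Complex.normSq_apply]
  nlinarith [sq_nonneg (v.1.re + v.2.im), sq_nonneg (v.1.im - v.2.re)]

lemma normSq_add_le (a b : ℂ) : Complex.normSq (a + b) ≤ 2 * Complex.normSq a + 2 * Complex.normSq b := by
  simp [Complex.normSq_apply]
  nlinarith [sq_nonneg (a.re - b.re), sq_nonneg (a.im - b.im)]

/-- Both coordinates of the relation (w ∧ k) v = (v ∧ k) w - (v ∧ w) k between three vectors of the
plane are estimated and added. -/
lemma chordal_triangle (v w k : ℂ × ℂ) : Complex.normSq (vdet w k) * nsq v ≤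
    2 * (Complex.normSq (vdet v k) * nsq w) + 2 * (Complex.normSq (vdet v w) * nsq k) := by
  have h1 : vdet w k * v.1 = vdet v k * w.1 + -(vdet v w * k.1) := by simp [vdet]; ring
  have h2 : vdet w k * v.2 = vdet v k * w.2 + -(vdet v w * k.2) := by simp [vdet]; ring
  have e1 := normSq_add_le (vdet v k * w.1) (-(vdet v w * k.1))
  have e2 := normSq_add_le (vdet v k * w.2) (-(vdet v w * k.2))
  rw [← h1] at e1
  rw [← h2] at e2
  simp only [Complex.normSq_mul, Complex.normSq_neg] at e1 e2
  simp only [nsq]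
  linarith

lemma ne_neg_one_of_injective (hρ : Function.Injective ρ) (γ : Pi2) : ρ γ ≠ -1 := by
  intro h
  have h2 : ρ (γ ^ 2) = 1 := by rw [map_pow, h, neg_one_sq]
  have h3 : γ ^ 2 = 1 := hρ (by rw [h2, map_one])
  have h4 : γ = 1 := by
    by_contra hne
    exact not_isOfFinOrder_of_isMulTorsionFree hne (isOfFinOrder_iff_pow_eq_one.2 ⟨2, by norm_num, h3⟩)
  rw [h4, map_one] at h
  have := congrArg (fun A : SpecialLinearGroup (Fin 2) ℝ => A 0 0) h
  norm_num at this

/-- A nilpotent part: a parabolic element moves horocyclic points a small distance. -/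
lemma exists_horocyclic {A : SpecialLinearGroup (Fin 2) ℝ} (h1 : A ≠ 1) (h2 : A ≠ -1)
    (ht : |trace (A : Matrix (Fin 2) (Fin 2) ℝ)| = 2) :
    ∃ D : ℝ, ∀ n : ℝ, ∃ v : ℂ × ℂ, imf v = n ∧
      vdet v (lin (A : Matrix (Fin 2) (Fin 2) ℝ) v) = D := by
  have hdet := SL2_det_eq A
  rw [trace_fin_two] at ht
  change |A 0 0 + A 1 1| = 2 at ht
  obtain ⟨ε, hε, htr⟩ : ∃ ε : ℝ, ε * ε = 1 ∧ A 0 0 + A 1 1 = 2 * ε := by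
    rcases eq_or_eq_neg_of_abs_eq ht with h | h
    · exact ⟨1, by norm_num, by linarith⟩
    · exact ⟨-1, by norm_num, by linarith⟩
  have hN : (A 0 0 - ε) * (A 1 1 - ε) = A 0 1 * A 1 0 := by
    linear_combination hdet - ε * htr - hε
  have hA1 : A 1 1 = 2 * ε - A 0 0 := by linarith
  by_cases hc : A 1 0 = 0
  · have ha : A 0 0 = ε := by
      rw [hc, hA1] at hN
      have : (A 0 0 - ε) ^ 2 = 0 := by linear_combination -hN
      have := pow_eq_zero_iff (two_ne_zero) |>.1 this
      linarith
    have hb : A 0 1 ≠ 0 := by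
      intro hb
      have hd : A 1 1 = ε := by linarith
      rcases mul_self_eq_one_iff.1 hε with h | h
      · apply h1; ext i j; fin_cases i <;> fin_cases j <;> simp [ha, hb, hc, hd, h]
      · apply h2; ext i j; fin_cases i <;> fin_cases j <;> simp [ha, hb, hc, hd, h]
    refine ⟨-A 0 1, fun n => ⟨(n * Complex.I, 1), by simp [imf], ?_⟩⟩
    have hd : A 1 1 = ε := by linarith
    simp only [vdet, lin]
    change (n * Complex.I * (A 1 0 * (n * Complex.I) + A 1 1 * 1) - 1 * (A 0 0 * (n * Complex.I) + A 0 1 * 1) : ℂ) = _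
    rw [hc, hd, ha]; push_cast; ring
  -- For the nilpotent N = A - ε the vector (f1, f2) = N(1, 0) spans the kernel. Adding an imaginary
  -- multiple of it to (1, 0) adjusts the height n, but leaves v ∧ Av = v ∧ Nv = f2 unchanged.
  · set f1 := A 0 0 - ε with hf1
    set f2 := A 1 0
    refine ⟨f2, fun n => ⟨(1 + (-n / f2 : ℝ) * Complex.I * f1, (-n / f2 : ℝ) * Complex.I * f2), ?_, ?_⟩⟩
    · simp [imf]
      field_simp
    · have hN' : (f1 : ℂ) * (A 1 1 - ε) = A 0 1 * f2 := by exact_mod_cast hN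
      have hA0 : (A 0 0 : ℂ) = f1 + ε := by rw [hf1]; push_cast; ring
      have hA1' : (A 1 1 : ℂ) = ε - f1 := by
        have : A 1 1 = ε - f1 := by rw [hf1, hA1]; ring
        rw [this]; push_cast; ring
      set x : ℂ := ((-n / f2 : ℝ) : ℂ) * Complex.I
      simp only [vdet, lin]
      change (1 + x * f1) * (f2 * (1 + x * f1) + A 1 1 * (x * f2)) - x * f2 * (A 0 0 * (1 + x * f1) + A 0 1 * (x * f2)) = (f2 : ℂ)
      rw [hA1'] at hN' ⊢
      rw [hA0]
      linear_combination x ^ 2 * f2 * hN'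

lemma lin_SL_ne_zero (A : SpecialLinearGroup (Fin 2) ℝ) {v : ℂ × ℂ} (hv : v ≠ 0) :
    lin (A : Matrix (Fin 2) (Fin 2) ℝ) v ≠ 0 :=
  lin_ne_zero (by rw [A.det_coe]; exact one_ne_zero) hv

lemma imf_lin_SL (A : SpecialLinearGroup (Fin 2) ℝ) (v : ℂ × ℂ) :
    imf (lin (A : Matrix (Fin 2) (Fin 2) ℝ) v) = imf v := by
  rw [imf_lin, A.det_coe, one_mul]

lemma vdet_lin_SL (A : SpecialLinearGroup (Fin 2) ℝ) (v w : ℂ × ℂ) :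
    vdet (lin (A : Matrix (Fin 2) (Fin 2) ℝ) v) (lin (A : Matrix (Fin 2) (Fin 2) ℝ) w) = vdet v w := by
  rw [vdet_lin, A.det_coe, Complex.ofReal_one, one_mul]

/-- A discrete embedding with compact bordered quotient has only hyperbolic elements. -/
theorem two_lt_abs_trace (hρ : IsDiscreteEmbedding ρ) [CompactSpace (QuotientSurface ρ)]
    {γ : Pi2} (hγ : γ ≠ 1) : 2 < |trace (ρ γ : Matrix (Fin 2) (Fin 2) ℝ)| := by
  refine lt_of_le_of_ne (two_le_abs_trace hρ hγ) fun ht => ?_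
  obtain ⟨D, hD⟩ := exists_horocyclic (A := ρ γ)
    (fun h => hγ (hρ.1 (by rw [h, map_one]))) (ne_neg_one_of_injective hρ.1 γ) ht.symm
  choose v hv hvD using fun n : ℕ => hD (n + 1)
  have hv0 : ∀ n, v n ≠ 0 := fun n h => by
    have := hv n
    rw [h] at this
    simp only [imf, Prod.fst_zero, Prod.snd_zero, zero_mul, Complex.zero_im] at this
    have : (0 : ℝ) < n + 1 := by positivity
    linarith
  have hb : ∀ n, pt (v n) ∈ bordered ρ := fun n =>
    upperHalf_subset_bordered hρ ((imf_pt_pos (hv0 n)).2 (by rw [hv]; positivity))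
  -- The points with vectors v n rise into the cusp of γ; by compactness their classes cluster at
  -- the class of an ordinary point k.
  obtain ⟨x, hx⟩ := exists_clusterPt_of_compactSpace
    (Filter.map (fun n : ℕ => Quotient.mk (orbitSetoid ρ) ⟨pt (v n), hb n⟩) Filter.atTop)
  obtain ⟨⟨k, hk⟩, rfl⟩ := Quotient.exists_rep x
  obtain ⟨U, hU, hfree⟩ := exists_free_nhd hk.2
  obtain ⟨ε, hε, hUε⟩ := exists_chordal_nhd hU
  have hW := chordal_mem_nhds k (show 0 < ε / 4 by positivity)
  set W := {z | Complex.normSq (vdet (vec z) (vec k)) < ε / 4 * nsq (vec z)}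
  have hO : Quotient.mk (orbitSetoid ρ) '' {z : bordered ρ | (z : OnePoint ℂ) ∈ W ∩ U} ∈
      𝓝 (Quotient.mk (orbitSetoid ρ) ⟨k, hk⟩) :=
    isOpenMap_quotient_mk.image_mem_nhds
      (continuous_subtype_val.continuousAt.preimage_mem_nhds (Filter.inter_mem hW hU))
  have hfreq := (mapClusterPt_iff_frequently.1 hx) _ hO
  -- Beyond this threshold the displacement term of `chordal_triangle` uses at most half of the
  -- allowance ε; the ε / 4 in the definition of W leaves the other half.
  obtain ⟨n, hn, hmem⟩ := (Filter.frequently_atTop.1 hfreq) (⌈D ^ 2 * nsq (vec k) / ε⌉₊)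
  obtain ⟨w, ⟨hwW, hwU⟩, hwq⟩ := hmem
  obtain ⟨g, hg⟩ := Quotient.exact hwq.symm
  change moeb ρ g (pt (v n)) = w at hg
  set G : Matrix (Fin 2) (Fin 2) ℝ := (ρ g : Matrix (Fin 2) (Fin 2) ℝ)
  set A : Matrix (Fin 2) (Fin 2) ℝ := (ρ γ : Matrix (Fin 2) (Fin 2) ℝ)
  have hAv0 := lin_SL_ne_zero (ρ γ) (hv0 n)
  have hGv0 := lin_SL_ne_zero (ρ g) (hv0 n)
  have hGAv0 := lin_SL_ne_zero (ρ g) hAv0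
  have hw' : moeb ρ (g * γ * g⁻¹) w = pt (lin G (lin A (v n))) := by
    rw [← hg, moeb_mul, moeb_inv_moeb, moeb_mul, moeb_pt _ (hv0 n), moeb_pt _ hAv0]
  -- The height n + 1 is preserved by g and γ and bounds the squared norms from below, while the
  -- determinant D does not grow with n. So the conjugate of γ moves w only slightly, and w does not
  -- leave the neighbourhood U on which the action is free.
  have hone : g * γ * g⁻¹ = 1 := by
    refine hfree _ _ hwU ?_
    rw [hw']
    apply hUε _ hGAv0
    rw [← hg, moeb_pt _ (hv0 n)] at hwW
    have hW1 := (chordal_pt hGv0).1 hwW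
    change Complex.normSq (vdet (lin G (v n)) (vec k)) < ε / 4 * nsq (lin G (v n)) at hW1
    have htri := chordal_triangle (lin G (v n)) (lin G (lin A (v n))) (vec k)
    have hDD : vdet (lin G (v n)) (lin G (lin A (v n))) = D := by
      rw [← hvD n]; exact vdet_lin_SL (ρ g) _ _
    rw [hDD, Complex.normSq_ofReal] at htri
    have hnn : D ^ 2 * nsq (vec k) / ε ≤ n := (Nat.le_ceil _).trans (by exact_mod_cast hn)
    rw [div_le_iff₀ hε] at hnn
    have hn0 : (0 : ℝ) ≤ n := Nat.cast_nonneg n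
    have hp1 : 2 * ((n : ℝ) + 1) ≤ nsq (lin G (v n)) := by
      have h := two_imf_le_nsq (lin G (v n))
      have h2 : imf (lin G (v n)) = n + 1 := by rw [← hv n]; exact imf_lin_SL (ρ g) _
      rwa [h2] at h
    have hp2 : 2 * ((n : ℝ) + 1) ≤ nsq (lin G (lin A (v n))) := by
      have h := two_imf_le_nsq (lin G (lin A (v n)))
      have h2 : imf (lin G (lin A (v n))) = n + 1 := by
        rw [← hv n]; exact (imf_lin_SL (ρ g) _).trans (imf_lin_SL (ρ γ) _)
      rwa [h2] at h
    set P := nsq (lin G (v n))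
    set Q := nsq (lin G (lin A (v n)))
    have hPQ : 4 * (n : ℝ) < P * Q := by nlinarith
    have hfin : Complex.normSq (vdet (lin G (lin A (v n))) (vec k)) * P < ε * Q * P := by
      have hQ : 0 < Q := by linarith
      have h1 : Complex.normSq (vdet (lin G (v n)) (vec k)) * Q < ε / 4 * P * Q :=
        mul_lt_mul_of_pos_right hW1 hQ
      nlinarith
    exact lt_of_mul_lt_mul_right hfin (by linarith)
  apply hγ
  have : γ = g⁻¹ * (g * γ * g⁻¹) * g := by group
  rw [this, hone]; group

end Discontinuity

end PantsChar

end

noncomputable section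

namespace PantsChar

open Matrix Topology

/-! ### Invariant intervals of the ideal circle -/

lemma hform_sign_const {C : Set (OnePoint ℂ)} (hC : IsPreconnected C) {A B D E : ℝ}
    (h : ∀ z ∈ C, hform A B D E (vec z) ≠ 0) :
    (∀ z ∈ C, 0 < hform A B D E (vec z)) ∨ (∀ z ∈ C, hform A B D E (vec z) < 0) := by
  by_contra hcon
  push Not at hcon
  obtain ⟨⟨a, ha, ha0⟩, b, hb, hb0⟩ := hcon
  have ha1 : hfun A B D E a ≤ 0 := not_lt.1 fun h => absurd (hfun_pos_iff.1 h) (not_lt.2 ha0)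
  have hb1 : 0 ≤ hfun A B D E b := not_lt.1 fun h => absurd (hfun_neg_iff.1 h) (not_lt.2 hb0)
  obtain ⟨z, hz, h0⟩ := hC.intermediate_value ha hb (continuous_hfun A B D E).continuousOn ⟨ha1, hb1⟩
  refine h z hz ?_
  rw [hfun, div_eq_zero_iff] at h0
  exact h0.resolve_right (nsq_vec_pos z).ne'

/-- A real quadratic form. -/
def rform (A B E : ℝ) (v : ℝ × ℝ) : ℝ := A * v.1 ^ 2 + 2 * B * (v.1 * v.2) + E * v.2 ^ 2

/-- The complexification of a real vector. -/
def cvec (v : ℝ × ℝ) : ℂ × ℂ := (v.1, v.2)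

lemma cvec_ne_zero {v : ℝ × ℝ} (hv : v ≠ 0) : cvec v ≠ 0 := by
  intro h
  apply hv
  ext
  · exact Complex.ofReal_eq_zero.1 (congrArg Prod.fst h)
  · exact Complex.ofReal_eq_zero.1 (congrArg Prod.snd h)

lemma hform_cvec (A B E : ℝ) (v : ℝ × ℝ) : hform A B 0 E (cvec v) = rform A B E v := by
  simp [hform, rform, cvec, Complex.normSq_apply]
  ring

/-- The real linear action on real vectors. -/
def rlin (M : Matrix (Fin 2) (Fin 2) ℝ) (v : ℝ × ℝ) : ℝ × ℝ :=
  (M 0 0 * v.1 + M 0 1 * v.2, M 1 0 * v.1 + M 1 1 * v.2)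

lemma lin_cvec (M : Matrix (Fin 2) (Fin 2) ℝ) (v : ℝ × ℝ) : lin M (cvec v) = cvec (rlin M v) := by
  simp [lin, cvec, rlin]

lemma rlin_mul (M N : Matrix (Fin 2) (Fin 2) ℝ) (v : ℝ × ℝ) : rlin (M * N) v = rlin M (rlin N v) := by
  simp only [rlin, Matrix.mul_apply, Fin.sum_univ_two]
  ext <;> simp only <;> ring

lemma rlin_ne_zero {M : Matrix (Fin 2) (Fin 2) ℝ} (hM : M.det ≠ 0) {v : ℝ × ℝ} (hv : v ≠ 0) :
    rlin M v ≠ 0 := by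
  intro h
  have := lin_ne_zero hM (cvec_ne_zero hv)
  rw [lin_cvec, h] at this
  simp [cvec] at this

lemma exists_real_vec {z : OnePoint ℂ} (hz : z ∈ idealCircle) :
    ∃ v : ℝ × ℝ, v ≠ 0 ∧ vec z = cvec v ∧ z = pt (cvec v) := by
  rcases hz with rfl | ⟨t, rfl⟩
  · exact ⟨(1, 0), by simp, by simp [cvec], by simp [cvec, pt]⟩
  · exact ⟨(t, 1), by simp, by simp [cvec], by simp [cvec, pt]⟩

lemma pt_cvec_mem_idealCircle {v : ℝ × ℝ} (hv : v ≠ 0) : pt (cvec v) ∈ idealCircle := by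
  obtain ⟨t, ht, h⟩ := vec_pt (cvec_ne_zero hv)
  have h1 : imf (cvec v) = 0 := by simp [imf, cvec]
  rw [h, imf_smul] at h1
  rw [mem_idealCircle]
  exact (mul_eq_zero.1 h1).resolve_left (Complex.normSq_pos.2 ht).ne'

lemma hform_pt_pos {A B D E : ℝ} {v : ℂ × ℂ} (hv : v ≠ 0) :
    0 < hform A B D E (vec (pt v)) ↔ 0 < hform A B D E v := by
  obtain ⟨t, ht, h⟩ := vec_pt hv
  conv_rhs => rw [h]
  exact (hform_pos_iff ht).symm

/-- The quadratic form whose zeros are the fixed points of a matrix. -/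
def fixForm (M : Matrix (Fin 2) (Fin 2) ℝ) (v : ℝ × ℝ) : ℝ :=
  rform (M 1 0) ((M 1 1 - M 0 0) / 2) (-M 0 1) v

lemma moeb_eq_self_of_fixForm {ρ : Pi2 →* SpecialLinearGroup (Fin 2) ℝ} {γ : Pi2} {v : ℝ × ℝ}
    (hv : v ≠ 0) (h : fixForm (ρ γ : Matrix (Fin 2) (Fin 2) ℝ) v = 0) :
    moeb ρ γ (pt (cvec v)) = pt (cvec v) := by
  have hv' := cvec_ne_zero hv
  rw [moeb_pt _ hv', pt_eq_pt_iff (lin_SL_ne_zero _ hv') hv']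
  rw [lin_cvec]
  simp only [cvec, rlin]
  unfold fixForm rform at h
  norm_cast
  linear_combination -h

/-- An interval of ordinary points of the ideal circle preserved by an element of `π`. -/
structure InvariantInterval (ρ : Pi2 →* SpecialLinearGroup (Fin 2) ℝ) (c : Pi2)
    (C : Set (OnePoint ℂ)) : Prop where
  preconnected : IsPreconnected C
  nonempty : C.Nonempty
  subset_circle : C ⊆ idealCircle
  subset_disc : C ⊆ discontinuitySet ρ
  map_mem : ∀ z ∈ C, moeb ρ c z ∈ C
  inv_mem : ∀ z ∈ C, moeb ρ c⁻¹ z ∈ C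

lemma InvariantInterval.inv {ρ : Pi2 →* SpecialLinearGroup (Fin 2) ℝ} {c : Pi2}
    {C : Set (OnePoint ℂ)} (h : InvariantInterval ρ c C) : InvariantInterval ρ c⁻¹ C :=
  ⟨h.1, h.2, h.3, h.4, h.6, by rw [inv_inv]; exact h.5⟩

lemma exists_real_eigenvector (M : Matrix (Fin 2) (Fin 2) ℝ) (hM : M.det = 1) {l : ℝ}
    (hl : l ^ 2 - M.trace * l + 1 = 0) : ∃ P : ℝ × ℝ, P ≠ 0 ∧ rlin M P = l • P := by
  have h0 : (M - l • (1 : Matrix (Fin 2) (Fin 2) ℝ)).det = 0 := by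
    rw [det_fin_two] at hM ⊢
    rw [trace_fin_two] at hl
    simp
    linear_combination hl + hM
  obtain ⟨v, hv, h⟩ := exists_mulVec_eq_zero_iff.2 h0
  have e0 := congrFun h 0
  have e1 := congrFun h 1
  simp [Matrix.mulVec, dotProduct, Fin.sum_univ_two] at e0 e1
  refine ⟨(v 0, v 1), fun h => hv ?_, ?_⟩
  · ext i; fin_cases i
    · exact congrArg Prod.fst h
    · exact congrArg Prod.snd h
  · ext
    · simp [rlin]; linarith
    · simp [rlin]; linarith

/-- Eigenvectors of a hyperbolic matrix. -/
lemma exists_hyperbolic_eigenvectors (M : SpecialLinearGroup (Fin 2) ℝ)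
    (ht : 2 < |trace (M : Matrix (Fin 2) (Fin 2) ℝ)|) :
    ∃ (l : ℝ) (P Q : ℝ × ℝ), 1 < l ^ 2 ∧ rlin M P = l • P ∧ rlin M Q = l⁻¹ • Q ∧
      P.1 * Q.2 - P.2 * Q.1 ≠ 0 := by
  set t := trace (M : Matrix (Fin 2) (Fin 2) ℝ)
  have ht4 : 4 < t ^ 2 := by
    have := sq_abs t; nlinarith
  set s := Real.sqrt (t ^ 2 - 4)
  have hs : s * s = t ^ 2 - 4 := Real.mul_self_sqrt (by linarith)
  have hs0 : 0 < s := Real.sqrt_pos.2 (by linarith)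
  obtain ⟨l, hl, hl1⟩ : ∃ l : ℝ, l ^ 2 - t * l + 1 = 0 ∧ 1 < l ^ 2 := by
    rcases lt_or_ge 0 t with h | h
    · refine ⟨(t + s) / 2, by linear_combination hs / 4, ?_⟩
      have : 2 < t := by nlinarith
      nlinarith
    · refine ⟨(t - s) / 2, by linear_combination hs / 4, ?_⟩
      have : t < -2 := by nlinarith
      nlinarith
  have hl0 : l ≠ 0 := by rintro rfl; norm_num at hl1
  have hl' : l⁻¹ ^ 2 - t * l⁻¹ + 1 = 0 := by
    field_simp
    linear_combination hl
  obtain ⟨P, hP0, hP⟩ := exists_real_eigenvector M M.det_coe hl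
  obtain ⟨Q, hQ0, hQ⟩ := exists_real_eigenvector M M.det_coe hl'
  refine ⟨l, P, Q, hl1, hP, hQ, fun hD => ?_⟩
  have hll : l ≠ l⁻¹ := fun h => by
    have : l ^ 2 = 1 := by rw [sq]; nth_rw 2 [h]; exact mul_inv_cancel₀ hl0
    linarith
  have p1 := congrArg Prod.fst hP
  have p2 := congrArg Prod.snd hP
  have q1 := congrArg Prod.fst hQ
  have q2 := congrArg Prod.snd hQ
  simp only [rlin, Prod.smul_fst, Prod.smul_snd, smul_eq_mul] at p1 p2 q1 q2
  -- the two vectors are parallel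
  have hpar : ∃ k : ℝ, Q = k • P := by
    by_cases h1 : P.1 = 0
    · have h2 : P.2 ≠ 0 := fun h2 => hP0 (Prod.ext h1 h2)
      refine ⟨Q.2 / P.2, ?_⟩
      ext
      · have : P.2 * Q.1 = 0 := by rw [h1] at hD; linarith
        simp [h1, (mul_eq_zero.1 this).resolve_left h2]
      · simp [h2]
    · refine ⟨Q.1 / P.1, ?_⟩
      ext
      · simp [h1]
      · simp
        field_simp
        linarith
  obtain ⟨k, rfl⟩ := hpar
  simp only [Prod.smul_fst, Prod.smul_snd, smul_eq_mul] at q1 q2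
  have hk : k ≠ 0 := by rintro rfl; simp at hQ0
  apply hP0
  have a1 : (k * (l - l⁻¹)) * P.1 = 0 := by linear_combination q1 - k * p1
  have a2 : (k * (l - l⁻¹)) * P.2 = 0 := by linear_combination q2 - k * p2
  have hne := mul_ne_zero hk (sub_ne_zero.2 hll)
  exact Prod.ext ((mul_eq_zero.1 a1).resolve_left hne) ((mul_eq_zero.1 a2).resolve_left hne)

/-- The term A L ^ n dominates for large n. It is used to pass to the limit of a quadratic form
along an orbit of a hyperbolic element. -/
lemma nonneg_of_pow_growth {A B E L : ℝ} (hL : 1 < L) (h : ∀ n : ℕ, 0 ≤ A * L ^ n + B + E * (L⁻¹) ^ n) :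
    0 ≤ A := by
  by_contra hA
  push Not at hA
  obtain ⟨n, hn⟩ := pow_unbounded_of_one_lt ((|B| + |E|) / -A) hL
  rw [div_lt_iff₀ (by linarith)] at hn
  have h1 := h n
  have h2 : E * (L⁻¹) ^ n ≤ |E| := by
    have h3 : (L⁻¹) ^ n ≤ 1 := pow_le_one₀ (by positivity) (inv_le_one_of_one_le₀ hL.le)
    have h4 : 0 ≤ (L⁻¹) ^ n := by positivity
    calc E * (L⁻¹) ^ n ≤ |E| * (L⁻¹) ^ n := by gcongr; exact le_abs_self E
      _ ≤ |E| * 1 := by gcongr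
      _ = |E| := mul_one _
  have := le_abs_self B
  linarith

/-- A quadratic form positive on an invariant interval is nonnegative at its ends. -/
lemma InvariantInterval.ends_nonneg {ρ : Pi2 →* SpecialLinearGroup (Fin 2) ℝ} {c : Pi2}
    {C : Set (OnePoint ℂ)} (hC : InvariantInterval ρ c C) (hc : c ≠ 1) {l : ℝ} {P Q : ℝ × ℝ}
    (hl : 1 < l ^ 2) (hP : rlin (ρ c) P = l • P) (hQ : rlin (ρ c) Q = l⁻¹ • Q)
    (hD : P.1 * Q.2 - P.2 * Q.1 ≠ 0) {A B E : ℝ} (hF : ∀ z ∈ C, 0 < hform A B 0 E (vec z)) :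
    0 ≤ rform A B E P ∧ 0 ≤ rform A B E Q := by
  have hl0 : l ≠ 0 := by rintro rfl; norm_num at hl
  obtain ⟨z, hz⟩ := hC.nonempty
  obtain ⟨v, hv0, -, hzv⟩ := exists_real_vec (hC.subset_circle hz)
  set D := P.1 * Q.2 - P.2 * Q.1 with hDdef
  set α := (v.1 * Q.2 - v.2 * Q.1) / D with hα
  set β := (P.1 * v.2 - P.2 * v.1) / D with hβ
  have hv : v = α • P + β • Q := by
    ext
    · simp only [Prod.fst_add, Prod.smul_fst, smul_eq_mul, hα, hβ]; field_simp; rw [hDdef]; ring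
    · simp only [Prod.snd_add, Prod.smul_snd, smul_eq_mul, hα, hβ]; field_simp; rw [hDdef]; ring
  have p1 := congrArg Prod.fst hP
  have p2 := congrArg Prod.snd hP
  have q1 := congrArg Prod.fst hQ
  have q2 := congrArg Prod.snd hQ
  simp only [rlin, Prod.smul_fst, Prod.smul_snd, smul_eq_mul] at p1 p2 q1 q2
  have hlinc : ∀ a b : ℝ, rlin (ρ c) (a • P + b • Q) = (a * l) • P + (b * l⁻¹) • Q := fun a b => by
    ext
    · simp only [rlin, Prod.fst_add, Prod.snd_add, Prod.smul_fst, Prod.smul_snd, smul_eq_mul]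
      linear_combination a * p1 + b * q1
    · simp only [rlin, Prod.fst_add, Prod.snd_add, Prod.smul_fst, Prod.smul_snd, smul_eq_mul]
      linear_combination a * p2 + b * q2
  -- An ordinary point is not fixed by c, so both coordinates α and β of v in the eigenbasis are
  -- nonzero.
  have hfix : fixForm (ρ c : Matrix (Fin 2) (Fin 2) ℝ) v ≠ 0 := fun h =>
    moeb_ne_self (hC.subset_disc hz) hc (by rw [hzv]; exact moeb_eq_self_of_fixForm hv0 h)
  have hfe : fixForm (ρ c : Matrix (Fin 2) (Fin 2) ℝ) v = α * β * (l⁻¹ - l) * D := by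
    have h1 : fixForm (ρ c : Matrix (Fin 2) (Fin 2) ℝ) v =
        v.1 * (rlin (ρ c) v).2 - v.2 * (rlin (ρ c) v).1 := by
      simp only [fixForm, rform, rlin]; ring
    rw [h1, hv, hlinc]
    simp only [Prod.fst_add, Prod.snd_add, Prod.smul_fst, Prod.smul_snd, smul_eq_mul]
    rw [hDdef]; ring
  have hα0 : α ≠ 0 := fun h => hfix (by rw [hfe, h]; ring)
  have hβ0 : β ≠ 0 := fun h => hfix (by rw [hfe, h]; ring)
  -- forward and backward orbits
  have hpos : ∀ a b : ℝ, (a ≠ 0 ∧ b ≠ 0) → pt (cvec (a • P + b • Q)) ∈ C →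
      0 < a ^ 2 * rform A B E P + 2 * (a * b) * (A * (P.1 * Q.1) + B * (P.1 * Q.2 + P.2 * Q.1) +
        E * (P.2 * Q.2)) + b ^ 2 * rform A B E Q := by
    intro a b hab h
    have hne : a • P + b • Q ≠ 0 := by
      intro h0
      have e1 := congrArg Prod.fst h0
      have e2 := congrArg Prod.snd h0
      simp only [Prod.fst_add, Prod.snd_add, Prod.smul_fst, Prod.smul_snd, smul_eq_mul,
        Prod.fst_zero, Prod.snd_zero] at e1 e2
      have : a * D = 0 := by rw [hDdef]; linear_combination Q.2 * e1 - Q.1 * e2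
      exact (mul_ne_zero hab.1 hD) this
    have h1 := hF _ h
    rw [hform_pt_pos (cvec_ne_zero hne), hform_cvec] at h1
    refine h1.trans_eq ?_
    simp only [rform, Prod.fst_add, Prod.snd_add, Prod.smul_fst, Prod.smul_snd, smul_eq_mul]
    ring
  have hstep : ∀ a b : ℝ, a ≠ 0 ∧ b ≠ 0 → pt (cvec (a • P + b • Q)) ∈ C →
      pt (cvec ((a * l) • P + (b * l⁻¹) • Q)) ∈ C := by
    intro a b hab h
    have h1 := hC.map_mem _ h
    have hne : a • P + b • Q ≠ 0 := by
      intro h0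
      have e1 := congrArg Prod.fst h0
      have e2 := congrArg Prod.snd h0
      simp only [Prod.fst_add, Prod.snd_add, Prod.smul_fst, Prod.smul_snd, smul_eq_mul,
        Prod.fst_zero, Prod.snd_zero] at e1 e2
      have : a * D = 0 := by rw [hDdef]; linear_combination Q.2 * e1 - Q.1 * e2
      exact (mul_ne_zero hab.1 hD) this
    rwa [moeb_pt _ (cvec_ne_zero hne), lin_cvec, hlinc] at h1
  have hback : ∀ a b : ℝ, a ≠ 0 ∧ b ≠ 0 → pt (cvec (a • P + b • Q)) ∈ C →
      pt (cvec ((a * l⁻¹) • P + (b * l) • Q)) ∈ C := by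
    intro a b hab h
    have h1 := hC.inv_mem _ h
    have hne : (a * l⁻¹) • P + (b * l) • Q ≠ 0 := by
      intro h0
      have e1 := congrArg Prod.fst h0
      have e2 := congrArg Prod.snd h0
      simp only [Prod.fst_add, Prod.snd_add, Prod.smul_fst, Prod.smul_snd, smul_eq_mul,
        Prod.fst_zero, Prod.snd_zero] at e1 e2
      have : a * l⁻¹ * D = 0 := by rw [hDdef]; linear_combination Q.2 * e1 - Q.1 * e2
      exact (mul_ne_zero (mul_ne_zero hab.1 (inv_ne_zero hl0)) hD) this
    have h2 : moeb ρ c (pt (cvec ((a * l⁻¹) • P + (b * l) • Q))) = pt (cvec (a • P + b • Q)) := by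
      rw [moeb_pt _ (cvec_ne_zero hne), lin_cvec, hlinc]
      congr 3
      · field_simp
      · field_simp
    rwa [← h2, moeb_inv_moeb] at h1
  have hnz : ∀ n : ℕ, α * l ^ n ≠ 0 ∧ β * (l⁻¹) ^ n ≠ 0 := fun n =>
    ⟨mul_ne_zero hα0 (pow_ne_zero _ hl0), mul_ne_zero hβ0 (pow_ne_zero _ (inv_ne_zero hl0))⟩
  have hnz' : ∀ n : ℕ, α * (l⁻¹) ^ n ≠ 0 ∧ β * l ^ n ≠ 0 := fun n =>
    ⟨mul_ne_zero hα0 (pow_ne_zero _ (inv_ne_zero hl0)), mul_ne_zero hβ0 (pow_ne_zero _ hl0)⟩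
  have hn : ∀ n : ℕ, pt (cvec ((α * l ^ n) • P + (β * (l⁻¹) ^ n) • Q)) ∈ C := fun n => by
    induction n with
    | zero => simpa [← hv, ← hzv] using hz
    | succ n ih =>
      have := hstep _ _ (hnz n) ih
      rwa [mul_assoc, mul_assoc, ← pow_succ, ← pow_succ] at this
  have hn' : ∀ n : ℕ, pt (cvec ((α * (l⁻¹) ^ n) • P + (β * l ^ n) • Q)) ∈ C := fun n => by
    induction n with
    | zero => simpa [← hv, ← hzv] using hz
    | succ n ih =>
      have := hback _ _ (hnz' n) ih
      rwa [mul_assoc, mul_assoc, ← pow_succ, ← pow_succ] at this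
  set R := A * (P.1 * Q.1) + B * (P.1 * Q.2 + P.2 * Q.1) + E * (P.2 * Q.2)
  have hll : ∀ n : ℕ, l ^ n * (l⁻¹) ^ n = 1 := fun n => by
    rw [← mul_pow, mul_inv_cancel₀ hl0, one_pow]
  -- The orbit of z tends to P under c and to Q under c⁻¹. Along it, the leading coefficient of the
  -- form is α², respectively β², times its value at the end.
  constructor
  · have : 0 ≤ α ^ 2 * rform A B E P := by
      refine nonneg_of_pow_growth (B := 2 * (α * β) * R) (E := β ^ 2 * rform A B E Q) hl fun n => ?_
      refine (hpos _ _ (hnz n) (hn n)).le.trans_eq ?_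
      rw [← inv_pow, ← pow_mul, ← pow_mul, mul_comm 2 n, pow_mul, pow_mul]
      linear_combination 2 * α * β * R * hll n
    exact nonneg_of_mul_nonneg_right this (by positivity)
  · have : 0 ≤ β ^ 2 * rform A B E Q := by
      refine nonneg_of_pow_growth (B := 2 * (α * β) * R) (E := α ^ 2 * rform A B E P) hl fun n => ?_
      refine (hpos _ _ (hnz' n) (hn' n)).le.trans_eq ?_
      rw [← inv_pow, ← pow_mul, ← pow_mul, mul_comm 2 n, pow_mul, pow_mul]
      linear_combination 2 * α * β * R * hll n
    exact nonneg_of_mul_nonneg_right this (by positivity)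

lemma SL2_inv_apply (N : SpecialLinearGroup (Fin 2) ℝ) :
    ((N⁻¹ : SpecialLinearGroup (Fin 2) ℝ) : Matrix (Fin 2) (Fin 2) ℝ) =
      !![N 1 1, -N 0 1; -N 1 0, N 0 0] := by
  rw [SpecialLinearGroup.SL2_inv_expl]
  rfl

lemma trace_commutator_entries (M N : SpecialLinearGroup (Fin 2) ℝ) :
    trace ((M * N * M⁻¹ * N⁻¹ : SpecialLinearGroup (Fin 2) ℝ) : Matrix (Fin 2) (Fin 2) ℝ) =
      ((M 0 0 * N 0 0 + M 0 1 * N 1 0) * M 1 1 - (M 0 0 * N 0 1 + M 0 1 * N 1 1) * M 1 0) * N 1 1 -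
      ((M 0 0 * N 0 1 + M 0 1 * N 1 1) * M 0 0 - (M 0 0 * N 0 0 + M 0 1 * N 1 0) * M 0 1) * N 1 0 -
      ((M 1 0 * N 0 0 + M 1 1 * N 1 0) * M 1 1 - (M 1 0 * N 0 1 + M 1 1 * N 1 1) * M 1 0) * N 0 1 +
      ((M 1 0 * N 0 1 + M 1 1 * N 1 1) * M 0 0 - (M 1 0 * N 0 0 + M 1 1 * N 1 0) * M 0 1) * N 0 0 := by
  simp [adjugate_fin_two, trace_fin_two, mul_apply, Fin.sum_univ_two]
  ring

/-- The trace of the commutator of a hyperbolic matrix with another matrix. -/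
lemma trace_commutator_of_eigenvectors {M N : SpecialLinearGroup (Fin 2) ℝ} {l : ℝ} {P Q : ℝ × ℝ}
    (hl : l ≠ 0) (hP : rlin M P = l • P) (hQ : rlin M Q = l⁻¹ • Q)
    (hD : P.1 * Q.2 - P.2 * Q.1 ≠ 0) :
    trace ((M * N * M⁻¹ * N⁻¹ : SpecialLinearGroup (Fin 2) ℝ) : Matrix (Fin 2) (Fin 2) ℝ) - 2 =
      (l - l⁻¹) ^ 2 / (P.1 * Q.2 - P.2 * Q.1) ^ 2 * (fixForm N P * fixForm N Q) := by
  have p1 := congrArg Prod.fst hP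
  have p2 := congrArg Prod.snd hP
  have q1 := congrArg Prod.fst hQ
  have q2 := congrArg Prod.snd hQ
  simp only [rlin, Prod.smul_fst, Prod.smul_snd, smul_eq_mul] at p1 p2 q1 q2
  have hN := SL2_det_eq N
  -- The entries of M are recovered from its eigenvectors and eigenvalues; what remains is a
  -- polynomial identity modulo det N = 1 and l l⁻¹ = 1.
  have a00 : M 0 0 = (l * P.1 * Q.2 - l⁻¹ * Q.1 * P.2) / (P.1 * Q.2 - P.2 * Q.1) := by
    rw [eq_div_iff hD]; linear_combination Q.2 * p1 - P.2 * q1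
  have a01 : M 0 1 = (l⁻¹ - l) * P.1 * Q.1 / (P.1 * Q.2 - P.2 * Q.1) := by
    rw [eq_div_iff hD]; linear_combination P.1 * q1 - Q.1 * p1
  have a10 : M 1 0 = (l - l⁻¹) * P.2 * Q.2 / (P.1 * Q.2 - P.2 * Q.1) := by
    rw [eq_div_iff hD]; linear_combination Q.2 * p2 - P.2 * q2
  have a11 : M 1 1 = (l⁻¹ * P.1 * Q.2 - l * Q.1 * P.2) / (P.1 * Q.2 - P.2 * Q.1) := by
    rw [eq_div_iff hD]; linear_combination P.1 * q2 - Q.1 * p2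
  rw [trace_commutator_entries, a00, a01, a10, a11]
  simp only [fixForm, rform]
  generalize N 0 0 = a at *
  generalize N 0 1 = b at *
  generalize N 1 0 = c at *
  generalize N 1 1 = d at *
  obtain ⟨x, y⟩ := P
  obtain ⟨z, w⟩ := Q
  simp only at *
  clear a00 a01 a10 a11 p1 p2 q1 q2 hP hQ
  have hll : l * l⁻¹ = 1 := mul_inv_cancel₀ hl
  generalize l⁻¹ = m at *
  obtain ⟨E, hE⟩ : ∃ E, E = x * w - y * z := ⟨_, rfl⟩
  rw [← hE] at hD ⊢
  field_simp
  rw [hE]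
  linear_combination (2 * (x * w - y * z) ^ 2 * l * m) * hN + 2 * (x * w - y * z) ^ 2 * hll

end PantsChar

end

noncomputable section

namespace PantsChar

open Matrix Topology

/-! ### Trace identities -/

/-- Fricke's identity: κ at the character is the trace of one group element, which for an embedding
has to be hyperbolic. -/
lemma trace_commutator (M N : SpecialLinearGroup (Fin 2) ℝ) :
    trace ((M * N * M⁻¹ * N⁻¹ : SpecialLinearGroup (Fin 2) ℝ) : Matrix (Fin 2) (Fin 2) ℝ) =
      trace (M : Matrix (Fin 2) (Fin 2) ℝ) ^ 2 + trace (N : Matrix (Fin 2) (Fin 2) ℝ) ^ 2 +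
      trace ((M * N : SpecialLinearGroup (Fin 2) ℝ) : Matrix (Fin 2) (Fin 2) ℝ) ^ 2 -
      trace (M : Matrix (Fin 2) (Fin 2) ℝ) * trace (N : Matrix (Fin 2) (Fin 2) ℝ) *
      trace ((M * N : SpecialLinearGroup (Fin 2) ℝ) : Matrix (Fin 2) (Fin 2) ℝ) - 2 := by
  have hM := SL2_det_eq M
  have hN := SL2_det_eq N
  rw [trace_commutator_entries]
  simp [trace_fin_two, mul_apply, Fin.sum_univ_two]
  linear_combination ((M 0 0 + M 1 1) ^ 2 - 2 * (M 0 0 * M 1 1 - M 0 1 * M 1 0)) * hN +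
    ((N 0 0 + N 1 1) ^ 2 - 2) * hM

lemma trace_mul_mul_mul (M N : SpecialLinearGroup (Fin 2) ℝ) :
    trace ((M * N * (N * M) : SpecialLinearGroup (Fin 2) ℝ) : Matrix (Fin 2) (Fin 2) ℝ) =
      trace (M : Matrix (Fin 2) (Fin 2) ℝ) * trace (N : Matrix (Fin 2) (Fin 2) ℝ) *
      trace ((M * N : SpecialLinearGroup (Fin 2) ℝ) : Matrix (Fin 2) (Fin 2) ℝ) -
      trace (M : Matrix (Fin 2) (Fin 2) ℝ) ^ 2 - trace (N : Matrix (Fin 2) (Fin 2) ℝ) ^ 2 + 2 := by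
  have hM := SL2_det_eq M
  have hN := SL2_det_eq N
  simp [trace_fin_two, mul_apply, Fin.sum_univ_two]
  linear_combination (-(M 0 0 + M 1 1) ^ 2 + 2 * (M 0 0 * M 1 1 - M 0 1 * M 1 0)) * hN +
    (-(N 0 0 + N 1 1) ^ 2 + 2) * hM

lemma trace_SL2R_mul_comm (M N : SpecialLinearGroup (Fin 2) ℝ) :
    trace ((M * N : SpecialLinearGroup (Fin 2) ℝ) : Matrix (Fin 2) (Fin 2) ℝ) =
      trace ((N * M : SpecialLinearGroup (Fin 2) ℝ) : Matrix (Fin 2) (Fin 2) ℝ) :=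
  Matrix.trace_mul_comm (M : Matrix (Fin 2) (Fin 2) ℝ) (N : Matrix (Fin 2) (Fin 2) ℝ)

lemma trace_SL2R_inv (M : SpecialLinearGroup (Fin 2) ℝ) :
    trace ((M⁻¹ : SpecialLinearGroup (Fin 2) ℝ) : Matrix (Fin 2) (Fin 2) ℝ) =
      trace (M : Matrix (Fin 2) (Fin 2) ℝ) := by
  simp [adjugate_fin_two, trace_fin_two, add_comm]

/-- Let x, y, z be the traces of M, N, MN, and let w = xyz - x² - y². Fricke's identity for the pair
(MN, NM), with tr(MN · NM) = w + 2, shows that the trace of its commutator exceeds 2 by w (4 - (x² +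
y² + z² - xyz)). The second factor is negative by `h1`, so w ≤ 0. -/
lemma trace_mul_le_of_commutators (M N : SpecialLinearGroup (Fin 2) ℝ)
    (h1 : 2 < trace ((M * N * M⁻¹ * N⁻¹ : SpecialLinearGroup (Fin 2) ℝ) : Matrix (Fin 2) (Fin 2) ℝ))
    (h2 : 2 ≤ trace ((M * N * (N * M) * (M * N)⁻¹ * (N * M)⁻¹ : SpecialLinearGroup (Fin 2) ℝ) :
      Matrix (Fin 2) (Fin 2) ℝ)) :
    trace (M : Matrix (Fin 2) (Fin 2) ℝ) * trace (N : Matrix (Fin 2) (Fin 2) ℝ) *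
      trace ((M * N : SpecialLinearGroup (Fin 2) ℝ) : Matrix (Fin 2) (Fin 2) ℝ) ≤
    trace (M : Matrix (Fin 2) (Fin 2) ℝ) ^ 2 + trace (N : Matrix (Fin 2) (Fin 2) ℝ) ^ 2 := by
  rw [trace_commutator] at h1 h2
  rw [trace_mul_mul_mul, trace_SL2R_mul_comm N M] at h2
  generalize trace (M : Matrix (Fin 2) (Fin 2) ℝ) = x at *
  generalize trace (N : Matrix (Fin 2) (Fin 2) ℝ) = y at *
  generalize trace ((M * N : SpecialLinearGroup (Fin 2) ℝ) : Matrix (Fin 2) (Fin 2) ℝ) = z at *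
  have h3 : 0 ≤ (x * y * z - x ^ 2 - y ^ 2) * (4 - (x ^ 2 + y ^ 2 + z ^ 2 - x * y * z)) := by
    linarith [h2]
  by_contra h
  push Not at h
  nlinarith

/-- If xyz ≥ 0, the inequalities hold for the absolute values. For p ≤ q ≤ r the one with the two
smallest numbers reads pqr ≤ p² + q² ≤ 2qr, which contradicts p > 2. -/
lemma mul_neg_of_mul_le_sq {x y z : ℝ} (hx : 2 < |x|) (hy : 2 < |y|) (hz : 2 < |z|)
    (h1 : x * y * z ≤ x ^ 2 + y ^ 2) (h2 : x * y * z ≤ y ^ 2 + z ^ 2) (h3 : x * y * z ≤ z ^ 2 + x ^ 2) :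
    x * y * z < 0 := by
  by_contra h
  push Not at h
  rw [← abs_of_nonneg h, abs_mul, abs_mul] at h1 h2 h3
  rw [← sq_abs x, ← sq_abs y] at h1
  rw [← sq_abs z, ← sq_abs y] at h2
  rw [← sq_abs x, ← sq_abs z] at h3
  generalize |x| = p at *
  generalize |y| = q at *
  generalize |z| = r at *
  have key : ∀ p q r : ℝ, 2 < p → 2 < q → 2 < r → p ≤ q → q ≤ r → p * q * r ≤ p ^ 2 + q ^ 2 → False := by
    intro p q r hp hq hr h1 h2 h3
    have : p * q * r ≤ 2 * q * r := by nlinarith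
    have : (p - 2) * (q * r) ≤ 0 := by linarith
    have : 0 < (p - 2) * (q * r) := by apply mul_pos <;> [linarith; positivity]
    linarith
  rcases le_total p q with a | a <;> rcases le_total q r with b | b <;> rcases le_total p r with c | c
  · exact key p q r hx hy hz a b (by linarith)
  · exact key p q r hx hy hz a b (by linarith)
  · exact key p r q hx hz hy c b (by linarith)
  · exact key r p q hz hx hy c a (by linarith)
  · exact key q p r hy hx hz a c (by linarith)
  · exact key q r p hy hz hx b c (by linarith)
  · exact key r q p hz hy hx b a (by linarith)
  · exact key r q p hz hy hx b a (by linarith)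

/-! ### Boundary components -/

section Boundary

variable {ρ : Pi2 →* SpecialLinearGroup (Fin 2) ℝ} {h : QuotientSurface ρ ≃ₜ ThreeHoledSphere}

lemma boundaryPreimage_subset_circle (hb : MatchesBoundary ρ h) (i : Fin 3) :
    boundaryPreimage ρ h i ⊆ idealCircle := fun z ⟨hz, hi⟩ => (hb ⟨z, hz⟩).2 ⟨i, hi⟩

lemma boundaryPreimage_subset_disc (i : Fin 3) :
    boundaryPreimage ρ h i ⊆ discontinuitySet ρ := fun _ ⟨hz, _⟩ => hz.2

lemma moeb_mem_boundaryPreimage (i : Fin 3) (γ : Pi2) {z : OnePoint ℂ}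
    (hz : z ∈ boundaryPreimage ρ h i) : moeb ρ γ z ∈ boundaryPreimage ρ h i := by
  obtain ⟨hz, hi⟩ := hz
  refine ⟨moeb_mem_bordered γ hz, ?_⟩
  have e : Quotient.mk (orbitSetoid ρ) ⟨z, hz⟩ =
      Quotient.mk (orbitSetoid ρ) ⟨moeb ρ γ z, moeb_mem_bordered γ hz⟩ := Quotient.sound ⟨γ, rfl⟩
  rwa [← e]

lemma invariantInterval_of_image_eq (hb : MatchesBoundary ρ h) {i : Fin 3} {z : OnePoint ℂ}
    (hz : z ∈ boundaryPreimage ρ h i) {γ : Pi2}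
    (hγ : moeb ρ γ '' connectedComponentIn (boundaryPreimage ρ h i) z =
      connectedComponentIn (boundaryPreimage ρ h i) z) :
    InvariantInterval ρ γ (connectedComponentIn (boundaryPreimage ρ h i) z) where
  preconnected := isPreconnected_connectedComponentIn
  nonempty := ⟨z, mem_connectedComponentIn hz⟩
  subset_circle := (connectedComponentIn_subset _ _).trans (boundaryPreimage_subset_circle hb i)
  subset_disc := (connectedComponentIn_subset _ _).trans (boundaryPreimage_subset_disc i)
  map_mem w hw := hγ ▸ Set.mem_image_of_mem _ hw
  inv_mem w hw := by
    rw [← hγ] at hw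
    obtain ⟨u, hu, rfl⟩ := hw
    rwa [moeb_inv_moeb]

lemma CorrespondsTo.exists_invariantInterval (hb : MatchesBoundary ρ h) {γ : Pi2} {i : Fin 3}
    (hc : CorrespondsTo ρ h γ i) : ∃ C, InvariantInterval ρ γ C := by
  obtain ⟨z, hz, hs⟩ := hc
  refine ⟨_, invariantInterval_of_image_eq hb hz ?_⟩
  have : γ ∈ (Subgroup.zpowers γ : Set Pi2) := Subgroup.mem_zpowers γ
  rwa [← hs] at this

instance : CompactSpace ThreeHoledSphere := by
  refine isCompact_iff_compactSpace (s := {w : ℂ | ‖w‖ ≤ 4 ∧ 1 ≤ ‖w - 2‖ ∧ 1 ≤ ‖w + 2‖}).1 ?_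
  refine Metric.isCompact_of_isClosed_isBounded ?_ ?_
  · have c1 : IsClosed {w : ℂ | ‖w‖ ≤ 4} := isClosed_le (by fun_prop) (by fun_prop)
    have c2 : IsClosed {w : ℂ | 1 ≤ ‖w - 2‖} := isClosed_le (by fun_prop) (by fun_prop)
    have c3 : IsClosed {w : ℂ | 1 ≤ ‖w + 2‖} := isClosed_le (by fun_prop) (by fun_prop)
    exact c1.inter (c2.inter c3)
  · refine (Metric.isBounded_closedBall (x := (0 : ℂ)) (r := 4)).subset fun w hw => ?_
    simpa using hw.1

end Boundary

/-- The commutator of an element preserving an interval of ordinary points with any element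
has trace at least two. -/
lemma InvariantInterval.two_le_trace_commutator {ρ : Pi2 →* SpecialLinearGroup (Fin 2) ℝ} {c : Pi2}
    {C : Set (OnePoint ℂ)} (hC : InvariantInterval ρ c C) (hc : c ≠ 1)
    (ht : 2 < |trace (ρ c : Matrix (Fin 2) (Fin 2) ℝ)|) {δ : Pi2} (hδ : δ ≠ 1) :
    2 ≤ trace ((ρ c * ρ δ * (ρ c)⁻¹ * (ρ δ)⁻¹ : SpecialLinearGroup (Fin 2) ℝ) :
      Matrix (Fin 2) (Fin 2) ℝ) := by
  obtain ⟨l, P, Q, hl, hP, hQ, hD⟩ := exists_hyperbolic_eigenvectors (ρ c) ht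
  have hl0 : l ≠ 0 := by rintro rfl; norm_num at hl
  have h := trace_commutator_of_eigenvectors (N := ρ δ) hl0 hP hQ hD
  -- A zero of the form on C would be an ordinary point fixed by δ. If the form is negative on C,
  -- the argument below is applied to its opposite.
  have hF : ∀ z ∈ C, hform ((ρ δ : Matrix (Fin 2) (Fin 2) ℝ) 1 0)
      (((ρ δ : Matrix (Fin 2) (Fin 2) ℝ) 1 1 - (ρ δ : Matrix (Fin 2) (Fin 2) ℝ) 0 0) / 2) 0
      (-(ρ δ : Matrix (Fin 2) (Fin 2) ℝ) 0 1) (vec z) ≠ 0 := fun z hz h0 => by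
    obtain ⟨v, hv0, hv, hzv⟩ := exists_real_vec (hC.subset_circle hz)
    rw [hv, hform_cvec] at h0
    exact moeb_ne_self (hC.subset_disc hz) hδ (by rw [hzv]; exact moeb_eq_self_of_fixForm hv0 h0)
  have hnn : 0 ≤ fixForm (ρ δ) P * fixForm (ρ δ) Q := by
    rcases hform_sign_const hC.preconnected hF with h1 | h1
    · obtain ⟨h2, h3⟩ := hC.ends_nonneg hc hl hP hQ hD h1
      exact mul_nonneg h2 h3
    · have h1' : ∀ z ∈ C, 0 < hform (-(ρ δ : Matrix (Fin 2) (Fin 2) ℝ) 1 0)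
        (-(((ρ δ : Matrix (Fin 2) (Fin 2) ℝ) 1 1 - (ρ δ : Matrix (Fin 2) (Fin 2) ℝ) 0 0) / 2)) 0
        ((ρ δ : Matrix (Fin 2) (Fin 2) ℝ) 0 1) (vec z) := fun z hz => by
          have := h1 z hz
          simp only [hform] at this ⊢
          linarith
      obtain ⟨h2, h3⟩ := hC.ends_nonneg hc hl hP hQ hD h1'
      have e : ∀ v, fixForm (ρ δ) v = -rform (-(ρ δ : Matrix (Fin 2) (Fin 2) ℝ) 1 0)
        (-(((ρ δ : Matrix (Fin 2) (Fin 2) ℝ) 1 1 - (ρ δ : Matrix (Fin 2) (Fin 2) ℝ) 0 0) / 2))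
        ((ρ δ : Matrix (Fin 2) (Fin 2) ℝ) 0 1) v := fun v => by
          simp only [fixForm, rform]; ring
      rw [e, e, neg_mul_neg]
      exact mul_nonneg h2 h3
  have : 0 ≤ (l - l⁻¹) ^ 2 / (P.1 * Q.2 - P.2 * Q.1) ^ 2 * (fixForm (ρ δ) P * fixForm (ρ δ) Q) := by
    positivity
  linarith

/-! ### The characters of embeddings with given boundary -/

lemma genX_mul_genY_ne : (genX * genY : Pi2) ≠ genY * genX := by
  intro h
  have := congrArg FreeGroup.toWord h
  revert this
  decide

lemma pair_ne (φ : Pi2 ≃* Pi2) : φ genX * φ genY ≠ φ genY * φ genX := by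
  rw [← map_mul, ← map_mul]
  exact fun h => genX_mul_genY_ne (φ.injective h)

/-- The interval of A gives tr [A, B] ≥ 2, strictly since the commutator is hyperbolic; the interval
of AB, tested against BA, gives tr [AB, BA] ≥ 2. These are the two hypotheses of
`trace_mul_le_of_commutators`. -/
lemma trace_relation {ρ : Pi2 →* SpecialLinearGroup (Fin 2) ℝ} {A B : Pi2}
    (hyp : ∀ γ, γ ≠ 1 → 2 < |trace (ρ γ : Matrix (Fin 2) (Fin 2) ℝ)|)
    (hAB : A * B ≠ B * A) (hA : ∃ C, InvariantInterval ρ A C) (hC : ∃ C, InvariantInterval ρ (A * B) C) :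
    trace (ρ A : Matrix (Fin 2) (Fin 2) ℝ) * trace (ρ B : Matrix (Fin 2) (Fin 2) ℝ) *
      trace (ρ (A * B) : Matrix (Fin 2) (Fin 2) ℝ) ≤
    trace (ρ A : Matrix (Fin 2) (Fin 2) ℝ) ^ 2 + trace (ρ B : Matrix (Fin 2) (Fin 2) ℝ) ^ 2 := by
  have hA1 : A ≠ 1 := by rintro rfl; simp at hAB
  have hB1 : B ≠ 1 := by rintro rfl; simp at hAB
  have hAB1 : A * B ≠ 1 := fun h => hAB (by rw [h, mul_eq_one_iff_eq_inv.1 h, mul_inv_cancel])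
  have hBA1 : B * A ≠ 1 := fun h => hAB (by rw [h, mul_eq_one_iff_eq_inv.1 h, mul_inv_cancel])
  obtain ⟨C, hA⟩ := hA
  obtain ⟨C', hC⟩ := hC
  rw [map_mul]
  apply trace_mul_le_of_commutators
  · have h1 := hA.two_le_trace_commutator hA1 (hyp A hA1) hB1
    have h2 := hyp (A * B * A⁻¹ * B⁻¹) (fun h => hAB (by
      rwa [mul_inv_eq_one, mul_inv_eq_iff_eq_mul] at h))
    rw [map_mul, map_mul, map_mul, map_inv, map_inv, abs_of_nonneg (by linarith)] at h2
    exact h2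
  · have h1 := hC.two_le_trace_commutator hAB1 (hyp _ hAB1) hBA1
    rwa [map_mul, map_mul] at h1

lemma trace_of_isConjToReal {ρ : Pi2 →* SpecialLinearGroup (Fin 2) ℂ} {g} {ρ₀}
    (h : IsConjToReal ρ g ρ₀) (γ : Pi2) : trace (ρ γ : Matrix (Fin 2) (Fin 2) ℂ) =
      (trace (ρ₀ γ : Matrix (Fin 2) (Fin 2) ℝ) : ℝ) := by
  rw [h γ, trace_SL2_mul_comm, ← mul_assoc, inv_mul_cancel, one_mul]
  simp [trace_fin_two]

lemma mem_signOctant_of_mul_neg {x y z : ℝ} (hx : 2 < |x|) (hy : 2 < |y|) (hz : 2 < |z|)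
    (h : x * y * z < 0) : (![(x : ℂ), (y : ℂ), (z : ℂ)] : Fin 3 → ℂ) ∈ signOctant := by
  have key : ∀ t : ℝ, 2 < |t| → ∃ s : ℤˣ, ∃ q : ℝ, q < -2 ∧ t = ((s : ℤ) : ℝ) * q := by
    intro t ht
    rcases abs_cases t with ⟨h1, h2⟩ | ⟨h1, h2⟩
    · exact ⟨-1, -t, by linarith, by simp⟩
    · exact ⟨1, t, by linarith, by simp⟩
  obtain ⟨s0, q0, h0, rfl⟩ := key x hx
  obtain ⟨s1, q1, h1, rfl⟩ := key y hy
  obtain ⟨s2, q2, h2, rfl⟩ := key z hz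
  refine ⟨![s0, s1, s2], ?_, fun i => ((![q0, q1, q2] i : ℝ) : ℂ), ⟨![q0, q1, q2], ?_, rfl⟩, ?_⟩
  · have hq : q0 * q1 * q2 < 0 := mul_neg_of_pos_of_neg (mul_pos_of_neg_of_neg (by linarith) (by linarith)) (by linarith)
    rcases Int.units_eq_one_or (s0 * s1 * s2) with h3 | h3
    · simpa using h3
    · exfalso
      have : ((s0 * s1 * s2 : ℤˣ) : ℤ) = -1 := by rw [h3]; rfl
      have h4 : ((s0 : ℤ) : ℝ) * ((s1 : ℤ) : ℝ) * ((s2 : ℤ) : ℝ) = -1 := by exact_mod_cast this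
      have : ((s0 : ℤ) : ℝ) * q0 * (((s1 : ℤ) : ℝ) * q1) * (((s2 : ℤ) : ℝ) * q2) = - (q0 * q1 * q2) := by
        linear_combination (q0 * q1 * q2) * h4
      linarith
  · intro i; fin_cases i <;> simpa
  · ext i; fin_cases i <;> simp

/-- The character of an embedding with given boundary components. -/
theorem character_mem_signOctant {ρ : Pi2 →* SpecialLinearGroup (Fin 2) ℂ} {φ : Pi2 ≃* Pi2}
    (h : IsPEmbeddingWith ρ (fun i => φ (peripheral i))) :
    character (ρ.comp φ.toMonoidHom) ∈ signOctant := by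
  obtain ⟨g, ρ₀, hg, hd, h, hb, e, he⟩ := h
  have : CompactSpace (QuotientSurface ρ₀) := h.symm.compactSpace
  have hyp : ∀ γ, γ ≠ 1 → 2 < |trace (ρ₀ γ : Matrix (Fin 2) (Fin 2) ℝ)| := fun γ hγ =>
    two_lt_abs_trace hd hγ
  have hX := (he 0).exists_invariantInterval hb
  have hY := (he 1).exists_invariantInterval hb
  have hZ := (he 2).exists_invariantInterval hb
  simp only [peripheral, cons_val_zero, cons_val_one, cons_val, genZ] at hX hY hZ
  have hne := pair_ne φ
  have hXY : ∃ C, InvariantInterval ρ₀ (φ genX * φ genY) C := by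
    obtain ⟨C, hC⟩ := hZ
    exact ⟨C, by simpa using hC.inv⟩
  have r1 := trace_relation hyp hne hX hXY
  -- By XYZ = 1 the same relation applies to the pairs (Y, Z) and (Z, X), whose products are X⁻¹ and
  -- Y⁻¹. Inverses preserve the same intervals and have the same traces.
  have hZ' : ∃ C, InvariantInterval ρ₀ (φ genX * φ genY)⁻¹ C := by simpa using hZ
  have hX' : ∃ C, InvariantInterval ρ₀ (φ genY * (φ genX * φ genY)⁻¹) C := by
    obtain ⟨C, hC⟩ := hX
    exact ⟨C, by simpa using hC.inv⟩
  have hY' : ∃ C, InvariantInterval ρ₀ ((φ genX * φ genY)⁻¹ * φ genX) C := by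
    obtain ⟨C, hC⟩ := hY
    exact ⟨C, by simpa using hC.inv⟩
  have r2 := trace_relation hyp (A := φ genY) (B := (φ genX * φ genY)⁻¹)
    (fun h => hne (by
      have := congrArg (fun t => φ genX * φ genY * t * (φ genX * φ genY)) h
      simp [mul_assoc] at this
      rw [← mul_assoc, ← mul_assoc] at this
      exact mul_right_cancel this)) hY hX'
  have r3 := trace_relation hyp (A := (φ genX * φ genY)⁻¹) (B := φ genX)
    (fun h => hne (by
      have := congrArg (fun t => φ genX * φ genY * t * (φ genX * φ genY)) h
      simp [mul_assoc] at this
      exact this)) hZ' hY'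
  have e1 : φ genY * (φ genX * φ genY)⁻¹ = (φ genX)⁻¹ := by group
  have e2 : (φ genX * φ genY)⁻¹ * φ genX = (φ genY)⁻¹ := by group
  rw [e1] at r2
  rw [e2] at r3
  simp only [map_inv ρ₀, trace_SL2R_inv] at r2 r3
  have hx := hyp (φ genX) (fun h => hne (by rw [h]; simp))
  have hy := hyp (φ genY) (fun h => hne (by rw [h]; simp))
  have hz := hyp (φ genX * φ genY) (fun h => hne (by rw [h, mul_eq_one_iff_eq_inv.1 h]; simp))
  have := mem_signOctant_of_mul_neg hx hy hz (mul_neg_of_mul_le_sq hx hy hz r1 (by linarith) (by linarith))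
  convert this using 1
  ext i
  fin_cases i
  · exact trace_of_isConjToReal hg _
  · exact trace_of_isConjToReal hg _
  · simp only [← map_mul φ]; exact trace_of_isConjToReal hg _

end PantsChar

end

noncomputable section

namespace PantsChar

open Matrix Topology

/-! ### Arcs of the ideal circle -/

/-- An arc of the ideal circle centred at the point with homogeneous coordinates `v`. -/
def arc (v : ℝ × ℝ) (ε : ℝ) : Set (OnePoint ℂ) :=
  (fun t : ℝ => pt (cvec (v.1 - t * v.2, v.2 + t * v.1))) '' Set.Icc (-ε) ε

lemma sq_add_sq_pos {v : ℝ × ℝ} (hv : v ≠ 0) : 0 < v.1 ^ 2 + v.2 ^ 2 := by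
  by_contra h
  have h1 : v.1 = 0 := by nlinarith [sq_nonneg v.1, sq_nonneg v.2]
  have h2 : v.2 = 0 := by nlinarith [sq_nonneg v.1, sq_nonneg v.2]
  exact hv (Prod.ext h1 h2)

lemma arc_vec_ne_zero {v : ℝ × ℝ} (hv : v ≠ 0) (t : ℝ) : (v.1 - t * v.2, v.2 + t * v.1) ≠ (0 : ℝ × ℝ) := by
  intro h
  have h1 : v.1 - t * v.2 = 0 := congrArg Prod.fst h
  have h2 : v.2 + t * v.1 = 0 := congrArg Prod.snd h
  have := sq_add_sq_pos hv
  have h3 : v.1 ^ 2 + v.2 ^ 2 = 0 := by linear_combination v.1 * h1 + v.2 * h2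
  linarith

lemma continuous_arc {v : ℝ × ℝ} (hv : v ≠ 0) :
    Continuous fun t : ℝ => pt (cvec (v.1 - t * v.2, v.2 + t * v.1)) := by
  have hdet : (!![-v.2, v.1; v.1, v.2] : Matrix (Fin 2) (Fin 2) ℝ).det ≠ 0 := by
    rw [det_fin_two_of]
    have := sq_add_sq_pos hv
    intro h; nlinarith
  have h := (continuous_mob (GeneralLinearGroup.mkOfDetNeZero _ hdet)).comp
    ((OnePoint.continuous_coe (X := ℂ)).comp Complex.continuous_ofReal)
  refine h.congr fun t => ?_
  simp only [Function.comp]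
  rw [mob_eq_pt]
  congr 1
  simp [lin, cvec, GeneralLinearGroup.mkOfDetNeZero]
  constructor <;> ring

lemma isCompact_arc {v : ℝ × ℝ} (hv : v ≠ 0) (ε : ℝ) : IsCompact (arc v ε) :=
  isCompact_Icc.image (continuous_arc hv)

lemma isPreconnected_arc {v : ℝ × ℝ} (hv : v ≠ 0) (ε : ℝ) : IsPreconnected (arc v ε) :=
  isPreconnected_Icc.image _ (continuous_arc hv).continuousOn

lemma mem_arc_self (v : ℝ × ℝ) {ε : ℝ} (hε : 0 ≤ ε) : pt (cvec v) ∈ arc v ε :=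
  ⟨0, ⟨by linarith, hε⟩, by simp⟩

lemma arc_subset_circle {v : ℝ × ℝ} (hv : v ≠ 0) (ε : ℝ) : arc v ε ⊆ idealCircle := by
  rintro _ ⟨t, -, rfl⟩
  exact pt_cvec_mem_idealCircle (arc_vec_ne_zero hv t)

lemma pt_cvec_eq {v w : ℝ × ℝ} (hv : v ≠ 0) (hw : w ≠ 0) :
    pt (cvec v) = pt (cvec w) ↔ v.1 * w.2 = v.2 * w.1 := by
  rw [pt_eq_pt_iff (cvec_ne_zero hv) (cvec_ne_zero hw)]
  simp only [cvec]
  norm_cast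

/-- The parameter of a point of the arc is the tangent of the angle from v to x, the quotient of
their determinant by their scalar product. -/
lemma mem_arc_of_le {v x : ℝ × ℝ} (hv : v ≠ 0) (hx : x ≠ 0) {ε : ℝ} (hε : 0 ≤ ε)
    (h : (v.1 * x.2 - v.2 * x.1) ^ 2 ≤ ε ^ 2 * (v.1 * x.1 + v.2 * x.2) ^ 2) :
    pt (cvec x) ∈ arc v ε := by
  have hv2 := sq_add_sq_pos hv
  have hx2 := sq_add_sq_pos hx
  have ha : v.1 * x.1 + v.2 * x.2 ≠ 0 := fun h0 => by
    rw [h0] at h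
    have h1 : (v.1 ^ 2 + v.2 ^ 2) * (x.1 ^ 2 + x.2 ^ 2) =
      (v.1 * x.2 - v.2 * x.1) ^ 2 + (v.1 * x.1 + v.2 * x.2) ^ 2 := by ring
    rw [h0] at h1
    nlinarith [mul_pos hv2 hx2]
  have habs : |(v.1 * x.2 - v.2 * x.1) / (v.1 * x.1 + v.2 * x.2)| ≤ ε := by
    rw [abs_div, div_le_iff₀ (abs_pos.2 ha)]
    rw [← mul_pow] at h
    have := sq_le_sq.1 h
    rwa [abs_mul, abs_of_nonneg hε] at this
  refine ⟨(v.1 * x.2 - v.2 * x.1) / (v.1 * x.1 + v.2 * x.2), abs_le.1 habs, ?_⟩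
  simp only
  rw [pt_cvec_eq (arc_vec_ne_zero hv _) hx]
  obtain ⟨a, hae⟩ : ∃ a, a = v.1 * x.1 + v.2 * x.2 := ⟨_, rfl⟩
  rw [← hae] at ha ⊢
  simp only
  field_simp
  rw [hae]
  ring

/-- The strict form of the inequality in `mem_arc_of_le` says that a hermitian form is positive at
x, which is an open condition. -/
lemma exists_open_inter_subset_arc {v : ℝ × ℝ} (hv : v ≠ 0) {ε : ℝ} (hε : 0 < ε) :
    ∃ U : Set (OnePoint ℂ), IsOpen U ∧ pt (cvec v) ∈ U ∧ U ∩ idealCircle ⊆ arc v ε := by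
  have hv2 := sq_add_sq_pos hv
  refine ⟨_, isOpen_hform_pos (ε ^ 2 * v.1 ^ 2 - v.2 ^ 2) ((ε ^ 2 + 1) * (v.1 * v.2)) 0
    (ε ^ 2 * v.2 ^ 2 - v.1 ^ 2), ?_, ?_⟩
  · rw [Set.mem_ofPred_eq, hform_pt_pos (cvec_ne_zero hv), hform_cvec]
    have : rform (ε ^ 2 * v.1 ^ 2 - v.2 ^ 2) ((ε ^ 2 + 1) * (v.1 * v.2)) (ε ^ 2 * v.2 ^ 2 - v.1 ^ 2) v =
      (ε * (v.1 ^ 2 + v.2 ^ 2)) ^ 2 := by simp only [rform]; ring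
    rw [this]; positivity
  · rintro z ⟨hz, hzc⟩
    obtain ⟨x, hx, hzx, rfl⟩ := exists_real_vec hzc
    rw [Set.mem_ofPred_eq, hzx, hform_cvec] at hz
    refine mem_arc_of_le hv hx hε.le ?_
    simp only [rform] at hz
    linarith

lemma exists_arc_subset {v : ℝ × ℝ} (hv : v ≠ 0) {U : Set (OnePoint ℂ)} (hU : U ∈ 𝓝 (pt (cvec v))) :
    ∃ ε > 0, arc v ε ⊆ U := by
  have h := (continuous_arc hv).continuousAt (x := 0)
  have h0 : pt (cvec (v.1 - 0 * v.2, v.2 + 0 * v.1)) = pt (cvec v) := by simp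
  rw [ContinuousAt, h0] at h
  obtain ⟨ε, hε, hs⟩ := Metric.nhds_basis_closedBall.mem_iff.1 (h hU)
  refine ⟨ε, hε, ?_⟩
  rintro _ ⟨t, ht, rfl⟩
  apply hs
  rw [Real.closedBall_eq_Icc]
  simpa using ht

lemma isPreconnected_idealCircle : IsPreconnected idealCircle := by
  have h10 : ((1, 0) : ℝ × ℝ) ≠ 0 := by simp
  have h01 : ((0, 1) : ℝ × ℝ) ≠ 0 := by simp
  have h11 : ((1, 1) : ℝ × ℝ) ≠ 0 := by simp
  have e : idealCircle = arc (1, 0) 1 ∪ arc (0, 1) 1 := by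
    apply Set.Subset.antisymm
    · intro z hz
      obtain ⟨x, hx, -, rfl⟩ := exists_real_vec hz
      rcases le_total (x.2 ^ 2) (x.1 ^ 2) with h | h
      · left; exact mem_arc_of_le h10 hx zero_le_one (by simpa using h)
      · right; exact mem_arc_of_le h01 hx zero_le_one (by simpa using h)
    · exact Set.union_subset (arc_subset_circle h10 _) (arc_subset_circle h01 _)
  rw [e]
  exact (isPreconnected_arc h10 1).union (pt (cvec (1, 1)))
    (mem_arc_of_le h10 h11 zero_le_one (by simp)) (mem_arc_of_le h01 h11 zero_le_one (by simp))
    (isPreconnected_arc h01 1)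

/-! ### Components of the boundary with nontrivial stabilizer -/

lemma isClosed_boundaryCircle (i : Fin 3) : IsClosed (boundaryCircle i) := by
  fin_cases i
  · exact isClosed_eq (f := fun w : ThreeHoledSphere => ‖(w : ℂ)‖) (by fun_prop) continuous_const
  · exact isClosed_eq (f := fun w : ThreeHoledSphere => ‖(w : ℂ) - 2‖) (by fun_prop) continuous_const
  · exact isClosed_eq (f := fun w : ThreeHoledSphere => ‖(w : ℂ) + 2‖) (by fun_prop) continuous_const

lemma boundaryCircle_nonempty (i : Fin 3) : (boundaryCircle i).Nonempty := by
  fin_cases i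
  · exact ⟨⟨4, by norm_num⟩, by simp [boundaryCircle]⟩
  · exact ⟨⟨3, by norm_num⟩, by simp [boundaryCircle]; norm_num⟩
  · exact ⟨⟨-3, by norm_num⟩, by simp [boundaryCircle]; norm_num⟩

lemma boundaryCircle_disjoint {i j : Fin 3} (hij : i ≠ j) {w : ThreeHoledSphere}
    (hi : w ∈ boundaryCircle i) (hj : w ∈ boundaryCircle j) : False := by
  have key1 : ‖(w : ℂ)‖ = 4 → ‖(w : ℂ) - 2‖ = 1 → False := fun h1 h2 => by
    have := norm_add_le ((w : ℂ) - 2) 2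
    simp at this; rw [h1, h2] at this; norm_num at this
  have key2 : ‖(w : ℂ)‖ = 4 → ‖(w : ℂ) + 2‖ = 1 → False := fun h1 h2 => by
    have := norm_sub_le ((w : ℂ) + 2) 2
    simp at this; rw [h1, h2] at this; norm_num at this
  have key3 : ‖(w : ℂ) - 2‖ = 1 → ‖(w : ℂ) + 2‖ = 1 → False := fun h1 h2 => by
    have := norm_sub_le ((w : ℂ) + 2) ((w : ℂ) - 2)
    rw [show (w : ℂ) + 2 - (w - 2) = 4 by ring, h1, h2] at this; norm_num at this
  fin_cases i <;> fin_cases j <;> simp [boundaryCircle] at hi hj hij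
  · exact key1 hi hj
  · exact key2 hi hj
  · exact key1 hj hi
  · exact key3 hi hj
  · exact key2 hj hi
  · exact key3 hj hi

section Boundary

variable {ρ : Pi2 →* SpecialLinearGroup (Fin 2) ℝ} {h : QuotientSurface ρ ≃ₜ ThreeHoledSphere}

lemma boundaryPreimage_disjoint {i j : Fin 3} (hij : i ≠ j) {z : OnePoint ℂ}
    (hi : z ∈ boundaryPreimage ρ h i) (hj : z ∈ boundaryPreimage ρ h j) : False := by
  obtain ⟨hz, hi⟩ := hi
  obtain ⟨hz', hj⟩ := hj
  exact boundaryCircle_disjoint hij hi hj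

/-- All ordinary points of the ideal circle lie over some boundary circle, and the circles other
than the i-th form a closed set. -/
lemma exists_nhd_boundaryPreimage (hb : MatchesBoundary ρ h) {i : Fin 3} {z : OnePoint ℂ}
    (hz : z ∈ boundaryPreimage ρ h i) : ∃ V ∈ 𝓝 z, V ∩ idealCircle ⊆ boundaryPreimage ρ h i := by
  obtain ⟨hzb, hzi⟩ := hz
  have hcl : IsClosed (⋃ j ∈ {j : Fin 3 | j ≠ i}, boundaryCircle j) :=
    (Set.toFinite _).isClosed_biUnion fun j _ => isClosed_boundaryCircle j
  have hopen := hcl.isOpen_compl.preimage (h.continuous.comp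
    (continuous_quotient_mk' (s := orbitSetoid ρ)))
  obtain ⟨V, hV, hVe⟩ := isOpen_induced_iff.1 hopen
  have hzV : (⟨z, hzb⟩ : bordered ρ) ∈ Subtype.val ⁻¹' V := by
    rw [hVe]
    intro hmem
    obtain ⟨j, hj, hm⟩ := Set.mem_iUnion₂.1 hmem
    exact boundaryCircle_disjoint hj hm hzi
  refine ⟨V ∩ discontinuitySet ρ, Filter.inter_mem (hV.mem_nhds hzV)
    ((isOpen_discontinuitySet ρ).mem_nhds hzb.2), ?_⟩
  rintro w ⟨⟨hwV, hwd⟩, hwc⟩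
  have hwb : w ∈ bordered ρ := ⟨Or.inr hwc, hwd⟩
  obtain ⟨j, hj⟩ := (hb ⟨w, hwb⟩).1 hwc
  have hw : (⟨w, hwb⟩ : bordered ρ) ∈ Subtype.val ⁻¹' V := hwV
  rw [hVe] at hw
  by_cases hji : j = i
  · subst hji; exact ⟨hwb, hj⟩
  · exact (hw (Set.mem_iUnion₂.2 ⟨j, hji, hj⟩)).elim

/-- Every point of a boundary preimage has a compact arc as neighbourhood. -/
lemma exists_arc_nhd_boundaryPreimage (hb : MatchesBoundary ρ h) {i : Fin 3} {z : OnePoint ℂ}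
    (hz : z ∈ boundaryPreimage ρ h i) :
    ∃ (K U : Set (OnePoint ℂ)), IsCompact K ∧ IsPreconnected K ∧ K ⊆ boundaryPreimage ρ h i ∧
      IsOpen U ∧ z ∈ U ∧ U ∩ idealCircle ⊆ K ∧ z ∈ K := by
  obtain ⟨V, hV, hVs⟩ := exists_nhd_boundaryPreimage hb hz
  obtain ⟨v, hv, -, rfl⟩ := exists_real_vec (boundaryPreimage_subset_circle hb i hz)
  obtain ⟨ε, hε, hs⟩ := exists_arc_subset hv hV
  obtain ⟨U, hU, hzU, hUs⟩ := exists_open_inter_subset_arc hv hε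
  exact ⟨arc v ε, U, isCompact_arc hv ε, isPreconnected_arc hv ε,
    fun w hw => hVs ⟨hs hw, arc_subset_circle hv ε hw⟩, hU, hzU, hUs, mem_arc_self v hε.le⟩

/-- An element acts by a homeomorphism preserving the boundary preimage. It maps a component onto
itself as soon as it maps one of its points into it. -/
lemma image_component_eq {i : Fin 3} {z w : OnePoint ℂ} {γ : Pi2}
    (hw : w ∈ connectedComponentIn (boundaryPreimage ρ h i) z)
    (hγ : moeb ρ γ w ∈ connectedComponentIn (boundaryPreimage ρ h i) z) :
    moeb ρ γ '' connectedComponentIn (boundaryPreimage ρ h i) z =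
      connectedComponentIn (boundaryPreimage ρ h i) z := by
  have key : ∀ (γ : Pi2) (w : OnePoint ℂ), w ∈ connectedComponentIn (boundaryPreimage ρ h i) z →
      moeb ρ γ w ∈ connectedComponentIn (boundaryPreimage ρ h i) z →
      moeb ρ γ '' connectedComponentIn (boundaryPreimage ρ h i) z ⊆
      connectedComponentIn (boundaryPreimage ρ h i) z := by
    intro γ w hw hγ
    have hpre : IsPreconnected (moeb ρ γ '' connectedComponentIn (boundaryPreimage ρ h i) z) :=
      isPreconnected_connectedComponentIn.image _ (continuous_moeb ρ γ).continuousOn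
    rw [connectedComponentIn_eq hγ] at hpre ⊢
    rw [connectedComponentIn_eq hγ] at hw
    refine hpre.subset_connectedComponentIn ⟨w, hw, rfl⟩ ?_
    rintro _ ⟨u, hu, rfl⟩
    exact moeb_mem_boundaryPreimage i γ (connectedComponentIn_subset _ _ hu)
  apply Set.Subset.antisymm (key γ w hw hγ)
  intro u hu
  refine ⟨moeb ρ γ⁻¹ u, key γ⁻¹ (moeb ρ γ w) hγ (by rwa [moeb_inv_moeb]) ⟨u, hu, rfl⟩, moeb_moeb_inv ρ γ u⟩

/-- Some component of the preimage of each boundary circle has a nontrivial stabilizer. -/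
theorem exists_invariantInterval (hρ : IsDiscreteEmbedding ρ) (hb : MatchesBoundary ρ h) (i : Fin 3) :
    ∃ C ⊆ boundaryPreimage ρ h i, ∃ c : Pi2, c ≠ 1 ∧ InvariantInterval ρ c C := by
  have : CompactSpace (QuotientSurface ρ) := h.symm.compactSpace
  obtain ⟨p, hp⟩ := boundaryCircle_nonempty i
  obtain ⟨⟨z, hzb⟩, hz⟩ := Quotient.exists_rep (h.symm p)
  have hzB : z ∈ boundaryPreimage ρ h i := ⟨hzb, by
    rw [hz]; simpa using hp⟩
  set B := boundaryPreimage ρ h i with hB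
  set C := connectedComponentIn B z with hC
  by_contra hcon
  have hstab : ∀ γ, ∀ w ∈ C, moeb ρ γ w ∈ C → γ = 1 := by
    intro γ w hw hγ
    by_contra hne
    exact hcon ⟨C, connectedComponentIn_subset _ _, γ, hne,
      invariantInterval_of_image_eq hb hzB (image_component_eq hw hγ)⟩
  -- a finite cover by compact arcs
  have hloc : ∀ x ∈ (h ⁻¹' boundaryCircle i : Set (QuotientSurface ρ)), ∃ N ∈ 𝓝 x, ∃ K : Set (OnePoint ℂ),
      IsCompact K ∧ IsPreconnected K ∧ K ⊆ B ∧ K.Nonempty ∧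
      ∀ w (hw : w ∈ B), Quotient.mk (orbitSetoid ρ) ⟨w, hw.1⟩ ∈ N → ∃ γ, moeb ρ γ w ∈ K := by
    intro x hx
    obtain ⟨⟨y, hyb⟩, rfl⟩ := Quotient.exists_rep x
    obtain ⟨K, U, hK, hKp, hKB, hU, hyU, hUK, hyK⟩ := exists_arc_nhd_boundaryPreimage hb
      (show y ∈ boundaryPreimage ρ h i from ⟨hyb, hx⟩)
    refine ⟨_, isOpenMap_quotient_mk.image_mem_nhds (continuous_subtype_val.continuousAt.preimage_mem_nhds
      (hU.mem_nhds hyU)), K, hK, hKp, hKB, ⟨y, hyK⟩, ?_⟩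
    rintro w hw ⟨⟨u, hub⟩, hu, huw⟩
    obtain ⟨γ, hγ⟩ := Quotient.exact huw.symm
    change moeb ρ γ w = u at hγ
    refine ⟨γ, hUK ⟨by rw [hγ]; exact hu, ?_⟩⟩
    exact (moeb_mem_idealCircle γ).2 (boundaryPreimage_subset_circle hb i hw)
  choose! N hN K hK hKp hKB hKne hcov using hloc
  have hcomp : IsCompact (h ⁻¹' boundaryCircle i : Set (QuotientSurface ρ)) :=
    ((isClosed_boundaryCircle i).preimage h.continuous).isCompact
  obtain ⟨t, htN, ht⟩ := hcomp.elim_nhds_subcover N hN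
  -- The translates of the chosen arcs which meet C are contained in C. If one arc had two such
  -- translates, a nontrivial element would preserve C; so there are finitely many, and C is a
  -- finite union of compact sets.
  set S : Set (QuotientSurface ρ × Pi2) := {q | q.1 ∈ t ∧ (moeb ρ q.2 '' K q.1 ∩ C).Nonempty} with hS
  have hsub : ∀ q ∈ S, moeb ρ q.2 '' K q.1 ⊆ C := by
    rintro ⟨x, γ⟩ ⟨hx, w, hw, hwC⟩
    simp only at hx hw ⊢
    rw [hC, connectedComponentIn_eq hwC]
    refine ((hKp x (htN x hx)).image _ (continuous_moeb ρ γ).continuousOn).subset_connectedComponentIn hw ?_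
    rintro _ ⟨u, hu, rfl⟩
    exact moeb_mem_boundaryPreimage i γ (hKB x (htN x hx) hu)
  have hfin : S.Finite := by
    refine Set.Finite.of_finite_image (f := Prod.fst) (t.finite_toSet.subset ?_) ?_
    · rintro _ ⟨q, hq, rfl⟩
      exact hq.1
    · rintro ⟨x, γ⟩ hq ⟨x', γ'⟩ hq' (rfl : x = x')
      obtain ⟨y, hy⟩ := hKne x (htN x hq.1)
      have h1 := hsub _ hq ⟨y, hy, rfl⟩
      have h2 := hsub _ hq' ⟨y, hy, rfl⟩
      have h3 := hstab (γ' * γ⁻¹) _ h1 (by simp only [moeb_mul, moeb_inv_moeb]; exact h2)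
      rw [mul_inv_eq_one] at h3
      simp [h3]
  have hCeq : C = ⋃ q ∈ S, moeb ρ q.2 '' K q.1 := by
    apply Set.Subset.antisymm
    · intro w hw
      have hwB : w ∈ B := connectedComponentIn_subset _ _ hw
      obtain ⟨x, hx, hxN⟩ := Set.mem_iUnion₂.1 (ht (show Quotient.mk (orbitSetoid ρ) ⟨w, hwB.1⟩ ∈
        (h ⁻¹' boundaryCircle i : Set (QuotientSurface ρ)) from hwB.2))
      obtain ⟨γ, hγ⟩ := hcov x (htN x hx) w hwB hxN
      have hwm : w ∈ moeb ρ γ⁻¹ '' K x := ⟨_, hγ, moeb_inv_moeb ρ γ w⟩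
      exact Set.mem_iUnion₂.2 ⟨(x, γ⁻¹), ⟨hx, w, hwm, hw⟩, hwm⟩
    · exact Set.iUnion₂_subset hsub
  have hCcl : IsClosed C := by
    rw [hCeq]
    exact hfin.isClosed_biUnion fun q hq =>
      ((hK q.1 (htN _ hq.1)).image (continuous_moeb ρ q.2)).isClosed
  -- a fixed point of a hyperbolic element is not ordinary
  have hX1 : (genX : Pi2) ≠ 1 := FreeGroup.of_ne_one 0
  obtain ⟨l, P, Q, hl, hP, hQ, hD⟩ := exists_hyperbolic_eigenvectors (ρ genX) (two_lt_abs_trace hρ hX1)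
  have hl0 : l ≠ 0 := by rintro rfl; norm_num at hl
  have hP0 : P ≠ 0 := by rintro rfl; simp at hD
  have hPn : pt (cvec P) ∉ C := fun hmem => by
    refine moeb_ne_self (boundaryPreimage_subset_disc i (connectedComponentIn_subset _ _ hmem)) hX1 ?_
    rw [moeb_pt _ (cvec_ne_zero hP0), lin_cvec, hP, pt_cvec_eq (smul_ne_zero hl0 hP0) hP0]
    simp only [Prod.smul_fst, Prod.smul_snd, smul_eq_mul]; ring
  -- C is relatively open in the ideal circle too. Being nonempty, closed and without the fixed
  -- point P, it contradicts the connectedness of the circle.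
  have hCop : ∃ u, IsOpen u ∧ C ⊆ u ∧ u ∩ idealCircle ⊆ C := by
    have : ∀ w ∈ C, ∃ U, IsOpen U ∧ w ∈ U ∧ U ∩ idealCircle ⊆ C := by
      intro w hw
      obtain ⟨K, U, hK, hKp, hKB, hU, hyU, hUK, hyK⟩ := exists_arc_nhd_boundaryPreimage hb
        (connectedComponentIn_subset _ _ hw)
      refine ⟨U, hU, hyU, hUK.trans ?_⟩
      rw [hC, connectedComponentIn_eq hw]
      exact hKp.subset_connectedComponentIn hyK hKB
    choose! U hU hwU hUC using this
    refine ⟨⋃ w ∈ C, U w, isOpen_biUnion hU, fun w hw => Set.mem_iUnion₂.2 ⟨w, hw, hwU w hw⟩, ?_⟩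
    rintro x ⟨hx, hxc⟩
    obtain ⟨w, hw, hxw⟩ := Set.mem_iUnion₂.1 hx
    exact hUC w hw ⟨hxw, hxc⟩
  obtain ⟨u, hu, hCu, huC⟩ := hCop
  have hzC : z ∈ C := mem_connectedComponentIn hzB
  have hzc := boundaryPreimage_subset_circle hb i hzB
  obtain ⟨x, hx, hxu, hxn⟩ := isPreconnected_idealCircle u Cᶜ hu hCcl.isOpen_compl
    (fun x hx => by by_cases h : x ∈ C; exacts [Or.inl (hCu h), Or.inr h])
    ⟨z, hzc, hCu hzC⟩ ⟨_, pt_cvec_mem_idealCircle hP0, hPn⟩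
  exact hxn (huC ⟨hxu, hx⟩)

end Boundary

end PantsChar

end

noncomputable section

namespace PantsChar

open Matrix Topology

/-! ### Points outside an invariant interval -/

/-- The determinant of two real vectors. -/
def rdet (v w : ℝ × ℝ) : ℝ := v.1 * w.2 - v.2 * w.1

lemma rdet_rlin (T : Matrix (Fin 2) (Fin 2) ℝ) (v w : ℝ × ℝ) :
    rdet (rlin T v) (rlin T w) = T.det * rdet v w := by
  simp only [rdet, rlin, det_fin_two]; ring

/-- Two points outside an invariant interval do not separate its ends. -/
lemma InvariantInterval.not_separated {ρ : Pi2 →* SpecialLinearGroup (Fin 2) ℝ} {c : Pi2}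
    {C : Set (OnePoint ℂ)} (hC : InvariantInterval ρ c C) (hc : c ≠ 1) {l : ℝ} {P Q : ℝ × ℝ}
    (hl : 1 < l ^ 2) (hP : rlin (ρ c) P = l • P) (hQ : rlin (ρ c) Q = l⁻¹ • Q)
    (hD : P.1 * Q.2 - P.2 * Q.1 ≠ 0) {m m' : ℝ × ℝ} (hm : m ≠ 0) (hm' : m' ≠ 0)
    (hmC : pt (cvec m) ∉ C) (hmC' : pt (cvec m') ∉ C) :
    0 ≤ rdet P m * rdet P m' * (rdet Q m * rdet Q m') := by
  -- The product of the two determinants is a quadratic form in v whose only zeros are m and m', so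
  -- it does not vanish on C.
  have e : ∀ v, rdet v m * rdet v m' =
    rform (m.2 * m'.2) (-(m.2 * m'.1 + m.1 * m'.2) / 2) (m.1 * m'.1) v := fun v => by
      simp only [rdet, rform]; ring
  have e' : ∀ v, rdet v m * rdet v m' =
    -rform (-(m.2 * m'.2)) ((m.2 * m'.1 + m.1 * m'.2) / 2) (-(m.1 * m'.1)) v := fun v => by
      simp only [rdet, rform]; ring
  have hF : ∀ z ∈ C, hform (m.2 * m'.2) (-(m.2 * m'.1 + m.1 * m'.2) / 2) 0 (m.1 * m'.1) (vec z) ≠ 0 := by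
    intro z hz h0
    obtain ⟨v, hv0, hv, rfl⟩ := exists_real_vec (hC.subset_circle hz)
    rw [hv, hform_cvec, ← e] at h0
    rcases mul_eq_zero.1 h0 with h | h
    · exact hmC (((pt_cvec_eq hv0 hm).2 (sub_eq_zero.1 h)) ▸ hz)
    · exact hmC' (((pt_cvec_eq hv0 hm').2 (sub_eq_zero.1 h)) ▸ hz)
  rcases hform_sign_const hC.preconnected hF with h1 | h1
  · obtain ⟨h2, h3⟩ := hC.ends_nonneg hc hl hP hQ hD h1
    rw [e, e]
    exact mul_nonneg h2 h3
  · have h1' : ∀ z ∈ C, 0 < hform (-(m.2 * m'.2)) ((m.2 * m'.1 + m.1 * m'.2) / 2) 0 (-(m.1 * m'.1))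
        (vec z) := fun z hz => by
      have := h1 z hz
      simp only [hform] at this ⊢
      linarith
    obtain ⟨h2, h3⟩ := hC.ends_nonneg hc hl hP hQ hD h1'
    rw [e', e', neg_mul_neg]
    exact mul_nonneg h2 h3

/-! ### Normal form of a pair whose commutator has trace less than `-2` -/

/-- Conjugation by an element of `GL(2, ℝ)`. -/
def conjSL (T : GL (Fin 2) ℝ) : SpecialLinearGroup (Fin 2) ℝ →* SpecialLinearGroup (Fin 2) ℝ where
  toFun A := ⟨(T⁻¹ : GL (Fin 2) ℝ) * (A : Matrix (Fin 2) (Fin 2) ℝ) * (T : Matrix (Fin 2) (Fin 2) ℝ), by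
    rw [Matrix.coe_units_inv, det_mul, det_mul, A.det_coe, mul_one, ← det_mul,
      Matrix.nonsing_inv_mul _ (isUnit_iff_ne_zero.2 (det_GL_ne_zero T)), det_one]⟩
  map_one' := by
    ext1
    simp
  map_mul' A B := by
    apply Subtype.ext
    change _ * ((A : Matrix (Fin 2) (Fin 2) ℝ) * (B : Matrix (Fin 2) (Fin 2) ℝ)) * _ =
      (_ * (A : Matrix (Fin 2) (Fin 2) ℝ) * _) * (_ * (B : Matrix (Fin 2) (Fin 2) ℝ) * _)
    simp only [mul_assoc]
    rw [Units.mul_inv_cancel_left]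

lemma conjSL_spec (T : GL (Fin 2) ℝ) (A : SpecialLinearGroup (Fin 2) ℝ) :
    (T : Matrix (Fin 2) (Fin 2) ℝ) * (conjSL T A : Matrix (Fin 2) (Fin 2) ℝ) =
      (A : Matrix (Fin 2) (Fin 2) ℝ) * T := by
  change _ * (_ * (A : Matrix (Fin 2) (Fin 2) ℝ) * _) = _
  rw [mul_assoc, Units.mul_inv_cancel_left]

lemma conjSL_eq_of {T : GL (Fin 2) ℝ} {A : SpecialLinearGroup (Fin 2) ℝ} {B : Matrix (Fin 2) (Fin 2) ℝ}
    (h : (A : Matrix (Fin 2) (Fin 2) ℝ) * T = T * B) : (conjSL T A : Matrix (Fin 2) (Fin 2) ℝ) = B := by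
  change _ * (A : Matrix (Fin 2) (Fin 2) ℝ) * _ = _
  rw [mul_assoc, h, Units.inv_mul_cancel_left]

lemma trace_conjSL (T : GL (Fin 2) ℝ) (A : SpecialLinearGroup (Fin 2) ℝ) :
    trace (conjSL T A : Matrix (Fin 2) (Fin 2) ℝ) = trace (A : Matrix (Fin 2) (Fin 2) ℝ) := by
  change trace (_ * (A : Matrix (Fin 2) (Fin 2) ℝ) * _) = _
  rw [mul_assoc, Matrix.trace_mul_comm, mul_assoc, Units.mul_inv, mul_one]

/-- The parameters of the normal form. -/
structure TorusData where
  (m d e u s : ℝ)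
  hm : 1 < m
  hd : 0 < d
  he : 0 < e
  hs : 0 < s
  hu : d * e < u
  hus : u = m * d * e - s
  rel : m * ((u - d * e) * s) = 1 + m * d ^ 2 + m * e ^ 2

namespace TorusData

variable (t : TorusData)

lemma u_pos : 0 < t.u := (mul_pos t.hd t.he).trans t.hu

lemma m_pos : 0 < t.m := one_pos.trans t.hm

/-- The first matrix of the normal form. -/
def X0 : Matrix (Fin 2) (Fin 2) ℝ := !![-t.m * t.d, -(1 + t.m * t.d ^ 2); 1, t.d]

/-- The second matrix of the normal form. -/
def Y0 : Matrix (Fin 2) (Fin 2) ℝ := !![t.e, t.u; -(1 + t.m * t.e ^ 2) / t.u, -t.m * t.e]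

end TorusData

lemma exists_sign {x : ℝ} (hx : x ≠ 0) : ∃ ε y : ℝ, (ε = 1 ∨ ε = -1) ∧ 0 < y ∧ x = ε * y := by
  rcases lt_or_gt_of_ne hx with h | h
  · exact ⟨-1, -x, Or.inr rfl, by linarith, by ring⟩
  · exact ⟨1, x, Or.inl rfl, h, by ring⟩

/-- The two factors have a positive product and the positive sum (m - 1) d e. -/
lemma torus_pos {m d e u : ℝ} (hm : 1 < m) (hd : 0 < d) (he : 0 < e)
    (h : m * ((u - d * e) * (m * d * e - u)) = 1 + m * d ^ 2 + m * e ^ 2) :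
    0 < u - d * e ∧ 0 < m * d * e - u := by
  have hde : 0 < d * e := mul_pos hd he
  have hprod : 0 < (u - d * e) * (m * d * e - u) := by
    refine pos_of_mul_pos_right (a := m) ?_ (by linarith)
    rw [h]
    positivity
  have hsum : 0 < (m - 1) * (d * e) := mul_pos (by linarith) hde
  rcases pos_and_pos_or_neg_and_neg_of_mul_pos hprod with h | h
  · exact h
  · linarith [h.1, h.2]

/-- In an eigenbasis of the commutator K, whose eigenvalue l is less than -1, the relation K B A = A
B determines the pair up to a rescaling of the basis and signs. The rescaling is used to normalise
one entry of A, the signs to make the diagonal parameters d and e positive; m is -l. -/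
theorem exists_torusData {A B : SpecialLinearGroup (Fin 2) ℝ}
    (hK : trace ((A * B * A⁻¹ * B⁻¹ : SpecialLinearGroup (Fin 2) ℝ) : Matrix (Fin 2) (Fin 2) ℝ) < -2)
    (hA : trace (A : Matrix (Fin 2) (Fin 2) ℝ) ≠ 0) (hB : trace (B : Matrix (Fin 2) (Fin 2) ℝ) ≠ 0) :
    ∃ (t : TorusData) (T : GL (Fin 2) ℝ) (ε δ : ℝ), (ε = 1 ∨ ε = -1) ∧ (δ = 1 ∨ δ = -1) ∧
      (conjSL T A : Matrix (Fin 2) (Fin 2) ℝ) = ε • t.X0 ∧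
      (conjSL T B : Matrix (Fin 2) (Fin 2) ℝ) = δ • t.Y0 := by
  set K := A * B * A⁻¹ * B⁻¹ with hKdef
  obtain ⟨l, P, Q, hl2, hP, hQ, hD⟩ := exists_hyperbolic_eigenvectors K
    (by rw [abs_of_neg (by linarith)]; linarith)
  have hl0 : l ≠ 0 := by rintro rfl; norm_num at hl2
  have hdet1 : (!![P.1, Q.1; P.2, Q.2] : Matrix (Fin 2) (Fin 2) ℝ).det ≠ 0 := by
    rw [det_fin_two_of]; intro h; apply hD; linarith
  set T1 : GL (Fin 2) ℝ := GeneralLinearGroup.mkOfDetNeZero _ hdet1 with hT1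
  have hT1m : (T1 : Matrix (Fin 2) (Fin 2) ℝ) = !![P.1, Q.1; P.2, Q.2] := rfl
  have p1 := congrArg Prod.fst hP
  have p2 := congrArg Prod.snd hP
  have q1 := congrArg Prod.fst hQ
  have q2 := congrArg Prod.snd hQ
  simp only [rlin, Prod.smul_fst, Prod.smul_snd, smul_eq_mul] at p1 p2 q1 q2
  have hK1 : (conjSL T1 K : Matrix (Fin 2) (Fin 2) ℝ) = !![l, 0; 0, l⁻¹] := by
    apply conjSL_eq_of
    rw [hT1m]
    ext i j
    fin_cases i <;> fin_cases j <;> simp [mul_apply, Fin.sum_univ_two] <;> linarith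
  have htr := trace_conjSL T1 K
  rw [hK1, trace_fin_two_of] at htr
  have hl : l < -1 := by
    by_contra hcon
    push Not at hcon
    have h0 : 0 < l := by nlinarith
    have := inv_pos.2 h0
    linarith
  set A1 := conjSL T1 A with hA1
  set B1 := conjSL T1 B with hB1
  have eKBA : conjSL T1 K * (B1 * A1) = A1 * B1 := by
    rw [hA1, hB1, ← map_mul, ← map_mul, ← map_mul, hKdef]; congr 1; group
  -- A⁻¹ K is conjugate to A⁻¹, and K B to B. As K is diagonal, the two trace equations determine
  -- the ratios of the diagonal entries of A and of B.
  have hinvA : trace ((A1⁻¹ * conjSL T1 K : SpecialLinearGroup (Fin 2) ℝ) : Matrix (Fin 2) (Fin 2) ℝ) =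
      trace (A1 : Matrix (Fin 2) (Fin 2) ℝ) := by
    rw [← trace_SL2R_inv A1, hA1, hKdef, ← map_inv, ← map_mul, trace_conjSL, trace_conjSL,
      show A⁻¹ * (A * B * A⁻¹ * B⁻¹) = B * (A⁻¹ * B⁻¹) by group, trace_SL2R_mul_comm,
      inv_mul_cancel_right]
  have hB' : trace ((conjSL T1 K * B1 : SpecialLinearGroup (Fin 2) ℝ) : Matrix (Fin 2) (Fin 2) ℝ) =
      trace (B1 : Matrix (Fin 2) (Fin 2) ℝ) := by
    rw [hB1, hKdef, ← map_mul, trace_conjSL, trace_conjSL,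
      show A * B * A⁻¹ * B⁻¹ * B = A * (B * A⁻¹) by group, trace_SL2R_mul_comm,
      inv_mul_cancel_right]
  have hdA := SL2_det_eq A1
  have hdB := SL2_det_eq B1
  rw [← trace_conjSL T1 A, ← hA1, trace_fin_two] at hA
  rw [← trace_conjSL T1 B, ← hB1, trace_fin_two] at hB
  have eM : (!![l, 0; 0, l⁻¹] : Matrix (Fin 2) (Fin 2) ℝ) *
      ((B1 : Matrix (Fin 2) (Fin 2) ℝ) * (A1 : Matrix (Fin 2) (Fin 2) ℝ)) =
      (A1 : Matrix (Fin 2) (Fin 2) ℝ) * (B1 : Matrix (Fin 2) (Fin 2) ℝ) := by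
    rw [← hK1]; exact congrArg Subtype.val eKBA
  have e11 := congrFun (congrFun eM 0) 0
  simp [mul_apply, Fin.sum_univ_two] at e11
  change trace (((A1⁻¹ : SpecialLinearGroup (Fin 2) ℝ) : Matrix (Fin 2) (Fin 2) ℝ) *
    (conjSL T1 K : Matrix (Fin 2) (Fin 2) ℝ)) = _ at hinvA
  change trace ((conjSL T1 K : Matrix (Fin 2) (Fin 2) ℝ) * (B1 : Matrix (Fin 2) (Fin 2) ℝ)) = _ at hB'
  rw [hK1, SL2_inv_apply] at hinvA
  rw [hK1] at hB'
  rw [trace_fin_two, mul_apply, mul_apply, Fin.sum_univ_two, Fin.sum_univ_two] at hB'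
  simp [trace_fin_two] at hinvA hB'
  have sA : ∀ M : Matrix (Fin 2) (Fin 2) ℝ, M = !![M 0 0, M 0 1; M 1 0, M 1 1] := fun M =>
    Matrix.eta_fin_two M
  have eA := sA A1
  have eB := sA B1
  have cA := conjSL_spec T1 A
  have cB := conjSL_spec T1 B
  rw [← hA1, eA] at cA
  rw [← hB1, eB] at cB
  clear eA eB eKBA eM sA
  generalize A1 0 0 = x1 at *
  generalize A1 0 1 = x2 at *
  generalize A1 1 0 = x3 at *
  generalize A1 1 1 = x4 at *
  generalize B1 0 0 = y1 at *
  generalize B1 0 1 = y2 at *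
  generalize B1 1 0 = y3 at *
  generalize B1 1 1 = y4 at *
  have hll : l * l⁻¹ = 1 := mul_inv_cancel₀ hl0
  have hli : l⁻¹ ≠ 1 := fun h => by rw [h] at hll; linarith
  have rx : x1 = l * x4 := by
    have : (l⁻¹ - 1) * (x1 - l * x4) = 0 := by linear_combination hinvA - x4 * hll
    exact sub_eq_zero.1 ((mul_eq_zero.1 this).resolve_left (sub_ne_zero.2 hli))
  have ry : y4 = l * y1 := by
    have : (l⁻¹ - 1) * (y4 - l * y1) = 0 := by linear_combination hB' - y1 * hll
    exact sub_eq_zero.1 ((mul_eq_zero.1 this).resolve_left (sub_ne_zero.2 hli))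
  subst rx ry
  have hx4 : x4 ≠ 0 := by rintro rfl; simp at hA
  have hy1 : y1 ≠ 0 := by rintro rfl; simp at hB
  obtain ⟨ε, d, hε, hd, rfl⟩ := exists_sign hx4
  obtain ⟨δ, e, hδ, he, rfl⟩ := exists_sign hy1
  have hε2 : ε ^ 2 = 1 := by rcases hε with rfl | rfl <;> norm_num
  have hδ2 : δ ^ 2 = 1 := by rcases hδ with rfl | rfl <;> norm_num
  have hx23 : x2 * x3 = l * d ^ 2 - 1 := by linear_combination -hdA + l * d ^ 2 * hε2
  have hy23 : y2 * y3 = l * e ^ 2 - 1 := by linear_combination -hdB + l * e ^ 2 * hδ2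
  have hx3 : x3 ≠ 0 := by rintro rfl; nlinarith [sq_nonneg d]
  have hy2 : y2 ≠ 0 := by rintro rfl; nlinarith [sq_nonneg e]
  have hε0 : ε ≠ 0 := by rintro rfl; norm_num at hε2
  have hδ0 : δ ≠ 0 := by rintro rfl; norm_num at hδ2
  set u := ε * δ * (x3 * y2) with hu
  set m := -l with hm
  have hu0 : u ≠ 0 := by rw [hu]; positivity
  -- The upper left entry of K B A = A B is multiplied by x3 * y2, and the determinants eliminate
  -- the other off-diagonal entries.
  have hquad : (1 + m * d ^ 2) * (1 + m * e ^ 2) = m * u * ((m + 1) * (d * e) - u) := by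
    have h1 : (x2 * x3) * (y2 * y3) = (l * d ^ 2 - 1) * (l * e ^ 2 - 1) := by rw [hx23, hy23]
    have h2 : x2 * y3 = l * (δ * e * (l * (ε * d)) + y2 * x3) - l * (ε * d) * (δ * e) := by
      linear_combination -e11
    have h3 : (x2 * x3) * (y2 * y3) = x3 * y2 * (l * (δ * e * (l * (ε * d)) + y2 * x3) - l * (ε * d) * (δ * e)) := by
      rw [← h2]; ring
    have hεδ : (ε * δ) ^ 2 = 1 := by rw [mul_pow, hε2, hδ2, one_mul]
    rw [hm, hu]
    linear_combination h3 - h1 - l * (x3 * y2) ^ 2 * hεδ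
  have hquad2 : m * ((u - d * e) * (m * d * e - u)) = 1 + m * d ^ 2 + m * e ^ 2 := by
    linear_combination -hquad
  have hm1 : 1 < m := by linarith
  have hpos := torus_pos hm1 hd he hquad2
  have hx3' : ε * x3 ≠ 0 := mul_ne_zero hε0 hx3
  -- The factor ε * x3 on the second eigenvector makes the lower left entry of the conjugated A
  -- equal to ε.
  have hdet2 : (!![P.1, Q.1; P.2, Q.2] * !![1, 0; 0, ε * x3] : Matrix (Fin 2) (Fin 2) ℝ).det ≠ 0 := by
    rw [det_mul]
    refine mul_ne_zero hdet1 ?_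
    rw [det_fin_two_of]; simpa using hx3'
  refine ⟨⟨m, d, e, u, m * d * e - u, hm1, hd, he, hpos.2, by linarith [hpos.1], by ring, hquad2⟩,
    GeneralLinearGroup.mkOfDetNeZero _ hdet2, ε, δ, hε, hδ, ?_, ?_⟩
  · apply conjSL_eq_of
    change _ * (!![P.1, Q.1; P.2, Q.2] * !![1, 0; 0, ε * x3] : Matrix (Fin 2) (Fin 2) ℝ) =
      (!![P.1, Q.1; P.2, Q.2] * !![1, 0; 0, ε * x3] : Matrix (Fin 2) (Fin 2) ℝ) * _
    rw [← mul_assoc, ← hT1m, ← cA, mul_assoc, mul_assoc]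
    congr 1
    ext i j
    fin_cases i <;> fin_cases j <;> simp [TorusData.X0, mul_apply, Fin.sum_univ_two, hm]
    · ring
    · linear_combination ε * hx23
    · linear_combination -x3 * hε2
    · ring
  · apply conjSL_eq_of
    change _ * (!![P.1, Q.1; P.2, Q.2] * !![1, 0; 0, ε * x3] : Matrix (Fin 2) (Fin 2) ℝ) =
      (!![P.1, Q.1; P.2, Q.2] * !![1, 0; 0, ε * x3] : Matrix (Fin 2) (Fin 2) ℝ) * _
    rw [← mul_assoc, ← hT1m, ← cB, mul_assoc, mul_assoc]
    congr 1
    ext i j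
    fin_cases i <;> fin_cases j <;> simp [TorusData.Y0, mul_apply, Fin.sum_univ_two, hm]
    · rw [hu]; linear_combination -(ε * x3 * y2) * hδ2
    · rw [hu]
      field_simp
      linear_combination hy23
    · ring

end PantsChar

end

noncomputable section

namespace PantsChar

open Matrix Topology

/-! ### Ping-pong for a pair in normal form -/

lemma Prod_dichotomy (v : ℝ × ℝ) : v.2 = 0 ∨ ∃ w q : ℝ, q ≠ 0 ∧ v = (-w * q, q) := by
  by_cases h : v.2 = 0
  · exact Or.inl h
  · exact Or.inr ⟨-v.1 / v.2, v.2, h, by ext <;> simp; field_simp⟩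

namespace TorusData

variable (t : TorusData)

/-- In the coordinate w = -v.1 / v.2 the arcs are [0, r1] for Y, [r2, r3] for X⁻¹, [r4, r5] for Y⁻¹
and [r6, ∞] for X. The arcs of one generator and its inverse separate those of the other, which is
the pattern of a one-holed torus. -/
def r1 : ℝ := t.d
def r2 : ℝ := (1 + t.m * t.d ^ 2) / (t.m * t.d)
def r3 : ℝ := t.u * t.s / (t.d + t.e * t.s)
def r4 : ℝ := (t.e + t.d * t.s) / t.s
def r5 : ℝ := t.m * t.e * t.u / (1 + t.m * t.e ^ 2)
def r6 : ℝ := t.u / t.e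

lemma r1_pos : 0 < t.r1 := t.hd

lemma r1_lt_r2 : t.r1 < t.r2 := by
  have := t.m_pos; have := t.hd
  rw [r1, r2, lt_div_iff₀ (by positivity)]
  nlinarith

/-- After cross-multiplication and use of `rel` and `hus`, the differences for r2 < r3 < r4 < r5 are
e u, u / m and d u. -/
lemma r2_lt_r3 : t.r2 < t.r3 := by
  have := t.m_pos; have := t.hd; have := t.he; have := t.hs
  rw [r2, r3, div_lt_div_iff₀ (by positivity) (by positivity)]
  have h1 : t.u * t.s * (t.m * t.d) - (1 + t.m * t.d ^ 2) * (t.d + t.e * t.s) = t.e * t.u := by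
    linear_combination t.d * t.rel - t.e * t.hus
  have := mul_pos t.he t.u_pos
  linarith

lemma r3_lt_r4 : t.r3 < t.r4 := by
  have := t.m_pos; have := t.hd; have := t.he; have := t.hs
  rw [r3, r4, div_lt_div_iff₀ (by positivity) (by positivity)]
  have h1 : t.m * ((t.e + t.d * t.s) * (t.d + t.e * t.s) - t.u * t.s * t.s) = t.u := by
    linear_combination -t.s * t.rel - t.hus
  have : 0 < t.m * ((t.e + t.d * t.s) * (t.d + t.e * t.s) - t.u * t.s * t.s) := by
    rw [h1]; exact t.u_pos
  have := pos_of_mul_pos_right this t.m_pos.le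
  linarith

lemma r4_lt_r5 : t.r4 < t.r5 := by
  have := t.m_pos; have := t.hd; have := t.he; have := t.hs
  rw [r4, r5, div_lt_div_iff₀ (by positivity) (by positivity)]
  have h1 : t.m * t.e * t.u * t.s - (t.e + t.d * t.s) * (1 + t.m * t.e ^ 2) = t.d * t.u := by
    linear_combination t.e * t.rel - t.d * t.hus
  have := mul_pos t.hd t.u_pos
  linarith

lemma r5_lt_r6 : t.r5 < t.r6 := by
  have := t.m_pos; have := t.hd; have := t.he; have := t.u_pos
  rw [r5, r6, div_lt_div_iff₀ (by positivity) (by positivity)]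
  nlinarith

/-- The linear forms bounding the arc of a letter. -/
def arcForms : Fin 2 × Bool → (ℝ × ℝ) × (ℝ × ℝ)
  | (0, true) => ((-1, -t.r6), (0, 1))
  | (0, false) => ((-1, -t.r2), (1, t.r3))
  | (1, true) => ((-1, 0), (1, t.r1))
  | (1, false) => ((-1, -t.r4), (1, t.r5))

/-- The product of two linear forms. -/
def _root_.PantsChar.formProd (f : (ℝ × ℝ) × (ℝ × ℝ)) (v : ℝ × ℝ) : ℝ :=
  (f.1.1 * v.1 + f.1.2 * v.2) * (f.2.1 * v.1 + f.2.2 * v.2)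

/-- The closed arc of a letter. -/
def InArc (a : Fin 2 × Bool) (v : ℝ × ℝ) : Prop := 0 ≤ formProd (t.arcForms a) v

/-- The matrix of a letter. -/
def mat : Fin 2 × Bool → Matrix (Fin 2) (Fin 2) ℝ
  | (0, true) => t.X0
  | (0, false) => !![t.d, 1 + t.m * t.d ^ 2; -1, -t.m * t.d]
  | (1, true) => t.Y0
  | (1, false) => !![-t.m * t.e, -t.u; (1 + t.m * t.e ^ 2) / t.u, t.e]

/-- Sign positions on the line. -/
lemma inArc_cases {a : Fin 2 × Bool} {v : ℝ × ℝ} (hv : v ≠ 0) (h : t.InArc a v) :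
    (a = (0, true) ∧ v.2 = 0) ∨ ∃ w q : ℝ, q ≠ 0 ∧ v = (-w * q, q) ∧
      ((a = (0, true) ∧ t.r6 ≤ w) ∨ (a = (0, false) ∧ t.r2 ≤ w ∧ w ≤ t.r3) ∨
       (a = (1, true) ∧ 0 ≤ w ∧ w ≤ t.r1) ∨ (a = (1, false) ∧ t.r4 ≤ w ∧ w ≤ t.r5)) := by
  have h12 := t.r1_lt_r2; have h23 := t.r2_lt_r3; have h34 := t.r3_lt_r4
  have h45 := t.r4_lt_r5; have h56 := t.r5_lt_r6; have h1 := t.r1_pos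
  rcases Prod_dichotomy v with h0 | ⟨w, q, hq, rfl⟩
  · left
    have hv1 : 0 < v.1 ^ 2 := by
      have := sq_add_sq_pos hv; rw [h0] at this; simpa using this
    refine ⟨?_, h0⟩
    obtain ⟨i, b⟩ := a
    fin_cases i <;> cases b <;> simp [InArc, formProd, arcForms, h0] at h ⊢ <;> nlinarith
  · right
    refine ⟨w, q, hq, rfl, ?_⟩
    have hq2 : 0 < q ^ 2 := by positivity
    have between : ∀ a b : ℝ, a < b → 0 ≤ q ^ 2 * ((w - a) * (b - w)) → a ≤ w ∧ w ≤ b := by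
      intro a b hab h
      have h := nonneg_of_mul_nonneg_right h hq2
      constructor <;> by_contra hcon <;> push Not at hcon <;> nlinarith
    obtain ⟨i, b⟩ := a
    fin_cases i <;> cases b <;> simp [InArc, formProd, arcForms] at h ⊢
    · exact between _ _ h23 (by linarith)
    · have : 0 ≤ q ^ 2 * (w - t.r6) := by linarith
      linarith [nonneg_of_mul_nonneg_right this hq2]
    · exact between _ _ h45 (by linarith)
    · exact between _ _ h1 (by linarith)

/-- The form of the arc of a letter, pulled back by the letter, is a positive multiple of a form
vanishing at two of the ends. So X maps the complement of (r1, r4) into its arc, Y the complement of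
(r3, r6), X⁻¹ the interval [0, r5] and Y⁻¹ the interval [r2, ∞]. In each case only the arc of the
inverse letter is left out. -/
lemma formProd_X (v : ℝ × ℝ) : formProd (t.arcForms (0, true)) (rlin (t.mat (0, true)) v) =
    t.s / t.e * ((v.1 + t.r4 * v.2) * (v.1 + t.r1 * v.2)) := by
  have := t.he.ne'; have := t.hs.ne'
  simp [formProd, arcForms, mat, X0, rlin, r6, r4, r1]
  field_simp
  linear_combination (-(v.1 + t.d * v.2) * (v.1 + t.d * v.2)) * t.hus

lemma formProd_Y (v : ℝ × ℝ) : formProd (t.arcForms (1, true)) (rlin (t.mat (1, true)) v) =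
    t.e * (t.d + t.e * t.s) / t.u * ((v.1 + t.r6 * v.2) * (v.1 + t.r3 * v.2)) := by
  have h1 := t.he; have h2 := t.u_pos.ne'
  have h3 : t.d + t.e * t.s ≠ 0 := by have := t.hd; have := t.hs; positivity
  have e1 : t.e * v.1 + t.u * v.2 = t.e * (v.1 + t.r6 * v.2) := by
    rw [r6]; field_simp
  have e2 : t.e * v.1 + t.u * v.2 + t.r1 * (-(1 + t.m * t.e ^ 2) / t.u * v.1 + -t.m * t.e * v.2) =
      -((t.d + t.e * t.s) / t.u) * (v.1 + t.r3 * v.2) := by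
    rw [r1, r3]; field_simp
    linear_combination (t.e * v.1 + t.u * v.2) * t.hus
  have : formProd (t.arcForms (1, true)) (rlin (t.mat (1, true)) v) =
      -(t.e * v.1 + t.u * v.2) * (t.e * v.1 + t.u * v.2 + t.r1 *
        (-(1 + t.m * t.e ^ 2) / t.u * v.1 + -t.m * t.e * v.2)) := by
    simp [formProd, arcForms, mat, Y0, rlin]
  rw [this, e1] at *
  rw [← e1, e2, e1]
  ring

lemma formProd_X_inv (v : ℝ × ℝ) : formProd (t.arcForms (0, false)) (rlin (t.mat (0, false)) v) =
    (1 + t.m * t.e ^ 2) / (t.m ^ 2 * t.d * (t.d + t.e * t.s)) * (-v.1 * (v.1 + t.r5 * v.2)) := by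
  have h0 := t.m_pos; have h1 := t.he; have h2 := t.hd
  have h3 : t.d + t.e * t.s ≠ 0 := by have := t.hd; have := t.hs; positivity
  have h4 : 1 + t.m * t.e ^ 2 ≠ 0 := by positivity
  have e1 : -(t.d * v.1 + (1 + t.m * t.d ^ 2) * v.2) + -t.r2 * (-v.1 + -t.m * t.d * v.2) =
      v.1 / (t.m * t.d) := by
    rw [r2]; field_simp; ring
  have e2 : (t.d * v.1 + (1 + t.m * t.d ^ 2) * v.2) + t.r3 * (-v.1 + -t.m * t.d * v.2) =
      -((1 + t.m * t.e ^ 2) / (t.m * (t.d + t.e * t.s))) * (v.1 + t.r5 * v.2) := by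
    rw [r3, r5]
    obtain ⟨E, hE⟩ : ∃ E, E = t.d + t.e * t.s := ⟨_, rfl⟩
    rw [← hE] at h3 ⊢
    field_simp
    rw [hE]
    linear_combination (-v.1 - t.m * t.d * v.2) * t.rel + t.m * t.e * v.2 * t.hus
  have : formProd (t.arcForms (0, false)) (rlin (t.mat (0, false)) v) =
      (-(t.d * v.1 + (1 + t.m * t.d ^ 2) * v.2) + -t.r2 * (-v.1 + -t.m * t.d * v.2)) *
      ((t.d * v.1 + (1 + t.m * t.d ^ 2) * v.2) + t.r3 * (-v.1 + -t.m * t.d * v.2)) := by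
    simp [formProd, arcForms, mat, rlin]
  rw [this, e1, e2]
  field_simp

lemma formProd_Y_inv (v : ℝ × ℝ) : formProd (t.arcForms (1, false)) (rlin (t.mat (1, false)) v) =
    t.u * t.d / (t.s * (1 + t.m * t.e ^ 2)) * (-(v.1 + t.r2 * v.2) * v.2) := by
  have h0 := t.m_pos; have h1 := t.he; have h2 := t.hd; have h3 := t.hs; have h5 := t.u_pos
  have h4 : 1 + t.m * t.e ^ 2 ≠ 0 := by positivity
  have e1 : -(-t.m * t.e * v.1 + -t.u * v.2) + -t.r4 * ((1 + t.m * t.e ^ 2) / t.u * v.1 + t.e * v.2) =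
      t.d / t.s * (v.1 + t.r2 * v.2) := by
    rw [r2, r4]; field_simp
    linear_combination (t.m * t.e * v.1 + t.u * v.2) * t.rel - t.m * t.d * v.1 * t.hus
  have e2 : (-t.m * t.e * v.1 + -t.u * v.2) + t.r5 * ((1 + t.m * t.e ^ 2) / t.u * v.1 + t.e * v.2) =
      -(t.u / (1 + t.m * t.e ^ 2)) * v.2 := by
    rw [r5]; field_simp; ring
  have : formProd (t.arcForms (1, false)) (rlin (t.mat (1, false)) v) =
      (-(-t.m * t.e * v.1 + -t.u * v.2) + -t.r4 * ((1 + t.m * t.e ^ 2) / t.u * v.1 + t.e * v.2)) *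
      ((-t.m * t.e * v.1 + -t.u * v.2) + t.r5 * ((1 + t.m * t.e ^ 2) / t.u * v.1 + t.e * v.2)) := by
    simp [formProd, arcForms, mat, rlin]
  rw [this, e1, e2]
  field_simp

/-- A letter maps the arc of any letter other than its inverse into its own arc. -/
lemma inArc_mat {a b : Fin 2 × Bool} (hab : b ≠ (a.1, !a.2)) {v : ℝ × ℝ} (hv : v ≠ 0)
    (h : t.InArc b v) : t.InArc a (rlin (t.mat a) v) := by
  have h12 := t.r1_lt_r2; have h23 := t.r2_lt_r3; have h34 := t.r3_lt_r4
  have h45 := t.r4_lt_r5; have h56 := t.r5_lt_r6; have h1 := t.r1_pos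
  have hm := t.m_pos; have hd := t.hd; have he := t.he; have hs := t.hs; have hu := t.u_pos
  have hc := t.inArc_cases hv h
  obtain ⟨i, b'⟩ := a
  fin_cases i <;> cases b' <;> simp only [Fin.zero_eta, Fin.mk_one, Bool.not_true, Bool.not_false] at hab ⊢ <;>
    unfold InArc
  · rw [formProd_X_inv]
    apply mul_nonneg (by positivity)
    rcases hc with ⟨rfl, h0⟩ | ⟨w, q, hq, rfl, ⟨rfl, hc⟩ | ⟨rfl, hc, hc'⟩ | ⟨rfl, hc, hc'⟩ | ⟨rfl, hc, hc'⟩⟩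
    · simp at hab
    · simp at hab
    · have : 0 ≤ q ^ 2 * (w * (t.r5 - w)) := mul_nonneg (sq_nonneg q) (mul_nonneg (by linarith) (by linarith))
      linarith
    · have : 0 ≤ q ^ 2 * (w * (t.r5 - w)) := mul_nonneg (sq_nonneg q) (mul_nonneg (by linarith) (by linarith))
      linarith
    · have : 0 ≤ q ^ 2 * (w * (t.r5 - w)) := mul_nonneg (sq_nonneg q) (mul_nonneg (by linarith) (by linarith))
      linarith
  · rw [formProd_X]
    apply mul_nonneg (by positivity)
    rcases hc with ⟨rfl, h0⟩ | ⟨w, q, hq, rfl, ⟨rfl, hc⟩ | ⟨rfl, hc, hc'⟩ | ⟨rfl, hc, hc'⟩ | ⟨rfl, hc, hc'⟩⟩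
    · rw [h0]; simp; exact mul_self_nonneg _
    · have : 0 ≤ q ^ 2 * ((w - t.r4) * (w - t.r1)) := mul_nonneg (sq_nonneg q) (mul_nonneg (by linarith) (by linarith))
      linarith
    · simp at hab
    · have : 0 ≤ q ^ 2 * ((t.r4 - w) * (t.r1 - w)) := mul_nonneg (sq_nonneg q) (mul_nonneg (by linarith) (by linarith))
      linarith
    · have : 0 ≤ q ^ 2 * ((w - t.r4) * (w - t.r1)) := mul_nonneg (sq_nonneg q) (mul_nonneg (by linarith) (by linarith))
      linarith
  · rw [formProd_Y_inv]
    apply mul_nonneg (by positivity)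
    rcases hc with ⟨rfl, h0⟩ | ⟨w, q, hq, rfl, ⟨rfl, hc⟩ | ⟨rfl, hc, hc'⟩ | ⟨rfl, hc, hc'⟩ | ⟨rfl, hc, hc'⟩⟩
    · rw [h0]; simp
    · have : 0 ≤ q ^ 2 * (w - t.r2) := mul_nonneg (sq_nonneg q) (by linarith)
      linarith
    · have : 0 ≤ q ^ 2 * (w - t.r2) := mul_nonneg (sq_nonneg q) (by linarith)
      linarith
    · simp at hab
    · have : 0 ≤ q ^ 2 * (w - t.r2) := mul_nonneg (sq_nonneg q) (by linarith)
      linarith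
  · rw [formProd_Y]
    apply mul_nonneg (by positivity)
    rcases hc with ⟨rfl, h0⟩ | ⟨w, q, hq, rfl, ⟨rfl, hc⟩ | ⟨rfl, hc, hc'⟩ | ⟨rfl, hc, hc'⟩ | ⟨rfl, hc, hc'⟩⟩
    · rw [h0]; simp; exact mul_self_nonneg _
    · have : 0 ≤ q ^ 2 * ((w - t.r6) * (w - t.r3)) := mul_nonneg (sq_nonneg q) (mul_nonneg (by linarith) (by linarith))
      linarith
    · have : 0 ≤ q ^ 2 * ((t.r6 - w) * (t.r3 - w)) := mul_nonneg (sq_nonneg q) (mul_nonneg (by linarith) (by linarith))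
      linarith
    · have : 0 ≤ q ^ 2 * ((t.r6 - w) * (t.r3 - w)) := mul_nonneg (sq_nonneg q) (mul_nonneg (by linarith) (by linarith))
      linarith
    · simp at hab

/-- The marks separating the arcs: images of `(1, 1)`. -/
def markMat : Fin 4 → Matrix (Fin 2) (Fin 2) ℝ :=
  ![1, t.mat (0, false), t.mat (1, false) * t.mat (0, false), t.mat (1, false)]

/-- The `w`-coordinates of the marks. -/
lemma exists_mark (i : Fin 4) : ∃ μ q : ℝ, q ≠ 0 ∧ rlin (t.markMat i) (1, 1) = (-μ * q, q) ∧
    ((i = 0 ∧ μ < 0) ∨ (i = 1 ∧ t.r1 < μ ∧ μ < t.r2) ∨ (i = 2 ∧ t.r3 < μ ∧ μ < t.r4) ∨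
      (i = 3 ∧ t.r5 < μ ∧ μ < t.r6)) := by
  have h0 := t.m_pos; have h1 := t.he; have h2 := t.hd; have h3 := t.hs; have h5 := t.u_pos
  -- The columns of the matrices are the images of ∞ and 0 and represent the ends of a gap between
  -- arcs. The vector (1, 1) goes to the sum of the columns, so the coordinate of a mark is a
  -- mediant and lies strictly inside the gap.
  have mediant : ∀ a b c d : ℝ, 0 < b → 0 < d → a / b < c / d →
      a / b < (a + c) / (b + d) ∧ (a + c) / (b + d) < c / d := by
    intro a b c d hb hd h
    rw [div_lt_div_iff₀ hb hd] at h
    constructor <;> rw [div_lt_div_iff₀ (by positivity) (by positivity)] <;> nlinarith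
  fin_cases i
  · exact ⟨-1, 1, one_ne_zero, by simp [markMat, rlin], Or.inl ⟨rfl, by norm_num⟩⟩
  · have h12 := t.r1_lt_r2
    have e1 : t.r1 = t.d / 1 := by simp [r1]
    rw [e1, r2] at h12 ⊢
    have hm := mediant _ _ _ _ one_pos (by positivity) h12
    refine ⟨_, -(1 + t.m * t.d), by have : 0 < 1 + t.m * t.d := by positivity
                                    exact (neg_neg_of_pos this).ne, ?_, Or.inr (Or.inl ⟨rfl, hm⟩)⟩
    simp only [markMat, mat, rlin]
    ext
    · simp; field_simp; ring
    · simp; ring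
  · have h34 := t.r3_lt_r4
    have e4 : t.r4 = (t.u * (t.e + t.d * t.s)) / (t.u * t.s) := by rw [r4]; field_simp
    have e4' : t.r4 = (t.m * (t.e + t.d * t.s)) / (t.m * t.s) := by rw [r4]; field_simp
    have e3 : t.r3 = t.s / ((t.d + t.e * t.s) / t.u) := by rw [r3]; field_simp
    rw [e3, e4'] at h34 ⊢
    have hm := mediant _ _ _ _ (by positivity) (by positivity) h34
    refine ⟨_, (t.d + t.e * t.s) / t.u + t.m * t.s, by positivity, ?_, Or.inr (Or.inr (Or.inl ⟨rfl, hm⟩))⟩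
    have e : t.markMat 2 = t.mat (1, false) * t.mat (0, false) := rfl
    change rlin (t.markMat 2) (1, 1) = _
    rw [e, rlin_mul]
    simp only [mat, rlin]
    ext
    · simp; field_simp
      linear_combination (1 + t.m * t.d) * t.hus
    · simp; field_simp
      linear_combination -t.rel - (t.m * t.d * t.e + t.e) * t.hus
  · have h56 := t.r5_lt_r6
    have e5 : t.r5 = t.m * t.e / ((1 + t.m * t.e ^ 2) / t.u) := by rw [r5]; field_simp
    rw [e5, r6] at h56 ⊢
    have hm := mediant _ _ _ _ (by positivity) (by positivity) h56
    refine ⟨_, (1 + t.m * t.e ^ 2) / t.u + t.e, by positivity, ?_, Or.inr (Or.inr (Or.inr ⟨rfl, hm⟩))⟩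
    change rlin (t.mat (1, false)) (1, 1) = _
    simp only [mat, rlin]
    ext
    · simp; field_simp; ring
    · simp

end TorusData

end PantsChar

end

/-! ### Fixed points of words in normal form, and the exclusion of the one-holed torus -/

noncomputable section

namespace PantsChar

open Matrix Topology

lemma formProd_smul (f : (ℝ × ℝ) × (ℝ × ℝ)) (k : ℝ) (v : ℝ × ℝ) :
    formProd f (k • v) = k ^ 2 * formProd f v := by
  simp [formProd]; ring

lemma rlin_smul_mat (k : ℝ) (M : Matrix (Fin 2) (Fin 2) ℝ) (v : ℝ × ℝ) :
    rlin (k • M) v = k • rlin M v := by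
  simp only [rlin, Matrix.smul_apply, smul_eq_mul]
  ext <;> simp <;> ring

lemma rlin_SL_ne_zero (A : SpecialLinearGroup (Fin 2) ℝ) {v : ℝ × ℝ} (hv : v ≠ 0) :
    rlin (A : Matrix (Fin 2) (Fin 2) ℝ) v ≠ 0 :=
  rlin_ne_zero (by rw [A.det_coe]; exact one_ne_zero) hv

lemma rlin_SL_mul (A B : SpecialLinearGroup (Fin 2) ℝ) (v : ℝ × ℝ) :
    rlin ((A * B : SpecialLinearGroup (Fin 2) ℝ) : Matrix (Fin 2) (Fin 2) ℝ) v =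
      rlin (A : Matrix (Fin 2) (Fin 2) ℝ) (rlin (B : Matrix (Fin 2) (Fin 2) ℝ) v) :=
  rlin_mul (A : Matrix (Fin 2) (Fin 2) ℝ) (B : Matrix (Fin 2) (Fin 2) ℝ) v

lemma rlin_one (v : ℝ × ℝ) : rlin (1 : Matrix (Fin 2) (Fin 2) ℝ) v = v := by simp [rlin]

namespace TorusData

variable {t : TorusData} {σ : Pi2 →* SpecialLinearGroup (Fin 2) ℝ} {ε δ : ℝ}

lemma mat_letter (hε : ε = 1 ∨ ε = -1) (hδ : δ = 1 ∨ δ = -1)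
    (hX : (σ genX : Matrix (Fin 2) (Fin 2) ℝ) = ε • t.X0)
    (hY : (σ genY : Matrix (Fin 2) (Fin 2) ℝ) = δ • t.Y0) (a : Fin 2 × Bool) :
    ∃ k : ℝ, k ≠ 0 ∧ (σ (FreeGroup.mk [a]) : Matrix (Fin 2) (Fin 2) ℝ) = k • t.mat a := by
  have hε0 : ε ≠ 0 := by rcases hε with rfl | rfl <;> norm_num
  have hδ0 : δ ≠ 0 := by rcases hδ with rfl | rfl <;> norm_num
  obtain ⟨i, b⟩ := a
  fin_cases i <;> cases b
  · refine ⟨ε, hε0, ?_⟩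
    have e : FreeGroup.mk [((0 : Fin 2), false)] = genX⁻¹ := rfl
    simp only [Fin.zero_eta]
    rw [e, map_inv, SL2_inv_apply, hX]
    simp only [mat, X0]
    ext i j; fin_cases i <;> fin_cases j <;> simp <;> ring
  · exact ⟨ε, hε0, hX⟩
  · refine ⟨δ, hδ0, ?_⟩
    have e : FreeGroup.mk [((1 : Fin 2), false)] = genY⁻¹ := rfl
    simp only [Fin.mk_one]
    rw [e, map_inv, SL2_inv_apply, hY]
    simp only [mat, Y0]
    ext i j; fin_cases i <;> fin_cases j <;> simp <;> ring
  · exact ⟨δ, hδ0, hY⟩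

/-- Ping-pong along the word: no letter of the reduced list is followed by its inverse, and the
final b plays the part of the letter before which the word is written. -/
lemma inArc_word
    (hmat : ∀ a, ∃ k : ℝ, k ≠ 0 ∧ (σ (FreeGroup.mk [a]) : Matrix (Fin 2) (Fin 2) ℝ) = k • t.mat a)
    {b : Fin 2 × Bool} {v : ℝ × ℝ} (hv : v ≠ 0) (h : t.InArc b v) :
    ∀ (L : List (Fin 2 × Bool)) (a : Fin 2 × Bool), FreeGroup.IsReduced (a :: L ++ [b]) →
      t.InArc a (rlin (σ (FreeGroup.mk (a :: L))) v) := by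
  have step : ∀ {a c : Fin 2 × Bool} {v : ℝ × ℝ}, v ≠ 0 → (a.1 = c.1 → a.2 = c.2) → t.InArc c v →
      t.InArc a (rlin (σ (FreeGroup.mk [a])) v) := by
    intro a c v hv hac h
    obtain ⟨k, hk, hm⟩ := hmat a
    rw [hm, rlin_smul_mat, InArc, formProd_smul]
    refine mul_nonneg (sq_nonneg k) (t.inArc_mat ?_ hv h)
    rintro rfl
    have := hac rfl
    simp at this
  intro L
  induction L with
  | nil =>
    intro a hr
    exact step hv (FreeGroup.isReduced_cons_cons.1 hr).1 h
  | cons c L ih =>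
    intro a hr
    obtain ⟨hac, hr'⟩ := FreeGroup.isReduced_cons_cons.1 hr
    have h1 := ih c hr'
    have e : FreeGroup.mk (a :: c :: L) = FreeGroup.mk [a] * FreeGroup.mk (c :: L) := by
      rw [FreeGroup.mul_mk]; rfl
    rw [e, map_mul, rlin_SL_mul]
    exact step (rlin_SL_ne_zero _ hv) hac h1

/-- The attracting fixed point of a cyclically reduced word lies in the arc of its first letter. -/
lemma inArc_attracting
    (hmat : ∀ a, ∃ k : ℝ, k ≠ 0 ∧ (σ (FreeGroup.mk [a]) : Matrix (Fin 2) (Fin 2) ℝ) = k • t.mat a)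
    {a : Fin 2 × Bool} {L : List (Fin 2 × Bool)}
    (hL : FreeGroup.IsReduced (a :: L ++ [a])) {l : ℝ} {P Q : ℝ × ℝ} (hl : 1 < l ^ 2)
    (hP : rlin (σ (FreeGroup.mk (a :: L))) P = l • P)
    (hQ : rlin (σ (FreeGroup.mk (a :: L))) Q = l⁻¹ • Q)
    (hD : P.1 * Q.2 - P.2 * Q.1 ≠ 0) : t.InArc a P := by
  have hl0 : l ≠ 0 := by rintro rfl; norm_num at hl
  set M := (σ (FreeGroup.mk (a :: L)) : Matrix (Fin 2) (Fin 2) ℝ) with hM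
  have hQ0 : Q ≠ 0 := by rintro rfl; simp at hD
  -- An end of the arc serves as starting vector: the two ends are different, so at least one of
  -- them is not the repelling direction Q.
  obtain ⟨v, hv0, hva, hvQ⟩ : ∃ v : ℝ × ℝ, v ≠ 0 ∧ t.InArc a v ∧ v.1 * Q.2 - v.2 * Q.1 ≠ 0 := by
    have hdet : (t.arcForms a).1.1 * (t.arcForms a).2.2 - (t.arcForms a).1.2 * (t.arcForms a).2.1 ≠ 0 := by
      have h1 := t.r1_pos; have h23 := t.r2_lt_r3; have h45 := t.r4_lt_r5
      obtain ⟨i, b⟩ := a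
      fin_cases i <;> cases b <;> simp [arcForms] <;> intro h <;> linarith
    rcases hf : t.arcForms a with ⟨⟨f1, f2⟩, g1, g2⟩
    rw [hf] at hdet
    simp only at hdet
    by_cases h1 : f2 * Q.2 + f1 * Q.1 = 0
    · refine ⟨(g2, -g1), ?_, ?_, ?_⟩
      · intro h
        have e1 : g2 = 0 := congrArg Prod.fst h
        have e2 : -g1 = 0 := congrArg Prod.snd h
        apply hdet; linear_combination f1 * e1 + f2 * e2
      · rw [InArc, hf]; simp only [formProd]
        have : g1 * g2 + g2 * -g1 = 0 := by ring
        rw [this, mul_zero]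
      · intro h2
        simp only at h2
        have e1 : (f1 * g2 - f2 * g1) * Q.1 = 0 := by linear_combination g2 * h1 - f2 * h2
        have e2 : (f1 * g2 - f2 * g1) * Q.2 = 0 := by linear_combination f1 * h2 - g1 * h1
        exact hQ0 (Prod.ext ((mul_eq_zero.1 e1).resolve_left hdet) ((mul_eq_zero.1 e2).resolve_left hdet))
    · refine ⟨(f2, -f1), ?_, ?_, ?_⟩
      · intro h
        have e1 : f2 = 0 := congrArg Prod.fst h
        have e2 : -f1 = 0 := congrArg Prod.snd h
        apply hdet; linear_combination -g1 * e1 - g2 * e2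
      · rw [InArc, hf]; simp only [formProd]
        have : f1 * f2 + f2 * -f1 = 0 := by ring
        rw [this, zero_mul]
      · intro h2; apply h1; simp only at h2; linarith
  have hn : ∀ n : ℕ, (rlin M)^[n] v ≠ 0 ∧ t.InArc a ((rlin M)^[n] v) := by
    intro n
    induction n with
    | zero => exact ⟨hv0, hva⟩
    | succ n ih =>
      rw [Function.iterate_succ_apply']
      exact ⟨rlin_SL_ne_zero _ ih.1, inArc_word hmat ih.1 ih.2 L a hL⟩
  set D := P.1 * Q.2 - P.2 * Q.1 with hDdef
  set α := (v.1 * Q.2 - v.2 * Q.1) / D with hα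
  set β := (P.1 * v.2 - P.2 * v.1) / D with hβ
  have hv : v = α • P + β • Q := by
    ext
    · simp only [Prod.fst_add, Prod.smul_fst, smul_eq_mul, hα, hβ]; field_simp; rw [hDdef]; ring
    · simp only [Prod.snd_add, Prod.smul_snd, smul_eq_mul, hα, hβ]; field_simp; rw [hDdef]; ring
  have hα0 : α ≠ 0 := div_ne_zero hvQ hD
  have p1 := congrArg Prod.fst hP
  have p2 := congrArg Prod.snd hP
  have q1 := congrArg Prod.fst hQ
  have q2 := congrArg Prod.snd hQ
  simp only [rlin, Prod.smul_fst, Prod.smul_snd, smul_eq_mul] at p1 p2 q1 q2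
  have hiter : ∀ n : ℕ, (rlin M)^[n] v = (α * l ^ n) • P + (β * (l⁻¹) ^ n) • Q := by
    intro n
    induction n with
    | zero => simpa using hv
    | succ n ih =>
      rw [Function.iterate_succ_apply', ih]
      ext
      · simp only [rlin, Prod.fst_add, Prod.snd_add, Prod.smul_fst, Prod.smul_snd, smul_eq_mul]
        linear_combination α * l ^ n * p1 + β * (l⁻¹) ^ n * q1
      · simp only [rlin, Prod.fst_add, Prod.snd_add, Prod.smul_fst, Prod.smul_snd, smul_eq_mul]
        linear_combination α * l ^ n * p2 + β * (l⁻¹) ^ n * q2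
  obtain ⟨R, hR⟩ : ∃ R : ℝ, ∀ x y : ℝ, formProd (t.arcForms a) (x • P + y • Q) =
      x ^ 2 * formProd (t.arcForms a) P + x * y * R + y ^ 2 * formProd (t.arcForms a) Q := by
    refine ⟨((t.arcForms a).1.1 * P.1 + (t.arcForms a).1.2 * P.2) *
      ((t.arcForms a).2.1 * Q.1 + (t.arcForms a).2.2 * Q.2) +
      ((t.arcForms a).1.1 * Q.1 + (t.arcForms a).1.2 * Q.2) *
      ((t.arcForms a).2.1 * P.1 + (t.arcForms a).2.2 * P.2), fun x y => ?_⟩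
    simp only [formProd, Prod.fst_add, Prod.snd_add, Prod.smul_fst, Prod.smul_snd, smul_eq_mul]
    ring
  have hll : ∀ n : ℕ, l ^ n * (l⁻¹) ^ n = 1 := fun n => by
    rw [← mul_pow, mul_inv_cancel₀ hl0, one_pow]
  -- All iterates of v stay in the closed arc and converge to P; the leading coefficient gives the
  -- sign of the form at P.
  have : 0 ≤ α ^ 2 * formProd (t.arcForms a) P := by
    refine nonneg_of_pow_growth (B := α * β * R) (E := β ^ 2 * formProd (t.arcForms a) Q) hl fun n => ?_
    have h := (hn n).2
    rw [InArc, hiter, hR] at h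
    refine h.trans_eq ?_
    rw [← inv_pow, ← pow_mul, ← pow_mul, mul_comm 2 n, pow_mul, pow_mul]
    linear_combination α * β * R * hll n
  exact nonneg_of_mul_nonneg_right this (by positivity)

/-- The position of an arc on the circle. -/
def idx : Fin 2 × Bool → Fin 4
  | (0, true) => 3
  | (0, false) => 1
  | (1, true) => 0
  | (1, false) => 2

lemma idx_injective : Function.Injective idx := by
  rintro ⟨i, b⟩ ⟨j, c⟩ h
  fin_cases i <;> fin_cases j <;> cases b <;> cases c <;> simp [idx] at h ⊢

/-- On the line the mark i precedes the arc of index i, and the mark 0 precedes all arcs. So the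
product of the two determinants changes sign exactly at the mark i; the factor k removes the signs
of the vectors representing the marks. -/
lemma mark_sign (i : Fin 4) (hi : i ≠ 0) : ∃ k : ℝ, k ≠ 0 ∧ ∀ (a : Fin 2 × Bool) (v : ℝ × ℝ), v ≠ 0 →
    t.InArc a v →
      (idx a < i → k * (rdet v (rlin (t.markMat 0) (1, 1)) * rdet v (rlin (t.markMat i) (1, 1))) < 0) ∧
      (i ≤ idx a → 0 < k * (rdet v (rlin (t.markMat 0) (1, 1)) * rdet v (rlin (t.markMat i) (1, 1)))) := by
  obtain ⟨μ, q', hq', e0, hμ⟩ := t.exists_mark 0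
  obtain ⟨ν, q'', hq'', ei, hν⟩ := t.exists_mark i
  have hμ0 : μ < 0 := by simpa using hμ
  rw [e0, ei]
  have h12 := t.r1_lt_r2; have h23 := t.r2_lt_r3; have h34 := t.r3_lt_r4
  have h45 := t.r4_lt_r5; have h56 := t.r5_lt_r6; have h1 := t.r1_pos
  refine ⟨q' * q'', mul_ne_zero hq' hq'', fun a v hv ha => ?_⟩
  rcases t.inArc_cases hv ha with ⟨rfl, h0⟩ | ⟨w, q, hq, rfl, hc⟩
  · have hv1 : 0 < v.1 ^ 2 := by
      have := sq_add_sq_pos hv; rw [h0] at this; simpa using this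
    have e : q' * q'' * (rdet v (-μ * q', q') * rdet v (-ν * q'', q'')) = v.1 ^ 2 * (q' * q'') ^ 2 := by
      simp only [rdet, h0]; ring
    rw [e]
    refine ⟨fun h => ?_, fun _ => by positivity⟩
    simp only [idx] at h
    exact absurd h (not_lt.2 (Fin.le_last i))
  · have e : q' * q'' * (rdet (-w * q, q) (-μ * q', q') * rdet (-w * q, q) (-ν * q'', q'')) =
        (q * q' * q'') ^ 2 * ((w - μ) * (w - ν)) := by
      simp only [rdet]; ring
    rw [e]
    have hpos : 0 < (q * q' * q'') ^ 2 := by positivity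
    have neg : 0 ≤ w → w < ν → (q * q' * q'') ^ 2 * ((w - μ) * (w - ν)) < 0 := fun h h' =>
      mul_neg_of_pos_of_neg hpos (mul_neg_of_pos_of_neg (by linarith) (by linarith))
    have pos : 0 ≤ w → ν < w → 0 < (q * q' * q'') ^ 2 * ((w - μ) * (w - ν)) := fun h h' =>
      mul_pos hpos (mul_pos (by linarith) (by linarith))
    rcases hν with ⟨rfl, hν⟩ | ⟨rfl, hν, hν'⟩ | ⟨rfl, hν, hν'⟩ | ⟨rfl, hν, hν'⟩
    · exact absurd rfl hi
    all_goals
      rcases hc with ⟨rfl, hc⟩ | ⟨rfl, hc, hc'⟩ | ⟨rfl, hc, hc'⟩ | ⟨rfl, hc, hc'⟩ <;>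
      first
        | exact ⟨fun _ => neg (by linarith) (by linarith), fun h => absurd h (by decide)⟩
        | exact ⟨fun h => absurd h (by decide), fun _ => pos (by linarith) (by linarith)⟩

/-- The mark just before the later of the two arcs, together with the mark 0, separates the arcs. -/
lemma exists_separating_mark {a b : Fin 2 × Bool} (hab : a ≠ b) {P Q : ℝ × ℝ} (hP0 : P ≠ 0) (hQ0 : Q ≠ 0)
    (hP : t.InArc a P) (hQ : t.InArc b Q) : ∃ i : Fin 4,
      rdet P (rlin (t.markMat 0) (1, 1)) * rdet P (rlin (t.markMat i) (1, 1)) *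
      (rdet Q (rlin (t.markMat 0) (1, 1)) * rdet Q (rlin (t.markMat i) (1, 1))) < 0 := by
  have hne : idx a ≠ idx b := fun h => hab (idx_injective h)
  rcases lt_or_gt_of_ne hne with h | h
  · obtain ⟨k, hk, hs⟩ := mark_sign (t := t) (idx b) (by rintro h0; rw [h0] at h; exact absurd h (Fin.not_lt_zero _))
    refine ⟨idx b, ?_⟩
    have h1 := (hs a P hP0 hP).1 h
    have h2 := (hs b Q hQ0 hQ).2 le_rfl
    have := mul_neg_of_neg_of_pos h1 h2
    have hk2 : 0 < k ^ 2 := by positivity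
    by_contra hcon
    push Not at hcon
    have := mul_nonneg hk2.le hcon
    linarith
  · obtain ⟨k, hk, hs⟩ := mark_sign (t := t) (idx a) (by rintro h0; rw [h0] at h; exact absurd h (Fin.not_lt_zero _))
    refine ⟨idx a, ?_⟩
    have h1 := (hs a P hP0 hP).2 le_rfl
    have h2 := (hs b Q hQ0 hQ).1 h
    have := mul_neg_of_pos_of_neg h1 h2
    have hk2 : 0 < k ^ 2 := by positivity
    by_contra hcon
    push Not at hcon
    have := mul_nonneg hk2.le hcon
    linarith

end TorusData

lemma InvariantInterval.conj {ρ : Pi2 →* SpecialLinearGroup (Fin 2) ℝ} {c : Pi2}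
    {C : Set (OnePoint ℂ)} (h : InvariantInterval ρ c C) (g : Pi2) :
    InvariantInterval ρ (g * c * g⁻¹) (moeb ρ g '' C) where
  preconnected := h.preconnected.image _ (continuous_moeb ρ g).continuousOn
  nonempty := h.nonempty.image _
  subset_circle := by
    rintro _ ⟨z, hz, rfl⟩
    exact (moeb_mem_idealCircle g).2 (h.subset_circle hz)
  subset_disc := by
    rintro _ ⟨z, hz, rfl⟩
    exact moeb_mem_discontinuitySet g (h.subset_disc hz)
  map_mem := by
    rintro _ ⟨z, hz, rfl⟩
    exact ⟨_, h.map_mem z hz, by simp [moeb_mul, moeb_inv_moeb]⟩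
  inv_mem := by
    rintro _ ⟨z, hz, rfl⟩
    exact ⟨_, h.inv_mem z hz, by simp [_root_.mul_inv_rev, moeb_mul, moeb_inv_moeb]⟩

lemma exists_conj_cyclicallyReduced {c : Pi2} (hc : c ≠ 1) : ∃ (g : Pi2) (L : List (Fin 2 × Bool)),
    L ≠ [] ∧ FreeGroup.IsReduced (L ++ L) ∧ c = g * FreeGroup.mk L * g⁻¹ := by
  have hr : FreeGroup.IsReduced c.toWord := FreeGroup.isReduced_toWord
  have hcy := FreeGroup.reduceCyclically.isCyclicallyReduced hr
  have hconj := FreeGroup.reduceCyclically.conj_conjugator_reduceCyclically c.toWord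
  set L := FreeGroup.reduceCyclically c.toWord
  set w := FreeGroup.reduceCyclically.conjugator c.toWord
  have e : c = FreeGroup.mk w * FreeGroup.mk L * (FreeGroup.mk w)⁻¹ := by
    rw [FreeGroup.inv_mk, FreeGroup.mul_mk, FreeGroup.mul_mk, hconj, FreeGroup.mk_toWord]
  refine ⟨_, L, ?_, ?_, e⟩
  · intro h0
    apply hc
    rw [e, h0, ← FreeGroup.one_eq_mk, mul_one, mul_inv_cancel]
  · have := (hcy.flatten_replicate 2).isReduced
    simpa [List.replicate] using this

/-- A trace below -2 would be the case of a one-holed torus, whose boundary is connected: the marks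
in the four gaps lie in one orbit, yet they would lie over each of the three boundary circles. -/
theorem commutator_trace_ge {ρ : Pi2 →* SpecialLinearGroup (Fin 2) ℝ}
    {h : QuotientSurface ρ ≃ₜ ThreeHoledSphere} (hρ : IsDiscreteEmbedding ρ) (hb : MatchesBoundary ρ h) :
    -2 ≤ trace ((ρ genX * ρ genY * (ρ genX)⁻¹ * (ρ genY)⁻¹ : SpecialLinearGroup (Fin 2) ℝ) :
      Matrix (Fin 2) (Fin 2) ℝ) := by
  by_contra hK
  push Not at hK
  have : CompactSpace (QuotientSurface ρ) := h.symm.compactSpace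
  have hyp : ∀ γ, γ ≠ 1 → 2 < |trace (ρ γ : Matrix (Fin 2) (Fin 2) ℝ)| := fun γ hγ =>
    two_lt_abs_trace hρ hγ
  have htr : ∀ i : Fin 2, trace (ρ (FreeGroup.of i) : Matrix (Fin 2) (Fin 2) ℝ) ≠ 0 := fun i h0 => by
    have := hyp _ (FreeGroup.of_ne_one i)
    rw [h0] at this; norm_num at this
  obtain ⟨t, T, ε, δ, hε, hδ, hX, hY⟩ := exists_torusData hK (htr 0) (htr 1)
  set σ : Pi2 →* SpecialLinearGroup (Fin 2) ℝ := (conjSL T).comp ρ with hσ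
  have hmat := TorusData.mat_letter (σ := σ) hε hδ hX hY
  have hT : ∀ γ v, rlin (T : Matrix (Fin 2) (Fin 2) ℝ) (rlin (σ γ) v) = rlin (ρ γ) (rlin T v) := by
    intro γ v
    rw [← rlin_mul, ← rlin_mul]
    congr 1
    exact conjSL_spec T (ρ γ)
  have hT0 : ∀ {v : ℝ × ℝ}, v ≠ 0 → rlin (T : Matrix (Fin 2) (Fin 2) ℝ) v ≠ 0 := fun hv =>
    rlin_ne_zero (det_GL_ne_zero T) hv
  have h11 : ((1, 1) : ℝ × ℝ) ≠ 0 := by simp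
  set m1 := rlin (T : Matrix (Fin 2) (Fin 2) ℝ) (1, 1) with hm1
  have hm10 : m1 ≠ 0 := hT0 h11
  -- all marks are in one orbit
  have hmark : ∀ i : Fin 4, rlin (t.markMat i) (1, 1) ≠ 0 ∧ ∃ g : Pi2,
      pt (cvec (rlin T (rlin (t.markMat i) (1, 1)))) = moeb ρ g (pt (cvec m1)) := by
    have key : ∀ (M : Matrix (Fin 2) (Fin 2) ℝ) (g : Pi2) (k : ℝ), k ≠ 0 →
        (σ g : Matrix (Fin 2) (Fin 2) ℝ) = k • M → rlin M (1, 1) ≠ 0 ∧ ∃ g : Pi2,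
        pt (cvec (rlin T (rlin M (1, 1)))) = moeb ρ g (pt (cvec m1)) := by
      intro M g k hk hM
      have hne := rlin_SL_ne_zero (σ g) h11
      have e : rlin (σ g) (1, 1) = k • rlin M (1, 1) := by rw [hM, rlin_smul_mat]
      have hM0 : rlin M (1, 1) ≠ 0 := fun h0 => hne (by rw [e, h0, smul_zero])
      refine ⟨hM0, g, ?_⟩
      rw [moeb_pt _ (cvec_ne_zero hm10), lin_cvec, hm1, ← hT, e,
        pt_cvec_eq (hT0 hM0) (hT0 (smul_ne_zero hk hM0))]
      simp only [rlin, Prod.smul_fst, Prod.smul_snd, smul_eq_mul]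
      ring
    obtain ⟨k, hk, hkm⟩ := hmat (0, false)
    obtain ⟨k', hk', hkm'⟩ := hmat (1, false)
    intro i
    fin_cases i
    · exact key 1 1 1 one_ne_zero (by rw [map_one]; simp)
    · exact key _ _ k hk hkm
    · refine key _ (FreeGroup.mk [(1, false)] * FreeGroup.mk [(0, false)]) (k' * k) (mul_ne_zero hk' hk) ?_
      rw [map_mul]
      change (σ (FreeGroup.mk [(1, false)]) : Matrix (Fin 2) (Fin 2) ℝ) *
        (σ (FreeGroup.mk [(0, false)]) : Matrix (Fin 2) (Fin 2) ℝ) = _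
      rw [hkm, hkm', smul_mul_smul_comm]
      rfl
    · exact key _ _ k' hk' hkm'
  -- An interval over the i-th circle with nontrivial stabilizer is translated so that the
  -- stabilizing element becomes a cyclically reduced word. The ends of the interval then lie in the
  -- arcs of two different letters, and the interval contains a mark.
  have claim : ∀ i, pt (cvec m1) ∈ boundaryPreimage ρ h i := by
    intro i
    obtain ⟨C, hCB, c, hc, hC⟩ := exists_invariantInterval hρ hb i
    obtain ⟨g, L, hL0, hL, rfl⟩ := exists_conj_cyclicallyReduced hc
    have hC' := hC.conj g⁻¹
    rw [show g⁻¹ * (g * FreeGroup.mk L * g⁻¹) * g⁻¹⁻¹ = FreeGroup.mk L by group] at hC'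
    have hCB' : moeb ρ g⁻¹ '' C ⊆ boundaryPreimage ρ h i := by
      rintro _ ⟨z, hz, rfl⟩
      exact moeb_mem_boundaryPreimage i _ (hCB hz)
    have hc' : FreeGroup.mk L ≠ 1 := fun h0 => hc (by rw [h0]; group)
    obtain ⟨l, P, Q, hl, hP, hQ, hD⟩ := exists_hyperbolic_eigenvectors (σ (FreeGroup.mk L))
      (by rw [hσ, MonoidHom.comp_apply, trace_conjSL]; exact hyp _ hc')
    have hl0 : l ≠ 0 := by rintro rfl; norm_num at hl
    have hP0 : P ≠ 0 := by rintro rfl; simp at hD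
    have hQ0 : Q ≠ 0 := by rintro rfl; simp at hD
    -- the arcs of the fixed points
    have hLr : FreeGroup.IsReduced (FreeGroup.invRev L ++ FreeGroup.invRev L) := by
      rw [← FreeGroup.invRev_append, FreeGroup.isReduced_iff_reduce_eq, FreeGroup.reduce_invRev, hL.reduce_eq]
    have hcyc : ∀ (a : Fin 2 × Bool) (M : List (Fin 2 × Bool)), FreeGroup.IsReduced (a :: M ++ a :: M) →
        FreeGroup.IsReduced (a :: M ++ [a]) := fun a M hr =>
      hr.infix ⟨[], M, by simp⟩
    have hinvP : rlin (σ (FreeGroup.mk (FreeGroup.invRev L))) P = l⁻¹ • P := by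
      rw [← FreeGroup.inv_mk]
      have : rlin (σ (FreeGroup.mk L)⁻¹) (rlin (σ (FreeGroup.mk L)) P) = P := by
        rw [← rlin_SL_mul, ← map_mul, inv_mul_cancel, map_one]; exact rlin_one P
      rw [hP] at this
      calc rlin (σ (FreeGroup.mk L)⁻¹) P = l⁻¹ • rlin (σ (FreeGroup.mk L)⁻¹) (l • P) := by
            ext <;> simp [rlin] <;> field_simp
        _ = l⁻¹ • P := by rw [this]
    have hinvQ : rlin (σ (FreeGroup.mk (FreeGroup.invRev L))) Q = l • Q := by
      rw [← FreeGroup.inv_mk]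
      have : rlin (σ (FreeGroup.mk L)⁻¹) (rlin (σ (FreeGroup.mk L)) Q) = Q := by
        rw [← rlin_SL_mul, ← map_mul, inv_mul_cancel, map_one]; exact rlin_one Q
      rw [hQ] at this
      calc rlin (σ (FreeGroup.mk L)⁻¹) Q = l • rlin (σ (FreeGroup.mk L)⁻¹) (l⁻¹ • Q) := by
            ext <;> simp [rlin] <;> field_simp
        _ = l • Q := by rw [this]
    obtain ⟨a, M, hLa⟩ := List.exists_cons_of_ne_nil hL0
    have hL0' : FreeGroup.invRev L ≠ [] := fun h0 => hL0 (by
      have := congrArg List.length h0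
      rw [FreeGroup.invRev_length] at this
      exact List.length_eq_zero_iff.1 this)
    obtain ⟨b, N, hLb⟩ := List.exists_cons_of_ne_nil hL0'
    have haP : t.InArc a P := by
      rw [hLa] at hP hQ hL
      exact TorusData.inArc_attracting hmat (hcyc _ _ hL) hl hP hQ hD
    have hbQ : t.InArc b Q := by
      rw [hLb] at hinvP hinvQ hLr
      exact TorusData.inArc_attracting hmat (hcyc _ _ hLr) hl hinvQ hinvP
        (fun h0 => hD (by linarith))
    -- If L and its inverse began with the same letter, L would end with the inverse of its first
    -- letter and would not be cyclically reduced.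
    have hab : a ≠ b := by
      rintro rfl
      have e1 : L = FreeGroup.invRev N ++ [(a.1, !a.2)] := by
        rw [← FreeGroup.invRev_invRev (L₁ := L), hLb, FreeGroup.invRev_cons]
        rfl
      have h1 : FreeGroup.IsReduced [(a.1, !a.2), a] := by
        refine hL.infix ⟨FreeGroup.invRev N, M, ?_⟩
        conv_rhs => rw [hLa]
        conv_rhs => rw [← hLa]
        nth_rw 1 [e1]
        rw [hLa]
        simp
      have := (FreeGroup.isReduced_cons_cons.1 h1).1 rfl
      simp at this
    obtain ⟨j, hj⟩ := TorusData.exists_separating_mark hab hP0 hQ0 haP hbQ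
    have hPT : rlin (ρ (FreeGroup.mk L)) (rlin T P) = l • rlin T P := by
      rw [← hT, hP]; ext <;> simp [rlin] <;> ring
    have hQT : rlin (ρ (FreeGroup.mk L)) (rlin T Q) = l⁻¹ • rlin T Q := by
      rw [← hT, hQ]; ext <;> simp [rlin] <;> ring
    have hDT : (rlin T P).1 * (rlin T Q).2 - (rlin T P).2 * (rlin T Q).1 ≠ 0 := by
      have := rdet_rlin T P Q
      simp only [rdet] at this
      rw [this]
      exact mul_ne_zero (det_GL_ne_zero T) hD
    -- Two marks which separate the ends of the interval cannot both lie outside it. The determinant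
    -- of T enters to the fourth power and does not affect the sign.
    have hor : pt (cvec (rlin T (rlin (t.markMat 0) (1, 1)))) ∈ moeb ρ g⁻¹ '' C ∨
        pt (cvec (rlin T (rlin (t.markMat j) (1, 1)))) ∈ moeb ρ g⁻¹ '' C := by
      by_contra hcon
      push Not at hcon
      have := hC'.not_separated hc' hl hPT hQT hDT (hT0 (hmark 0).1) (hT0 (hmark j).1) hcon.1 hcon.2
      simp only [rdet_rlin] at this
      have hd : 0 < (T : Matrix (Fin 2) (Fin 2) ℝ).det ^ 4 := by
        have := det_GL_ne_zero T; positivity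
      have := mul_neg_of_pos_of_neg hd hj
      linarith
    have fin : ∀ k, pt (cvec (rlin T (rlin (t.markMat k) (1, 1)))) ∈ moeb ρ g⁻¹ '' C →
        pt (cvec m1) ∈ boundaryPreimage ρ h i := by
      intro k hk
      obtain ⟨γ, hγ⟩ := (hmark k).2
      have := moeb_mem_boundaryPreimage i γ⁻¹ (hCB' hk)
      rwa [hγ, moeb_inv_moeb] at this
    exact hor.elim (fin _) (fin _)
  exact boundaryPreimage_disjoint (by decide : (0 : Fin 3) ≠ 1) (claim 0) (claim 1)

end PantsChar

end

noncomputable section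

namespace PantsChar

open Matrix Topology

/-! ### Descent by Vieta involutions -/

/-- The two roots Z and ab - Z of the equation for the last coordinate differ by d, where d² = (a² -
4)(b² - 4) + 4 (k - 2). So either d ≥ c, as claimed, or d is negative; it remains to see that the
larger coordinate Z is not the smaller root. -/
lemma vieta_decrease {a b Z k c : ℝ} (ha : 2 < a) (hb : 2 < b) (haZ : a ≤ Z) (hbZ : b ≤ Z)
    (hk : a ^ 2 + b ^ 2 + Z ^ 2 - a * b * Z - 2 = k) (hc : 0 < c) (hc1 : c ≤ 1) (hck : c ≤ k - 2) :
    |a * b - Z| ≤ Z - c := by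
  wlog hab : a ≤ b generalizing a b
  · rw [mul_comm]
    exact this hb ha hbZ haZ (by linarith) (by linarith)
  have hab4 : 4 < a * b := by nlinarith
  rw [abs_le]
  refine ⟨by linarith, ?_⟩
  by_contra hcon
  push Not at hcon
  set d := 2 * Z - a * b with hd
  have hd2 : d ^ 2 = (a ^ 2 - 4) * (b ^ 2 - 4) + 4 * (k - 2) := by rw [hd, ← hk]; ring
  have h1 : 0 < (a ^ 2 - 4) * (b ^ 2 - 4) := mul_pos (by nlinarith) (by nlinarith)
  have hdc : d < c := by linarith
  have hd0 : d < 0 := by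
    by_contra h0
    push Not at h0
    have : d ^ 2 < c ^ 2 := by gcongr
    nlinarith
  -- The quadratic polynomial is negative at b, so b lies strictly between the roots. If Z were the
  -- smaller root, this would contradict b ≤ Z.
  have hqb : b ^ 2 * (2 - a) + a ^ 2 - 2 - k < 0 := by
    have h2 : b ^ 2 * (2 - a) ≤ a ^ 2 * (2 - a) :=
      mul_le_mul_of_nonpos_right (by nlinarith) (by linarith)
    have h3 : a ^ 2 * (2 - a) + a ^ 2 - 4 = -((a - 2) ^ 2 * (a + 1)) := by ring
    have h4 : 0 ≤ (a - 2) ^ 2 * (a + 1) := by positivity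
    linarith
  have h5 : (Z - b) * (Z + b - a * b) ≤ 0 :=
    mul_nonpos_of_nonneg_of_nonpos (by linarith) (by linarith)
  linarith

/-- The Vieta involution on real triples. -/
def rvieta (i : Fin 3) (p : Fin 3 → ℝ) : Fin 3 → ℝ :=
  fun j => if j = i then p (i + 1) * p (i + 2) - p i else p j

lemma ofReal_rvieta (i : Fin 3) (p : Fin 3 → ℝ) :
    (fun j => ((rvieta i p j : ℝ) : ℂ)) = vieta i fun j => ((p j : ℝ) : ℂ) := by
  ext j
  by_cases h : j = i <;> simp [rvieta, vieta, h]

lemma rkappa_rvieta (i : Fin 3) (p : Fin 3 → ℝ) :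
    (rvieta i p 0) ^ 2 + (rvieta i p 1) ^ 2 + (rvieta i p 2) ^ 2 -
      rvieta i p 0 * rvieta i p 1 * rvieta i p 2 - 2 =
    p 0 ^ 2 + p 1 ^ 2 + p 2 ^ 2 - p 0 * p 1 * p 2 - 2 := by
  fin_cases i <;> simp [rvieta] <;> ring

/-- Since κ is invariant, each step decreases the sum of absolute values by at least the same c =
min 1 (k - 2). All triples have entries of absolute value above 2, so the descent has to stop, and
it stops only at a negative product. -/
theorem descent {R : (Fin 3 → ℝ) → Prop} (hR : ∀ p, R p → ∀ i, 2 < |p i|)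
    (hV : ∀ i p, R p → R (rvieta i p)) {k : ℝ} (hk : 2 < k) (p : Fin 3 → ℝ) (hp : R p)
    (hkp : p 0 ^ 2 + p 1 ^ 2 + p 2 ^ 2 - p 0 * p 1 * p 2 - 2 = k) :
    (fun i => ((p i : ℝ) : ℂ)) ∈ gamOctant := by
  obtain ⟨c, hc, hc1, hck⟩ : ∃ c : ℝ, 0 < c ∧ c ≤ 1 ∧ c ≤ k - 2 :=
    ⟨min 1 (k - 2), lt_min one_pos (by linarith), min_le_left _ _, min_le_right _ _⟩
  obtain ⟨n, hn⟩ := exists_nat_ge ((|p 0| + |p 1| + |p 2|) / c)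
  rw [div_le_iff₀ hc] at hn
  induction n generalizing p with
  | zero =>
    have := hR p hp 0
    have := hR p hp 1
    have := hR p hp 2
    simp at hn
    linarith
  | succ n ih =>
    have h0 := hR p hp 0
    have h1 := hR p hp 1
    have h2 := hR p hp 2
    rcases lt_or_ge (p 0 * p 1 * p 2) 0 with hneg | hpos
    · have := mem_signOctant_of_mul_neg h0 h1 h2 hneg
      apply signOctant_subset_gamOctant
      convert this using 1
      ext i; fin_cases i <;> rfl
    · have hpabs : p 0 * p 1 * p 2 = |p 0| * |p 1| * |p 2| := by
        rw [← abs_mul, ← abs_mul, abs_of_nonneg hpos]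
      have key : ∀ i, |rvieta i p 0| + |rvieta i p 1| + |rvieta i p 2| ≤ (n : ℝ) * c →
          (fun i => ((p i : ℝ) : ℂ)) ∈ gamOctant := by
        intro i hi
        have h := ih (rvieta i p) (hV i p hp) (by rw [rkappa_rvieta, hkp]) hi
        rw [ofReal_rvieta] at h
        have := vieta_mem_gamOctant i h
        rwa [vieta_vieta] at this
      have hkabs : |p 0| ^ 2 + |p 1| ^ 2 + |p 2| ^ 2 - |p 0| * |p 1| * |p 2| - 2 = k := by
        rw [← hpabs, sq_abs, sq_abs, sq_abs, hkp]
      -- For xyz ≥ 0 the numbers xy and z have compatible signs, so the Vieta involution commutes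
      -- with absolute values and `vieta_decrease` applies to positive triples.
      have habs : ∀ x y z : ℝ, 0 ≤ x * y * z → 0 < |z| → |x * y - z| = abs (|x| * |y| - |z|) := by
        intro x y z h hz
        have hz0 : z ≠ 0 := abs_pos.1 hz
        rw [← abs_mul]
        rcases lt_or_gt_of_ne hz0 with hz | hz
        · rw [abs_of_neg hz, abs_of_nonpos (nonpos_of_mul_nonneg_left h hz), ← abs_neg]
          congr 1; ring
        · rw [abs_of_pos hz, abs_of_nonneg (nonneg_of_mul_nonneg_left h hz)]
      push_cast at hn
      have hmax : (|p 1| ≤ |p 0| ∧ |p 2| ≤ |p 0|) ∨ (|p 0| ≤ |p 1| ∧ |p 2| ≤ |p 1|) ∨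
          (|p 0| ≤ |p 2| ∧ |p 1| ≤ |p 2|) := by
        rcases le_total |p 0| |p 1| with a | a <;> rcases le_total |p 1| |p 2| with b | b <;>
          rcases le_total |p 0| |p 2| with d | d <;> simp [a, b, d]
        all_goals exact Or.inl (by linarith)
      rcases hmax with ⟨a, b⟩ | ⟨a, b⟩ | ⟨a, b⟩
      · apply key 0
        have h := vieta_decrease h1 h2 a b (by linarith) hc hc1 hck
        rw [← habs (p 1) (p 2) (p 0) (by linarith) (by linarith)] at h
        simp [rvieta]
        linarith
      · apply key 1
        have h := vieta_decrease h2 h0 b a (by linarith) hc hc1 hck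
        rw [← habs (p 2) (p 0) (p 1) (by linarith) (by linarith)] at h
        simp [rvieta]
        linarith
      · apply key 2
        have h := vieta_decrease h0 h1 a b (by linarith) hc hc1 hck
        rw [← habs (p 0) (p 1) (p 2) (by linarith) (by linarith)] at h
        simp [rvieta]
        linarith

/-- The descent runs over the real characters of the representations ρ ∘ φ. Their entries are traces
of nontrivial elements, so hyperbolicity keeps them outside [-2, 2], and the trace of the commutator
is greater than 2 by `commutator_trace_ge`. -/
theorem character_mem_gamOctant {ρ : Pi2 →* SpecialLinearGroup (Fin 2) ℂ} (h : IsPEmbedding ρ) :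
    character ρ ∈ gamOctant := by
  obtain ⟨g, ρ₀, hg, hd, h, hb⟩ := h
  have : CompactSpace (QuotientSurface ρ₀) := h.symm.compactSpace
  have hyp : ∀ γ, γ ≠ 1 → 2 < |trace (ρ₀ γ : Matrix (Fin 2) (Fin 2) ℝ)| := fun γ hγ =>
    two_lt_abs_trace hd hγ
  set R : (Fin 3 → ℝ) → Prop := fun p => ∃ φ : Pi2 ≃* Pi2,
    character (ρ.comp φ.toMonoidHom) = fun i => ((p i : ℝ) : ℂ) with hR
  have hchar : ∀ φ : Pi2 ≃* Pi2, character (ρ.comp φ.toMonoidHom) =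
      ![((trace (ρ₀ (φ genX) : Matrix (Fin 2) (Fin 2) ℝ) : ℝ) : ℂ),
        ((trace (ρ₀ (φ genY) : Matrix (Fin 2) (Fin 2) ℝ) : ℝ) : ℂ),
        ((trace (ρ₀ (φ genX * φ genY) : Matrix (Fin 2) (Fin 2) ℝ) : ℝ) : ℂ)] := fun φ => by
    rw [character_comp, trace_of_isConjToReal hg, trace_of_isConjToReal hg, trace_of_isConjToReal hg]
  set q : Fin 3 → ℝ := ![trace (ρ₀ genX : Matrix (Fin 2) (Fin 2) ℝ),
    trace (ρ₀ genY : Matrix (Fin 2) (Fin 2) ℝ), trace (ρ₀ (genX * genY) : Matrix (Fin 2) (Fin 2) ℝ)] with hq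
  have hcq : character ρ = fun i => ((q i : ℝ) : ℂ) := by
    have := hchar (MulEquiv.refl _)
    have e : ρ.comp (MulEquiv.refl Pi2).toMonoidHom = ρ := by ext; rfl
    rw [e] at this
    rw [this]
    ext i; fin_cases i <;> rfl
  rw [hcq]
  have hswap : ∀ (a : Pi2 ≃* Pi2) (f : Equiv.Perm (Fin 3)),
      (∀ σ : Pi2 →* SpecialLinearGroup (Fin 2) ℂ, character (σ.comp a.toMonoidHom) = character σ ∘ f) →
      ∀ p, R p → R (p ∘ f) := by
    rintro a f ha p ⟨φ, hφ⟩
    refine ⟨a.trans φ, ?_⟩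
    have e : ρ.comp (a.trans φ).toMonoidHom = (ρ.comp φ.toMonoidHom).comp a.toMonoidHom := by ext; rfl
    rw [e, ha, hφ]
    rfl
  have h01 := hswap autSwap _ character_comp_autSwap
  have h12 := hswap autShear _ character_comp_autShear
  have hv2 : ∀ p, R p → R (rvieta 2 p) := by
    rintro p ⟨φ, hφ⟩
    refine ⟨autInv.trans φ, ?_⟩
    have e : ρ.comp (autInv.trans φ).toMonoidHom = (ρ.comp φ.toMonoidHom).comp autInv.toMonoidHom := by
      ext; rfl
    rw [e, character_comp_autInv, hφ, ofReal_rvieta]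
  have hv1 : ∀ p, R p → R (rvieta 1 p) := by
    intro p hp
    have := h12 _ (hv2 _ (h12 _ hp))
    convert this using 1
    ext i; fin_cases i <;> simp [rvieta, Equiv.swap_apply_of_ne_of_ne, mul_comm]
  have hv0 : ∀ p, R p → R (rvieta 0 p) := by
    intro p hp
    have := h01 _ (hv1 _ (h01 _ hp))
    convert this using 1
    ext i; fin_cases i <;> simp [rvieta, Equiv.swap_apply_of_ne_of_ne, mul_comm]
  refine descent (R := R) ?_ ?_ (k := trace ((ρ₀ genX * ρ₀ genY * (ρ₀ genX)⁻¹ * (ρ₀ genY)⁻¹ :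
    SpecialLinearGroup (Fin 2) ℝ) : Matrix (Fin 2) (Fin 2) ℝ)) ?_ q ?_ ?_
  · rintro p ⟨φ, hφ⟩ i
    rw [hchar] at hφ
    have hne := pair_ne φ
    have hx := hyp (φ genX) (fun h => hne (by rw [h]; simp))
    have hy := hyp (φ genY) (fun h => hne (by rw [h]; simp))
    have hz := hyp (φ genX * φ genY) (fun h => hne (by rw [h, mul_eq_one_iff_eq_inv.1 h]; simp))
    have hi := congrFun hφ i
    fin_cases i
    · have : trace (ρ₀ (φ genX) : Matrix (Fin 2) (Fin 2) ℝ) = p 0 := Complex.ofReal_injective hi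
      change 2 < |p 0|
      rw [← this]; exact hx
    · have : trace (ρ₀ (φ genY) : Matrix (Fin 2) (Fin 2) ℝ) = p 1 := Complex.ofReal_injective hi
      change 2 < |p 1|
      rw [← this]; exact hy
    · have : trace (ρ₀ (φ genX * φ genY) : Matrix (Fin 2) (Fin 2) ℝ) = p 2 := Complex.ofReal_injective hi
      change 2 < |p 2|
      rw [← this]; exact hz
  · intro i p hp
    fin_cases i
    exacts [hv0 p hp, hv1 p hp, hv2 p hp]
  · have h1 := commutator_trace_ge hd hb
    have h2 := hyp (genX * genY * genX⁻¹ * genY⁻¹) (fun h => genX_mul_genY_ne (by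
      rwa [mul_inv_eq_one, mul_inv_eq_iff_eq_mul] at h))
    rw [map_mul, map_mul, map_mul, map_inv, map_inv] at h2
    rcases lt_abs.1 h2 with h2 | h2
    · exact h2
    · linarith
  · exact ⟨MulEquiv.refl _, by rw [← hcq]; rfl⟩
  · rw [trace_commutator, ← map_mul]
    simp [hq]

end PantsChar

end

/-! ### From characters to embeddings -/

noncomputable section

namespace PantsChar

open Matrix Topology

/-! ### Groups generated by three reflections -/

/-- Three real matrices of determinant `-1` and order two, which act on the closed upper half-plane
(after composition with the complex conjugation) as the reflections in three disjoint geodesics.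
The geodesic of index `i` is the zero set of the form `c |p|² - 2 a Re(p q̄) - b |q|²`. -/
structure ReflData where
  a : Fin 3 → ℝ
  b : Fin 3 → ℝ
  c : Fin 3 → ℝ
  det_eq : ∀ i, a i ^ 2 + b i * c i = 1
  c_lt_b : ∀ i, c i < b i
  ε : ℝ
  ε_pos : 0 < ε
  add_le : ∀ i j, i ≠ j → ∀ v, hform (c i) (-a i) 0 (-b i) v + hform (c j) (-a j) 0 (-b j) v ≤
    -(ε * nsq v)

namespace ReflData

variable (D : ReflData)

/-- The form which defines the geodesic of index `i`. -/
def q (i : Fin 3) (v : ℂ × ℂ) : ℝ := hform (D.c i) (-D.a i) 0 (-D.b i) v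

/-- The reflection of index `i`, as a matrix. -/
def R (i : Fin 3) : Matrix (Fin 2) (Fin 2) ℝ := !![D.a i, D.b i; D.c i, -D.a i]

lemma det_R (i : Fin 3) : (D.R i).det = -1 := by
  rw [R, det_fin_two_of]
  linear_combination -D.det_eq i

/-- The reflection of index `i`, as an invertible matrix. -/
def RG (i : Fin 3) : GL (Fin 2) ℝ :=
  GeneralLinearGroup.mkOfDetNeZero (D.R i) (by rw [det_R]; norm_num)

@[simp] lemma coe_RG (i : Fin 3) : (D.RG i : Matrix (Fin 2) (Fin 2) ℝ) = D.R i := rfl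

/-- The reflection of index `i`, composed with the complex conjugation. -/
def r (i : Fin 3) (z : OnePoint ℂ) : OnePoint ℂ := mob (D.RG i) z

/-- The linear action of words in the reflections. -/
def wv (l : List (Fin 3)) (v : ℂ × ℂ) : ℂ × ℂ := l.foldr (fun i u => lin (D.R i) u) v

/-- The action of words in the reflections on the sphere. -/
def wm (l : List (Fin 3)) (z : OnePoint ℂ) : OnePoint ℂ := l.foldr D.r z

@[simp] lemma wv_nil (v : ℂ × ℂ) : D.wv [] v = v := rfl

@[simp] lemma wv_cons (i : Fin 3) (l : List (Fin 3)) (v : ℂ × ℂ) :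
    D.wv (i :: l) v = lin (D.R i) (D.wv l v) := rfl

@[simp] lemma wm_nil (z : OnePoint ℂ) : D.wm [] z = z := rfl

@[simp] lemma wm_cons (i : Fin 3) (l : List (Fin 3)) (z : OnePoint ℂ) :
    D.wm (i :: l) z = D.r i (D.wm l z) := rfl

lemma wm_append (l m : List (Fin 3)) (z : OnePoint ℂ) : D.wm (l ++ m) z = D.wm l (D.wm m z) := by
  simp [wm]

lemma wv_append (l m : List (Fin 3)) (v : ℂ × ℂ) : D.wv (l ++ m) v = D.wv l (D.wv m v) := by
  simp [wv]

lemma lin_R_ne_zero (i : Fin 3) {v : ℂ × ℂ} (hv : v ≠ 0) : lin (D.R i) v ≠ 0 :=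
  lin_ne_zero (by rw [det_R]; norm_num) hv

lemma wv_ne_zero (l : List (Fin 3)) {v : ℂ × ℂ} (hv : v ≠ 0) : D.wv l v ≠ 0 := by
  induction l with
  | nil => exact hv
  | cons i l ih => exact D.lin_R_ne_zero i ih

lemma wm_pt (l : List (Fin 3)) {v : ℂ × ℂ} (hv : v ≠ 0) : D.wm l (pt v) = pt (D.wv l v) := by
  induction l with
  | nil => rfl
  | cons i l ih =>
    rw [wm_cons, ih, r, mob_pt _ (D.wv_ne_zero l hv)]
    rfl

lemma lin_R_lin_R (i : Fin 3) (v : ℂ × ℂ) : lin (D.R i) (lin (D.R i) v) = v := by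
  rw [← lin_mul]
  have : D.R i * D.R i = 1 := by
    have h := D.det_eq i
    ext j k
    fin_cases j <;> fin_cases k <;> simp [R, mul_apply, Fin.sum_univ_two]
    · linear_combination h
    · ring
    · ring
    · linear_combination h
  rw [this, lin_one]

@[simp] lemma r_r (i : Fin 3) (z : OnePoint ℂ) : D.r i (D.r i z) = z := by
  have h := D.wm_pt [i, i] (vec_ne_zero z)
  simpa [lin_R_lin_R] using h

lemma wv_reverse_wv (l : List (Fin 3)) (v : ℂ × ℂ) : D.wv l.reverse (D.wv l v) = v := by
  induction l with
  | nil => rfl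
  | cons i l ih => rw [List.reverse_cons, wv_append, wv_cons, wv_cons, wv_nil, lin_R_lin_R, ih]

lemma wm_reverse_wm (l : List (Fin 3)) (z : OnePoint ℂ) : D.wm l.reverse (D.wm l z) = z := by
  induction l with
  | nil => rfl
  | cons i l ih => rw [List.reverse_cons, wm_append, wm_cons, wm_cons, wm_nil, r_r, ih]

lemma continuous_r (i : Fin 3) : Continuous (D.r i) := continuous_mob _

lemma continuous_wm (l : List (Fin 3)) : Continuous (D.wm l) := by
  induction l with
  | nil => exact continuous_id
  | cons i l ih => exact (D.continuous_r i).comp ih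

lemma normSq_vdet_wv (l : List (Fin 3)) (v w : ℂ × ℂ) :
    Complex.normSq (vdet (D.wv l v) (D.wv l w)) = Complex.normSq (vdet v w) := by
  induction l with
  | nil => rfl
  | cons i l ih => rw [wv_cons, wv_cons, vdet_lin, det_R, map_mul, ih]; simp

lemma q_lin (i : Fin 3) (v : ℂ × ℂ) : D.q i (lin (D.R i) v) = -D.q i v := by
  have h := D.det_eq i
  have : D.b i * D.c i = 1 - D.a i ^ 2 := by linear_combination h
  simp only [q, hform, lin, R, of_apply, cons_val', cons_val_zero, cons_val_fin_one, cons_val_one,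
    Complex.normSq_apply, Complex.add_re, Complex.add_im, Complex.mul_re, Complex.mul_im,
    Complex.star_def, Complex.conj_re, Complex.conj_im, Complex.ofReal_re, Complex.ofReal_im]
  linear_combination (-(D.c i * (v.1.re ^ 2 + v.1.im ^ 2)) + D.b i * (v.2.re ^ 2 + v.2.im ^ 2) +
    2 * D.a i * (v.1.re * v.2.re + v.1.im * v.2.im)) * h

/-- As c < b, the norm increases where q is negative and decreases where q is positive. This governs
both the growth of reduced words and the process of moving a point towards the cell. -/
lemma nsq_lin (i : Fin 3) (v : ℂ × ℂ) :
    nsq (lin (D.R i) v) = nsq v + (D.c i - D.b i) * D.q i v := by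
  have h := D.det_eq i
  simp only [nsq, q, hform, lin, R, of_apply, cons_val', cons_val_zero, cons_val_fin_one,
    cons_val_one,
    Complex.normSq_apply, Complex.add_re, Complex.add_im, Complex.mul_re, Complex.mul_im,
    Complex.star_def, Complex.conj_re, Complex.conj_im, Complex.ofReal_re, Complex.ofReal_im]
  linear_combination (v.1.re ^ 2 + v.1.im ^ 2 + v.2.re ^ 2 + v.2.im ^ 2) * h

lemma q_add_q {i j : Fin 3} (h : i ≠ j) (v : ℂ × ℂ) : D.q i v + D.q j v ≤ -(D.ε * nsq v) :=
  D.add_le i j h v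

/-- The sum of two of the forms is negative definite, so the discs where they are nonnegative are
disjoint. -/
lemma q_lt_of_nonneg {i j : Fin 3} (h : i ≠ j) {v : ℂ × ℂ} (hv : v ≠ 0) (hj : 0 ≤ D.q j v) :
    D.q i v < 0 := by
  have := D.q_add_q h v
  have := mul_pos D.ε_pos (nsq_pos hv)
  linarith

/-! ### The ping-pong argument -/

/-- The cone over the intersection of the three half-planes. -/
def S (v : ℂ × ℂ) : Prop := ∀ i, D.q i v ≤ 0

/-- Ping-pong: the last reflection applied puts the point into its own closed disc, and the next one
is different, hence has its disc away from that point by the margin ε. -/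
lemma q_wv_nonneg {i : Fin 3} {l : List (Fin 3)} (hl : (i :: l).IsChain (· ≠ ·)) {v : ℂ × ℂ}
    (hv : v ≠ 0) (hS : D.S v) :
    0 ≤ D.q i (D.wv (i :: l) v) ∧ (l ≠ [] → D.q i (D.wv l v) ≤ -(D.ε * nsq (D.wv l v))) := by
  induction l generalizing i with
  | nil =>
    refine ⟨?_, fun h => (h rfl).elim⟩
    rw [wv_cons, q_lin]
    exact neg_nonneg.2 (hS i)
  | cons j l ih =>
    obtain ⟨hij, hl'⟩ := List.isChain_cons_cons.1 hl
    have h1 := (ih hl').1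
    have h2 := D.q_add_q hij (D.wv (j :: l) v)
    have h3 := mul_pos D.ε_pos (nsq_pos (D.wv_ne_zero (j :: l) hv))
    rw [wv_cons, q_lin]
    exact ⟨by linarith, fun _ => by linarith⟩

lemma q_wv_pos {i j : Fin 3} {l : List (Fin 3)} (hl : (i :: j :: l).IsChain (· ≠ ·)) {v : ℂ × ℂ}
    (hv : v ≠ 0) (hS : D.S v) : 0 < D.q i (D.wv (i :: j :: l) v) := by
  have h1 := (D.q_wv_nonneg hl hv hS).2 (by simp)
  have h3 := mul_pos D.ε_pos (nsq_pos (D.wv_ne_zero (j :: l) hv))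
  rw [wv_cons, q_lin]
  linarith

/-- The only words which do not move a point of the cone out of the cone are the trivial one, and
the reflections in the sides containing that point. -/
lemma eq_of_S_wv {l : List (Fin 3)} (hl : l.IsChain (· ≠ ·)) {v : ℂ × ℂ} (hv : v ≠ 0)
    (hS : D.S v) (hS' : D.S (D.wv l v)) : l = [] ∨ ∃ i, l = [i] ∧ D.q i v = 0 := by
  match l with
  | [] => exact Or.inl rfl
  | [i] =>
    refine Or.inr ⟨i, rfl, ?_⟩
    have h1 := hS' i
    rw [wv_cons, q_lin, wv_nil] at h1
    exact le_antisymm (hS i) (by linarith)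
  | i :: j :: l => exact absurd (hS' i) (not_le.2 (D.q_wv_pos hl hv hS))

/-- After the first reflection every further one multiplies the squared norm by at least 1 + η: by
`nsq_lin` the increase is (b - c) times -q, and both factors are bounded below by `m` and
`q_wv_nonneg`. -/
lemma exists_growth : ∃ η : ℝ, 0 < η ∧ ∀ (l : List (Fin 3)) (i : Fin 3),
    (i :: l).IsChain (· ≠ ·) → ∀ v, v ≠ 0 → D.S v → (1 + η) ^ l.length * nsq v ≤
      nsq (D.wv (i :: l) v) := by
  obtain ⟨m, hm, hmi⟩ : ∃ m : ℝ, 0 < m ∧ ∀ i, m ≤ D.b i - D.c i := by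
    obtain ⟨i₀, h⟩ := Finite.exists_min fun i => D.b i - D.c i
    exact ⟨_, sub_pos.2 (D.c_lt_b i₀), h⟩
  refine ⟨m * D.ε, mul_pos hm D.ε_pos, fun l => ?_⟩
  induction l with
  | nil =>
    intro i _ v hv hS
    rw [wv_cons, nsq_lin, List.length_nil, pow_zero, one_mul, wv_nil]
    nlinarith [hS i, D.c_lt_b i]
  | cons j l ih =>
    intro i hl v hv hS
    have h1 := ih j (List.isChain_cons_cons.1 hl).2 v hv hS
    have h2 := (D.q_wv_nonneg hl hv hS).2 (by simp)
    have h3 := nsq_pos (D.wv_ne_zero (j :: l) hv)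
    rw [wv_cons, nsq_lin, List.length_cons, pow_succ]
    have h4 : m * D.ε * nsq (D.wv (j :: l) v) ≤ (D.c i - D.b i) * D.q i (D.wv (j :: l) v) := by
      have e1 := mul_le_mul_of_nonneg_left h2 (sub_pos.2 (D.c_lt_b i)).le
      have e2 := mul_le_mul_of_nonneg_right (hmi i) (mul_pos D.ε_pos h3).le
      linarith
    have h5 := mul_le_mul_of_nonneg_left h1 (by have := mul_pos hm D.ε_pos; linarith : 0 ≤ 1 + m * D.ε)
    nlinarith

/-- The base point. -/
def o : ℂ × ℂ := (Complex.I, 1)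

lemma o_ne_zero : o ≠ 0 := by simp [o, Prod.ext_iff]

lemma q_o (i : Fin 3) : D.q i o < 0 := by
  have := D.c_lt_b i
  simp [q, hform, o]
  linarith

lemma S_o : D.S o := fun i => (D.q_o i).le

/-- The intersection of the three half-planes. -/
def cell : Set (OnePoint ℂ) := {z | D.S (vec z)}

lemma q_smul {t : ℂ} (ht : t ≠ 0) (i : Fin 3) (v : ℂ × ℂ) :
    (D.q i (t • v) ≤ 0 ↔ D.q i v ≤ 0) ∧ (D.q i (t • v) < 0 ↔ D.q i v < 0) := by
  refine ⟨?_, hform_neg_iff ht⟩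
  rw [← not_lt, ← not_lt]
  exact not_congr (hform_pos_iff ht)

lemma S_smul {t : ℂ} (ht : t ≠ 0) (v : ℂ × ℂ) : D.S (t • v) ↔ D.S v :=
  forall_congr' fun i => (D.q_smul ht i v).1

lemma pt_mem_cell {v : ℂ × ℂ} (hv : v ≠ 0) : pt v ∈ D.cell ↔ D.S v := by
  obtain ⟨t, ht, h⟩ := vec_pt hv
  conv_rhs => rw [h]
  exact (D.S_smul ht _).symm

lemma wm_mem_cell {l : List (Fin 3)} {z : OnePoint ℂ} : D.wm l z ∈ D.cell ↔ D.S (D.wv l (vec z)) := by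
  rw [← pt_mem_cell D (D.wv_ne_zero l (vec_ne_zero z)), ← wm_pt D l (vec_ne_zero z), pt_vec]

lemma isClosed_cell : IsClosed D.cell := by
  have : D.cell = ⋂ i, {z | D.q i (vec z) ≤ 0} := by ext z; simp [cell, S]
  rw [this]
  exact isClosed_iInter fun i => isClosed_hform_nonpos _ _ _ _

lemma eq_of_mem_cell {l : List (Fin 3)} (hl : l.IsChain (· ≠ ·)) {z : OnePoint ℂ}
    (hS : z ∈ D.cell) (hS' : D.wm l z ∈ D.cell) : l = [] ∨ ∃ i, l = [i] ∧ D.q i (vec z) = 0 :=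
  D.eq_of_S_wv hl (vec_ne_zero z) hS (D.wm_mem_cell.1 hS')

/-- Points which cannot be moved into the cell are limits of the orbit of the base point. -/
lemma exists_wm_mem_of_forall_notMem {z : OnePoint ℂ} (hz : ∀ l, D.wm l z ∉ D.cell)
    {U : Set (OnePoint ℂ)} (hU : U ∈ 𝓝 z) :
    ∃ l : List (Fin 3), Even l.length ∧ D.wm l (pt o) ∈ U := by
  -- A point outside the cell violates one inequality; reflecting in this side lowers the norm.
  -- Afterwards this inequality holds strictly, so the next side is a different one and the word
  -- stays reduced.
  have step : ∀ n : ℕ, ∃ l : List (Fin 3), l.length = n ∧ l.IsChain (· ≠ ·) ∧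
      nsq (D.wv l (vec z)) ≤ nsq (vec z) ∧ ∀ i ∈ l.head?, D.q i (D.wv l (vec z)) < 0 := by
    intro n
    induction n with
    | zero => exact ⟨[], rfl, List.isChain_nil, le_rfl, by simp⟩
    | succ n ih =>
      obtain ⟨l, hn, hc, hle, hh⟩ := ih
      have h1 := hz l
      rw [wm_mem_cell] at h1
      simp only [S, not_forall, not_le] at h1
      obtain ⟨i, hi⟩ := h1
      refine ⟨i :: l, by simp [hn], ?_, ?_, ?_⟩
      · rw [List.isChain_cons]
        refine ⟨fun j hj hij => ?_, hc⟩
        subst hij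
        exact lt_asymm hi (hh i hj)
      · rw [wv_cons, nsq_lin]
        nlinarith [D.c_lt_b i]
      · intro j hj
        obtain rfl : i = j := by simpa using hj
        rw [wv_cons, q_lin]
        linarith
  obtain ⟨δ, hδ, hU'⟩ := exists_chordal_nhd hU
  obtain ⟨η, hη, hgrow⟩ := D.exists_growth
  obtain ⟨N, hN⟩ := pow_unbounded_of_one_lt (nsq (vec z) / δ) (by linarith : 1 < 1 + η)
  obtain ⟨l, hl, hc, hle, -⟩ := step (2 * (N + 1))
  refine ⟨l.reverse, by rw [List.length_reverse, hl]; exact even_two_mul _, ?_⟩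
  rw [wm_pt D _ o_ne_zero]
  apply hU' _ (D.wv_ne_zero _ o_ne_zero)
  -- Words preserve |v ∧ w|. The distance of the image of the base point from z is therefore
  -- controlled by the bounded norm of the moved z, divided by the norm of the image, which grows
  -- exponentially. The length 2 (N + 1) is even, so the word comes from an element of π.
  have h1 : Complex.normSq (vdet (D.wv l.reverse o) (vec z)) ≤ nsq o * nsq (vec z) := by
    conv_lhs => rw [← D.wv_reverse_wv l (vec z), normSq_vdet_wv]
    refine (normSq_vdet_le _ _).trans ?_
    exact mul_le_mul_of_nonneg_left hle (nsq_nonneg _)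
  have hc' : l.reverse.IsChain (· ≠ ·) := by
    rw [List.isChain_reverse]
    exact hc.imp fun a b h => h.symm
  have hlen : l.reverse.length = 2 * (N + 1) := by rw [List.length_reverse, hl]
  match hm : l.reverse with
  | [] => rw [hm] at hlen; simp at hlen
  | i :: m =>
    rw [hm] at hc' h1 hlen
    have h2 := hgrow m i hc' o o_ne_zero D.S_o
    have h3 : (1 + η) ^ N ≤ (1 + η) ^ m.length :=
      pow_le_pow_right₀ (by linarith) (by rw [List.length_cons] at hlen; omega)
    have h4 := nsq_pos o_ne_zero
    rw [div_lt_iff₀ hδ] at hN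
    have h5 : nsq (vec z) < (1 + η) ^ m.length * δ :=
      hN.trans_le (mul_le_mul_of_nonneg_right h3 hδ.le)
    have h6 := mul_lt_mul_of_pos_left h5 h4
    have h7 := mul_le_mul_of_nonneg_left h2 hδ.le
    nlinarith

/-! ### The neighbourhoods of the sides of the cell -/

/-- The geometric reflection is the matrix composed with complex conjugation. It fixes its circle,
so there the matrix itself acts as conjugation. -/
lemma exists_lin_eq_star {i : Fin 3} {v : ℂ × ℂ} (hv : v ≠ 0) (h : D.q i v = 0) :
    ∃ t : ℂ, t ≠ 0 ∧ lin (D.R i) v = t • (star v.1, star v.2) := by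
  have hs : ((star v.1, star v.2) : ℂ × ℂ) ≠ 0 := by
    simpa [Prod.ext_iff] using hv
  have h1 := D.lin_R_ne_zero i hv
  obtain ⟨t, ht, e⟩ := vec_pt h1
  obtain ⟨s, hs', e'⟩ := vec_pt hs
  have h2 : pt (lin (D.R i) v) = pt (star v.1, star v.2) := by
    rw [pt_eq_pt_iff h1 hs]
    have : ((lin (D.R i) v).1 * star v.2 - (lin (D.R i) v).2 * star v.1) = -(D.q i v : ℂ) := by
      apply Complex.ext <;>
      simp [q, hform, lin, R, Complex.normSq_apply] <;> ring
    rw [h] at this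
    simpa [sub_eq_zero] using this
  refine ⟨t / s, div_ne_zero ht hs', ?_⟩
  rw [e, e', smul_smul, div_mul_cancel₀ _ hs', h2]

lemma q_star (i : Fin 3) (v : ℂ × ℂ) : D.q i (star v.1, star v.2) = D.q i v := by
  simp [q, hform, Complex.normSq_apply]

lemma q_vec_r {i j : Fin 3} {z : OnePoint ℂ} :
    D.q j (vec (D.r i z)) < 0 ↔ D.q j (lin (D.R i) (vec z)) < 0 := by
  obtain ⟨t, ht, h⟩ := vec_mob (D.RG i) z
  rw [coe_RG] at h
  rw [h]
  exact ((D.q_smul ht j _).2).symm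

/-- At a point of the side i the other two inequalities are strict, also after applying `r i`, which
acts there as conjugation and preserves the forms. Nearby points thus satisfy the remaining
inequality before or after the reflection. -/
lemma cell_mem_nhds {z : OnePoint ℂ} (hz : z ∈ D.cell) :
    D.cell ∈ 𝓝 z ∨ ∃ i, D.q i (vec z) = 0 ∧ D.cell ∪ D.r i ⁻¹' D.cell ∈ 𝓝 z := by
  by_cases h : ∃ i, D.q i (vec z) = 0
  · obtain ⟨i, hi⟩ := h
    refine Or.inr ⟨i, hi, ?_⟩
    have h1 : ∀ j, j ≠ i → {w | D.q j (vec w) < 0 ∧ D.q j (vec (D.r i w)) < 0} ∈ 𝓝 z := by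
      intro j hj
      apply IsOpen.mem_nhds
      · exact (isOpen_hform_neg _ _ _ _).inter
          ((isOpen_hform_neg _ _ _ _).preimage (D.continuous_r i))
      · have hlt := D.q_lt_of_nonneg hj (vec_ne_zero z) hi.ge
        refine ⟨hlt, ?_⟩
        rw [q_vec_r]
        obtain ⟨t, ht, e⟩ := D.exists_lin_eq_star (vec_ne_zero z) hi
        rw [e, (D.q_smul ht j _).2, q_star]
        exact hlt
    have h2 : ∀ᶠ w in 𝓝 z, ∀ j, j ≠ i → D.q j (vec w) < 0 ∧ D.q j (vec (D.r i w)) < 0 := by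
      rw [Filter.eventually_all]
      intro j
      by_cases hj : j = i
      · exact Filter.Eventually.of_forall fun w h => (h hj).elim
      · filter_upwards [h1 j hj] with w hw _ using hw
    filter_upwards [h2] with w hw
    rcases le_or_gt (D.q i (vec w)) 0 with hq | hq
    · refine Or.inl fun j => ?_
      rcases eq_or_ne j i with rfl | hj
      · exact hq
      · exact (hw j hj).1.le
    · refine Or.inr fun j => ?_
      rcases eq_or_ne j i with rfl | hj
      · refine (D.q_vec_r.2 ?_).le
        rw [q_lin]
        linarith
      · exact (hw j hj).2.le
  · push Not at h
    refine Or.inl ?_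
    have h2 : ∀ᶠ w in 𝓝 z, ∀ j, D.q j (vec w) < 0 := by
      rw [Filter.eventually_all]
      exact fun j => (isOpen_hform_neg _ _ _ _).mem_nhds (lt_of_le_of_ne (hz j) (h j))
    filter_upwards [h2] with w hw j using (hw j).le

end ReflData

end PantsChar

end

noncomputable section

namespace PantsChar

open Matrix Topology

namespace ReflData

/-! ### Words in the reflections and elements of the free group -/

/-- The automorphism of the free group which inverts both generators. -/
def flip : Pi2 →* Pi2 := FreeGroup.lift ![genX⁻¹, genY⁻¹]

lemma flip_genX : flip genX = genX⁻¹ := by simp [flip, genX, genY]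

lemma flip_genY : flip genY = genY⁻¹ := by simp [flip, genX, genY]

@[simp] lemma flip_flip (γ : Pi2) : flip (flip γ) = γ := by
  have : flip.comp flip = MonoidHom.id Pi2 := by
    ext i
    fin_cases i
    · change flip (flip genX) = genX
      rw [flip_genX, map_inv, flip_genX, inv_inv]
    · change flip (flip genY) = genY
      rw [flip_genY, map_inv, flip_genY, inv_inv]
  exact DFunLike.congr_fun this γ

/-- The products of the three reflections with the second one. -/
def letter : Fin 3 → Pi2 := ![genX, 1, genY⁻¹]

/-- The element of the free group given by a word in the reflections, multiplied by the second
reflection if the word has odd length. -/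
def val : List (Fin 3) → Pi2
  | [] => 1
  | i :: l => letter i * flip (val l)

lemma letter_mul_flip (i : Fin 3) : letter i * flip (letter i) = 1 := by
  fin_cases i
  · change genX * flip genX = 1
    rw [flip_genX, mul_inv_cancel]
  · change 1 * flip 1 = 1
    simp
  · change genY⁻¹ * flip genY⁻¹ = 1
    rw [map_inv, flip_genY, mul_inv_cancel]

lemma val_cons_cons_self (i : Fin 3) (l : List (Fin 3)) : val (i :: i :: l) = val l := by
  rw [val, val, map_mul, flip_flip, ← mul_assoc, letter_mul_flip, one_mul]

lemma val_append (l m : List (Fin 3)) : val (l ++ m) = val l * flip^[l.length] (val m) := by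
  induction l with
  | nil => simp [val]
  | cons i l ih =>
    rw [List.cons_append, val, ih, val, map_mul, List.length_cons, Function.iterate_succ_apply',
      mul_assoc]

lemma iterate_flip_injective (n : ℕ) : Function.Injective (flip^[n]) :=
  Function.Injective.iterate (Function.LeftInverse.injective flip_flip) n

lemma iterate_flip_even {n : ℕ} (hn : Even n) (γ : Pi2) : flip^[n] γ = γ := by
  rw [(show Function.Involutive flip from flip_flip).iterate_even hn]
  rfl

lemma val_append_congr {l m : List (Fin 3)} (h : val l = val m)
    (he : Even l.length ↔ Even m.length) (k : List (Fin 3)) : val (l ++ k) = val (m ++ k) := by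
  have hi : Function.Involutive flip := flip_flip
  rw [val_append, val_append, h]
  congr 1
  by_cases hm : Even m.length
  · rw [hi.iterate_even (he.2 hm), hi.iterate_even hm]
  · rw [hi.iterate_odd (Nat.not_even_iff_odd.1 fun h => hm (he.1 h)),
      hi.iterate_odd (Nat.not_even_iff_odd.1 hm)]

lemma exists_chain (l : List (Fin 3)) : ∃ m : List (Fin 3), m.IsChain (· ≠ ·) ∧ val m = val l ∧
    (Even m.length ↔ Even l.length) := by
  induction l with
  | nil => exact ⟨[], List.isChain_nil, rfl, Iff.rfl⟩
  | cons i l ih =>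
    obtain ⟨m, hm, hv, he⟩ := ih
    match m with
    | [] => exact ⟨[i], List.isChain_singleton _, by rw [val, hv, ← val], by
        simpa [Nat.even_add_one] using he⟩
    | j :: m =>
      rcases eq_or_ne i j with rfl | hij
      · refine ⟨m, (List.isChain_cons.1 hm).2, ?_, ?_⟩
        · rw [val, ← hv, ← val, val_cons_cons_self]
        · rw [List.length_cons, Nat.even_add_one, ← he, List.length_cons, Nat.even_add_one, not_not]
      · exact ⟨i :: j :: m, List.isChain_cons_cons.2 ⟨hij, hm⟩, by rw [val, hv, ← val], by
          rw [List.length_cons, Nat.even_add_one, he, List.length_cons (as := l), Nat.even_add_one]⟩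

/-- X is the product of reflections 0 and 1, and Y that of 1 and 2; prefixing two letters preserves
parity and multiplies the value without applying `flip`. -/
lemma exists_val_eq_mul (γ : Pi2) : ∀ l : List (Fin 3), ∃ m, val m = γ * val l ∧
    (Even m.length ↔ Even l.length) := by
  have e : ∀ n : ℕ, Even (n + 1 + 1) ↔ Even n := fun n => by simp [Nat.even_add_one]
  induction γ using FreeGroup.induction_on with
  | C1 => exact fun l => ⟨l, by rw [one_mul], Iff.rfl⟩
  | of i =>
    intro l
    fin_cases i
    · refine ⟨0 :: 1 :: l, ?_, e _⟩
      rw [val, val, map_mul, flip_flip]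
      change genX * (flip 1 * val l) = genX * val l
      simp
    · refine ⟨1 :: 2 :: l, ?_, e _⟩
      rw [val, val, map_mul, flip_flip]
      change 1 * (flip genY⁻¹ * val l) = genY * val l
      rw [map_inv, flip_genY, inv_inv, one_mul]
  | inv_of i _ =>
    intro l
    fin_cases i
    · refine ⟨1 :: 0 :: l, ?_, e _⟩
      rw [val, val, map_mul, flip_flip]
      change 1 * (flip genX * val l) = genX⁻¹ * val l
      rw [flip_genX, one_mul]
    · refine ⟨2 :: 1 :: l, ?_, e _⟩
      rw [val, val, map_mul, flip_flip]
      change genY⁻¹ * (flip 1 * val l) = genY⁻¹ * val l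
      simp
  | mul γ δ hγ hδ =>
    intro l
    obtain ⟨m, hm, hem⟩ := hδ l
    obtain ⟨k, hk, hek⟩ := hγ m
    exact ⟨k, by rw [hk, hm, mul_assoc], hek.trans hem⟩

/-- Every element of the free group is given by a reduced word of even length. -/
lemma exists_val_eq (γ : Pi2) : ∃ l : List (Fin 3), l.IsChain (· ≠ ·) ∧ Even l.length ∧ val l = γ := by
  obtain ⟨l, hl, he⟩ := exists_val_eq_mul γ []
  obtain ⟨m, hm, hv, he'⟩ := exists_chain l
  exact ⟨m, hm, he'.2 (he.2 (by simp)), by rw [hv, hl, val, mul_one]⟩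

variable (D : ReflData)

/-- The representation `ρ` is generated by products of pairs of reflections. -/
def Generates (ρ : Pi2 →* SpecialLinearGroup (Fin 2) ℝ) : Prop :=
  (∀ z, moeb ρ genX z = D.r 0 (D.r 1 z)) ∧ ∀ z, moeb ρ genY z = D.r 1 (D.r 2 z)

namespace Generates

variable {D} {ρ : Pi2 →* SpecialLinearGroup (Fin 2) ℝ}

lemma moeb_genX_inv (h : D.Generates ρ) (z : OnePoint ℂ) : moeb ρ genX⁻¹ z = D.r 1 (D.r 0 z) := by
  rw [← moeb_inv_moeb ρ genX (D.r 1 (D.r 0 z)), h.1, r_r, r_r]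

lemma moeb_genY_inv (h : D.Generates ρ) (z : OnePoint ℂ) : moeb ρ genY⁻¹ z = D.r 2 (D.r 1 z) := by
  rw [← moeb_inv_moeb ρ genY (D.r 2 (D.r 1 z)), h.2, r_r, r_r]

/-- Conjugation by the middle reflection inverts its product with either of the other two. -/
lemma moeb_flip (h : D.Generates ρ) (γ : Pi2) :
    ∀ z, moeb ρ (flip γ) (D.r 1 z) = D.r 1 (moeb ρ γ z) := by
  induction γ using FreeGroup.induction_on with
  | C1 => simp [moeb_one]
  | of i =>
    fin_cases i
    · intro z
      change moeb ρ (flip genX) _ = D.r 1 (moeb ρ genX z)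
      rw [flip_genX, h.moeb_genX_inv, h.1]
    · intro z
      change moeb ρ (flip genY) _ = D.r 1 (moeb ρ genY z)
      rw [flip_genY, h.moeb_genY_inv, h.2, r_r, r_r]
  | inv_of i _ =>
    fin_cases i
    · intro z
      change moeb ρ (flip genX⁻¹) _ = D.r 1 (moeb ρ genX⁻¹ z)
      rw [map_inv, flip_genX, inv_inv, h.moeb_genX_inv, h.1, r_r, r_r]
    · intro z
      change moeb ρ (flip genY⁻¹) _ = D.r 1 (moeb ρ genY⁻¹ z)
      rw [map_inv, flip_genY, inv_inv, h.moeb_genY_inv, h.2]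
  | mul γ δ hγ hδ => intro z; rw [map_mul, moeb_mul, hδ, hγ, moeb_mul]

lemma moeb_letter (h : D.Generates ρ) (i : Fin 3) (z : OnePoint ℂ) :
    moeb ρ (letter i) (D.r 1 z) = D.r i z := by
  fin_cases i
  · change moeb ρ genX _ = D.r 0 z
    rw [h.1, r_r]
  · change moeb ρ 1 _ = D.r 1 z
    rw [moeb_one]
  · change moeb ρ genY⁻¹ _ = D.r 2 z
    rw [h.moeb_genY_inv, r_r]

lemma wm_eq (h : D.Generates ρ) (l : List (Fin 3)) (z : OnePoint ℂ) :
    D.wm l z = moeb ρ (val l) ((D.r 1)^[l.length] z) := by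
  induction l with
  | nil => exact (moeb_one _ _).symm
  | cons i l ih =>
    rw [wm_cons, ih, ← h.moeb_letter, ← h.moeb_flip, val, moeb_mul, List.length_cons,
      Function.iterate_succ_apply']

lemma wm_even (h : D.Generates ρ) {l : List (Fin 3)} (hl : Even l.length) (z : OnePoint ℂ) :
    D.wm l z = moeb ρ (val l) z := by
  rw [h.wm_eq, (show Function.Involutive (D.r 1) from D.r_r 1).iterate_even hl]
  rfl

lemma wm_congr (h : D.Generates ρ) {l m : List (Fin 3)} (hlm : val l = val m)
    (he : Even l.length ↔ Even m.length) (z : OnePoint ℂ) : D.wm l z = D.wm m z := by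
  have hi : Function.Involutive (D.r 1) := D.r_r 1
  rw [h.wm_eq, h.wm_eq, hlm]
  congr 1
  by_cases hm : Even m.length
  · rw [hi.iterate_even (he.2 hm), hi.iterate_even hm]
  · rw [hi.iterate_odd (Nat.not_even_iff_odd.1 fun h => hm (he.1 h)),
      hi.iterate_odd (Nat.not_even_iff_odd.1 hm)]

/-- Words which move a point of the cell into the cell. -/
lemma val_of_mem_cell (h : D.Generates ρ) {l : List (Fin 3)} {z : OnePoint ℂ} (hz : z ∈ D.cell)
    (hl : D.wm l z ∈ D.cell) : (Even l.length ∧ val l = 1) ∨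
      ∃ i, ¬ Even l.length ∧ val l = letter i ∧ D.q i (vec z) = 0 := by
  obtain ⟨m, hm, hv, he⟩ := exists_chain l
  rw [← h.wm_congr hv he] at hl
  rcases D.eq_of_mem_cell hm hz hl with rfl | ⟨i, rfl, hi⟩
  · exact Or.inl ⟨he.1 (by simp), hv.symm⟩
  · refine Or.inr ⟨i, fun h => absurd (he.2 h) (by simp), ?_, hi⟩
    rw [← hv, val, val, map_one, mul_one]

lemma injective (h : D.Generates ρ) : Function.Injective ρ := by
  rw [injective_iff_map_eq_one]
  intro γ hγ
  obtain ⟨l, -, he, rfl⟩ := exists_val_eq γ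
  have ho : pt o ∈ D.cell := (D.pt_mem_cell o_ne_zero).2 D.S_o
  have h1 : D.wm l (pt o) = pt o := by
    rw [h.wm_even he, moeb, hγ, map_one, one_smul]
  rcases h.val_of_mem_cell ho (h1 ▸ ho) with h2 | ⟨i, h2, -⟩
  · exact h2.2
  · exact (h2 he).elim

/-- The base point lies in the open cell. A group element close to the identity keeps it there, and
only the trivial even word does so. -/
lemma isDiscreteEmbedding (h : D.Generates ρ) : IsDiscreteEmbedding ρ := by
  refine ⟨h.injective, ?_⟩
  have hc : Continuous fun g : SpecialLinearGroup (Fin 2) ℝ => fun i : Fin 3 =>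
      D.q i (lin (g : Matrix (Fin 2) (Fin 2) ℝ) o) := by
    have h00 : ∀ i j, Continuous fun g : SpecialLinearGroup (Fin 2) ℝ =>
        (g : Matrix (Fin 2) (Fin 2) ℝ) i j := fun i j =>
      (continuous_subtype_val).matrix_elem i j
    refine continuous_pi fun i => ?_
    simp only [q, hform, lin, o, Complex.normSq_apply]
    simp
    fun_prop
  set V : Set (SpecialLinearGroup (Fin 2) ℝ) :=
    {g | ∀ i : Fin 3, D.q i (lin (g : Matrix (Fin 2) (Fin 2) ℝ) o) < 0} with hV
  have hVo : IsOpen V := by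
    have : V = ⋂ i, {g : SpecialLinearGroup (Fin 2) ℝ | D.q i (lin g.1 o) < 0} := by
      ext; simp [V]
    rw [this]
    exact isOpen_iInter_of_finite fun i => isOpen_lt ((continuous_pi_iff.1 hc) i) continuous_const
  rw [discreteTopology_iff_isOpen_singleton_one]
  have : ({1} : Set ρ.range) = Subtype.val ⁻¹' V := by
    ext ⟨g, γ, rfl⟩
    simp only [Set.mem_singleton_iff, Set.mem_preimage]
    constructor
    · intro e
      have e' : ρ γ = 1 := congrArg Subtype.val e
      rw [e']
      intro i
      change D.q i (lin 1 o) < 0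
      rw [lin_one]
      exact D.q_o i
    · intro hg
      obtain ⟨l, -, he, rfl⟩ := exists_val_eq γ
      have ho : pt o ∈ D.cell := (D.pt_mem_cell o_ne_zero).2 D.S_o
      have h1 : D.wm l (pt o) ∈ D.cell := by
        rw [h.wm_even he, moeb_eq_mob, mob_pt _ o_ne_zero]
        exact (D.pt_mem_cell (lin_SL_ne_zero _ o_ne_zero)).2 fun i => (hg i).le
      rcases h.val_of_mem_cell ho h1 with h2 | ⟨i, h2, -⟩
      · ext1
        change ρ (val l) = 1
        rw [h2.2, map_one]
      · exact (h2 he).elim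
  rw [this]
  exact hVo.preimage continuous_subtype_val

/-! ### The set of discontinuity -/

/-- A point which cannot be moved into the cell is a limit of the orbit of the base point, and
infinitely many elements of this orbit come near it; this is impossible at an ordinary point. -/
lemma exists_wm_mem_cell (h : D.Generates ρ) {z : OnePoint ℂ} (hz : z ∈ discontinuitySet ρ) :
    ∃ l, D.wm l z ∈ D.cell := by
  by_contra! hcon
  obtain ⟨U, hU, hfin⟩ := hz
  have ho : pt o ∈ D.cell := (D.pt_mem_cell o_ne_zero).2 D.S_o
  obtain ⟨l, hle, hl⟩ := D.exists_wm_mem_of_forall_notMem hcon hU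
  set F := {γ : Pi2 | (moeb ρ γ '' U ∩ U).Nonempty}
  set E : Set (OnePoint ℂ) := (fun γ => moeb ρ γ (D.wm l (pt o))) '' F
  have hE : E.Finite := hfin.image _
  -- E collects the images of one orbit point in U under the finitely many elements returning U to
  -- itself. It does not contain z, since its points can be moved back to the base point; a second
  -- orbit point in U but outside E gives the contradiction.
  have hzE : z ∉ E := by
    rintro ⟨γ, -, rfl⟩
    obtain ⟨m, -, hm, rfl⟩ := exists_val_eq γ
    apply hcon (l.reverse ++ m.reverse)
    beta_reduce
    rw [← h.wm_even hm, wm_append, wm_reverse_wm, wm_reverse_wm]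
    exact ho
  obtain ⟨m, hme, hm⟩ := D.exists_wm_mem_of_forall_notMem hcon
    (Filter.inter_mem hU (hE.isClosed.isOpen_compl.mem_nhds hzE))
  refine hm.2 ⟨val m * (val l)⁻¹, ?_, ?_⟩
  · refine ⟨D.wm m (pt o), ⟨D.wm l (pt o), hl, ?_⟩, hm.1⟩
    rw [h.wm_even hle, h.wm_even hme, moeb_mul, moeb_inv_moeb]
  · simp only
    rw [h.wm_even hle, h.wm_even hme, moeb_mul, moeb_inv_moeb]

/-- A small neighbourhood is covered by the cell and one mirror image. A word bringing it back to
itself becomes, after at most one reflection at either end, a word bringing the cell back to itself,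
and those have only four values up to parity. -/
lemma exists_nhd_finite (h : D.Generates ρ) {z : OnePoint ℂ} (hz : z ∈ D.cell) :
    ∃ U ∈ 𝓝 z, (val '' {l | (D.wm l '' U ∩ U).Nonempty}).Finite := by
  obtain ⟨i, U, hU, hUc⟩ : ∃ i, ∃ U ∈ 𝓝 z, U ⊆ D.cell ∪ D.r i ⁻¹' D.cell := by
    rcases D.cell_mem_nhds hz with h1 | ⟨i, -, h1⟩
    · exact ⟨0, _, h1, Set.subset_union_left⟩
    · exact ⟨i, _, h1, le_rfl⟩
  refine ⟨U, hU, ?_⟩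
  set K : Set (List (Fin 3)) := {[], [i]}
  set M : Set (List (Fin 3)) := {[], [0], [1], [2]}
  have hK : K.Finite := by simp [K]
  have hM : M.Finite := by simp [M]
  have hUK : ∀ w ∈ U, ∃ k ∈ K, D.wm k w ∈ D.cell := fun w hw => by
    rcases hUc hw with h1 | h1
    · exact ⟨[], by simp [K], h1⟩
    · exact ⟨[i], by simp [K], h1⟩
  have hfin : ((fun t : List (Fin 3) × List (Fin 3) × List (Fin 3) =>
      val (t.1 ++ t.2.1 ++ t.2.2)) '' (K ×ˢ M ×ˢ K)).Finite :=
    (hK.prod (hM.prod hK)).image _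
  refine hfin.subset ?_
  rintro _ ⟨l, ⟨_, ⟨w, hw, rfl⟩, hw'⟩, rfl⟩
  obtain ⟨k, hk, hkw⟩ := hUK w hw
  obtain ⟨k', hk', hkw'⟩ := hUK _ hw'
  have hkk : ∀ k ∈ K, ∀ l, val (k ++ (k ++ l)) = val l := by
    rintro k (rfl | rfl) l
    · rfl
    · exact val_cons_cons_self _ _
  have h2 : D.wm (k' ++ l ++ k) (D.wm k w) ∈ D.cell := by
    rw [wm_append, wm_append]
    have : D.wm k (D.wm k w) = w := by
      rcases hk with rfl | rfl
      · rfl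
      · exact D.r_r i w
    rw [this]
    exact hkw'
  obtain ⟨m, hmM, hm, hme⟩ : ∃ m ∈ M, val (k' ++ l ++ k) = val m ∧
      (Even (k' ++ l ++ k).length ↔ Even m.length) := by
    rcases h.val_of_mem_cell hkw h2 with h3 | ⟨j, he, h3, -⟩
    · exact ⟨[], by simp [M], h3.2, by simpa using h3.1⟩
    · refine ⟨[j], by fin_cases j <;> simp [M], ?_, by simpa using he⟩
      rw [h3, val, val, map_one, mul_one]
  refine ⟨(k', m, k), ⟨hk', hmM, hk⟩, ?_⟩
  have h4 : val (l ++ k) = val (k' ++ m) := by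
    rw [← hkk k' hk' (l ++ k), val_append k', ← List.append_assoc, hm, ← val_append]
  have h5 : Even (l ++ k).length ↔ Even (k' ++ m).length := by
    simp only [List.length_append, Nat.even_add] at hme ⊢
    tauto
  have h6 : val (l ++ (k ++ k)) = val l := by
    rw [val_append]
    have := hkk k hk []
    rw [List.append_nil] at this
    rw [this, val]
    simp
  change val (k' ++ m ++ k) = val l
  rw [← h6, ← List.append_assoc]
  exact (val_append_congr h4 h5 k).symm

/-- A neighbourhood of the image in the cell is pulled back by the word; conjugation by the word is
injective on the group elements concerned. -/
lemma subset_discontinuitySet (h : D.Generates ρ) {z : OnePoint ℂ} {l : List (Fin 3)}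
    (hz : D.wm l z ∈ D.cell) : z ∈ discontinuitySet ρ := by
  obtain ⟨U, hU, hfin⟩ := h.exists_nhd_finite hz
  refine ⟨D.wm l ⁻¹' U, (D.continuous_wm l).continuousAt hU, ?_⟩
  refine Set.Finite.of_finite_image (f := fun γ => val l * flip^[l.length] (γ * val l.reverse))
    (hfin.subset ?_) ?_
  · rintro _ ⟨γ, ⟨_, ⟨w, hw, rfl⟩, hw'⟩, rfl⟩
    obtain ⟨m, -, hm, rfl⟩ := exists_val_eq γ
    refine ⟨l ++ (m ++ l.reverse), ?_, ?_⟩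
    · refine ⟨D.wm l (D.wm m w), ⟨D.wm l w, hw, ?_⟩, ?_⟩
      · rw [wm_append, wm_append, wm_reverse_wm]
      · rw [h.wm_even hm]
        exact hw'
    · rw [val_append, val_append, iterate_flip_even hm]
  · intro γ _ δ _ e
    exact mul_right_cancel (iterate_flip_injective _ (mul_left_cancel e))

lemma mem_discontinuitySet (h : D.Generates ρ) {z : OnePoint ℂ} :
    z ∈ discontinuitySet ρ ↔ ∃ l, D.wm l z ∈ D.cell :=
  ⟨h.exists_wm_mem_cell, fun ⟨_, hl⟩ => h.subset_discontinuitySet hl⟩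

end Generates

end ReflData

end PantsChar

end

noncomputable section

namespace PantsChar

open Matrix Topology

/-! ### Right-angled hexagons: the half of the pair of pants -/

/-- Bipolar coordinates with respect to `±2`. -/
def bip (e δ s : ℝ) : ℂ := ⟨δ * s / 8, e * √((s ^ 2 - 16) * (16 - δ ^ 2)) / 8⟩

section bip

variable {e δ s : ℝ}

lemma bip_sq (he : e ^ 2 = 1) (hδ : |δ| ≤ 4) (hs : 4 ≤ s) :
    (bip e δ s).im ^ 2 = (s ^ 2 - 16) * (16 - δ ^ 2) / 64 := by
  have h1 : 0 ≤ (s ^ 2 - 16) * (16 - δ ^ 2) := by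
    have := sq_le_sq' (abs_le.1 hδ).1 (abs_le.1 hδ).2
    apply mul_nonneg <;> nlinarith
  have h2 := Real.sq_sqrt h1
  simp only [bip]
  rw [div_pow, mul_pow, he, h2]
  norm_num

lemma norm_bip_add (he : e ^ 2 = 1) (hδ : |δ| ≤ 4) (hs : 4 ≤ s) : ‖bip e δ s + 2‖ = (s + δ) / 2 := by
  have h0 : 0 ≤ (s + δ) / 2 := by have := (abs_le.1 hδ).1; linarith
  rw [← sq_eq_sq₀ (norm_nonneg _) h0, ← Complex.normSq_eq_norm_sq, Complex.normSq_apply,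
    Complex.add_im, Complex.add_re]
  have := bip_sq he hδ hs
  have h3 : (bip e δ s).re = δ * s / 8 := rfl
  simp only [Complex.re_ofNat, Complex.im_ofNat, add_zero, h3]
  linear_combination this

lemma norm_bip_sub (he : e ^ 2 = 1) (hδ : |δ| ≤ 4) (hs : 4 ≤ s) : ‖bip e δ s - 2‖ = (s - δ) / 2 := by
  have h0 : 0 ≤ (s - δ) / 2 := by have := (abs_le.1 hδ).2; linarith
  rw [← sq_eq_sq₀ (norm_nonneg _) h0, ← Complex.normSq_eq_norm_sq, Complex.normSq_apply,
    Complex.sub_im, Complex.sub_re]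
  have := bip_sq he hδ hs
  have h3 : (bip e δ s).re = δ * s / 8 := rfl
  simp only [Complex.re_ofNat, Complex.im_ofNat, sub_zero, h3]
  linear_combination this

lemma norm_bip_sq (he : e ^ 2 = 1) (hδ : |δ| ≤ 4) (hs : 4 ≤ s) :
    ‖bip e δ s‖ ^ 2 = (s ^ 2 + δ ^ 2) / 4 - 4 := by
  rw [← Complex.normSq_eq_norm_sq, Complex.normSq_apply]
  have := bip_sq he hδ hs
  have h3 : (bip e δ s).re = δ * s / 8 := rfl
  rw [h3]
  linear_combination this

lemma bip_im_eq_zero (he : e ^ 2 = 1) (hδ : |δ| ≤ 4) (hs : 4 ≤ s) :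
    (bip e δ s).im = 0 ↔ s = 4 ∨ |δ| = 4 := by
  have h := bip_sq he hδ hs
  rw [← sq_eq_zero_iff, h, div_eq_zero_iff, mul_eq_zero]
  have e1 : s ^ 2 - 16 = 0 ↔ s = 4 :=
    ⟨fun h => by nlinarith, fun h => by rw [h]; norm_num⟩
  have e2 : 16 - δ ^ 2 = 0 ↔ |δ| = 4 := by
    rw [← sq_abs]
    exact ⟨fun h => by nlinarith [abs_nonneg δ], fun h => by rw [h]; norm_num⟩
  rw [e1, e2]
  norm_num

/-- Every point of the plane has bipolar coordinates. -/
lemma exists_bip (w : ℂ) : |‖w + 2‖ - ‖w - 2‖| ≤ 4 ∧ 4 ≤ ‖w + 2‖ + ‖w - 2‖ ∧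
    ∀ e : ℝ, e ^ 2 = 1 → 0 ≤ e * w.im → bip e (‖w + 2‖ - ‖w - 2‖) (‖w + 2‖ + ‖w - 2‖) = w := by
  have hδ : |‖w + 2‖ - ‖w - 2‖| ≤ 4 := by
    refine (abs_norm_sub_norm_le _ _).trans_eq ?_
    rw [show w + 2 - (w - 2) = 4 by ring]
    simp
  have hs : 4 ≤ ‖w + 2‖ + ‖w - 2‖ := by
    refine le_trans (le_of_eq ?_) (norm_sub_le _ _)
    rw [show w + 2 - (w - 2) = 4 by ring]
    simp
  refine ⟨hδ, hs, fun e he hw => ?_⟩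
  have h1 : ‖w + 2‖ ^ 2 = (w.re + 2) ^ 2 + w.im ^ 2 := by
    rw [← Complex.normSq_eq_norm_sq, Complex.normSq_apply]; simp; ring
  have h2 : ‖w - 2‖ ^ 2 = (w.re - 2) ^ 2 + w.im ^ 2 := by
    rw [← Complex.normSq_eq_norm_sq, Complex.normSq_apply]; simp; ring
  have hre : (bip e (‖w + 2‖ - ‖w - 2‖) (‖w + 2‖ + ‖w - 2‖)).re = w.re := by
    simp only [bip]
    linear_combination (h1 - h2) / 8
  apply Complex.ext hre
  have h3 := bip_sq he hδ hs
  have h4 : ((‖w + 2‖ + ‖w - 2‖) ^ 2 - 16) * (16 - (‖w + 2‖ - ‖w - 2‖) ^ 2) / 64 = w.im ^ 2 := by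
    have e1 : ((‖w + 2‖ + ‖w - 2‖) ^ 2 - 16) * (16 - (‖w + 2‖ - ‖w - 2‖) ^ 2) =
      32 * (‖w + 2‖ ^ 2 + ‖w - 2‖ ^ 2) - (‖w + 2‖ ^ 2 - ‖w - 2‖ ^ 2) ^ 2 - 256 := by ring
    rw [e1, h1, h2]
    ring
  rw [h4] at h3
  have h5 : 0 ≤ e * (bip e (‖w + 2‖ - ‖w - 2‖) (‖w + 2‖ + ‖w - 2‖)).im := by
    have : e * (bip e (‖w + 2‖ - ‖w - 2‖) (‖w + 2‖ + ‖w - 2‖)).im = e ^ 2 *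
      (√(((‖w + 2‖ + ‖w - 2‖) ^ 2 - 16) * (16 - (‖w + 2‖ - ‖w - 2‖) ^ 2)) / 8) := by
      simp only [bip]; ring
    rw [this]
    positivity
  have h6 : e * (bip e (‖w + 2‖ - ‖w - 2‖) (‖w + 2‖ + ‖w - 2‖)).im = e * w.im := by
    rw [← sq_eq_sq₀ h5 hw, mul_pow, mul_pow, h3]
  have he0 : e ≠ 0 := by rintro rfl; norm_num at he
  exact mul_left_cancel₀ he0 h6

end bip

lemma exists_piecewise_linear {p₀ p₁ p₂ p₃ : ℝ} (h₀ : p₀ < p₁) (h₁ : p₁ < p₂) (h₂ : p₂ < p₃) :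
    ∃ f : ℝ → ℝ, Continuous f ∧ StrictMonoOn f (Set.Icc p₀ p₃) ∧ f p₀ = -4 ∧ f p₁ = -2 ∧
      f p₂ = 2 ∧ f p₃ = 4 := by
  have k₀ : 0 < 2 / (p₁ - p₀) := div_pos two_pos (sub_pos.2 h₀)
  have k₁ : 0 < 4 / (p₂ - p₁) := div_pos four_pos (sub_pos.2 h₁)
  have k₂ : 0 < 2 / (p₃ - p₂) := div_pos two_pos (sub_pos.2 h₂)
  have e₀ : 2 / (p₁ - p₀) * (p₁ - p₀) = 2 := div_mul_cancel₀ _ (sub_pos.2 h₀).ne'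
  have e₁ : 4 / (p₂ - p₁) * (p₂ - p₁) = 4 := div_mul_cancel₀ _ (sub_pos.2 h₁).ne'
  have e₂ : 2 / (p₃ - p₂) * (p₃ - p₂) = 2 := div_mul_cancel₀ _ (sub_pos.2 h₂).ne'
  refine ⟨fun u => -4 + 2 / (p₁ - p₀) * (min u p₁ - p₀) + 4 / (p₂ - p₁) * (max p₁ (min u p₂) - p₁) +
    2 / (p₃ - p₂) * (max p₂ u - p₂), by fun_prop, ?_, ?_, ?_, ?_, ?_⟩
  · intro u _ u' _ huu
    have a₀ : min u p₁ ≤ min u' p₁ := min_le_min_right _ huu.le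
    have a₁ : max p₁ (min u p₂) ≤ max p₁ (min u' p₂) := max_le_max_left _ (min_le_min_right _ huu.le)
    have a₂ : max p₂ u ≤ max p₂ u' := max_le_max_left _ huu.le
    have hid : ∀ u, min u p₁ + max p₁ (min u p₂) + max p₂ u = u + p₁ + p₂ := fun u => by
      rcases le_total u p₁ with h | h <;> rcases le_total u p₂ with h' | h' <;>
        simp [h, h', h₁.le] <;> linarith
    have b := hid u
    have b' := hid u'
    have c₀ := mul_le_mul_of_nonneg_left a₀ k₀.le
    have c₁ := mul_le_mul_of_nonneg_left a₁ k₁.le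
    have c₂ := mul_le_mul_of_nonneg_left a₂ k₂.le
    simp only
    by_contra hcon
    have d₀ : min u p₁ = min u' p₁ := mul_left_cancel₀ k₀.ne' (by linarith)
    have d₁ : max p₁ (min u p₂) = max p₁ (min u' p₂) := mul_left_cancel₀ k₁.ne' (by linarith)
    have d₂ : max p₂ u = max p₂ u' := mul_left_cancel₀ k₂.ne' (by linarith)
    linarith
  · simp [h₀.le, (h₀.trans h₁).le]
  · simp [h₁.le, e₀]; norm_num
  · simp [h₁.le, e₀, e₁]
  · simp [h₂.le, h₁.le, (h₁.trans h₂).le, e₀, e₁, e₂]; norm_num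

/-- The sides of a right-angled hexagon of the hyperbolic plane: two concentric half-circles, and a
half-circle between them. -/
structure Hexagon where
  ℓ : ℝ
  c : ℝ
  r : ℝ
  ℓ_gt : 1 < ℓ
  r_pos : 0 < r
  lt_sub : ℓ⁻¹ < c - r
  add_lt : c + r < ℓ

namespace Hexagon

variable (H : Hexagon)

lemma ℓ_pos : 0 < H.ℓ := one_pos.trans H.ℓ_gt

lemma inv_pos : 0 < H.ℓ⁻¹ := _root_.inv_pos.2 H.ℓ_pos

lemma c_pos : 0 < H.c := by have := H.lt_sub; have := H.inv_pos; have := H.r_pos; linarith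

/-- The values at the four breakpoints match the seams: ±4 are the outer ends of the real segments
of the half pants, and ±2 make the corners of `lo` at |u - c| = r correspond to the corners of `lo'`
at |δ| = 2. -/
lemma exists_slope : ∃ f : ℝ → ℝ, Continuous f ∧ StrictMonoOn f (Set.Icc H.ℓ⁻¹ H.ℓ) ∧ f H.ℓ⁻¹ = -4 ∧
    f (H.c - H.r) = -2 ∧ f (H.c + H.r) = 2 ∧ f H.ℓ = 4 :=
  exists_piecewise_linear H.lt_sub (by linarith [H.r_pos]) H.add_lt

/-- The first coordinate. -/
def f : ℝ → ℝ := H.exists_slope.choose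

lemma continuous_f : Continuous H.f := H.exists_slope.choose_spec.1

lemma strictMonoOn_f : StrictMonoOn H.f (Set.Icc H.ℓ⁻¹ H.ℓ) := H.exists_slope.choose_spec.2.1

lemma f_inv : H.f H.ℓ⁻¹ = -4 := H.exists_slope.choose_spec.2.2.1

lemma f_sub : H.f (H.c - H.r) = -2 := H.exists_slope.choose_spec.2.2.2.1

lemma f_add : H.f (H.c + H.r) = 2 := H.exists_slope.choose_spec.2.2.2.2.1

lemma f_ℓ : H.f H.ℓ = 4 := H.exists_slope.choose_spec.2.2.2.2.2

lemma inv_lt : H.ℓ⁻¹ < H.ℓ := by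
  have := H.lt_sub; have := H.add_lt; have := H.r_pos; linarith

/-- The lower bound for the distance to `c`, for a given distance to the origin. -/
def lo (u : ℝ) : ℝ := max H.r |u - H.c|

/-- The lower bound for the second coordinate. -/
def lo' (δ : ℝ) : ℝ := max 4 (2 + |δ|)

/-- The upper bound for the second coordinate. -/
def hi' (δ : ℝ) : ℝ := √(80 - δ ^ 2)

/-- The second coordinate. -/
def g (u v : ℝ) : ℝ :=
  lo' (H.f u) + (v - H.lo u) / (u + H.c - H.lo u) * (hi' (H.f u) - lo' (H.f u))

/-- The coordinates `(|z|, |z - c|)` of the hexagon. -/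
def Mem (u v : ℝ) : Prop := u ∈ Set.Icc H.ℓ⁻¹ H.ℓ ∧ H.lo u ≤ v ∧ v ≤ u + H.c

variable {H} {u v : ℝ}

lemma abs_f_le (hu : u ∈ Set.Icc H.ℓ⁻¹ H.ℓ) : |H.f u| ≤ 4 := by
  have h1 := H.strictMonoOn_f.monotoneOn (Set.left_mem_Icc.2 H.inv_lt.le) hu hu.1
  have h2 := H.strictMonoOn_f.monotoneOn hu (Set.right_mem_Icc.2 H.inv_lt.le) hu.2
  rw [H.f_inv] at h1
  rw [H.f_ℓ] at h2
  exact abs_le.2 ⟨h1, h2⟩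

lemma abs_f_eq (hu : u ∈ Set.Icc H.ℓ⁻¹ H.ℓ) : |H.f u| = 4 ↔ u = H.ℓ ∨ u = H.ℓ⁻¹ := by
  have hi := H.strictMonoOn_f.injOn
  rw [abs_eq (by norm_num), ← H.f_inv, ← H.f_ℓ, hi.eq_iff hu (Set.right_mem_Icc.2 H.inv_lt.le),
    hi.eq_iff hu (Set.left_mem_Icc.2 H.inv_lt.le)]

lemma two_le_f (hu : u ∈ Set.Icc H.ℓ⁻¹ H.ℓ) : 2 ≤ H.f u ↔ H.c + H.r ≤ u := by
  rw [← H.f_add]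
  refine H.strictMonoOn_f.le_iff_le ⟨?_, H.add_lt.le⟩ hu
  linarith [H.lt_sub, H.r_pos]

lemma f_le_neg_two (hu : u ∈ Set.Icc H.ℓ⁻¹ H.ℓ) : H.f u ≤ -2 ↔ u ≤ H.c - H.r := by
  rw [← H.f_sub]
  refine H.strictMonoOn_f.le_iff_le hu ⟨H.lt_sub.le, ?_⟩
  linarith [H.add_lt, H.r_pos]

lemma abs_f_le_two (hu : u ∈ Set.Icc H.ℓ⁻¹ H.ℓ) : |H.f u| ≤ 2 ↔ |u - H.c| ≤ H.r := by
  have m₁ : H.c - H.r ∈ Set.Icc H.ℓ⁻¹ H.ℓ := ⟨H.lt_sub.le, by linarith [H.add_lt, H.r_pos]⟩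
  have m₂ : H.c + H.r ∈ Set.Icc H.ℓ⁻¹ H.ℓ := ⟨by linarith [H.lt_sub, H.r_pos], H.add_lt.le⟩
  rw [abs_le, abs_le, ← H.f_sub, ← H.f_add, H.strictMonoOn_f.le_iff_le m₁ hu,
    H.strictMonoOn_f.le_iff_le hu m₂]
  constructor <;> rintro ⟨h1, h2⟩ <;> constructor <;> linarith

lemma lo_lt (hu : u ∈ Set.Icc H.ℓ⁻¹ H.ℓ) : H.lo u < u + H.c := by
  have := H.c_pos
  have h1 := H.inv_pos.trans_le hu.1
  rw [lo, max_lt_iff, abs_lt]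
  exact ⟨by linarith [H.lt_sub, H.inv_pos], by linarith, by linarith⟩

lemma lo'_lt {δ : ℝ} (h : |δ| ≤ 4) : lo' δ < hi' δ := by
  have h1 : δ ^ 2 ≤ 16 := by
    have := sq_le_sq' (abs_le.1 h).1 (abs_le.1 h).2
    linarith
  have : lo' δ ≤ 6 := max_le (by norm_num) (by linarith)
  refine this.trans_lt (Real.lt_sqrt_of_sq_lt ?_)
  linarith

lemma g_mem (h : H.Mem u v) : lo' (H.f u) ≤ H.g u v ∧ H.g u v ≤ hi' (H.f u) := by
  have h1 := sub_pos.2 (lo_lt h.1)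
  have h2 := sub_pos.2 (lo'_lt (abs_f_le h.1))
  have h3 : 0 ≤ (v - H.lo u) / (u + H.c - H.lo u) := div_nonneg (sub_nonneg.2 h.2.1) h1.le
  have h4 : (v - H.lo u) / (u + H.c - H.lo u) ≤ 1 := (div_le_one h1).2 (by linarith [h.2.2])
  unfold g
  constructor <;> nlinarith

lemma g_eq_lo' (h : H.Mem u v) : H.g u v = lo' (H.f u) ↔ v = H.lo u := by
  have h1 := sub_pos.2 (lo_lt h.1)
  have h2 := sub_pos.2 (lo'_lt (abs_f_le h.1))
  rw [g, add_eq_left, mul_eq_zero, div_eq_zero_iff, sub_eq_zero]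
  simp [h1.ne', h2.ne']

lemma g_eq_hi' (h : H.Mem u v) : H.g u v = hi' (H.f u) ↔ v = u + H.c := by
  have h1 := sub_pos.2 (lo_lt h.1)
  have h2 := sub_pos.2 (lo'_lt (abs_f_le h.1))
  have : H.g u v - hi' (H.f u) = (v - (u + H.c)) / (u + H.c - H.lo u) * (hi' (H.f u) - lo' (H.f u)) := by
    unfold g
    field_simp
    ring
  rw [← sub_eq_zero, this, mul_eq_zero, div_eq_zero_iff, sub_eq_zero]
  simp [h1.ne', h2.ne']

lemma four_le_g (h : H.Mem u v) : 4 ≤ H.g u v := (le_max_left _ _).trans (g_mem h).1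

/-- This and the next three lemmas match the sides. The inner circle goes to the segment s = 4
between ±2; the equalities in the triangle inequality, which describe the real axis, go to the three
boundary circles. -/
lemma g_eq_four (h : H.Mem u v) : H.g u v = 4 ↔ v = H.r := by
  constructor
  · intro e
    have h1 := (g_mem h).1
    rw [e] at h1
    have h2 : lo' (H.f u) = 4 := le_antisymm h1 (le_max_left _ _)
    rw [← h2, g_eq_lo' h] at e
    have h3 : 2 + |H.f u| ≤ 4 := (le_max_right _ _).trans_eq h2
    rw [e, lo, max_eq_left ((abs_f_le_two h.1).1 (by linarith))]
  · rintro rfl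
    have h1 : H.lo u = H.r := le_antisymm h.2.1 (le_max_left _ _)
    have h2 := (abs_f_le_two h.1).2 ((le_max_right _ _).trans_eq h1)
    rw [(g_eq_lo' h).2 h1.symm, lo', max_eq_left (by linarith)]

lemma g_sub_eq (h : H.Mem u v) : H.g u v - H.f u = 2 ↔ v = u - H.c := by
  have hm := g_mem h
  have h4 := four_le_g h
  constructor
  · intro e
    have h1 : 2 ≤ H.f u := by linarith
    have h2 : lo' (H.f u) = H.g u v := by
      refine le_antisymm hm.1 ?_
      rw [lo', abs_of_nonneg (by linarith)]
      exact le_max_of_le_right (by linarith)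
    rw [two_le_f h.1] at h1
    rw [(g_eq_lo' h).1 h2.symm, lo, abs_of_nonneg (by linarith [H.r_pos]), max_eq_right (by linarith)]
  · intro e
    have h1 : H.r ≤ v := (le_max_left _ _).trans h.2.1
    have h2 : 2 ≤ H.f u := (two_le_f h.1).2 (by linarith)
    have h3 : v = H.lo u := by
      rw [lo, abs_of_nonneg (by linarith [H.r_pos]), max_eq_right (by linarith)]
      exact e
    rw [(g_eq_lo' h).2 h3, lo', abs_of_nonneg (by linarith), max_eq_right (by linarith)]
    ring

lemma g_add_eq (h : H.Mem u v) : H.g u v + H.f u = 2 ↔ v = H.c - u := by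
  have hm := g_mem h
  have h4 := four_le_g h
  constructor
  · intro e
    have h1 : H.f u ≤ -2 := by linarith
    have h2 : lo' (H.f u) = H.g u v := by
      refine le_antisymm hm.1 ?_
      rw [lo', abs_of_nonpos (by linarith)]
      exact le_max_of_le_right (by linarith)
    rw [f_le_neg_two h.1] at h1
    rw [(g_eq_lo' h).1 h2.symm, lo, abs_of_nonpos (by linarith [H.r_pos]), max_eq_right (by linarith)]
    ring
  · intro e
    have h1 : H.r ≤ v := (le_max_left _ _).trans h.2.1
    have h2 : H.f u ≤ -2 := (f_le_neg_two h.1).2 (by linarith)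
    have h3 : v = H.lo u := by
      rw [lo, abs_of_nonpos (by linarith [H.r_pos]), max_eq_right (by linarith)]
      linarith
    rw [(g_eq_lo' h).2 h3, lo', abs_of_nonpos (by linarith), max_eq_right (by linarith)]
    ring

lemma g_sq_add_eq (h : H.Mem u v) : H.g u v ^ 2 + H.f u ^ 2 = 80 ↔ v = u + H.c := by
  rw [← g_eq_hi' h, hi']
  have h4 := four_le_g h
  have h1 : 0 ≤ 80 - H.f u ^ 2 := by
    have := abs_le.1 (abs_f_le h.1)
    nlinarith
  rw [eq_comm (b := √_), Real.sqrt_eq_iff_eq_sq h1 (by linarith)]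
  constructor <;> intro e <;> linarith

lemma coords_injective {u' v' : ℝ} (h : H.Mem u v) (h' : H.Mem u' v') (hf : H.f u = H.f u')
    (hg : H.g u v = H.g u' v') : u = u' ∧ v = v' := by
  obtain rfl := H.strictMonoOn_f.injOn h.1 h'.1 hf
  refine ⟨rfl, ?_⟩
  have h1 := sub_pos.2 (lo_lt h.1)
  have h2 := sub_pos.2 (lo'_lt (abs_f_le h.1))
  rw [g, g, add_right_inj] at hg
  have := mul_right_cancel₀ h2.ne' hg
  rw [div_left_inj' h1.ne'] at this
  linarith

lemma exists_coords {δ s : ℝ} (hδ : |δ| ≤ 4) (h1 : lo' δ ≤ s) (h2 : s ≤ hi' δ) :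
    ∃ u v, H.Mem u v ∧ H.f u = δ ∧ H.g u v = s := by
  obtain ⟨u, hu, rfl⟩ : δ ∈ H.f '' Set.Icc H.ℓ⁻¹ H.ℓ := by
    apply intermediate_value_Icc H.inv_lt.le H.continuous_f.continuousOn
    rw [H.f_inv, H.f_ℓ]
    exact abs_le.1 hδ
  have h3 := sub_pos.2 (lo_lt hu)
  have h4 := sub_pos.2 (lo'_lt (abs_f_le hu))
  have h5 : 0 ≤ (s - lo' (H.f u)) / (hi' (H.f u) - lo' (H.f u)) := div_nonneg (sub_nonneg.2 h1) h4.le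
  have h6 : (s - lo' (H.f u)) / (hi' (H.f u) - lo' (H.f u)) ≤ 1 := (div_le_one h4).2 (by linarith)
  refine ⟨u, H.lo u + (s - lo' (H.f u)) / (hi' (H.f u) - lo' (H.f u)) * (u + H.c - H.lo u),
    ⟨hu, by nlinarith, by nlinarith⟩, rfl, ?_⟩
  rw [g, add_sub_cancel_left, mul_div_cancel_right₀ _ h3.ne', div_mul_cancel₀ _ h4.ne']
  ring

/-! ### The map from the hexagon to the half of the pair of pants -/

variable (H)

/-- The region of the plane bounded by the three circles. -/
def region : Set ℂ := {x | H.Mem ‖x‖ ‖x - H.c‖}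

/-- The map from the hexagon to the upper half (`e = 1`) or lower half (`e = -1`) of the pair of
pants. -/
def G (e : ℝ) (x : ℂ) : ℂ := bip e (H.f ‖x‖) (H.g ‖x‖ ‖x - H.c‖)

lemma mem_region {x : ℂ} : x ∈ H.region ↔ H.ℓ⁻¹ ≤ ‖x‖ ∧ ‖x‖ ≤ H.ℓ ∧ H.r ≤ ‖x - H.c‖ := by
  have h1 : ‖x - H.c‖ ≤ ‖x‖ + H.c := by
    refine (norm_sub_le _ _).trans_eq ?_
    rw [Complex.norm_of_nonneg H.c_pos.le]
  have h2 : |‖x‖ - H.c| ≤ ‖x - H.c‖ := by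
    have := abs_norm_sub_norm_le x (H.c : ℂ)
    rwa [Complex.norm_of_nonneg H.c_pos.le] at this
  simp only [region, Mem, Set.mem_ofPred_eq, Set.mem_Icc, lo, max_le_iff]
  tauto

variable {H} {x : ℂ} {e : ℝ}

lemma continuousOn_G (e : ℝ) : ContinuousOn (H.G e) H.region := by
  have hf : Continuous fun x : ℂ => H.f ‖x‖ := H.continuous_f.comp continuous_norm
  have hlo : Continuous fun x : ℂ => H.lo ‖x‖ := by unfold lo; fun_prop
  have hlo' : Continuous fun x : ℂ => lo' (H.f ‖x‖) := by unfold lo'; fun_prop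
  have hhi' : Continuous fun x : ℂ => hi' (H.f ‖x‖) := by unfold hi'; fun_prop
  have hg : ContinuousOn (fun x : ℂ => H.g ‖x‖ ‖x - H.c‖) H.region := by
    unfold g
    refine hlo'.continuousOn.add (ContinuousOn.mul (ContinuousOn.div ?_ ?_ fun x hx => ?_)
      (hhi'.sub hlo').continuousOn)
    · exact ((continuous_id.sub continuous_const).norm.sub hlo).continuousOn
    · exact ((continuous_norm.add continuous_const).sub hlo).continuousOn
    · exact (sub_pos.2 (lo_lt hx.1)).ne'
  have hb : Continuous fun t : ℝ × ℝ => bip e t.1 t.2 := by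
    have : (fun t : ℝ × ℝ => bip e t.1 t.2) = fun t : ℝ × ℝ => ((t.1 * t.2 / 8 : ℝ) : ℂ) +
        ((e * √((t.2 ^ 2 - 16) * (16 - t.1 ^ 2)) / 8 : ℝ) : ℂ) * Complex.I := by
      ext t
      apply Complex.ext <;> simp [bip]
    rw [this]
    fun_prop
  exact hb.comp_continuousOn (hf.continuousOn.prodMk hg)

lemma G_im_eq_zero (he : e ^ 2 = 1) (hx : x ∈ H.region) :
    (H.G e x).im = 0 ↔ ‖x‖ = H.ℓ ∨ ‖x‖ = H.ℓ⁻¹ ∨ ‖x - H.c‖ = H.r := by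
  rw [G, bip_im_eq_zero he (abs_f_le hx.1) (four_le_g hx), g_eq_four hx, abs_f_eq hx.1]
  tauto

lemma G_neg (h : (H.G e x).im = 0) : H.G (-e) x = H.G e x := by
  apply Complex.ext
  · rfl
  · rw [h]
    simp only [G, bip] at h ⊢
    linarith

/-- The map for the sign e takes values in the half-plane e · Im ≥ 0, so the images for opposite
signs meet only on the real axis. -/
lemma G_im_eq_zero_of_eq {x y : ℂ} (h : H.G e x = H.G (-e) y) (he : e ^ 2 = 1) : (H.G e x).im = 0 := by
  have h1 : 0 ≤ e * (H.G e x).im := by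
    have : e * (H.G e x).im = e ^ 2 *
        (√((H.g ‖x‖ ‖x - H.c‖ ^ 2 - 16) * (16 - H.f ‖x‖ ^ 2)) / 8) := by simp only [G, bip]; ring
    rw [this]; positivity
  have h2 : 0 ≤ -(e * (H.G (-e) y).im) := by
    have : -(e * (H.G (-e) y).im) = e ^ 2 *
        (√((H.g ‖y‖ ‖y - H.c‖ ^ 2 - 16) * (16 - H.f ‖y‖ ^ 2)) / 8) := by simp only [G, bip]; ring
    rw [this]; positivity
  rw [← h] at h2
  have he0 : e ≠ 0 := by rintro rfl; norm_num at he
  exact (mul_eq_zero.1 (le_antisymm (by linarith) h1)).resolve_left he0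

/-- The map determines the distances to the origin and to `c`. -/
lemma norm_eq_of_G_eq {e' : ℝ} {y : ℂ} (he : e ^ 2 = 1) (he' : e' ^ 2 = 1) (hx : x ∈ H.region)
    (hy : y ∈ H.region) (h : H.G e x = H.G e' y) : ‖x‖ = ‖y‖ ∧ ‖x - H.c‖ = ‖y - H.c‖ := by
  have a₁ := norm_bip_add he (abs_f_le hx.1) (four_le_g hx)
  have a₂ := norm_bip_sub he (abs_f_le hx.1) (four_le_g hx)
  have b₁ := norm_bip_add he' (abs_f_le hy.1) (four_le_g hy)
  have b₂ := norm_bip_sub he' (abs_f_le hy.1) (four_le_g hy)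
  change ‖H.G e x + 2‖ = _ at a₁
  change ‖H.G e x - 2‖ = _ at a₂
  change ‖H.G e' y + 2‖ = _ at b₁
  change ‖H.G e' y - 2‖ = _ at b₂
  rw [h] at a₁ a₂
  exact coords_injective hx hy (by linarith) (by linarith)

/-- A complex number is determined by its distances to the origin and to `c`, up to conjugation. -/
lemma re_eq_of_norm_eq {y : ℂ} (h₁ : ‖x‖ = ‖y‖) (h₂ : ‖x - H.c‖ = ‖y - H.c‖) :
    x.re = y.re ∧ x.im ^ 2 = y.im ^ 2 := by
  have e₁ : x.re ^ 2 + x.im ^ 2 = y.re ^ 2 + y.im ^ 2 := by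
    have := congrArg (· ^ 2) h₁
    simp only [← Complex.normSq_eq_norm_sq, Complex.normSq_apply] at this
    linarith
  have e₂ : (x.re - H.c) ^ 2 + x.im ^ 2 = (y.re - H.c) ^ 2 + y.im ^ 2 := by
    have := congrArg (· ^ 2) h₂
    simp [← Complex.normSq_eq_norm_sq, Complex.normSq_apply] at this
    linarith
  have : x.re = y.re := mul_left_cancel₀ H.c_pos.ne' (by linarith)
  exact ⟨this, by rw [this] at e₁; linarith⟩

lemma G_mem (he : e ^ 2 = 1) (hx : x ∈ H.region) :
    ‖H.G e x‖ ≤ 4 ∧ 1 ≤ ‖H.G e x - 2‖ ∧ 1 ≤ ‖H.G e x + 2‖ := by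
  have h1 := norm_bip_add he (abs_f_le hx.1) (four_le_g hx)
  have h2 := norm_bip_sub he (abs_f_le hx.1) (four_le_g hx)
  have h3 := norm_bip_sq he (abs_f_le hx.1) (four_le_g hx)
  have h4 := g_mem hx
  have h5 : 2 + |H.f ‖x‖| ≤ H.g ‖x‖ ‖x - H.c‖ := (le_max_right _ _).trans h4.1
  have h6 := abs_le.1 (show |H.f ‖x‖| ≤ H.g ‖x‖ ‖x - H.c‖ - 2 by linarith)
  refine ⟨?_, ?_, ?_⟩
  · rw [← abs_of_nonneg (norm_nonneg (H.G e x))]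
    apply abs_le_of_sq_le_sq _ (by norm_num)
    rw [G, h3]
    have h7 : 0 ≤ 80 - H.f ‖x‖ ^ 2 := by
      have := abs_le.1 (abs_f_le hx.1)
      nlinarith
    have h8 := pow_le_pow_left₀ (by linarith [four_le_g hx]) h4.2 2
    rw [hi', Real.sq_sqrt h7] at h8
    linarith
  · rw [G, h2]; linarith
  · rw [G, h1]; linarith

lemma exists_G_eq {w : ℂ} (h1 : ‖w‖ ≤ 4) (h2 : 1 ≤ ‖w - 2‖) (h3 : 1 ≤ ‖w + 2‖) (he : e ^ 2 = 1)
    (hw : 0 ≤ e * w.im) : ∃ x ∈ H.region, 0 ≤ e * x.im ∧ H.G e x = w := by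
  obtain ⟨hδ, hs, hb⟩ := exists_bip w
  have e₁ : ‖w + 2‖ ^ 2 + ‖w - 2‖ ^ 2 = 2 * ‖w‖ ^ 2 + 8 := by
    simp only [← Complex.normSq_eq_norm_sq, Complex.normSq_apply]; simp; ring
  obtain ⟨u, v, hm, hf, hg⟩ := exists_coords (H := H) hδ (s := ‖w + 2‖ + ‖w - 2‖) (by
      refine max_le hs ?_
      rw [← le_sub_iff_add_le']
      exact abs_le.2 ⟨by linarith, by linarith⟩) (by
      apply Real.le_sqrt_of_sq_le
      nlinarith [norm_nonneg w])
  have hc := H.c_pos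
  have hu0 : 0 < u := H.inv_pos.trans_le hm.1.1
  have hv : |u - H.c| ≤ v := (le_max_right _ _).trans hm.2.1
  have hv0 : 0 ≤ v := (abs_nonneg _).trans hv
  have hv1 : (u - H.c) ^ 2 ≤ v ^ 2 := sq_le_sq' (by linarith [(abs_le.1 hv).1]) (abs_le.1 hv).2
  have hv2 : v ^ 2 ≤ (u + H.c) ^ 2 := pow_le_pow_left₀ hv0 hm.2.2 2
  -- The real part of the point with distances u from 0 and v from c, by the law of cosines; the
  -- bounds on v make the remaining radicand nonnegative.
  obtain ⟨p, hp⟩ : ∃ p : ℝ, p = (u ^ 2 + H.c ^ 2 - v ^ 2) / (2 * H.c) := ⟨_, rfl⟩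
  have hp' : 2 * H.c * p = u ^ 2 + H.c ^ 2 - v ^ 2 := by rw [hp]; field_simp
  have hpu : p ^ 2 ≤ u ^ 2 := sq_le_sq' (by nlinarith) (by nlinarith)
  have hsq := Real.sq_sqrt (sub_nonneg.2 hpu)
  have hxu : ‖(⟨p, e * √(u ^ 2 - p ^ 2)⟩ : ℂ)‖ = u := by
    rw [← sq_eq_sq₀ (norm_nonneg _) hu0.le, ← Complex.normSq_eq_norm_sq, Complex.normSq_apply]
    simp only
    linear_combination hsq + (√(u ^ 2 - p ^ 2)) ^ 2 * he
  have hxv : ‖(⟨p, e * √(u ^ 2 - p ^ 2)⟩ : ℂ) - H.c‖ = v := by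
    rw [← sq_eq_sq₀ (norm_nonneg _) hv0, ← Complex.normSq_eq_norm_sq, Complex.normSq_apply]
    simp only [Complex.sub_re, Complex.sub_im, Complex.ofReal_re, Complex.ofReal_im]
    linear_combination hsq + (√(u ^ 2 - p ^ 2)) ^ 2 * he - hp'
  refine ⟨⟨p, e * √(u ^ 2 - p ^ 2)⟩, ?_, ?_, ?_⟩
  · change H.Mem _ _
    rwa [hxu, hxv]
  · change 0 ≤ e * (e * √(u ^ 2 - p ^ 2))
    rw [← mul_assoc, ← sq, he, one_mul]
    positivity
  · rw [G, hxu, hxv, hf, hg, hb e he hw]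

/-! ### The sides on the real axis -/

/-- The triangle with vertices 0, c and x is degenerate exactly when one of the triangle
inequalities is an equality. -/
lemma im_eq_zero_iff (x : ℂ) : x.im = 0 ↔
    ‖x - H.c‖ = ‖x‖ + H.c ∨ ‖x - H.c‖ = ‖x‖ - H.c ∨ ‖x - H.c‖ = H.c - ‖x‖ := by
  have hc := H.c_pos
  have e₁ : ‖x‖ ^ 2 = x.re ^ 2 + x.im ^ 2 := by
    rw [← Complex.normSq_eq_norm_sq, Complex.normSq_apply]; ring
  have e₂ : ‖x - H.c‖ ^ 2 = (x.re - H.c) ^ 2 + x.im ^ 2 := by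
    rw [← Complex.normSq_eq_norm_sq, Complex.normSq_apply]
    simp
    ring
  have n₁ := norm_nonneg x
  have n₂ := norm_nonneg (x - H.c)
  constructor
  · intro h
    have hx : x = (x.re : ℂ) := Complex.ext rfl (by simpa using h)
    have a₁ : ‖x‖ = |x.re| := by conv_lhs => rw [hx, Complex.norm_real, Real.norm_eq_abs]
    have a₂ : ‖x - H.c‖ = |x.re - H.c| := by
      conv_lhs => rw [hx, ← Complex.ofReal_sub, Complex.norm_real, Real.norm_eq_abs]
    rw [a₁, a₂]
    rcases le_total 0 x.re with h1 | h1
    · rw [abs_of_nonneg h1]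
      rcases le_total 0 (x.re - H.c) with h2 | h2
      · rw [abs_of_nonneg h2]; tauto
      · rw [abs_of_nonpos h2]; right; right; ring
    · rw [abs_of_nonpos h1, abs_of_nonpos (by linarith)]
      left; ring
  · intro h
    have key : x.im ^ 2 * H.c ^ 2 = 0 := by
      have h1 : (‖x - H.c‖ ^ 2 - ‖x‖ ^ 2 - H.c ^ 2) ^ 2 = (2 * H.c * ‖x‖) ^ 2 := by
        rcases h with h | h | h <;> rw [h] <;> ring
      have h2 : ‖x - H.c‖ ^ 2 - ‖x‖ ^ 2 - H.c ^ 2 = -(2 * H.c * x.re) := by rw [e₁, e₂]; ring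
      rw [h2, mul_pow _ ‖x‖, e₁] at h1
      linear_combination -h1 / 4
    rcases mul_eq_zero.1 key with h1 | h1
    · exact pow_eq_zero_iff (two_ne_zero) |>.1 h1
    · exact absurd (pow_eq_zero_iff (two_ne_zero) |>.1 h1) hc.ne'

/-- The three sides of the hexagon on the real axis, as equations for the distances to the origin and
to `c`. -/
def side : Fin 3 → Set ℂ :=
  ![{x | ‖x - H.c‖ = ‖x‖ + H.c}, {x | ‖x - H.c‖ = ‖x‖ - H.c}, {x | ‖x - H.c‖ = H.c - ‖x‖}]

lemma im_eq_zero_iff_side (x : ℂ) : x.im = 0 ↔ ∃ k, x ∈ H.side k := by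
  rw [H.im_eq_zero_iff, Fin.exists_fin_succ, Fin.exists_fin_succ, Fin.exists_fin_succ]
  simp [side]

lemma G_mem_boundaryCircle (he : e ^ 2 = 1) (hx : x ∈ H.region) (k : Fin 3) :
    (⟨H.G e x, G_mem he hx⟩ : ThreeHoledSphere) ∈ boundaryCircle k ↔ x ∈ H.side k := by
  have h1 := norm_bip_add he (abs_f_le hx.1) (four_le_g hx)
  have h2 := norm_bip_sub he (abs_f_le hx.1) (four_le_g hx)
  have h3 := norm_bip_sq he (abs_f_le hx.1) (four_le_g hx)
  fin_cases k
  · change ‖H.G e x‖ = 4 ↔ ‖x - H.c‖ = ‖x‖ + H.c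
    rw [← g_sq_add_eq hx, ← sq_eq_sq₀ (norm_nonneg _) (by norm_num), G, h3]
    constructor <;> intro e <;> linarith
  · change ‖H.G e x - 2‖ = 1 ↔ ‖x - H.c‖ = ‖x‖ - H.c
    rw [← g_sub_eq hx, G, h2]
    constructor <;> intro e <;> linarith
  · change ‖H.G e x + 2‖ = 1 ↔ ‖x - H.c‖ = H.c - ‖x‖
    rw [← g_add_eq hx, G, h1]
    constructor <;> intro e <;> linarith

end Hexagon

end PantsChar

end

/-! ### Normalised triples of reflections: two concentric circles and one between them -/

noncomputable section

namespace PantsChar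

open Matrix Topology

/-- For a symmetric matrix of positive trace, determinant divided by trace is a lower bound for the
smaller eigenvalue. -/
lemma hform_neg_definite {α a β : ℝ} (hα : 0 < α) (hβ : 0 < β) (v : ℂ × ℂ) :
    hform (-α) a 0 (-β) v ≤ -((α * β - a ^ 2) / (α + β) * nsq v) := by
  obtain ⟨ε, hε⟩ : ∃ ε, ε = (α * β - a ^ 2) / (α + β) := ⟨_, rfl⟩
  have h1 : 0 < α + β := by linarith
  have h2 : ε * (α + β) = α * β - a ^ 2 := by rw [hε]; field_simp
  have h3 : 0 < α - ε := by
    have : 0 < (α - ε) * (α + β) := by nlinarith [sq_nonneg a]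
    exact pos_of_mul_pos_left this h1.le
  rw [← hε]
  simp only [hform, nsq, Complex.normSq_apply, Complex.mul_re, Complex.star_def, Complex.conj_re,
    Complex.conj_im]
  have key : 0 ≤ (α - ε) * ((α - ε) * (v.1.re * v.1.re + v.1.im * v.1.im) -
      2 * a * (v.1.re * v.2.re - v.1.im * -v.2.im) +
      (β - ε) * (v.2.re * v.2.re + v.2.im * v.2.im)) := by
    have e : (α - ε) * ((α - ε) * (v.1.re * v.1.re + v.1.im * v.1.im) -
      2 * a * (v.1.re * v.2.re - v.1.im * -v.2.im) +
      (β - ε) * (v.2.re * v.2.re + v.2.im * v.2.im)) =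
      ((α - ε) * v.1.re - a * v.2.re) ^ 2 + ((α - ε) * v.1.im - a * v.2.im) ^ 2 +
      ε ^ 2 * (v.2.re ^ 2 + v.2.im ^ 2) := by
      linear_combination -(v.2.re ^ 2 + v.2.im ^ 2) * h2
    rw [e]
    positivity
  have := nonneg_of_mul_nonneg_right key h3
  linarith

/-- Normalised data for three reflections whose pairwise products have traces less than `-2`. -/
structure Param where
  ℓ : ℝ
  A : ℝ
  B : ℝ
  C : ℝ
  ℓ_gt : 1 < ℓ
  A_pos : 0 < A
  B_pos : 0 < B
  C_pos : 0 < C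
  A_sq : A ^ 2 = 1 + B * C
  lt_z : 2 < ℓ * C - ℓ⁻¹ * B
  lt_y : 2 < ℓ * B - ℓ⁻¹ * C

namespace Param

variable (p : Param)

lemma ℓ_pos : 0 < p.ℓ := one_pos.trans p.ℓ_gt

lemma inv_lt_one : p.ℓ⁻¹ < 1 := inv_lt_one_of_one_lt₀ p.ℓ_gt

lemma inv_pos : 0 < p.ℓ⁻¹ := _root_.inv_pos.2 p.ℓ_pos

/-- The hexagon bounded by the three reflection lines. -/
def H : Hexagon where
  ℓ := p.ℓ
  c := p.A / p.C
  r := 1 / p.C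
  ℓ_gt := p.ℓ_gt
  r_pos := one_div_pos.2 p.C_pos
  lt_sub := by
    rw [← sub_div, lt_div_iff₀ p.C_pos]
    have h1 := p.A_sq
    have h2 := p.lt_y
    have h3 : p.ℓ⁻¹ * p.ℓ = 1 := inv_mul_cancel₀ p.ℓ_pos.ne'
    have h4 : (p.ℓ⁻¹ * p.C + 1) ^ 2 < p.A ^ 2 := by
      have : 0 < p.ℓ⁻¹ * p.C * (p.ℓ * p.B - p.ℓ⁻¹ * p.C - 2) :=
        mul_pos (mul_pos p.inv_pos p.C_pos) (by linarith)
      have e : p.ℓ⁻¹ * p.C * (p.ℓ * p.B) = p.B * p.C := by linear_combination (p.B * p.C) * h3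
      nlinarith
    have := lt_of_pow_lt_pow_left₀ 2 p.A_pos.le h4
    linarith
  add_lt := by
    rw [← add_div, div_lt_iff₀ p.C_pos]
    have h1 := p.A_sq
    have h2 := p.lt_z
    have h3 : p.ℓ⁻¹ * p.ℓ = 1 := inv_mul_cancel₀ p.ℓ_pos.ne'
    have h5 := mul_pos p.inv_pos p.B_pos
    have h4 : p.A ^ 2 < (p.ℓ * p.C - 1) ^ 2 := by
      have : 0 < p.ℓ * p.C * (p.ℓ * p.C - p.ℓ⁻¹ * p.B - 2) :=
        mul_pos (mul_pos p.ℓ_pos p.C_pos) (by linarith)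
      have e : p.ℓ * p.C * (p.ℓ⁻¹ * p.B) = p.B * p.C := by linear_combination (p.B * p.C) * h3
      nlinarith
    have := lt_of_pow_lt_pow_left₀ 2 (by linarith) h4
    linarith

/-- The three reflections. -/
def D : ReflData where
  a := ![0, 0, -p.A]
  b := ![p.ℓ, -p.ℓ⁻¹, p.B]
  c := ![p.ℓ⁻¹, -p.ℓ, -p.C]
  det_eq i := by
    have h1 := p.ℓ_pos.ne'
    have h2 := p.A_sq
    fin_cases i
    · change (0 : ℝ) ^ 2 + p.ℓ * p.ℓ⁻¹ = 1
      field_simp; norm_num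
    · change (0 : ℝ) ^ 2 + -p.ℓ⁻¹ * -p.ℓ = 1
      field_simp; norm_num
    · change (-p.A) ^ 2 + p.B * -p.C = 1
      linear_combination h2
  c_lt_b i := by
    have h1 := p.ℓ_gt
    have h2 := p.inv_lt_one
    have h3 := p.B_pos
    have h4 := p.C_pos
    fin_cases i
    · change p.ℓ⁻¹ < p.ℓ; linarith
    · change -p.ℓ < -p.ℓ⁻¹; linarith
    · change -p.C < p.B; linarith
  -- The three entries are the margins for the pairs (0, 1), (0, 2) and (1, 2); the last two are the
  -- bounds of `hform_neg_definite` for the sums of forms, with numerators equal to the excess of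
  -- minus the trace over 2.
  ε := min (p.ℓ - p.ℓ⁻¹) (min ((p.ℓ * p.C - p.ℓ⁻¹ * p.B - 2) / (p.C - p.ℓ⁻¹ + (p.ℓ + p.B)))
    ((p.ℓ * p.B - p.ℓ⁻¹ * p.C - 2) / (p.ℓ + p.C + (p.B - p.ℓ⁻¹))))
  ε_pos := by
    have h1 := p.ℓ_gt
    have h2 := p.inv_lt_one
    have h3 := p.B_pos
    have h4 := p.C_pos
    refine lt_min (by linarith) (lt_min (div_pos ?_ ?_) (div_pos ?_ ?_))
    · linarith [p.lt_z]
    · linarith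
    · linarith [p.lt_y]
    · linarith
  add_le := by
    have h1 := p.ℓ_gt
    have h2 := p.inv_lt_one
    have h3 := p.B_pos
    have h4 := p.C_pos
    have hz := p.lt_z
    have hy := p.lt_y
    have hA := p.A_sq
    have hl : p.ℓ⁻¹ * p.ℓ = 1 := inv_mul_cancel₀ p.ℓ_pos.ne'
    have hC : 0 < p.C - p.ℓ⁻¹ := by
      have : 0 < p.ℓ * (p.C - p.ℓ⁻¹) := by nlinarith [mul_pos p.inv_pos p.B_pos]
      exact pos_of_mul_pos_right this p.ℓ_pos.le
    have hB : 0 < p.B - p.ℓ⁻¹ := by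
      have : 0 < p.ℓ * (p.B - p.ℓ⁻¹) := by nlinarith [mul_pos p.inv_pos p.C_pos]
      exact pos_of_mul_pos_right this p.ℓ_pos.le
    obtain ⟨ε, hε⟩ : ∃ ε, ε = min (p.ℓ - p.ℓ⁻¹)
      (min ((p.ℓ * p.C - p.ℓ⁻¹ * p.B - 2) / (p.C - p.ℓ⁻¹ + (p.ℓ + p.B)))
      ((p.ℓ * p.B - p.ℓ⁻¹ * p.C - 2) / (p.ℓ + p.C + (p.B - p.ℓ⁻¹)))) := ⟨_, rfl⟩
    rw [← hε]
    have k01 : ∀ v, hform p.ℓ⁻¹ (-0) 0 (-p.ℓ) v + hform (-p.ℓ) (-0) 0 (- -p.ℓ⁻¹) v ≤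
        -(ε * nsq v) := by
      intro v
      have e1 : ε ≤ p.ℓ - p.ℓ⁻¹ := hε ▸ min_le_left _ _
      have e2 := mul_le_mul_of_nonneg_right e1 (nsq_nonneg v)
      have e3 : hform p.ℓ⁻¹ (-0) 0 (-p.ℓ) v + hform (-p.ℓ) (-0) 0 (- -p.ℓ⁻¹) v =
        -((p.ℓ - p.ℓ⁻¹) * nsq v) := by simp only [hform, nsq]; ring
      linarith
    have k02 : ∀ v, hform p.ℓ⁻¹ (-0) 0 (-p.ℓ) v + hform (-p.C) (- -p.A) 0 (-p.B) v ≤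
        -(ε * nsq v) := by
      intro v
      have e1 : ε ≤ (p.ℓ * p.C - p.ℓ⁻¹ * p.B - 2) / (p.C - p.ℓ⁻¹ + (p.ℓ + p.B)) :=
        hε ▸ (min_le_right _ _).trans (min_le_left _ _)
      have e2 := mul_le_mul_of_nonneg_right e1 (nsq_nonneg v)
      have e0 : (p.C - p.ℓ⁻¹) * (p.ℓ + p.B) - p.A ^ 2 = p.ℓ * p.C - p.ℓ⁻¹ * p.B - 2 := by
        linear_combination -hl - hA
      have e4 := hform_neg_definite hC (by linarith : 0 < p.ℓ + p.B) (a := p.A) v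
      rw [e0] at e4
      have e3 : hform p.ℓ⁻¹ (-0) 0 (-p.ℓ) v + hform (-p.C) (- -p.A) 0 (-p.B) v =
        hform (-(p.C - p.ℓ⁻¹)) p.A 0 (-(p.ℓ + p.B)) v := by simp only [hform]; ring
      linarith
    have k12 : ∀ v, hform (-p.ℓ) (-0) 0 (- -p.ℓ⁻¹) v + hform (-p.C) (- -p.A) 0 (-p.B) v ≤
        -(ε * nsq v) := by
      intro v
      have e1 : ε ≤ (p.ℓ * p.B - p.ℓ⁻¹ * p.C - 2) / (p.ℓ + p.C + (p.B - p.ℓ⁻¹)) :=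
        hε ▸ (min_le_right _ _).trans (min_le_right _ _)
      have e2 := mul_le_mul_of_nonneg_right e1 (nsq_nonneg v)
      have e0 : (p.ℓ + p.C) * (p.B - p.ℓ⁻¹) - p.A ^ 2 = p.ℓ * p.B - p.ℓ⁻¹ * p.C - 2 := by
        linear_combination -hl - hA
      have e4 := hform_neg_definite (by linarith : 0 < p.ℓ + p.C) hB (a := p.A) v
      rw [e0] at e4
      have e3 : hform (-p.ℓ) (-0) 0 (- -p.ℓ⁻¹) v + hform (-p.C) (- -p.A) 0 (-p.B) v =
        hform (-(p.ℓ + p.C)) p.A 0 (-(p.B - p.ℓ⁻¹)) v := by simp only [hform]; ring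
      linarith
    intro i j hij v
    fin_cases i <;> fin_cases j
    · exact (hij rfl).elim
    · exact k01 v
    · exact k02 v
    · rw [add_comm]; exact k01 v
    · exact (hij rfl).elim
    · exact k12 v
    · rw [add_comm]; exact k02 v
    · rw [add_comm]; exact k12 v
    · exact (hij rfl).elim

lemma q_zero_coe (x : ℂ) : p.D.q 0 (x, 1) = p.ℓ⁻¹ * (‖x‖ ^ 2 - p.ℓ ^ 2) := by
  have h : p.ℓ⁻¹ * p.ℓ = 1 := inv_mul_cancel₀ p.ℓ_pos.ne'
  change hform p.ℓ⁻¹ (-0) 0 (-p.ℓ) (x, 1) = _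
  rw [← Complex.normSq_eq_norm_sq]
  simp only [hform, map_one, star_one, mul_one]
  linear_combination p.ℓ * h

lemma q_one_coe (x : ℂ) : p.D.q 1 (x, 1) = p.ℓ * (p.ℓ⁻¹ ^ 2 - ‖x‖ ^ 2) := by
  have h : p.ℓ⁻¹ * p.ℓ = 1 := inv_mul_cancel₀ p.ℓ_pos.ne'
  change hform (-p.ℓ) (-0) 0 (- -p.ℓ⁻¹) (x, 1) = _
  rw [← Complex.normSq_eq_norm_sq]
  simp only [hform, map_one, star_one, mul_one]
  linear_combination -p.ℓ⁻¹ * h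

lemma q_two_coe (x : ℂ) : p.D.q 2 (x, 1) = p.C * (p.H.r ^ 2 - ‖x - p.H.c‖ ^ 2) := by
  have h := p.C_pos.ne'
  have hA := p.A_sq
  change hform (-p.C) (- -p.A) 0 (-p.B) (x, 1) =
    p.C * ((1 / p.C) ^ 2 - ‖x - ((p.A / p.C : ℝ) : ℂ)‖ ^ 2)
  rw [← Complex.normSq_eq_norm_sq]
  simp only [hform, map_one, star_one, mul_one, Complex.normSq_apply, Complex.sub_re, Complex.sub_im,
    Complex.ofReal_re, Complex.ofReal_im]
  field_simp
  linear_combination hA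

/-- Strict and weak inequalities for the three forms, in terms of the coordinates of the hexagon. -/
lemma q_nonpos_coe (x : ℂ) : (p.D.q 0 (x, 1) ≤ 0 ↔ ‖x‖ ≤ p.H.ℓ) ∧
    (p.D.q 1 (x, 1) ≤ 0 ↔ p.H.ℓ⁻¹ ≤ ‖x‖) ∧ (p.D.q 2 (x, 1) ≤ 0 ↔ p.H.r ≤ ‖x - p.H.c‖) := by
  have h1 := p.ℓ_pos
  have h2 := p.inv_pos
  refine ⟨?_, ?_, ?_⟩
  · rw [q_zero_coe, mul_nonpos_iff_pos_imp_nonpos]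
    simp only [h2, true_imp_iff, sub_nonpos]
    rw [sq_le_sq₀ (norm_nonneg _) h1.le]
    exact ⟨fun h => h.1, fun h => ⟨h, fun _ => h2.le⟩⟩
  · rw [q_one_coe, mul_nonpos_iff_pos_imp_nonpos]
    simp only [h1, true_imp_iff, sub_nonpos]
    rw [sq_le_sq₀ h2.le (norm_nonneg _)]
    exact ⟨fun h => h.1, fun h => ⟨h, fun _ => h1.le⟩⟩
  · rw [q_two_coe, mul_nonpos_iff_pos_imp_nonpos]
    simp only [p.C_pos, true_imp_iff, sub_nonpos]
    rw [sq_le_sq₀ p.H.r_pos.le (norm_nonneg _)]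
    exact ⟨fun h => h.1, fun h => ⟨h, fun _ => p.C_pos.le⟩⟩

lemma q_eq_zero_coe (x : ℂ) : (p.D.q 0 (x, 1) = 0 ↔ ‖x‖ = p.H.ℓ) ∧
    (p.D.q 1 (x, 1) = 0 ↔ ‖x‖ = p.H.ℓ⁻¹) ∧ (p.D.q 2 (x, 1) = 0 ↔ ‖x - p.H.c‖ = p.H.r) := by
  have h1 := p.ℓ_pos
  have h2 := p.inv_pos
  refine ⟨?_, ?_, ?_⟩
  · rw [q_zero_coe, mul_eq_zero, sub_eq_zero, sq_eq_sq₀ (norm_nonneg _) h1.le]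
    exact or_iff_right h2.ne'
  · rw [q_one_coe, mul_eq_zero, sub_eq_zero, sq_eq_sq₀ h2.le (norm_nonneg _), eq_comm (b := ‖x‖)]
    exact or_iff_right h1.ne'
  · rw [q_two_coe, mul_eq_zero, sub_eq_zero, sq_eq_sq₀ p.H.r_pos.le (norm_nonneg _),
      eq_comm (b := ‖_‖)]
    exact or_iff_right p.C_pos.ne'

/-- The cell is the full plane region, symmetric under conjugation; the hexagon of the closed upper
half-plane is its upper half. -/
lemma coe_mem_cell {x : ℂ} : (x : OnePoint ℂ) ∈ p.D.cell ↔ x ∈ p.H.region := by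
  obtain ⟨h0, h1, h2⟩ := p.q_nonpos_coe x
  rw [Hexagon.mem_region, ← h0, ← h1, ← h2]
  change (∀ i, p.D.q i (x, 1) ≤ 0) ↔ _
  rw [Fin.forall_fin_succ, Fin.forall_fin_succ, Fin.forall_fin_succ]
  simp only [IsEmpty.forall_iff, and_true]
  tauto

lemma infty_notMem_cell : OnePoint.infty ∉ p.D.cell := by
  intro h
  have h0 : hform p.ℓ⁻¹ (-0) 0 (-p.ℓ) (1, 0) ≤ 0 := h 0
  have := p.inv_pos
  simp [hform] at h0
  linarith [p.ℓ_pos]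

lemma exists_coe_of_mem_cell {z : OnePoint ℂ} (hz : z ∈ p.D.cell) :
    ∃ x ∈ p.H.region, z = (x : OnePoint ℂ) := by
  induction z using OnePoint.rec with
  | infty => exact (p.infty_notMem_cell hz).elim
  | coe x => exact ⟨x, p.coe_mem_cell.1 hz, rfl⟩

lemma exists_q_eq_zero {x : ℂ} :
    (∃ i, p.D.q i (x, 1) = 0) ↔ ‖x‖ = p.H.ℓ ∨ ‖x‖ = p.H.ℓ⁻¹ ∨ ‖x - p.H.c‖ = p.H.r := by
  obtain ⟨h0, h1, h2⟩ := p.q_eq_zero_coe x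
  rw [← h0, ← h1, ← h2, Fin.exists_fin_succ, Fin.exists_fin_succ, Fin.exists_fin_succ]
  simp only [IsEmpty.exists_iff, or_false]
  rfl

end Param

/-- On the fixed circle of a reflection, the matrix acts as the complex conjugation. -/
lemma ReflData.r_coe (D : ReflData) {i : Fin 3} {x : ℂ} (h : D.q i (x, 1) = 0) :
    D.r i x = (star x : ℂ) := by
  obtain ⟨t, ht, e⟩ := D.exists_lin_eq_star (v := (x, 1)) (by simp) h
  have h1 : D.r i x = pt (lin (D.R i) (x, 1)) := mob_eq_pt _ _
  rw [h1, e, pt_smul ht]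
  simp [pt]

lemma ReflData.imf_wm (D : ReflData) (l : List (Fin 3)) (z : OnePoint ℂ) : ∃ t : ℝ, 0 < t ∧
    imf (vec (D.wm l z)) = t * ((-1) ^ l.length * imf (vec z)) := by
  induction l with
  | nil => exact ⟨1, one_pos, by simp⟩
  | cons i l ih =>
    obtain ⟨t, ht, h⟩ := ih
    obtain ⟨s, hs, h'⟩ := imf_vec_mob (D.RG i) (D.wm l z)
    refine ⟨s * t, mul_pos hs ht, ?_⟩
    change imf (vec (mob (D.RG i) (D.wm l z))) = _
    rw [h', h, ReflData.coe_RG, D.det_R, List.length_cons, pow_succ]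
    ring

end PantsChar

end

/-! ### The developing map and the homeomorphism with the three-holed sphere -/

noncomputable section

namespace PantsChar

open Matrix Topology

/-- The affine coordinate. -/
def aff (z : OnePoint ℂ) : ℂ := z.elim 0 id

@[simp] lemma aff_coe (x : ℂ) : aff (x : OnePoint ℂ) = x := rfl

lemma continuousAt_aff (x : ℂ) : ContinuousAt aff (x : OnePoint ℂ) := by
  rw [OnePoint.continuousAt_coe]
  exact continuousAt_id

namespace Param

variable (p : Param)

/-- The developing map, for a choice of the word which moves a point into the cell. -/
def develop (z : OnePoint ℂ) : ℂ :=
  open Classical in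
  if h : ∃ l, p.D.wm l z ∈ p.D.cell then
    p.H.G ((-1) ^ h.choose.length) (aff (p.D.wm h.choose z)) else 0

variable {p} {ρ : Pi2 →* SpecialLinearGroup (Fin 2) ℝ}

lemma sq_neg_one_pow (n : ℕ) : ((-1 : ℝ) ^ n) ^ 2 = 1 := by
  rw [← pow_mul, mul_comm, pow_mul]; norm_num

lemma norm_star_sub (x : ℂ) (c : ℝ) : ‖star x - c‖ = ‖x - c‖ := by
  rw [← norm_star (x - c), star_sub]
  simp only [Complex.star_def, Complex.conj_ofReal]

lemma star_mem_region {x : ℂ} : star x ∈ p.H.region ↔ x ∈ p.H.region := by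
  simp only [Hexagon.region, Set.mem_ofPred_eq, norm_star_sub, norm_star]

lemma G_star (e : ℝ) (x : ℂ) : p.H.G e (star x) = p.H.G e x := by
  rw [Hexagon.G, Hexagon.G, norm_star_sub, norm_star]

/-- The two halves of the pair of pants are glued along the seams. -/
lemma G_neg_r {e : ℝ} (he : e ^ 2 = 1) {i : Fin 3} {x : ℂ} (hx : x ∈ p.H.region)
    (h : p.D.q i (x, 1) = 0) : p.H.G (-e) (aff (p.D.r i x)) = p.H.G e x := by
  rw [p.D.r_coe h, aff_coe, G_star]
  exact Hexagon.G_neg ((Hexagon.G_im_eq_zero he hx).2 (p.exists_q_eq_zero.1 ⟨i, h⟩))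

/-- Two words which move a point into the cell. -/
lemma wm_eq_or (hρ : p.D.Generates ρ) {l m : List (Fin 3)} {z : OnePoint ℂ}
    (hl : p.D.wm l z ∈ p.D.cell) (hm : p.D.wm m z ∈ p.D.cell) :
    ((Even l.length ↔ Even m.length) ∧ p.D.wm m = p.D.wm l) ∨
      ∃ i, (Even l.length ↔ ¬ Even m.length) ∧ p.D.wm m = p.D.wm (i :: l) ∧
        p.D.q i (vec (p.D.wm l z)) = 0 := by
  have hm' : p.D.wm (m ++ l.reverse) (p.D.wm l z) ∈ p.D.cell := by
    rwa [ReflData.wm_append, ReflData.wm_reverse_wm]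
  have e : ∀ w, p.D.wm m w = p.D.wm (m ++ l.reverse) (p.D.wm l w) := fun w => by
    rw [ReflData.wm_append, ReflData.wm_reverse_wm]
  have hlen : Even (m ++ l.reverse).length ↔ (Even m.length ↔ Even l.length) := by
    rw [List.length_append, List.length_reverse, Nat.even_add]
  rcases hρ.val_of_mem_cell hl hm' with ⟨h1, h2⟩ | ⟨i, h1, h2, h3⟩
  · refine Or.inl ⟨(hlen.1 h1).symm, ?_⟩
    funext w
    rw [e, hρ.wm_congr (m := []) h2 (by simpa using h1), ReflData.wm_nil]
  · refine Or.inr ⟨i, by rw [hlen] at h1; tauto, ?_, h3⟩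
    funext w
    rw [e, hρ.wm_congr (m := [i]) (h2.trans (by simp [ReflData.val])) (by simpa using h1),
      ReflData.wm_cons, ReflData.wm_cons, ReflData.wm_nil]

/-- The value does not depend on the word: two words which move z into the cell either act equally
with the same parity, or differ by a reflection in a seam through the point, where the two half-maps
agree. -/
lemma develop_eq (hρ : p.D.Generates ρ) {l : List (Fin 3)} {z : OnePoint ℂ}
    (hl : p.D.wm l z ∈ p.D.cell) :
    p.develop z = p.H.G ((-1) ^ l.length) (aff (p.D.wm l z)) := by
  have h : ∃ l, p.D.wm l z ∈ p.D.cell := ⟨l, hl⟩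
  rw [develop, dif_pos h]
  have hm := h.choose_spec
  set m := h.choose
  rcases wm_eq_or hρ hl hm with ⟨h1, h2⟩ | ⟨i, h1, h2, h3⟩
  · rw [h2]
    congr 1
    rcases Nat.even_or_odd l.length with h4 | h4
    · rw [h4.neg_one_pow, (h1.1 h4).neg_one_pow]
    · rw [h4.neg_one_pow, Odd.neg_one_pow]
      rw [← Nat.not_even_iff_odd] at h4 ⊢
      tauto
  · obtain ⟨x, hx, hxl⟩ := p.exists_coe_of_mem_cell hl
    rw [h2, ReflData.wm_cons, hxl, aff_coe, ← G_neg_r (sq_neg_one_pow l.length) hx (i := i)]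
    · congr 1
      rcases Nat.even_or_odd l.length with h4 | h4
      · rw [h4.neg_one_pow, Odd.neg_one_pow]
        exact Nat.not_even_iff_odd.1 (h1.1 h4)
      · rw [h4.neg_one_pow, Even.neg_one_pow, neg_neg]
        rw [← Nat.not_even_iff_odd] at h4
        tauto
    · rwa [hxl] at h3

/-- Near z the developing map is given by one formula on the preimage of the cell and, at a seam, by
a second one on the preimage of the mirror cell; together these sets form a neighbourhood. -/
lemma continuousAt_develop (hρ : p.D.Generates ρ) {l : List (Fin 3)} {z : OnePoint ℂ}
    (hl : p.D.wm l z ∈ p.D.cell) : ContinuousAt p.develop z := by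
  have key : ∀ m : List (Fin 3), p.D.wm m z ∈ p.D.cell →
      ContinuousWithinAt p.develop (p.D.wm m ⁻¹' p.D.cell) z := by
    intro m hm
    obtain ⟨x, hx, hxm⟩ := p.exists_coe_of_mem_cell hm
    have h1 : ContinuousWithinAt (fun w => p.H.G ((-1) ^ m.length) (aff w)) p.D.cell
        (p.D.wm m z) := by
      rw [hxm]
      refine ContinuousWithinAt.comp (g := p.H.G ((-1) ^ m.length)) (f := aff) (t := p.H.region) ?_ (continuousAt_aff x).continuousWithinAt ?_
      · exact Hexagon.continuousOn_G _ _ hx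
      · intro w hw
        obtain ⟨y, hy, rfl⟩ := p.exists_coe_of_mem_cell hw
        exact hy
    have h2 := h1.comp (f := p.D.wm m) (s := p.D.wm m ⁻¹' p.D.cell)
      (p.D.continuous_wm m).continuousAt.continuousWithinAt (Set.mapsTo_preimage (p.D.wm m) p.D.cell)
    exact h2.congr (fun w hw => develop_eq hρ hw) (develop_eq hρ hm)
  rcases p.D.cell_mem_nhds hl with h | ⟨i, hi, h⟩
  · exact (key l hl).continuousAt ((p.D.continuous_wm l).continuousAt h)
  · have hl' : p.D.wm (i :: l) z ∈ p.D.cell := by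
      obtain ⟨x, hx, hxl⟩ := p.exists_coe_of_mem_cell hl
      rw [hxl] at hi
      rw [ReflData.wm_cons, hxl, p.D.r_coe hi, coe_mem_cell, star_mem_region]
      exact hx
    refine ((key l hl).union (key (i :: l) hl')).continuousAt ?_
    exact (p.D.continuous_wm l).continuousAt h

lemma develop_moeb (hρ : p.D.Generates ρ) (γ : Pi2) {z : OnePoint ℂ} {l : List (Fin 3)}
    (hl : p.D.wm l z ∈ p.D.cell) : p.develop (moeb ρ γ z) = p.develop z := by
  obtain ⟨m, -, hm, rfl⟩ := ReflData.exists_val_eq γ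
  have e : p.D.wm (l ++ m.reverse) (moeb ρ (ReflData.val m) z) = p.D.wm l z := by
    rw [← hρ.wm_even hm, ReflData.wm_append, ReflData.wm_reverse_wm]
  rw [develop_eq hρ hl, develop_eq hρ (l := l ++ m.reverse) (by rwa [e]), e]
  congr 1
  rw [List.length_append, List.length_reverse, pow_add, hm.neg_one_pow, mul_one]

lemma develop_mem (hρ : p.D.Generates ρ) {z : OnePoint ℂ} {l : List (Fin 3)}
    (hl : p.D.wm l z ∈ p.D.cell) :
    ‖p.develop z‖ ≤ 4 ∧ 1 ≤ ‖p.develop z - 2‖ ∧ 1 ≤ ‖p.develop z + 2‖ := by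
  rw [develop_eq hρ hl]
  obtain ⟨x, hx, hxl⟩ := p.exists_coe_of_mem_cell hl
  rw [hxl]
  exact Hexagon.G_mem (sq_neg_one_pow _) hx

lemma mem_bordered (hρ : p.D.Generates ρ) {z : OnePoint ℂ} :
    z ∈ bordered ρ ↔ 0 ≤ imf (vec z) ∧ ∃ l, p.D.wm l z ∈ p.D.cell := by
  rw [bordered, Set.mem_inter_iff, mem_closedUpper, hρ.mem_discontinuitySet]

/-- The sign of the imaginary part of a point moved into the cell. -/
lemma im_of_wm_eq {l : List (Fin 3)} {z : OnePoint ℂ} {x : ℂ} (hz : 0 ≤ imf (vec z))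
    (h : p.D.wm l z = x) : 0 ≤ (-1) ^ l.length * x.im := by
  obtain ⟨t, ht, e⟩ := p.D.imf_wm l z
  rw [h] at e
  have : imf (vec (x : OnePoint ℂ)) = x.im := by simp [imf]
  rw [← this, e]
  have h2 := sq_neg_one_pow l.length
  have : (-1 : ℝ) ^ l.length * (t * ((-1) ^ l.length * imf (vec z))) = t * imf (vec z) := by
    linear_combination (t * imf (vec z)) * h2
  rw [this]
  positivity

lemma mem_idealCircle_iff {l : List (Fin 3)} {z : OnePoint ℂ} {x : ℂ}
    (h : p.D.wm l z = x) : z ∈ idealCircle ↔ x.im = 0 := by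
  obtain ⟨t, ht, e⟩ := p.D.imf_wm l z
  rw [h] at e
  have : imf (vec (x : OnePoint ℂ)) = x.im := by simp [imf]
  rw [mem_idealCircle, ← this, e, mul_eq_zero, mul_eq_zero]
  simp [ht.ne']

/-- The value determines the moved point up to conjugation, and the parity of the word determines
the sign of its imaginary part. For equal parities the moved points agree. For opposite parities the
value is real, the point lies on a seam, and one reflection in this seam restores an even word. -/
lemma exists_moeb_eq_of_develop_eq (hρ : p.D.Generates ρ) {z w : OnePoint ℂ} (hz : z ∈ bordered ρ)
    (hw : w ∈ bordered ρ) (h : p.develop z = p.develop w) : ∃ γ, moeb ρ γ z = w := by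
  obtain ⟨hz0, l, hl⟩ := (mem_bordered hρ).1 hz
  obtain ⟨hw0, m, hm⟩ := (mem_bordered hρ).1 hw
  rw [develop_eq hρ hl, develop_eq hρ hm] at h
  obtain ⟨x, hx, hxl⟩ := p.exists_coe_of_mem_cell hl
  obtain ⟨y, hy, hym⟩ := p.exists_coe_of_mem_cell hm
  rw [hxl, hym, aff_coe, aff_coe] at h
  have hx0 := im_of_wm_eq hz0 hxl
  have hy0 := im_of_wm_eq hw0 hym
  obtain ⟨n₁, n₂⟩ := Hexagon.norm_eq_of_G_eq (sq_neg_one_pow _) (sq_neg_one_pow _) hx hy h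
  obtain ⟨hre, him⟩ := Hexagon.re_eq_of_norm_eq n₁ n₂
  by_cases hpar : Even l.length ↔ Even m.length
  · have he : (-1 : ℝ) ^ l.length = (-1) ^ m.length := by
      rcases Nat.even_or_odd l.length with h4 | h4
      · rw [h4.neg_one_pow, (hpar.1 h4).neg_one_pow]
      · rw [h4.neg_one_pow, Odd.neg_one_pow]
        rw [← Nat.not_even_iff_odd] at h4 ⊢
        tauto
    have hxy : x = y := by
      refine Complex.ext hre ?_
      have h5 : (-1) ^ l.length * x.im = (-1) ^ l.length * y.im := by
        rw [← sq_eq_sq₀ hx0 (he ▸ hy0), mul_pow, mul_pow, him]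
      exact mul_left_cancel₀ (pow_ne_zero _ (by norm_num)) h5
    refine ⟨ReflData.val (m.reverse ++ l), ?_⟩
    rw [← hρ.wm_even, ReflData.wm_append, hxl, hxy, ← hym, ReflData.wm_reverse_wm]
    rw [List.length_append, List.length_reverse, Nat.even_add]
    tauto
  · have he : (-1 : ℝ) ^ m.length = -(-1) ^ l.length := by
      rcases Nat.even_or_odd l.length with h4 | h4
      · rw [h4.neg_one_pow, Odd.neg_one_pow]
        rw [← Nat.not_even_iff_odd]
        tauto
      · rw [h4.neg_one_pow, Even.neg_one_pow, neg_neg]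
        rw [← Nat.not_even_iff_odd] at h4
        tauto
    rw [he] at h hy0
    have h6 := Hexagon.G_im_eq_zero_of_eq h (sq_neg_one_pow _)
    rw [Hexagon.G_im_eq_zero (sq_neg_one_pow _) hx] at h6
    obtain ⟨i, hi⟩ := p.exists_q_eq_zero.2 h6
    have hxy : star x = y := by
      refine Complex.ext hre ?_
      have h5 : (-1) ^ l.length * x.im = (-1) ^ l.length * -y.im := by
        rw [← sq_eq_sq₀ hx0 (by linarith), mul_pow, mul_pow, him, neg_sq]
      have h6 := mul_left_cancel₀ (pow_ne_zero _ (by norm_num)) h5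
      rw [Complex.star_def, Complex.conj_im, h6, neg_neg]
    refine ⟨ReflData.val (m.reverse ++ (i :: l)), ?_⟩
    rw [← hρ.wm_even, ReflData.wm_append, ReflData.wm_cons, hxl, p.D.r_coe hi, hxy, ← hym,
      ReflData.wm_reverse_wm]
    rw [List.length_append, List.length_reverse, Nat.even_add, List.length_cons, Nat.even_add_one]
    tauto

/-- The upper half of the pants is reached from the cell itself, the lower half from its image under
the reflection 0. -/
lemma exists_develop_eq (hρ : p.D.Generates ρ) (w : ThreeHoledSphere) :
    ∃ z ∈ bordered ρ, p.develop z = w := by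
  obtain ⟨w, h1, h2, h3⟩ := w
  rcases le_total 0 w.im with h | h
  · obtain ⟨x, hx, hx0, hG⟩ := Hexagon.exists_G_eq (H := p.H) (e := 1) h1 h2 h3 (by norm_num)
      (by linarith)
    have hc : p.D.wm [] (x : OnePoint ℂ) ∈ p.D.cell := p.coe_mem_cell.2 hx
    refine ⟨x, (mem_bordered hρ).2 ⟨?_, [], hc⟩, ?_⟩
    · simpa [imf] using hx0
    · rw [develop_eq hρ hc]
      simpa using hG
  · obtain ⟨x, hx, hx0, hG⟩ := Hexagon.exists_G_eq (H := p.H) (e := -1) h1 h2 h3 (by norm_num)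
      (by linarith)
    have e : p.D.wm [0] (p.D.r 0 (x : OnePoint ℂ)) = x := p.D.r_r 0 x
    have hc : p.D.wm [0] (p.D.r 0 (x : OnePoint ℂ)) ∈ p.D.cell := by
      rw [e]; exact p.coe_mem_cell.2 hx
    refine ⟨p.D.r 0 x, (mem_bordered hρ).2 ⟨?_, [0], hc⟩, ?_⟩
    · obtain ⟨t, ht, e'⟩ := p.D.imf_wm [0] (x : OnePoint ℂ)
      change imf (vec (p.D.r 0 x)) = _ at e'
      rw [e']
      have : imf (vec (x : OnePoint ℂ)) = x.im := by simp [imf]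
      rw [this]
      have : (-1 : ℝ) ^ [(0 : Fin 3)].length = -1 := by simp
      rw [this]
      positivity
    · rw [develop_eq hρ hc, e]
      simpa using hG

/-- The map from the bordered surface to the three-holed sphere. -/
def toPants (hρ : p.D.Generates ρ) (z : bordered ρ) : ThreeHoledSphere :=
  ⟨p.develop z, develop_mem hρ ((mem_bordered hρ).1 z.2).2.choose_spec⟩

lemma continuous_toPants (hρ : p.D.Generates ρ) : Continuous (toPants hρ) := by
  refine Continuous.subtype_mk (continuous_iff_continuousAt.2 fun z => ?_) _
  exact (continuousAt_develop hρ ((mem_bordered hρ).1 z.2).2.choose_spec).comp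
    continuousAt_subtype_val

/-- The map from the quotient surface to the three-holed sphere. -/
def quotientToPants (hρ : p.D.Generates ρ) : QuotientSurface ρ → ThreeHoledSphere :=
  Quotient.lift (toPants hρ) (by
    rintro a b ⟨γ, h⟩
    apply Subtype.ext
    change p.develop a = p.develop b
    rw [← h, develop_moeb hρ γ ((mem_bordered hρ).1 a.2).2.choose_spec])

lemma bijective_quotientToPants (hρ : p.D.Generates ρ) :
    Function.Bijective (quotientToPants hρ) := by
  constructor
  · rintro ⟨a⟩ ⟨b⟩ h
    exact Quotient.sound (exists_moeb_eq_of_develop_eq hρ a.2 b.2 (congrArg Subtype.val h))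
  · intro w
    obtain ⟨z, hz, h⟩ := exists_develop_eq hρ w
    exact ⟨Quotient.mk _ ⟨z, hz⟩, Subtype.ext h⟩

/-- The hexagon and its mirror image in the side 0 form a compact set which meets every orbit; a
word of odd length is prolonged by the reflection 0. -/
lemma compactSpace_quotient (hρ : p.D.Generates ρ) : CompactSpace (QuotientSurface ρ) := by
  set K : Set (OnePoint ℂ) := {z | 0 ≤ imf (vec z)} ∩ (p.D.cell ∪ p.D.r 0 ⁻¹' p.D.cell) with hK
  have hKc : IsClosed K := by
    refine IsClosed.inter ?_ (p.D.isClosed_cell.union (p.D.isClosed_cell.preimage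
      (p.D.continuous_r 0)))
    simp_rw [imf_eq]
    exact isClosed_hform_nonneg _ _ _ _
  have hKb : K ⊆ bordered ρ := by
    rintro z ⟨h0, h | h⟩
    · exact (mem_bordered hρ).2 ⟨h0, [], h⟩
    · exact (mem_bordered hρ).2 ⟨h0, [0], h⟩
  have : CompactSpace K := isCompact_iff_compactSpace.1 hKc.isCompact
  refine Function.Surjective.compactSpace (f := fun z : K =>
    (Quotient.mk (orbitSetoid ρ) ⟨z, hKb z.2⟩ : QuotientSurface ρ)) ?_ ?_
  · exact continuous_quotient_mk'.comp (continuous_subtype_val.subtype_mk _)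
  · rintro ⟨z⟩
    obtain ⟨h0, l, hl⟩ := (mem_bordered hρ).1 z.2
    rcases Nat.even_or_odd l.length with he | ho
    · refine ⟨⟨p.D.wm l z, ?_, Or.inl hl⟩, ?_⟩
      · obtain ⟨t, ht, e⟩ := p.D.imf_wm l z
        change 0 ≤ imf (vec (p.D.wm l z))
        rw [e, he.neg_one_pow, one_mul]
        positivity
      · refine Quotient.sound ((orbitSetoid ρ).symm ⟨ReflData.val l, ?_⟩)
        rw [← hρ.wm_even he]
    · have he : Even (0 :: l).length := by
        rw [List.length_cons, Nat.even_add_one, Nat.not_even_iff_odd]; exact ho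
      refine ⟨⟨p.D.wm (0 :: l) z, ?_, Or.inr ?_⟩, ?_⟩
      · obtain ⟨t, ht, e⟩ := p.D.imf_wm (0 :: l) z
        change 0 ≤ imf (vec (p.D.wm (0 :: l) z))
        rw [e, he.neg_one_pow, one_mul]
        positivity
      · rw [Set.mem_preimage, ReflData.wm_cons, ReflData.r_r]
        exact hl
      · refine Quotient.sound ((orbitSetoid ρ).symm ⟨ReflData.val (0 :: l), ?_⟩)
        rw [← hρ.wm_even he]

/-- The quotient surface is homeomorphic to the three-holed sphere. -/
def homeo (hρ : p.D.Generates ρ) : QuotientSurface ρ ≃ₜ ThreeHoledSphere :=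
  have := compactSpace_quotient hρ
  Continuous.homeoOfEquivCompactToT2 (f := Equiv.ofBijective _ (bijective_quotientToPants hρ))
    ((continuous_toPants hρ).quotient_lift _)

lemma homeo_mk (hρ : p.D.Generates ρ) (z : bordered ρ) :
    homeo hρ (Quotient.mk (orbitSetoid ρ) z) = toPants hρ z := rfl

/-- The preimages of the boundary circles are unions of translates of the sides of the cell. -/
lemma homeo_mem_boundaryCircle (hρ : p.D.Generates ρ) {z : bordered ρ} {l : List (Fin 3)} {x : ℂ}
    (hx : x ∈ p.H.region) (h : p.D.wm l z = x) (k : Fin 3) :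
    homeo hρ (Quotient.mk (orbitSetoid ρ) z) ∈ boundaryCircle k ↔ x ∈ p.H.side k := by
  rw [homeo_mk, ← Hexagon.G_mem_boundaryCircle (sq_neg_one_pow l.length) hx]
  have hc : p.D.wm l z ∈ p.D.cell := by rw [h]; exact p.coe_mem_cell.2 hx
  have : toPants hρ z = ⟨p.H.G ((-1) ^ l.length) x, Hexagon.G_mem (sq_neg_one_pow _) hx⟩ := by
    apply Subtype.ext
    change p.develop z = _
    rw [develop_eq hρ hc, h, aff_coe]
  rw [this]

lemma matchesBoundary_homeo (hρ : p.D.Generates ρ) : MatchesBoundary ρ (homeo hρ) := by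
  intro z
  obtain ⟨-, l, hl⟩ := (mem_bordered hρ).1 z.2
  obtain ⟨x, hx, hxl⟩ := p.exists_coe_of_mem_cell hl
  rw [mem_idealCircle_iff hxl, p.H.im_eq_zero_iff_side]
  exact exists_congr fun k => (homeo_mem_boundaryCircle hρ hx hxl k).symm

end Param

end PantsChar

end

noncomputable section

namespace PantsChar

open Matrix Topology

/-! ### The boundary components and their stabilizers -/

/-- Two reflections generate a dihedral group, whose even words are powers of their product. -/
lemma ReflData.val_mem_zpowers {i j : Fin 3} : ∀ l : List (Fin 3), (∀ n ∈ l, n = i ∨ n = j) →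
    Even l.length → ReflData.val l ∈ Subgroup.zpowers (ReflData.letter i * ReflData.flip (letter j))
  | [], _, _ => one_mem _
  | [_], _, h => by simp at h
  | a :: b :: l, h, he => by
    have hab : ReflData.letter a * ReflData.flip (letter b) ∈
        Subgroup.zpowers (ReflData.letter i * ReflData.flip (letter j)) := by
      have hf : ∀ n, ReflData.flip (letter n) = (letter n)⁻¹ := fun n =>
        eq_inv_of_mul_eq_one_right (letter_mul_flip n)
      rcases h a (by simp) with rfl | rfl <;> rcases h b (by simp) with rfl | rfl
      · rw [letter_mul_flip]; exact one_mem _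
      · exact Subgroup.mem_zpowers _
      · rw [hf, hf, ← inv_mem_iff, _root_.mul_inv_rev, inv_inv]
        exact Subgroup.mem_zpowers _
      · rw [letter_mul_flip]; exact one_mem _
    rw [val, val, map_mul, flip_flip, ← mul_assoc]
    refine mul_mem hab (val_mem_zpowers l (fun n hn => h n (by simp [hn])) ?_)
    simpa [Nat.even_add_one] using he

namespace Param

variable {p : Param} {ρ : Pi2 →* SpecialLinearGroup (Fin 2) ℝ}

lemma mem_boundaryPreimage (hρ : p.D.Generates ρ) {k : Fin 3} {z : OnePoint ℂ} :
    z ∈ boundaryPreimage ρ (homeo hρ) k ↔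
      ∃ l, ∃ x ∈ p.H.region, x ∈ p.H.side k ∧ p.D.wm l z = (x : OnePoint ℂ) := by
  constructor
  · rintro ⟨hz, h⟩
    obtain ⟨-, l, hl⟩ := (mem_bordered hρ).1 hz
    obtain ⟨x, hx, hxl⟩ := p.exists_coe_of_mem_cell hl
    exact ⟨l, x, hx, (homeo_mem_boundaryCircle hρ (z := ⟨z, hz⟩) hx hxl k).1 h, hxl⟩
  · rintro ⟨l, x, hx, hxk, hxl⟩
    have hz : z ∈ bordered ρ := by
      refine (mem_bordered hρ).2 ⟨?_, l, by rw [hxl]; exact p.coe_mem_cell.2 hx⟩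
      have := (mem_idealCircle_iff hxl).2 ((p.H.im_eq_zero_iff_side x).2 ⟨k, hxk⟩)
      exact (mem_idealCircle.1 this).ge
    exact ⟨hz, (homeo_mem_boundaryCircle hρ (z := ⟨z, hz⟩) hx hxl k).2 hxk⟩

lemma mem_side_of_mem_boundaryPreimage (hρ : p.D.Generates ρ) {k : Fin 3} {z : OnePoint ℂ}
    (hz : z ∈ boundaryPreimage ρ (homeo hρ) k) {l : List (Fin 3)} (hl : p.D.wm l z ∈ p.D.cell) :
    ∃ x ∈ p.H.region, x ∈ p.H.side k ∧ p.D.wm l z = (x : OnePoint ℂ) := by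
  obtain ⟨hb, h⟩ := hz
  obtain ⟨x, hx, hxl⟩ := p.exists_coe_of_mem_cell hl
  exact ⟨x, hx, (homeo_mem_boundaryCircle hρ (z := ⟨z, hb⟩) hx hxl k).1 h, hxl⟩

/-- The points of a component of the preimage of a boundary circle are moved into the cell by the
two reflections in the seams which meet this boundary circle. -/
lemma exists_wm_of_mem_component (hρ : p.D.Generates ρ) {k m : Fin 3}
    (hm : ∀ x ∈ p.H.region, x ∈ p.H.side k → p.D.q m (x, 1) ≠ 0) {z w : OnePoint ℂ}
    (hz : z ∈ p.D.cell) (hzB : z ∈ boundaryPreimage ρ (homeo hρ) k)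
    (hw : w ∈ connectedComponentIn (boundaryPreimage ρ (homeo hρ) k) z) :
    ∃ l, (∀ n ∈ l, n ≠ m) ∧ p.D.wm l w ∈ p.D.cell := by
  set B := boundaryPreimage ρ (homeo hρ) k
  set A : OnePoint ℂ → Prop := fun w => ∃ l, (∀ n ∈ l, n ≠ m) ∧ p.D.wm l w ∈ p.D.cell with hA
  -- This says that the word acts like one which avoids the reflection m. As no point over the k-th
  -- circle lies on the seam m inside the cell, the condition does not depend on the word chosen for
  -- w.
  set A' : List (Fin 3) → Prop := fun l => ∃ l', (∀ n ∈ l', n ≠ m) ∧ p.D.wm l = p.D.wm l' with hA'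
  have h1 : ∀ w ∈ B, ∀ l, p.D.wm l w ∈ p.D.cell → (A w ↔ A' l) := by
    intro w hw l hl
    constructor
    · rintro ⟨l', hl', hw'⟩
      rcases wm_eq_or hρ hw' hl with ⟨-, e⟩ | ⟨n, -, e, hn⟩
      · exact ⟨l', hl', e⟩
      · refine ⟨n :: l', ?_, e⟩
        obtain ⟨x, hx, hxk, hxl⟩ := mem_side_of_mem_boundaryPreimage hρ hw hw'
        rw [hxl] at hn
        rintro n' (_ | ⟨_, hn'⟩)
        · rintro rfl
          exact hm x hx hxk hn
        · exact hl' n' hn'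
    · rintro ⟨l', hl', e⟩
      exact ⟨l', hl', e ▸ hl⟩
  have h2 : ∀ n, n ≠ m → ∀ l, (A' l ↔ A' (n :: l)) := by
    intro n hn l
    constructor
    · rintro ⟨l', hl', e⟩
      refine ⟨n :: l', ?_, ?_⟩
      · rintro n' (_ | ⟨_, hn'⟩)
        · exact hn
        · exact hl' n' hn'
      · funext w
        rw [ReflData.wm_cons, ReflData.wm_cons, e]
    · rintro ⟨l', hl', e⟩
      refine ⟨n :: l', ?_, ?_⟩
      · rintro n' (_ | ⟨_, hn'⟩)
        · exact hn
        · exact hl' n' hn'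
      · funext w
        rw [ReflData.wm_cons, ← e, ReflData.wm_cons, ReflData.r_r]
  -- The property A is locally constant on the boundary preimage: passing to a neighbouring cell
  -- uses a seam other than m. It therefore propagates along the component.
  have h3 : ∀ x ∈ B, ∀ᶠ y in 𝓝 x, y ∈ B → (A x ↔ A y) := by
    intro x hx
    obtain ⟨l, y, hy, hyk, hyl⟩ := (mem_boundaryPreimage hρ).1 hx
    have hl : p.D.wm l x ∈ p.D.cell := by rw [hyl]; exact p.coe_mem_cell.2 hy
    rcases p.D.cell_mem_nhds hl with h | ⟨i, hi, h⟩
    · filter_upwards [(p.D.continuous_wm l).continuousAt h] with w hw hwB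
      rw [h1 x hx l hl, h1 w hwB l hw]
    · have him : i ≠ m := by
        rintro rfl
        rw [hyl] at hi
        exact hm y hy hyk hi
      filter_upwards [(p.D.continuous_wm l).continuousAt h] with w hw hwB
      rw [h1 x hx l hl]
      rcases hw with hw | hw
      · rw [h1 w hwB l hw]
      · rw [h1 w hwB (i :: l) hw, h2 i him]
  have h4 : A z → A w := by
    refine (isPreconnected_connectedComponentIn (F := B) (x := z)).induction₂'
      (fun x y => A x → A y) ?_ (fun x y z _ _ _ h h' => h' ∘ h)
      (mem_connectedComponentIn hzB) hw
    intro x hx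
    have hCB := connectedComponentIn_subset B z
    filter_upwards [nhdsWithin_le_nhds (h3 x (hCB hx)), self_mem_nhdsWithin] with y hy hyC
    have := hy (hCB hyC)
    exact ⟨this.1, this.2⟩
  exact h4 ⟨[], by simp, hz⟩

/-- A side of the cell on the real axis yields an element which corresponds to a boundary
component. -/
lemma correspondsTo_of_side (hρ : p.D.Generates ρ) {k i j m : Fin 3}
    (hijm : ∀ n, n ≠ m → n = i ∨ n = j)
    (hm : ∀ x ∈ p.H.region, x ∈ p.H.side k → p.D.q m (x, 1) ≠ 0) {s t o : ℝ}
    (hJ : ∀ u ∈ Set.Icc s t, (u : ℂ) ∈ p.H.region ∧ (u : ℂ) ∈ p.H.side k)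
    (hs : p.D.q i ((s : ℂ), 1) = 0) (ht : p.D.q j ((t : ℂ), 1) = 0) (ho : o ∈ Set.Icc s t)
    (hoq : ∀ n, p.D.q n ((o : ℂ), 1) ≠ 0) :
    CorrespondsTo ρ (homeo hρ) (ReflData.letter i * ReflData.flip (ReflData.letter j)) k := by
  have hst : s ≤ t := ho.1.trans ho.2
  set J : Set (OnePoint ℂ) := (fun u : ℝ => ((u : ℂ) : OnePoint ℂ)) '' Set.Icc s t with hJdef
  set B := boundaryPreimage ρ (homeo hρ) k with hB
  have hJB : ∀ l : List (Fin 3), ∀ z, p.D.wm l z ∈ J → z ∈ B := by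
    rintro l z ⟨u, hu, e⟩
    exact (mem_boundaryPreimage hρ).2 ⟨l, u, (hJ u hu).1, (hJ u hu).2, e.symm⟩
  set z₀ : OnePoint ℂ := ((o : ℂ) : OnePoint ℂ)
  have hz₀ : z₀ ∈ J := ⟨o, ho, rfl⟩
  have hz₀B : z₀ ∈ B := hJB [] z₀ hz₀
  have hz₀c : z₀ ∈ p.D.cell := p.coe_mem_cell.2 (hJ o ho).1
  refine ⟨z₀, hz₀B, Set.Subset.antisymm ?_ ?_⟩
  -- The image of z₀ under δ is moved back into the cell by a word in the reflections i and j. As z₀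
  -- lies on no seam, the total word is trivial, so δ is the inverse of that word.
  · intro δ hδ
    have h1 : moeb ρ δ z₀ ∈ connectedComponentIn B z₀ := by
      have hδ' : moeb ρ δ '' connectedComponentIn B z₀ = connectedComponentIn B z₀ := hδ
      rw [← hδ']
      exact ⟨z₀, mem_connectedComponentIn hz₀B, rfl⟩
    obtain ⟨l, hl, hc⟩ := exists_wm_of_mem_component hρ hm hz₀c hz₀B h1
    obtain ⟨l', -, he, rfl⟩ := ReflData.exists_val_eq δ
    rw [← hρ.wm_even he, ← ReflData.wm_append] at hc
    rcases hρ.val_of_mem_cell hz₀c hc with ⟨h2, h3⟩ | ⟨n, -, -, hn⟩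
    · rw [List.length_append, Nat.even_add] at h2
      have hle := h2.2 he
      rw [ReflData.val_append, ReflData.iterate_flip_even hle] at h3
      rw [eq_inv_of_mul_eq_one_right h3]
      exact inv_mem (ReflData.val_mem_zpowers l (fun n hn => hijm n (hl n hn)) hle)
    · exact (hoq n hn).elim
  · have hJpre : IsPreconnected J := by
      refine isPreconnected_Icc.image _ (Continuous.continuousOn ?_)
      exact OnePoint.continuous_coe.comp Complex.continuous_ofReal
    have hfix : ∀ (n : Fin 3) (u : ℝ), p.D.q n ((u : ℂ), 1) = 0 →
        p.D.r n ((u : ℂ) : OnePoint ℂ) = ((u : ℂ) : OnePoint ℂ) := by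
      intro n u hu
      rw [p.D.r_coe hu, Complex.star_def, Complex.conj_ofReal]
    have hsJ : ((s : ℂ) : OnePoint ℂ) ∈ J := ⟨s, Set.left_mem_Icc.2 hst, rfl⟩
    have htJ : ((t : ℂ) : OnePoint ℂ) ∈ J := ⟨t, Set.right_mem_Icc.2 hst, rfl⟩
    -- The segment J and its translates by r i and by r i ∘ r j form a chain: consecutive ones share
    -- an end, fixed by the corresponding reflection. So z₀ and its image lie in the same component.
    have hTpre : IsPreconnected (J ∪ (p.D.r i '' J ∪ p.D.r i '' (p.D.r j '' J))) := by
      refine IsPreconnected.union ((s : ℂ) : OnePoint ℂ) hsJ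
        (Or.inl ⟨_, hsJ, hfix i s hs⟩) hJpre ?_
      refine IsPreconnected.union (p.D.r i ((t : ℂ) : OnePoint ℂ)) ⟨_, htJ, rfl⟩
        ⟨_, ⟨_, htJ, hfix j t ht⟩, rfl⟩ ?_ ?_
      · exact hJpre.image _ (p.D.continuous_r i).continuousOn
      · exact (hJpre.image _ (p.D.continuous_r j).continuousOn).image _
          (p.D.continuous_r i).continuousOn
    have hTB : J ∪ (p.D.r i '' J ∪ p.D.r i '' (p.D.r j '' J)) ⊆ B := by
      rintro z (hz | ⟨z, hz, rfl⟩ | ⟨_, ⟨z, hz, rfl⟩, rfl⟩)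
      · exact hJB [] z hz
      · exact hJB [i] _ (by simpa using hz)
      · exact hJB [j, i] _ (by simpa using hz)
    have hTC := hTpre.subset_connectedComponentIn (Or.inl hz₀) hTB
    have hγ : moeb ρ (ReflData.letter i * ReflData.flip (ReflData.letter j)) z₀ =
        p.D.r i (p.D.r j z₀) := by
      have := hρ.wm_even (l := [i, j]) (by simp) z₀
      simp only [ReflData.val, map_one, mul_one] at this
      exact this.symm
    have hmem : moeb ρ (ReflData.letter i * ReflData.flip (ReflData.letter j)) z₀ ∈
        connectedComponentIn B z₀ := by
      rw [hγ]
      exact hTC (Or.inr (Or.inr ⟨_, ⟨_, hz₀, rfl⟩, rfl⟩))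
    have himg := image_component_eq (mem_connectedComponentIn hz₀B) hmem
    let stab : Subgroup Pi2 :=
      { carrier := {δ | moeb ρ δ '' connectedComponentIn B z₀ = connectedComponentIn B z₀}
        mul_mem' := by
          intro a b ha hb
          have ha' : moeb ρ a '' connectedComponentIn B z₀ = connectedComponentIn B z₀ := ha
          have hb' : moeb ρ b '' connectedComponentIn B z₀ = connectedComponentIn B z₀ := hb
          change moeb ρ (a * b) '' _ = _
          rw [show moeb ρ (a * b) = moeb ρ a ∘ moeb ρ b from funext fun z => moeb_mul _ _ _ _,
            Set.image_comp, hb', ha']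
        one_mem' := by
          change moeb ρ 1 '' _ = _
          rw [show moeb ρ 1 = id from funext fun z => moeb_one _ _, Set.image_id]
        inv_mem' := by
          intro a ha
          have ha' : moeb ρ a '' connectedComponentIn B z₀ = connectedComponentIn B z₀ := ha
          change moeb ρ a⁻¹ '' _ = _
          conv_lhs => rw [← ha']
          rw [← Set.image_comp, show moeb ρ a⁻¹ ∘ moeb ρ a = id from
            funext fun z => moeb_inv_moeb _ _ _, Set.image_id] }
    exact (Subgroup.zpowers_le (H := stab)).2 himg

/-- Each real side of the hexagon joins two seams and is disjoint from the third, whose index is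
listed here. -/
lemma q_ne_zero_of_side {k : Fin 3} {x : ℂ} (hx : x ∈ p.H.side k) :
    p.D.q (![2, 1, 0] k) (x, 1) ≠ 0 := by
  obtain ⟨h0, h1, h2⟩ := p.q_eq_zero_coe x
  have := p.H.c_pos
  have := p.H.inv_pos
  have := p.H.lt_sub
  have := p.H.add_lt
  have := p.H.r_pos
  have := norm_nonneg x
  have := norm_nonneg (x - p.H.c)
  fin_cases k
  · change p.D.q 2 (x, 1) ≠ 0
    have e : ‖x - p.H.c‖ = ‖x‖ + p.H.c := hx
    rw [Ne, h2]
    intro h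
    linarith
  · change p.D.q 1 (x, 1) ≠ 0
    have e : ‖x - p.H.c‖ = ‖x‖ - p.H.c := hx
    rw [Ne, h1]
    intro h
    linarith
  · change p.D.q 0 (x, 1) ≠ 0
    have e : ‖x - p.H.c‖ = p.H.c - ‖x‖ := hx
    rw [Ne, h0]
    intro h
    linarith

/-- The images of the free generators and the inverse of their product correspond to the three
boundary components. -/
theorem isRealPEmbeddingWith (hρ : p.D.Generates ρ) : IsRealPEmbeddingWith ρ peripheral := by
  -- The circle 1, around 2, lies under the side from c + r to ℓ, between the seams 2 and 0, which
  -- gives Z; the circle 2 gives Y. This explains the transposition.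
  refine ⟨hρ.isDiscreteEmbedding, homeo hρ, matchesBoundary_homeo hρ, Equiv.swap 1 2, ?_⟩
  have hc := p.H.c_pos
  have hi := p.H.inv_pos
  have h1 := p.H.lt_sub
  have h2 := p.H.add_lt
  have hr := p.H.r_pos
  have n₁ : ∀ u : ℝ, ‖(u : ℂ)‖ = |u| := fun u => by rw [Complex.norm_real, Real.norm_eq_abs]
  have n₂ : ∀ u : ℝ, ‖(u : ℂ) - p.H.c‖ = |u - p.H.c| := fun u => by
    rw [← Complex.ofReal_sub, Complex.norm_real, Real.norm_eq_abs]
  have hq : ∀ u : ℝ, (p.D.q 0 ((u : ℂ), 1) = 0 ↔ |u| = p.H.ℓ) ∧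
      (p.D.q 1 ((u : ℂ), 1) = 0 ↔ |u| = p.H.ℓ⁻¹) ∧
      (p.D.q 2 ((u : ℂ), 1) = 0 ↔ |u - p.H.c| = p.H.r) := fun u => by
    rw [← n₁, ← n₂]; exact p.q_eq_zero_coe u
  have hq' : ∀ u : ℝ, |u| ≠ p.H.ℓ → |u| ≠ p.H.ℓ⁻¹ → |u - p.H.c| ≠ p.H.r →
      ∀ n, p.D.q n ((u : ℂ), 1) ≠ 0 := by
    intro u a0 a1 a2 n
    fin_cases n
    · exact fun h => a0 ((hq u).1.1 h)
    · exact fun h => a1 ((hq u).2.1.1 h)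
    · exact fun h => a2 ((hq u).2.2.1 h)
  intro k
  fin_cases k
  · change CorrespondsTo ρ (homeo hρ) genX (Equiv.swap 1 2 0)
    have e : Equiv.swap (1 : Fin 3) 2 0 = 0 := by decide
    have e' : genX = ReflData.letter 0 * ReflData.flip (ReflData.letter 1) := by
      change genX = genX * ReflData.flip 1
      simp
    rw [e, e']
    refine correspondsTo_of_side hρ (m := 2) (s := -p.H.ℓ) (t := -p.H.ℓ⁻¹) (o := -p.H.c) (by decide)
      (fun x _ hx => q_ne_zero_of_side (k := 0) hx) ?_ ?_ ?_ ⟨by linarith, by linarith⟩ ?_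
    · intro u hu
      have a := hu.1
      have b := hu.2
      have h3 : |u| = -u := abs_of_nonpos (by linarith)
      have h4 : |u - p.H.c| = -(u - p.H.c) := abs_of_nonpos (by linarith)
      refine ⟨p.H.mem_region.2 ?_, ?_⟩
      · rw [n₁, n₂, h3, h4]
        exact ⟨by linarith, by linarith, by linarith⟩
      · change ‖(u : ℂ) - p.H.c‖ = ‖(u : ℂ)‖ + p.H.c
        rw [n₁, n₂, h3, h4]
        ring
    · rw [(hq _).1, abs_neg, abs_of_pos p.H.ℓ_pos]
    · rw [(hq _).2.1, abs_neg, abs_of_pos p.H.inv_pos]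
    · apply hq'
      · rw [abs_neg, abs_of_pos hc]; exact (by linarith : p.H.c < p.H.ℓ).ne
      · rw [abs_neg, abs_of_pos hc]; exact (by linarith : p.H.ℓ⁻¹ < p.H.c).ne'
      · rw [abs_of_neg (by linarith)]; exact (by linarith : p.H.r < -(-p.H.c - p.H.c)).ne'
  · change CorrespondsTo ρ (homeo hρ) genY (Equiv.swap 1 2 1)
    have e : Equiv.swap (1 : Fin 3) 2 1 = 2 := by decide
    have e' : genY = ReflData.letter 1 * ReflData.flip (ReflData.letter 2) := by
      change genY = 1 * ReflData.flip genY⁻¹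
      rw [map_inv, ReflData.flip_genY, inv_inv, one_mul]
    rw [e, e']
    refine correspondsTo_of_side hρ (m := 0) (s := p.H.ℓ⁻¹) (t := p.H.c - p.H.r)
      (o := (p.H.ℓ⁻¹ + (p.H.c - p.H.r)) / 2) (by decide)
      (fun x _ hx => q_ne_zero_of_side (k := 2) hx) ?_ ?_ ?_ ⟨by linarith, by linarith⟩ ?_
    · intro u hu
      have a := hu.1
      have b := hu.2
      have h3 : |u| = u := abs_of_nonneg (by linarith)
      have h4 : |u - p.H.c| = -(u - p.H.c) := abs_of_nonpos (by linarith)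
      refine ⟨p.H.mem_region.2 ?_, ?_⟩
      · rw [n₁, n₂, h3, h4]
        exact ⟨by linarith, by linarith, by linarith⟩
      · change ‖(u : ℂ) - p.H.c‖ = p.H.c - ‖(u : ℂ)‖
        rw [n₁, n₂, h3, h4]
        ring
    · rw [(hq _).2.1, abs_of_pos p.H.inv_pos]
    · rw [(hq _).2.2, abs_of_nonpos (by linarith)]; ring
    · have h3 : |(p.H.ℓ⁻¹ + (p.H.c - p.H.r)) / 2| = (p.H.ℓ⁻¹ + (p.H.c - p.H.r)) / 2 :=
        abs_of_nonneg (by linarith)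
      apply hq'
      · rw [h3]; intro h; linarith
      · rw [h3]; intro h; linarith
      · rw [abs_of_neg (by linarith)]; intro h; linarith
  · change CorrespondsTo ρ (homeo hρ) genZ (Equiv.swap 1 2 2)
    have e : Equiv.swap (1 : Fin 3) 2 2 = 1 := by decide
    have e' : genZ = ReflData.letter 2 * ReflData.flip (ReflData.letter 0) := by
      change (genX * genY)⁻¹ = genY⁻¹ * ReflData.flip genX
      rw [ReflData.flip_genX, _root_.mul_inv_rev]
    rw [e, e']
    refine correspondsTo_of_side hρ (m := 1) (s := p.H.c + p.H.r) (t := p.H.ℓ)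
      (o := (p.H.c + p.H.r + p.H.ℓ) / 2) (by decide)
      (fun x _ hx => q_ne_zero_of_side (k := 1) hx) ?_ ?_ ?_ ⟨by linarith, by linarith⟩ ?_
    · intro u hu
      have a := hu.1
      have b := hu.2
      have h3 : |u| = u := abs_of_nonneg (by linarith)
      have h4 : |u - p.H.c| = u - p.H.c := abs_of_nonneg (by linarith)
      refine ⟨p.H.mem_region.2 ?_, ?_⟩
      · rw [n₁, n₂, h3, h4]
        exact ⟨by linarith, by linarith, by linarith⟩
      · change ‖(u : ℂ) - p.H.c‖ = ‖(u : ℂ)‖ - p.H.c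
        rw [n₁, n₂, h3, h4]
    · rw [(hq _).2.2, add_sub_cancel_left, abs_of_pos hr]
    · rw [(hq _).1, abs_of_pos p.H.ℓ_pos]
    · have h3 : |(p.H.c + p.H.r + p.H.ℓ) / 2| = (p.H.c + p.H.r + p.H.ℓ) / 2 :=
        abs_of_nonneg (by linarith)
      apply hq'
      · rw [h3]; intro h; linarith
      · rw [h3]; intro h; linarith
      · rw [abs_of_pos (by linarith)]; intro h; linarith

end Param

end PantsChar

end

noncomputable section

namespace PantsChar

open Matrix Topology

/-! ### Irreducible pairs of matrices with equal traces are conjugate -/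

/-- An irreducible pair of matrices in `SL(2, ℂ)` has a normal form, which depends only on the
traces and on an eigenvalue of the first matrix. -/
lemma exists_normal_form (A B : SpecialLinearGroup (Fin 2) ℂ) {x y z e : ℂ}
    (hx : trace (A : Matrix (Fin 2) (Fin 2) ℂ) = x) (hy : trace (B : Matrix (Fin 2) (Fin 2) ℂ) = y)
    (hz : trace ((A * B : SpecialLinearGroup (Fin 2) ℂ) : Matrix (Fin 2) (Fin 2) ℂ) = z)
    (he : e ^ 2 - x * e + 1 = 0) (hκ : x ^ 2 + y ^ 2 + z ^ 2 - x * y * z - 4 ≠ 0) :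
    ∃ P : SpecialLinearGroup (Fin 2) ℂ,
      (A : Matrix (Fin 2) (Fin 2) ℂ) * P = P * !![e, z - y * (x - e); 0, x - e] ∧
      (B : Matrix (Fin 2) (Fin 2) ℂ) * P = P * !![0, -1; 1, y] := by
  obtain ⟨A, hA⟩ := A
  obtain ⟨B, hB⟩ := B
  change trace A = x at hx
  change trace B = y at hy
  change trace (A * B) = z at hz
  change ∃ P : SpecialLinearGroup (Fin 2) ℂ, A * P.1 = P.1 * _ ∧ B * P.1 = P.1 * _
  have hee : e * (x - e) = 1 := by linear_combination -he
  obtain ⟨v, hv0, hv⟩ : ∃ v, v ≠ 0 ∧ (A - e • (1 : Matrix (Fin 2) (Fin 2) ℂ)) *ᵥ v = 0 := by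
    rw [Matrix.exists_mulVec_eq_zero_iff, det_fin_two]
    rw [det_fin_two] at hA
    rw [trace_fin_two] at hx
    simp
    linear_combination hA + he - e * hx
  have h0 := congrFun hv 0
  have h1 := congrFun hv 1
  rw [det_fin_two] at hA hB
  rw [trace_fin_two] at hx hy hz
  simp [mul_apply, Fin.sum_univ_two] at hz
  simp [mulVec, dotProduct, Fin.sum_univ_two] at h0 h1
  have i0 : A 1 1 * v 0 - A 0 1 * v 1 = (x - e) * v 0 := by linear_combination -h0 + v 0 * hx
  have i1 : -A 1 0 * v 0 + A 0 0 * v 1 = (x - e) * v 1 := by linear_combination -h1 + v 1 * hx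
  -- The determinant of (v, Bv). Were it zero, v would be a common eigenvector, and the traces would
  -- satisfy the relation excluded by `hκ`.
  obtain ⟨d, hd⟩ : ∃ d, d = v 0 * (B 1 0 * v 0 + B 1 1 * v 1) -
    (B 0 0 * v 0 + B 0 1 * v 1) * v 1 := ⟨_, rfl⟩
  have hd0 : d ≠ 0 := by
    intro hd0
    rw [hd0] at hd
    apply hκ
    obtain ⟨m, j0, j1⟩ : ∃ m, B 0 0 * v 0 + B 0 1 * v 1 = m * v 0 ∧
        B 1 0 * v 0 + B 1 1 * v 1 = m * v 1 := by
      by_cases hv00 : v 0 = 0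
      · have hv10 : v 1 ≠ 0 := fun h => hv0 (by ext i; fin_cases i <;> simpa)
        rw [hv00] at hd ⊢
        refine ⟨B 1 1, ?_, by ring⟩
        refine (mul_eq_zero.1 ?_).resolve_right hv10 |>.trans (by ring)
        linear_combination hd
      · refine ⟨(B 0 0 * v 0 + B 0 1 * v 1) / v 0, by field_simp, ?_⟩
        field_simp
        linear_combination -hd
    obtain ⟨i, hi⟩ : ∃ i, v i ≠ 0 := by
      by_contra! hcon
      exact hv0 (funext hcon)
    have hm : m * (y - m) = 1 := by
      apply mul_right_cancel₀ hi
      fin_cases i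
      · change m * (y - m) * v 0 = 1 * v 0
        linear_combination (m - B 1 1) * j0 + B 0 1 * j1 + v 0 * hB - m * v 0 * hy
      · change m * (y - m) * v 1 = 1 * v 1
        linear_combination (m - B 0 0) * j1 + B 1 0 * j0 + v 1 * hB - m * v 1 * hy
    have hz' : z = e * m + (x - e) * (y - m) := by
      apply mul_right_cancel₀ hi
      fin_cases i
      · change z * v 0 = _ * v 0
        rw [← hz, ← hy]
        linear_combination -B 0 1 * i1 + B 1 1 * i0 + (A 0 0 - (x - e)) * j0 + A 0 1 * j1 + m * h0
      · change z * v 1 = _ * v 1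
        rw [← hz, ← hy]
        linear_combination -B 1 0 * i0 + B 0 0 * i1 + (A 1 1 - (x - e)) * j1 + A 1 0 * j0 + m * h1
    rw [hz']
    linear_combination (2 - m ^ 2 - (y - m) ^ 2) * hee + (2 - e ^ 2 - (x - e) ^ 2) * hm
  -- In the basis (v, Bv) the matrix of B is given by the theorem of Cayley and Hamilton, and A is
  -- triangular; the factor t makes the change of basis unimodular.
  obtain ⟨t, ht⟩ := IsAlgClosed.exists_pow_nat_eq d⁻¹ two_pos
  have htd : t ^ 2 * d = 1 := by rw [ht, inv_mul_cancel₀ hd0]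
  refine ⟨⟨!![t * v 0, t * (B 0 0 * v 0 + B 0 1 * v 1); t * v 1, t * (B 1 0 * v 0 + B 1 1 * v 1)],
    ?_⟩, ?_, ?_⟩
  · rw [det_fin_two_of]
    linear_combination htd - t ^ 2 * hd
  · ext i j
    fin_cases i <;> fin_cases j <;> simp [mul_apply, Fin.sum_univ_two]
    · linear_combination t * h0
    · rw [← hz, ← hy]
      linear_combination t * B 0 1 * i1 - t * B 1 1 * i0
    · linear_combination t * h1
    · rw [← hz, ← hy]
      linear_combination t * B 1 0 * i0 - t * B 0 0 * i1
  · ext i j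
    fin_cases i <;> fin_cases j <;> simp [mul_apply, Fin.sum_univ_two]
    · ring
    · rw [← hy]
      linear_combination -t * v 0 * hB
    · ring
    · rw [← hy]
      linear_combination -t * v 1 * hB

/-- Irreducible pairs of matrices in `SL(2, ℂ)` with equal traces are conjugate. -/
lemma exists_conj_of_trace_eq {A B A' B' : SpecialLinearGroup (Fin 2) ℂ} {x y z : ℂ}
    (hx : trace (A : Matrix (Fin 2) (Fin 2) ℂ) = x) (hy : trace (B : Matrix (Fin 2) (Fin 2) ℂ) = y)
    (hz : trace ((A * B : SpecialLinearGroup (Fin 2) ℂ) : Matrix (Fin 2) (Fin 2) ℂ) = z)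
    (hx' : trace (A' : Matrix (Fin 2) (Fin 2) ℂ) = x)
    (hy' : trace (B' : Matrix (Fin 2) (Fin 2) ℂ) = y)
    (hz' : trace ((A' * B' : SpecialLinearGroup (Fin 2) ℂ) : Matrix (Fin 2) (Fin 2) ℂ) = z)
    (hκ : x ^ 2 + y ^ 2 + z ^ 2 - x * y * z - 4 ≠ 0) :
    ∃ g : SpecialLinearGroup (Fin 2) ℂ, A = g * A' * g⁻¹ ∧ B = g * B' * g⁻¹ := by
  obtain ⟨s, hs⟩ := IsAlgClosed.exists_pow_nat_eq (x ^ 2 - 4) two_pos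
  have he : ((x + s) / 2) ^ 2 - x * ((x + s) / 2) + 1 = 0 := by linear_combination hs / 4
  obtain ⟨P, hPA, hPB⟩ := exists_normal_form A B hx hy hz he hκ
  obtain ⟨Q, hQA, hQB⟩ := exists_normal_form A' B' hx' hy' hz' he hκ
  have key : ∀ {M M' : SpecialLinearGroup (Fin 2) ℂ} {N : Matrix (Fin 2) (Fin 2) ℂ},
      (M : Matrix (Fin 2) (Fin 2) ℂ) * P = P * N → (M' : Matrix (Fin 2) (Fin 2) ℂ) * Q = Q * N →
      M = P * Q⁻¹ * M' * (P * Q⁻¹)⁻¹ := by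
    intro M M' N h h'
    have hN : ((Q⁻¹ * (M' * Q) : SpecialLinearGroup (Fin 2) ℂ) : Matrix (Fin 2) (Fin 2) ℂ) = N := by
      change ((Q⁻¹ : SpecialLinearGroup (Fin 2) ℂ) : Matrix (Fin 2) (Fin 2) ℂ) *
        ((M' : Matrix (Fin 2) (Fin 2) ℂ) * Q) = N
      rw [h', ← Matrix.mul_assoc]
      have : ((Q⁻¹ : SpecialLinearGroup (Fin 2) ℂ) : Matrix (Fin 2) (Fin 2) ℂ) * Q =
        ((Q⁻¹ * Q : SpecialLinearGroup (Fin 2) ℂ) : Matrix (Fin 2) (Fin 2) ℂ) := rfl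
      rw [this, inv_mul_cancel]
      exact Matrix.one_mul N
    have hM : M * P = P * (Q⁻¹ * (M' * Q)) := by
      apply Subtype.ext
      change (M : Matrix (Fin 2) (Fin 2) ℂ) * P = (P : Matrix (Fin 2) (Fin 2) ℂ) *
        ((Q⁻¹ * (M' * Q) : SpecialLinearGroup (Fin 2) ℂ) : Matrix (Fin 2) (Fin 2) ℂ)
      rw [hN, h]
    rw [eq_mul_inv_of_mul_eq hM]
    group
  exact ⟨P * Q⁻¹, key hPA hQA, key hPB hQB⟩

/-- Two irreducible representations with the same character are conjugate. -/
lemma isConjToReal_of_character_eq {ρ : Pi2 →* SpecialLinearGroup (Fin 2) ℂ}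
    {ρ₀ : Pi2 →* SpecialLinearGroup (Fin 2) ℝ}
    (h : ∀ i, character ρ i =
      character ((SpecialLinearGroup.map Complex.ofRealHom).comp ρ₀) i)
    (hκ : character ρ 0 ^ 2 + character ρ 1 ^ 2 + character ρ 2 ^ 2 -
      character ρ 0 * character ρ 1 * character ρ 2 - 4 ≠ 0) : ∃ g, IsConjToReal ρ g ρ₀ := by
  set σ := (SpecialLinearGroup.map Complex.ofRealHom).comp ρ₀ with hσ
  have hz : trace ((ρ genX * ρ genY : SpecialLinearGroup (Fin 2) ℂ) :
      Matrix (Fin 2) (Fin 2) ℂ) = character ρ 2 := by rw [← map_mul]; rfl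
  have hz' : trace ((σ genX * σ genY : SpecialLinearGroup (Fin 2) ℂ) :
      Matrix (Fin 2) (Fin 2) ℂ) = character ρ 2 := by rw [← map_mul, h]; rfl
  obtain ⟨g, hgX, hgY⟩ := exists_conj_of_trace_eq (x := character ρ 0) (y := character ρ 1)
    (A := ρ genX) (B := ρ genY) (A' := σ genX) (B' := σ genY) rfl rfl hz (h 0).symm (h 1).symm hz' hκ
  refine ⟨g, ?_⟩
  have : ρ = (MulAut.conj g).toMonoidHom.comp σ := by
    ext1 i
    fin_cases i
    · exact hgX
    · exact hgY
  intro γ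
  conv_lhs => rw [this]
  rfl

/-! ### Transport along an automorphism of the free group -/

section transport

variable {ρ : Pi2 →* SpecialLinearGroup (Fin 2) ℝ} (φ : Pi2 ≃* Pi2)

lemma moeb_comp_symm (γ : Pi2) (z : OnePoint ℂ) :
    moeb (ρ.comp φ.symm.toMonoidHom) (φ γ) z = moeb ρ γ z := by
  simp [moeb]

lemma bordered_comp_symm : bordered (ρ.comp φ.symm.toMonoidHom) = bordered ρ := by
  have : discontinuitySet (ρ.comp φ.symm.toMonoidHom) = discontinuitySet ρ := by
    ext z
    refine exists_congr fun U => and_congr_right fun _ => ?_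
    have e : {γ : Pi2 | (moeb (ρ.comp φ.symm.toMonoidHom) γ '' U ∩ U).Nonempty} =
        φ '' {γ : Pi2 | (moeb ρ γ '' U ∩ U).Nonempty} := by
      ext γ
      obtain ⟨γ, rfl⟩ := φ.surjective γ
      rw [φ.injective.mem_set_image, Set.mem_ofPred_eq, Set.mem_ofPred_eq,
        show moeb (ρ.comp φ.symm.toMonoidHom) (φ γ) = moeb ρ γ from funext (moeb_comp_symm φ γ)]
    rw [e, Set.finite_image_iff φ.injective.injOn]
  rw [bordered, bordered, this]

lemma orbitSetoid_iff {a b : bordered ρ} :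
    orbitSetoid ρ a b ↔ ∃ γ, moeb ρ γ (a : OnePoint ℂ) = b := Iff.rfl

lemma exists_moeb_comp_symm {a b : OnePoint ℂ} :
    (∃ γ, moeb (ρ.comp φ.symm.toMonoidHom) γ a = b) ↔ ∃ γ, moeb ρ γ a = b := by
  constructor
  · rintro ⟨γ, h⟩
    obtain ⟨γ, rfl⟩ := φ.surjective γ
    exact ⟨γ, (moeb_comp_symm φ γ a).symm.trans h⟩
  · rintro ⟨γ, h⟩
    exact ⟨φ γ, (moeb_comp_symm φ γ a).trans h⟩

/-- The map between the quotient surfaces of two representations with the same orbits. -/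
def quotientMap {σ : Pi2 →* SpecialLinearGroup (Fin 2) ℝ} (hb : ∀ z ∈ bordered σ, z ∈ bordered ρ)
    (h : ∀ a b, (∃ γ, moeb σ γ a = b) ↔ ∃ γ, moeb ρ γ a = b) :
    QuotientSurface σ → QuotientSurface ρ :=
  Quotient.lift (fun a => Quotient.mk (orbitSetoid ρ) ⟨a, hb a a.2⟩) (by
    intro a b hab
    apply Quotient.sound
    change orbitSetoid ρ _ _
    change orbitSetoid σ a b at hab
    rw [orbitSetoid_iff] at hab ⊢
    exact (h _ _).1 hab)

lemma continuous_quotientMap {σ : Pi2 →* SpecialLinearGroup (Fin 2) ℝ}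
    (hb : ∀ z ∈ bordered σ, z ∈ bordered ρ)
    (h : ∀ a b, (∃ γ, moeb σ γ a = b) ↔ ∃ γ, moeb ρ γ a = b) : Continuous (quotientMap hb h) :=
  (continuous_quot_mk.comp (continuous_subtype_val.subtype_mk _)).quotient_lift _

/-- The quotient surface depends only on the image of the representation. -/
def quotientComp : QuotientSurface (ρ.comp φ.symm.toMonoidHom) ≃ₜ QuotientSurface ρ where
  toFun := quotientMap (fun _ hz => bordered_comp_symm (ρ := ρ) φ ▸ hz)
    (fun _ _ => exists_moeb_comp_symm φ)
  invFun := quotientMap (fun _ hz => (bordered_comp_symm (ρ := ρ) φ).symm ▸ hz)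
    (fun _ _ => (exists_moeb_comp_symm φ).symm)
  left_inv := by
    intro a
    obtain ⟨a, rfl⟩ := Quotient.exists_rep a
    rfl
  right_inv := by
    intro a
    obtain ⟨a, rfl⟩ := Quotient.exists_rep a
    rfl
  continuous_toFun := continuous_quotientMap _ _
  continuous_invFun := continuous_quotientMap _ _

lemma quotientComp_mk {z : OnePoint ℂ} (hz : z ∈ bordered (ρ.comp φ.symm.toMonoidHom))
    (hz' : z ∈ bordered ρ) : quotientComp φ (Quotient.mk _ ⟨z, hz⟩) =
      Quotient.mk (orbitSetoid ρ) ⟨z, hz'⟩ := rfl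

/-- The image group, hence its ordinary points and its quotient, do not change; only the names of
the group elements are replaced by their images under φ. -/
lemma isRealPEmbeddingWith_comp_symm {c : Fin 3 → Pi2} (h : IsRealPEmbeddingWith ρ c) :
    IsRealPEmbeddingWith (ρ.comp φ.symm.toMonoidHom) (fun i => φ (c i)) := by
  obtain ⟨⟨hinj, hdisc⟩, f, hf, e, he⟩ := h
  have hb := bordered_comp_symm (ρ := ρ) φ
  refine ⟨⟨hinj.comp φ.symm.injective, ?_⟩, (quotientComp φ).trans f, ?_, e, fun i => ?_⟩
  · have : (ρ.comp φ.symm.toMonoidHom).range = ρ.range := by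
      rw [MonoidHom.range_comp, MonoidHom.range_eq_top.2 φ.symm.surjective, MonoidHom.range_eq_map]
    rw [this]
    exact hdisc
  · intro z
    have h1 := hf ⟨z, hb ▸ z.2⟩
    rw [h1]
    refine exists_congr fun k => ?_
    rw [Homeomorph.trans_apply, ← quotientComp_mk φ z.2]
  · have hB : boundaryPreimage (ρ.comp φ.symm.toMonoidHom) ((quotientComp φ).trans f) (e i) =
        boundaryPreimage ρ f (e i) := by
      ext z
      constructor
      · rintro ⟨hz, h⟩
        rw [Homeomorph.trans_apply, quotientComp_mk φ hz (hb ▸ hz)] at h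
        exact ⟨hb ▸ hz, h⟩
      · rintro ⟨hz, h⟩
        rw [← quotientComp_mk φ (hb.symm ▸ hz) hz] at h
        exact ⟨hb.symm ▸ hz, h⟩
    obtain ⟨z, hz, h⟩ := he i
    refine ⟨z, hB ▸ hz, ?_⟩
    rw [hB]
    ext δ
    obtain ⟨δ, rfl⟩ := φ.surjective δ
    have h1 := Set.ext_iff.1 h δ
    rw [Set.mem_ofPred_eq] at h1 ⊢
    rw [show moeb (ρ.comp φ.symm.toMonoidHom) (φ δ) = moeb ρ δ from funext (moeb_comp_symm φ δ), h1]
    simp only [SetLike.mem_coe, Subgroup.mem_zpowers_iff, ← map_zpow, φ.injective.eq_iff]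

lemma isPEmbeddingWith_of_comp {ρ : Pi2 →* SpecialLinearGroup (Fin 2) ℂ} {c : Fin 3 → Pi2}
    (h : IsPEmbeddingWith (ρ.comp φ.toMonoidHom) c) : IsPEmbeddingWith ρ (fun i => φ (c i)) := by
  obtain ⟨g, ρ₀, hg, h⟩ := h
  refine ⟨g, ρ₀.comp φ.symm.toMonoidHom, fun γ => ?_, isRealPEmbeddingWith_comp_symm φ h⟩
  have := hg (φ.symm γ)
  simpa using this

end transport

end PantsChar

end

noncomputable section

namespace PantsChar

open Matrix Topology

/-! ### Real representations with given traces -/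

/-- The traces are -(ℓ² + ℓ⁻²), -(ℓB - ℓ⁻¹C) and -(ℓC - ℓ⁻¹B). The first determines ℓ > 1, the other
two are linear in B and C with positive solutions, and A is the root of 1 + BC. -/
lemma exists_param {x y z : ℝ} (hx : x < -2) (hy : y < -2) (hz : z < -2) : ∃ p : Param,
    trace (p.D.R 0 * p.D.R 1) = x ∧ trace (p.D.R 1 * p.D.R 2) = y ∧
    trace (p.D.R 0 * p.D.R 2) = z := by
  obtain ⟨L, hL, hLx⟩ : ∃ L : ℝ, 1 < L ∧ L + L⁻¹ = -x := by
    have h4 : 0 < x ^ 2 - 4 := by nlinarith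
    have hs := Real.sq_sqrt h4.le
    have hs0 := Real.sqrt_pos.2 h4
    have h1 : 1 < (-x + √(x ^ 2 - 4)) / 2 := by linarith
    refine ⟨_, h1, ?_⟩
    have h0 : (-x + √(x ^ 2 - 4)) ≠ 0 := by linarith
    field_simp
    linear_combination hs
  obtain ⟨ℓ, hℓ, hℓL⟩ : ∃ ℓ : ℝ, 1 < ℓ ∧ ℓ ^ 2 = L :=
    ⟨√L, by rw [Real.lt_sqrt one_pos.le]; linarith, Real.sq_sqrt (by linarith)⟩
  have hℓ0 : 0 < ℓ := by linarith
  have hi : ℓ⁻¹ * ℓ = 1 := inv_mul_cancel₀ hℓ0.ne'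
  have hi0 : 0 < ℓ⁻¹ := inv_pos.2 hℓ0
  have hi1 : ℓ⁻¹ < 1 := inv_lt_one_of_one_lt₀ hℓ
  have hx' : ℓ ^ 2 + ℓ⁻¹ ^ 2 = -x := by rw [← hLx, ← hℓL, inv_pow]
  have hd : 0 < ℓ ^ 2 - ℓ⁻¹ ^ 2 := by nlinarith
  obtain ⟨C, hC⟩ : ∃ C, C = (ℓ * -z + ℓ⁻¹ * -y) / (ℓ ^ 2 - ℓ⁻¹ ^ 2) := ⟨_, rfl⟩
  obtain ⟨B, hB⟩ : ∃ B, B = (ℓ * -y + ℓ⁻¹ * -z) / (ℓ ^ 2 - ℓ⁻¹ ^ 2) := ⟨_, rfl⟩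
  have hC0 : 0 < C := by
    rw [hC]; exact div_pos (add_pos (mul_pos hℓ0 (by linarith)) (mul_pos hi0 (by linarith))) hd
  have hB0 : 0 < B := by
    rw [hB]; exact div_pos (add_pos (mul_pos hℓ0 (by linarith)) (mul_pos hi0 (by linarith))) hd
  rw [eq_div_iff hd.ne'] at hC hB
  have e₁ : ℓ * C - ℓ⁻¹ * B = -z := by
    apply mul_right_cancel₀ hd.ne'
    linear_combination ℓ * hC - ℓ⁻¹ * hB
  have e₂ : ℓ * B - ℓ⁻¹ * C = -y := by
    apply mul_right_cancel₀ hd.ne'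
    linear_combination ℓ * hB - ℓ⁻¹ * hC
  have hA : 0 < 1 + B * C := by positivity
  refine ⟨⟨ℓ, √(1 + B * C), B, C, hℓ, Real.sqrt_pos.2 hA, hB0, hC0, Real.sq_sqrt hA.le,
    by linarith, by linarith⟩, ?_, ?_, ?_⟩
  · simp [ReflData.R, Param.D, trace_fin_two]
    linear_combination -hx'
  · simp [ReflData.R, Param.D, trace_fin_two]
    linear_combination -e₂
  · simp [ReflData.R, Param.D, trace_fin_two]
    linear_combination -e₁

/-- The product of two reflections, up to sign. -/
def ReflData.prod (D : ReflData) (i j : Fin 3) (e : ℤˣ) : SpecialLinearGroup (Fin 2) ℝ :=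
  ⟨((e : ℤ) : ℝ) • (D.R i * D.R j), by
    rw [det_smul, det_mul, D.det_R, D.det_R, Fintype.card_fin]
    rcases Int.units_eq_one_or e with rfl | rfl <;> norm_num⟩

/-- The representation generated by products of reflections, up to signs. -/
def ReflData.rep (D : ReflData) (s : Fin 3 → ℤˣ) : Pi2 →* SpecialLinearGroup (Fin 2) ℝ :=
  FreeGroup.lift ![D.prod 0 1 (s 0), D.prod 1 2 (s 1)]

lemma ReflData.rep_genX (D : ReflData) (s : Fin 3 → ℤˣ) : D.rep s genX = D.prod 0 1 (s 0) := by
  simp [rep, genX]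

lemma ReflData.rep_genY (D : ReflData) (s : Fin 3 → ℤˣ) : D.rep s genY = D.prod 1 2 (s 1) := by
  simp [rep, genY]

lemma ReflData.moeb_of_eq_prod (D : ReflData) {ρ : Pi2 →* SpecialLinearGroup (Fin 2) ℝ} {γ : Pi2}
    {i j : Fin 3} {e : ℤˣ} (h : ρ γ = D.prod i j e) (z : OnePoint ℂ) :
    moeb ρ γ z = D.r i (D.r j z) := by
  have h1 := D.wm_pt [i, j] (vec_ne_zero z)
  rw [pt_vec] at h1
  change D.r i (D.r j z) = _ at h1
  rw [h1, moeb_eq_mob, mob_eq_pt, h]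
  change pt (lin (((e : ℤ) : ℝ) • (D.R i * D.R j)) (vec z)) = pt (lin (D.R i) (lin (D.R j) (vec z)))
  have : lin (((e : ℤ) : ℝ) • (D.R i * D.R j)) (vec z) =
      (((e : ℤ) : ℝ) : ℂ) • lin (D.R i) (lin (D.R j) (vec z)) := by
    rw [← lin_mul]
    ext <;> simp [lin] <;> ring
  rw [this, pt_smul]
  simp

lemma ReflData.generates_rep (D : ReflData) (s : Fin 3 → ℤˣ) : D.Generates (D.rep s) :=
  ⟨D.moeb_of_eq_prod (D.rep_genX s), D.moeb_of_eq_prod (D.rep_genY s)⟩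

/-- The middle reflection cancels in the product of the two generators, and the remaining sign s 0 *
s 1 is s 2. -/
lemma ReflData.character_rep (D : ReflData) (s : Fin 3 → ℤˣ) (hs : s 0 * s 1 * s 2 = 1) (k : Fin 3) :
    character ((SpecialLinearGroup.map Complex.ofRealHom).comp (D.rep s)) k =
      (((s k : ℤ) : ℝ) * ![trace (D.R 0 * D.R 1), trace (D.R 1 * D.R 2), trace (D.R 0 * D.R 2)] k :
        ℝ) := by
  have htr : ∀ M : SpecialLinearGroup (Fin 2) ℝ,
      trace (SpecialLinearGroup.map Complex.ofRealHom M : Matrix (Fin 2) (Fin 2) ℂ) =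
        (trace (M : Matrix (Fin 2) (Fin 2) ℝ) : ℝ) := fun M => by simp [trace_fin_two]
  have h2 : ∀ (i j : Fin 3) (e : ℤˣ), trace (D.prod i j e : Matrix (Fin 2) (Fin 2) ℝ) =
      ((e : ℤ) : ℝ) * trace (D.R i * D.R j) := fun i j e => by
    change trace (((e : ℤ) : ℝ) • (D.R i * D.R j)) = _
    rw [trace_smul, smul_eq_mul]
  have h3 : D.prod 0 1 (s 0) * D.prod 1 2 (s 1) = D.prod 0 2 (s 2) := by
    apply Subtype.ext
    change (((s 0 : ℤ) : ℝ) • (D.R 0 * D.R 1)) * (((s 1 : ℤ) : ℝ) • (D.R 1 * D.R 2)) =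
      ((s 2 : ℤ) : ℝ) • (D.R 0 * D.R 2)
    have hRR : D.R 1 * D.R 1 = 1 := by
      have h := D.det_eq 1
      ext j k
      fin_cases j <;> fin_cases k <;> simp [R, mul_apply, Fin.sum_univ_two]
      · linear_combination h
      · ring
      · ring
      · linear_combination h
    have hs2 : s 2 = s 0 * s 1 := by
      rw [eq_inv_of_mul_eq_one_right hs, Int.units_inv_eq_self]
    rw [Matrix.smul_mul, Matrix.mul_smul, smul_smul, Matrix.mul_assoc, ← Matrix.mul_assoc (D.R 1),
      hRR, Matrix.one_mul, hs2]
    push_cast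
    rfl
  fin_cases k
  · change trace (SpecialLinearGroup.map Complex.ofRealHom (D.rep s genX) :
      Matrix (Fin 2) (Fin 2) ℂ) = _
    rw [htr, D.rep_genX, h2]
    rfl
  · change trace (SpecialLinearGroup.map Complex.ofRealHom (D.rep s genY) :
      Matrix (Fin 2) (Fin 2) ℂ) = _
    rw [htr, D.rep_genY, h2]
    rfl
  · change trace (SpecialLinearGroup.map Complex.ofRealHom (D.rep s (genX * genY)) :
      Matrix (Fin 2) (Fin 2) ℂ) = _
    rw [htr, map_mul, D.rep_genX, D.rep_genY, h3, h2]
    rfl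

/-- A representation whose character lies in the octant, up to signs, is a discrete embedding with
quotient a three-holed sphere whose boundary components correspond to `X`, `Y`, `Z`. -/
theorem isPEmbeddingWith_peripheral {ρ : Pi2 →* SpecialLinearGroup (Fin 2) ℂ}
    (h : character ρ ∈ signOctant) : IsPEmbeddingWith ρ peripheral := by
  obtain ⟨s, hs, q, ⟨t, ht, rfl⟩, h⟩ := h
  obtain ⟨p, hx, hy, hz⟩ := exists_param (ht 0) (ht 1) (ht 2)
  have hc : ∀ i, character ρ i = (((s i : ℤ) : ℝ) * t i : ℝ) := fun i => by
    rw [h]; push_cast; rfl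
  have hc' : ∀ i, character ρ i =
      character ((SpecialLinearGroup.map Complex.ofRealHom).comp (p.D.rep s)) i := fun i => by
    rw [hc, p.D.character_rep s hs, hx, hy, hz]
    congr 2
    fin_cases i <;> rfl
  -- Even sign-changes preserve κ, and on the octant the product of the coordinates is negative
  -- while all squares exceed 4; so κ > 2.
  obtain ⟨g, hg⟩ := isConjToReal_of_character_eq hc' (by
    rw [hc, hc, hc]
    norm_cast
    have e0 : ((s 0 : ℤ) : ℝ) ^ 2 = 1 := by
      rcases Int.units_eq_one_or (s 0) with h | h <;> rw [h] <;> norm_num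
    have e1 : ((s 1 : ℤ) : ℝ) ^ 2 = 1 := by
      rcases Int.units_eq_one_or (s 1) with h | h <;> rw [h] <;> norm_num
    have e2 : ((s 2 : ℤ) : ℝ) ^ 2 = 1 := by
      rcases Int.units_eq_one_or (s 2) with h | h <;> rw [h] <;> norm_num
    have e3 : ((s 0 : ℤ) : ℝ) * ((s 1 : ℤ) : ℝ) * ((s 2 : ℤ) : ℝ) = 1 := by
      simpa using congrArg (fun u : ℤˣ => ((u : ℤ) : ℝ)) hs
    have a0 := ht 0
    have a1 := ht 1
    have a2 := ht 2
    have b1 : 4 < t 0 * t 1 := by nlinarith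
    have b2 : t 0 * t 1 * t 2 < 0 := mul_neg_of_pos_of_neg (by linarith) (by linarith)
    have key : (((s 0 : ℤ) : ℝ) * t 0) ^ 2 + (((s 1 : ℤ) : ℝ) * t 1) ^ 2 +
        (((s 2 : ℤ) : ℝ) * t 2) ^ 2 - ((s 0 : ℤ) : ℝ) * t 0 * (((s 1 : ℤ) : ℝ) * t 1) *
          (((s 2 : ℤ) : ℝ) * t 2) - 4 =
        t 0 ^ 2 + t 1 ^ 2 + t 2 ^ 2 - t 0 * t 1 * t 2 - 4 := by
      linear_combination t 0 ^ 2 * e0 + t 1 ^ 2 * e1 + t 2 ^ 2 * e2 - t 0 * t 1 * t 2 * e3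
    rw [key]
    have : 0 < t 0 ^ 2 + t 1 ^ 2 + t 2 ^ 2 - t 0 * t 1 * t 2 - 4 := by nlinarith
    exact this.ne')
  exact ⟨g, p.D.rep s, hg, Param.isRealPEmbeddingWith (p.D.generates_rep s)⟩

theorem isPEmbeddingWith_of_mem_signOctant {ρ : Pi2 →* SpecialLinearGroup (Fin 2) ℂ}
    {φ : Pi2 ≃* Pi2} (h : character (ρ.comp φ.toMonoidHom) ∈ signOctant) :
    IsPEmbeddingWith ρ (fun i => φ (peripheral i)) :=
  isPEmbeddingWith_of_comp φ (isPEmbeddingWith_peripheral h)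

lemma IsPEmbeddingWith.isPEmbedding {ρ : Pi2 →* SpecialLinearGroup (Fin 2) ℂ} {c : Fin 3 → Pi2}
    (h : IsPEmbeddingWith ρ c) : IsPEmbedding ρ := by
  obtain ⟨g, ρ₀, hg, hd, f, hf, -⟩ := h
  exact ⟨g, ρ₀, hg, hd, f, hf⟩

end PantsChar

end

theorem mainTheorem5 (ρ : PantsChar.Pi2 →* Matrix.SpecialLinearGroup (Fin 2) ℂ) :
    (PantsChar.character ρ ∈ PantsChar.gamOctant ↔ PantsChar.IsPEmbedding ρ) ∧
    (PantsChar.character ρ ∈ PantsChar.gamOctant ↔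
      ∃ φ : PantsChar.Pi2 ≃* PantsChar.Pi2,
        PantsChar.IsPEmbeddingWith ρ (fun i => φ (PantsChar.peripheral i))) ∧
    (∀ φ : PantsChar.Pi2 ≃* PantsChar.Pi2,
      PantsChar.character (ρ.comp φ.toMonoidHom) ∈ PantsChar.signOctant ↔
        PantsChar.IsPEmbeddingWith ρ (fun i => φ (PantsChar.peripheral i))) ∧
    (PantsChar.character ρ ∈ PantsChar.signOctant ↔
      PantsChar.IsPEmbeddingWith ρ PantsChar.peripheral) := by
  have hiff : ∀ φ : PantsChar.Pi2 ≃* PantsChar.Pi2,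
      PantsChar.character (ρ.comp φ.toMonoidHom) ∈ PantsChar.signOctant ↔
        PantsChar.IsPEmbeddingWith ρ (fun i => φ (PantsChar.peripheral i)) := fun φ =>
    ⟨PantsChar.isPEmbeddingWith_of_mem_signOctant, PantsChar.character_mem_signOctant⟩
  have hex : PantsChar.character ρ ∈ PantsChar.gamOctant →
      ∃ φ : PantsChar.Pi2 ≃* PantsChar.Pi2,
        PantsChar.IsPEmbeddingWith ρ (fun i => φ (PantsChar.peripheral i)) := fun h => by
    obtain ⟨φ, hφ⟩ := PantsChar.exists_aut_of_mem_gamOctant h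
    exact ⟨φ, (hiff φ).1 hφ⟩
  refine ⟨⟨fun h => ?_, PantsChar.character_mem_gamOctant⟩, ⟨hex, ?_⟩, hiff, ?_⟩
  · obtain ⟨φ, hφ⟩ := hex h
    exact hφ.isPEmbedding
  · rintro ⟨φ, hφ⟩
    exact PantsChar.character_mem_gamOctant hφ.isPEmbedding
  · exact hiff (MulEquiv.refl PantsChar.Pi2)
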